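/- Let $n\ge 2$, let $K\subset\mathbb S^{n-1}$ be relatively open, let $\mathcal C=\{x\neq0:\ \hat x\in K\}$, $\hat x=x/|x|$, be the cone over $K$, and for $\epsilon>0$ put $\mathcal C_\epsilon=\mathcal C\cap B_\epsilon$, where $B_\epsilon$ is the ball of radius $\epsilon$ centred at $0$. Let $\delta>0$, let $d\in\mathcal K'_\delta:=\{d\in\mathbb S^{n-1}:\ d\cdot\theta>\delta\ \text{for all }\theta\in K\}$, let $d^\perp\in\mathbb S^{n-1}$ with $d\cdot d^\perp=0$, and put $\eta=\eta_\tau=-\tau(d+\mathrm i d^\perp)$ for $\tau>0$. Let $k\in\mathbb R$, let $\rho\in L^\infty(\mathbb R^n)$ and $\gamma\in W^{1,\infty}(\mathbb R^n)$ be real valued with $0<\lambda_1\le\gamma\le\lambda_2$ a.e. in $\mathcal C_\epsilon$. Let $u,v\in H^1(\mathcal C_\epsilon)$ (complex valued) be weak solutions of $$\nabla\cdot\gamma\nabla u+k^2\rho u=0,\quad \Delta v+k^2v=0\ \text{ in }\mathcal C_\epsilon,\qquad u=v,\quad \gamma\partial_\nu u=\partial_\nu v\ \text{ on }\partial\mathcal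 C_\epsilon\setminus\partial B_\epsilon .$$ The boundary conditions are understood weakly: $u-v$ is the limit in $H^1(\mathcal C_\epsilon)$ of functions in $C_c^\infty(\mathcal C)$, and $\int_{\mathcal C_\epsilon}\gamma\nabla u\cdot\nabla\psi-k^2\rho u\psi\,dx=\int_{\mathcal C_\epsilon}\nabla v\cdot\nabla\psi-k^2v\psi\,dx$ for all $\psi\in H^1(\mathcal C_\epsilon)$ vanishing near $\partial B_\epsilon$. For all large $\tau$ let $r=r_\tau\in H^1(\mathcal C_\epsilon)$ be such that $$w=\gamma^{-1/2}(1+r)e^{\eta\cdot x}\quad\text{is an } H^1(\mathcal C_\epsilon)\text{ weak solution of}\quad \nabla\cdot\gamma\nabla w+k^2\rho w=0\ \text{ in }\mathcal C_\epsilon,$$ and suppose that there are $p,\hat p>1$ (finite) and $\sigma_0>0$ with $$\|r\|_{L^p(\mathcal C_\epsilon)}=O(\tau^{-n/p-\sigma_0}),\qquad \|\nabla r\|_{L^{\hat p}(\mathcal C_\epsilon)}=O(\tau^{1-n/\hat p-\sigma_0})\qquad(\tau\to\infty).$$ Suppose that there are real constants $\alpha\ne-1$, $\beta$, $\alpha_0$,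 $\beta_0$ and $\sigma>0$, and functions $\gamma_\beta,\rho_0\in L^\infty(K)$ (real valued), $V\in L^\infty(K;\mathbb C^n)$, $\tilde v\in L^\infty(K;\mathbb C)$ with, for a.e. $x\in\mathcal C_\epsilon$, $$(\gamma-1)\gamma^{-1/2}=\gamma_\beta(\hat x)|x|^\beta+O(|x|^{\beta+\sigma}),\qquad \nabla v=V(\hat x)|x|^\alpha+O(|x|^{\alpha+\sigma}),$$ $$(\rho-1)\gamma^{-1/2}=\rho_0(\hat x)|x|^{\beta_0}+O(|x|^{\beta_0+\sigma}),\qquad v=\tilde v(\hat x)|x|^{\alpha_0}+O(|x|^{\alpha_0+\sigma}).$$ Write $A=\|\gamma_\beta\|_{L^\infty(K)}\|V\|_{L^\infty(K)}$, $B=\|\rho_0\|_{L^\infty(K)}\|\tilde v\|_{L^\infty(K)}$ (essential suprema for surface measure), and $$I_1(\tau)=\int_{\mathcal C_\epsilon}\gamma_\beta(\hat x)V(\hat x)\cdot\eta\,|x|^{\alpha+\beta}e^{\eta\cdot x}dx,\qquad I_2(\tau)=\int_{\mathcal C_\epsilon}\rho_0(\hat x)\tilde v(\hat x)|x|^{\alpha_0+\beta_0}e^{\eta\cdot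 x}dx ,$$ where $a\cdot b=\sum_j a_jb_j$. Then both integrals converge absolutely, and as $\tau\to\infty$ $$|I_1|=k^2B\,O(\tau^{-(n+\beta_0+\alpha_0)})+k^2O(\tau^{-(n+\beta_0+\alpha_0+\sigma)})+A\,O(\tau^{-(n+\beta+\alpha)})+O(\tau^{-(n+\beta+\alpha-1+\sigma)}),$$ $$k^2|I_2|=k^2B\,O(\tau^{-(n+\beta_0+\alpha_0+\sigma_0)})+k^2O(\tau^{-(n+\beta_0+\alpha_0+\sigma)})+A\,O(\tau^{-(n+\beta+\alpha-1)})+O(\tau^{-(n+\beta+\alpha-1+\sigma)}),$$ $$|I_1-k^2I_2|=k^2B\,O(\tau^{-(n+\beta_0+\alpha_0+\sigma_0)})+k^2O(\tau^{-(n+\beta_0+\alpha_0+\sigma)})+A\,O(\tau^{-(n+\beta+\alpha)})+O(\tau^{-(n+\beta+\alpha-1+\sigma)}).$$ The implied constants do not depend on $\tau$. -/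

import Mathlib

open MeasureTheory Filter Topology Asymptotics
open scoped ENNReal ContDiff

noncomputable section

namespace CornerScattering

/-! ### The generalized cone -/

/-- The space `ℝⁿ` with its Euclidean norm. -/
abbrev RSpace (n : ℕ) : Type := EuclideanSpace ℝ (Fin n)

/-- The space `ℂⁿ`. -/
abbrev CSpace (n : ℕ) : Type := EuclideanSpace ℂ (Fin n)

/-- The unit sphere `S^{n-1}` of `ℝⁿ`, as a type. -/
abbrev USphere (n : ℕ) : Type := Metric.sphere (0 : RSpace n) 1

/-- The infinite cone `C = {x ≠ 0 : x / |x| ∈ K}` over a set `K` of directions. -/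
def cone {n : ℕ} (K : Set (USphere n)) : Set (RSpace n) :=
  {x | ∃ θ ∈ K, ∃ t : ℝ, 0 < t ∧ x = t • (θ : RSpace n)}

/-- The truncated cone `C_ε = C ∩ B_ε`. -/
def truncCone {n : ℕ} (K : Set (USphere n)) (ε : ℝ) : Set (RSpace n) :=
  cone K ∩ Metric.ball 0 ε

/-- The set `K'_δ` of the directions `d` with `d · θ > δ` for every `θ ∈ K`. -/
def admissibleDirections {n : ℕ} (K : Set (USphere n)) (δ : ℝ) : Set (USphere n) :=
  {d | ∀ θ ∈ K, δ < inner ℝ (d : RSpace n) (θ : RSpace n)}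

/-- The direction `x / |x|` of a point `x ≠ 0`. -/
def dir {n : ℕ} (x : RSpace n) : RSpace n := ‖x‖⁻¹ • x

/-- `f ∈ L^∞(K)` with respect to the surface measure of the sphere; only the values of `f` at
the points of `K` matter. -/
def MemLinfty {n : ℕ} {F : Type*} [NormedAddCommGroup F] (K : Set (USphere n))
    (f : RSpace n → F) : Prop :=
  MemLp (fun θ : USphere n => f θ) ∞ ((volume : Measure (RSpace n)).toSphere.restrict K)

/-- The norm of `f` in `L^∞(K)`. -/
def linftyNorm {n : ℕ} {F : Type*} [NormedAddCommGroup F] (K : Set (USphere n))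
    (f : RSpace n → F) : ℝ :=
  (eLpNorm (fun θ : USphere n => f θ) ∞
    ((volume : Measure (RSpace n)).toSphere.restrict K)).toReal

/-- `f(x) = f₀(x/|x|) |x|^m + O(|x|^{m+σ})` for almost every `x ∈ S`. -/
def HasLeadingTerm {n : ℕ} {F : Type*} [NormedAddCommGroup F] [NormedSpace ℝ F]
    (S : Set (RSpace n)) (f f₀ : RSpace n → F) (m σ : ℝ) : Prop :=
  ∃ C : ℝ, ∀ᵐ x ∂(volume : Measure (RSpace n)).restrict S,
    ‖f x - ‖x‖ ^ m • f₀ (dir x)‖ ≤ C * ‖x‖ ^ (m + σ)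

/-! ### Weak derivatives and Sobolev spaces -/

/-- Smooth functions with compact support in `Ω`. -/
def IsTestFunction {n : ℕ} {𝕜 : Type*} [RCLike 𝕜] (Ω : Set (RSpace n)) (φ : RSpace n → 𝕜) :
    Prop :=
  ContDiff ℝ ∞ φ ∧ HasCompactSupport φ ∧ tsupport φ ⊆ Ω

/-- The vector `(∂₁φ(x), …, ∂ₙφ(x))` of the classical partial derivatives. -/
def classicalGrad {n : ℕ} {𝕜 : Type*} [RCLike 𝕜] (φ : RSpace n → 𝕜) (x : RSpace n) :
    EuclideanSpace 𝕜 (Fin n) :=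
  WithLp.toLp 2 fun i => fderiv ℝ φ x (EuclideanSpace.single i 1)

/-- `G` is the weak gradient of `f` in the open set `Ω`. -/
def HasWeakGradient {n : ℕ} {𝕜 : Type*} [RCLike 𝕜] (Ω : Set (RSpace n)) (f : RSpace n → 𝕜)
    (G : RSpace n → EuclideanSpace 𝕜 (Fin n)) : Prop :=
  LocallyIntegrableOn f Ω ∧ LocallyIntegrableOn G Ω ∧
    ∀ φ : RSpace n → 𝕜, IsTestFunction Ω φ → ∀ i : Fin n,
      ∫ x in Ω, f x * classicalGrad φ x i = -∫ x in Ω, G x i * φ x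

/-- `f ∈ H¹(Ω)`, with weak gradient `G`. -/
def IsH1 {n : ℕ} (Ω : Set (RSpace n)) (f : RSpace n → ℂ) (G : RSpace n → CSpace n) : Prop :=
  MemLp f 2 (volume.restrict Ω) ∧ MemLp G 2 (volume.restrict Ω) ∧ HasWeakGradient Ω f G

/-- `γ ∈ W^{1,∞}(ℝⁿ)`. -/
def IsW1Infty {n : ℕ} (γ : RSpace n → ℝ) : Prop :=
  MemLp γ ∞ (volume : Measure (RSpace n)) ∧
    ∃ G : RSpace n → RSpace n, MemLp G ∞ (volume : Measure (RSpace n)) ∧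
      HasWeakGradient Set.univ γ G

/-! ### The local transmission problem -/

/-- The bilinear (not conjugated) product `a · b = ∑ aᵢ bᵢ` of `ℂⁿ`. -/
def cdot {n : ℕ} (a b : CSpace n) : ℂ := ∑ i, a i * b i

/-- The form `∫_Ω γ ∇u · ∇ψ - k² ρ u ψ` of the operator `-(∇ · γ∇ + k² ρ)`. -/
def energyForm {n : ℕ} (k : ℝ) (γ ρ : RSpace n → ℝ) (Ω : Set (RSpace n))
    (u : RSpace n → ℂ) (Du : RSpace n → CSpace n)
    (ψ : RSpace n → ℂ) (Dψ : RSpace n → CSpace n) : ℂ :=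
  ∫ x in Ω, ((γ x : ℂ) * cdot (Du x) (Dψ x) - (k : ℂ) ^ 2 * (ρ x : ℂ) * u x * ψ x)

/-- `u ∈ H¹(Ω)`, with weak gradient `Du`, is a weak solution of `∇ · γ∇u + k² ρ u = 0` in `Ω`. -/
def IsWeakSolution {n : ℕ} (k : ℝ) (γ ρ : RSpace n → ℝ) (Ω : Set (RSpace n))
    (u : RSpace n → ℂ) (Du : RSpace n → CSpace n) : Prop :=
  IsH1 Ω u Du ∧
    ∀ φ : RSpace n → ℂ, IsTestFunction Ω φ → energyForm k γ ρ Ω u Du φ (classicalGrad φ) = 0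

/-- `z ∈ H¹(C_ε)` has trace zero on the lateral boundary `∂C_ε \ ∂B_ε`: it is a limit in
`H¹(C_ε)` of smooth functions that vanish near `∂C` (and are free near the cap `C ∩ ∂B_ε`). -/
def HasZeroLateralTrace {n : ℕ} (K : Set (USphere n)) (ε : ℝ)
    (z : RSpace n → ℂ) (Dz : RSpace n → CSpace n) : Prop :=
  ∃ φ : ℕ → RSpace n → ℂ, (∀ j, IsTestFunction (cone K) (φ j)) ∧
    Tendsto (fun j => eLpNorm (fun x => z x - φ j x) 2 (volume.restrict (truncCone K ε)))
      atTop (𝓝 0) ∧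
    Tendsto (fun j => eLpNorm (fun x => Dz x - classicalGrad (φ j) x) 2
      (volume.restrict (truncCone K ε))) atTop (𝓝 0)

/-- `ψ` vanishes almost everywhere in `C_ε` near the cap `C ∩ ∂B_ε`. -/
def VanishesNearCap {n : ℕ} (K : Set (USphere n)) (ε : ℝ) (ψ : RSpace n → ℂ) : Prop :=
  ∃ ε' < ε, ∀ᵐ x ∂(volume : Measure (RSpace n)).restrict (truncCone K ε), ε' ≤ ‖x‖ → ψ x = 0

/-- The local transmission problem: `u, v ∈ H¹(C_ε)`,
`∇ · γ∇u + k² ρ u = 0` and `Δv + k² v = 0` in `C_ε`, and `u = v`, `γ ∂_ν u = ∂_ν v` on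
`∂C_ε \ ∂B_ε`. By Green's formula, the pairing of the conormal derivative `γ ∂_ν u` of a solution
with the trace of a function `ψ ∈ H¹(C_ε)` that vanishes near the cap is the energy form of `u`
and `ψ`, which is how the conormal derivative of an `H¹` solution is defined. -/
structure LocalTransmission {n : ℕ} (k : ℝ) (γ ρ : RSpace n → ℝ) (K : Set (USphere n)) (ε : ℝ)
    (u v : RSpace n → ℂ) (Du Dv : RSpace n → CSpace n) : Prop where
  sol_u : IsWeakSolution k γ ρ (truncCone K ε) u Du
  sol_v : IsWeakSolution k 1 1 (truncCone K ε) v Dv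
  dirichlet : HasZeroLateralTrace K ε (u - v) (Du - Dv)
  conormal : ∀ (ψ : RSpace n → ℂ) (Dψ : RSpace n → CSpace n),
    IsH1 (truncCone K ε) ψ Dψ → VanishesNearCap K ε ψ →
      energyForm k γ ρ (truncCone K ε) u Du ψ Dψ = energyForm k 1 1 (truncCone K ε) v Dv ψ Dψ

/-! ### Complex geometrical optics functions -/

/-- The complex vector `η = -τ (d + i d^⊥)`. -/
def eta {n : ℕ} (d d' : USphere n) (τ : ℝ) : CSpace n :=
  WithLp.toLp 2 fun i =>
    -(τ : ℂ) * (((d : RSpace n) i : ℂ) + Complex.I * ((d' : RSpace n) i : ℂ))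

/-- The exponential `e^{η · x}`. -/
def cexpDot {n : ℕ} (η : CSpace n) (x : RSpace n) : ℂ :=
  Complex.exp (∑ i, η i * (x i : ℂ))

/-- The function `w = γ^{-1/2} (1 + r) e^{η · x}`. -/
def cgo {n : ℕ} (γ : RSpace n → ℝ) (r : RSpace n → ℂ) (η : CSpace n) (x : RSpace n) : ℂ :=
  ((γ x ^ (-(1 / 2) : ℝ) : ℝ) : ℂ) * (1 + r x) * cexpDot η x

/-! ### The leading terms -/

/-- The integrand `γ_β(x/|x|) V(x/|x|) · η |x|^{α+β} e^{η · x}`. -/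
def leadGrad {n : ℕ} (γβ : RSpace n → ℝ) (V : RSpace n → CSpace n) (α β : ℝ) (η : CSpace n)
    (x : RSpace n) : ℂ :=
  (γβ (dir x) : ℂ) * cdot (V (dir x)) η * ((‖x‖ ^ (α + β) : ℝ) : ℂ) * cexpDot η x

/-- The integrand `ρ₀(x/|x|) ṽ(x/|x|) |x|^{α₀+β₀} e^{η · x}`. -/
def leadPot {n : ℕ} (ρ₀ : RSpace n → ℝ) (v₀ : RSpace n → ℂ) (α₀ β₀ : ℝ) (η : CSpace n)
    (x : RSpace n) : ℂ :=
  (ρ₀ (dir x) : ℂ) * v₀ (dir x) * ((‖x‖ ^ (α₀ + β₀) : ℝ) : ℂ) * cexpDot η x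

end CornerScattering

end
open CornerScattering

noncomputable section

namespace CornerScattering

open Real Metric
open ENNReal (ofReal ofReal_le_ofReal ofReal_mul)
open Complex (norm_real continuous_ofReal ofRealCLM real_smul coe_smul conjCLE continuous_conj)
open Finset (mul_sum sum_congr sum_add_distrib sum_neg_distrib sum_le_sum sum_eq_zero sum_nonneg
  sum_sub_distrib sum_range_succ)
open Set (indicator_of_mem indicator_of_notMem inter_subset_left inter_subset_right mem_univ
  inter_subset_inter_right mem_singleton_iff inter_eq_left mem_smul_set_iff_inv_smul_mem₀
  mem_inter_iff subset_univ subset_inter)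
open Function (iterate_succ_apply')

variable {n : ℕ} {K : Set (USphere n)} {ε δ : ℝ} {d d' : USphere n} {Ω : Set (RSpace n)}
  {E F : Type*} [NormedAddCommGroup E] [NormedAddCommGroup F]

local notation "𝔼" => RSpace n
local notation "𝒞" => truncCone K ε
local notation:max "𝐞" τ:max => cexpDot (eta d d' τ)
local notation "½" => (1 / 2 : ℝ)
local notation:max "vol" S:max => Measure.restrict volume S
local notation:max "ℂ(" x ")" => ((x : ℝ) : ℂ)
local notation:max "pr" R:max i:max => (EuclideanSpace.proj i : EuclideanSpace R (Fin n) →L[R] R)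
local notation:100 f:101 "=𝒪" s:max => f =O[atTop] fun τ : ℝ => τ ^ s
local notation:max "AESM" f:max μ:max => AEStronglyMeasurable f μ
local notation "𝒟" => admissibleDirections K δ

scoped notation "∇" => classicalGrad

/-! ### Partial derivatives of smooth functions -/

/-- The `i`-th partial derivative. -/
def pd [NormedSpace ℝ F] (i : Fin n) (φ : 𝔼 → F) (x : 𝔼) : F :=
  fderiv ℝ φ x (EuclideanSpace.single i 1)

/-- The Laplacian. -/
def lapl [NormedSpace ℝ F] (φ : 𝔼 → F) (x : 𝔼) : F := ∑ i, pd i (pd i φ) x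

section Pd

variable [NormedSpace ℝ F]

lemma contDiff_pd {φ : 𝔼 → F} (h : ContDiff ℝ ∞ φ) (i : Fin n) : ContDiff ℝ ∞ (pd i φ) :=
  (h.fderiv_right (m := ∞) (by simp)).clm_apply contDiff_const

lemma contDiff_lapl {φ : 𝔼 → F} (h : ContDiff ℝ ∞ φ) : ContDiff ℝ ∞ (lapl φ) := by
  unfold lapl; exact ContDiff.sum fun i _ => contDiff_pd (contDiff_pd h i) i

lemma tsupport_pd_subset (φ : 𝔼 → F) (i : Fin n) : tsupport (pd i φ) ⊆ tsupport φ :=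
  tsupport_fderiv_apply_subset ℝ _

lemma hasCompactSupport_pd {φ : 𝔼 → F} (h : HasCompactSupport φ) (i : Fin n) :
    HasCompactSupport (pd i φ) :=
  h.fderiv_apply ℝ _

lemma pd_eq_zero {φ : 𝔼 → F} {x : 𝔼} (h : x ∉ tsupport φ) (i : Fin n) : pd i φ x = 0 :=
  image_eq_zero_of_notMem_tsupport fun h' => h (tsupport_pd_subset φ i h')

lemma lapl_eq_zero {φ : 𝔼 → F} {x : 𝔼} (h : x ∉ tsupport φ) : lapl φ x = 0 :=
  sum_eq_zero fun i _ => pd_eq_zero (fun h' => h (tsupport_pd_subset φ i h')) i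

lemma tsupport_lapl_subset (φ : 𝔼 → F) : tsupport (lapl φ) ⊆ tsupport φ := by
  refine closure_minimal (fun x hx => ?_) (isClosed_tsupport φ)
  by_contra h
  exact hx (lapl_eq_zero h)

lemma hasCompactSupport_lapl {φ : 𝔼 → F} (h : HasCompactSupport φ) : HasCompactSupport (lapl φ) :=
  h.of_isClosed_subset (isClosed_tsupport _) (tsupport_lapl_subset φ)

lemma pd_comp_const_sub (φ : 𝔼 → F) (i : Fin n) (x y : 𝔼) :
    pd i (fun y => φ (x - y)) y = -pd i φ (x - y) := by
  have e : (fun y => φ (x - y)) = fun y => (fun z => φ (x + z)) ((-1 : ℝ) • y) := by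
    funext y; simp [sub_eq_add_neg]
  unfold pd; rw [e, fderiv_comp_smul (f := fun z => φ (x + z)), fderiv_comp_add_left]
  simp [sub_eq_add_neg]

lemma pd_neg (φ : 𝔼 → F) (i : Fin n) : pd i (fun y => -φ y) = fun y => -pd i φ y := by
  funext y; simp [pd, fderiv_fun_neg]

lemma lapl_comp_const_sub (φ : 𝔼 → F) (x y : 𝔼) : lapl (fun y => φ (x - y)) y = lapl φ (x - y) := by
  unfold lapl; refine sum_congr rfl fun i _ => ?_
  have : pd i (fun y => φ (x - y)) = fun y => -pd i φ (x - y) := by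
    funext y; exact pd_comp_const_sub φ i x y
  rw [this, pd_neg (fun y => pd i φ (x - y))]; simp [pd_comp_const_sub]

lemma pd_comp_smul {φ : 𝔼 → F} (c : ℝ) (i : Fin n) (x : 𝔼) :
    pd i (fun y => φ (c • y)) x = c • pd i φ (c • x) := by
  unfold pd; rw [fderiv_comp_smul]; simp

lemma pd_const_smul {φ : 𝔼 → F} (c : ℝ) (i : Fin n) (x : 𝔼) :
    pd i (fun y => c • φ y) x = c • pd i φ x := by
  have e : (fun y => c • φ y) = c • φ := rfl; unfold pd; rw [e, fderiv_const_smul_field]; simp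

lemma lapl_scale {φ : 𝔼 → F} (c e : ℝ) (x : 𝔼) :
    lapl (fun y => e • φ (c • y)) x = (e * c ^ 2) • lapl φ (c • x) := by
  unfold lapl; rw [Finset.smul_sum]; refine sum_congr rfl fun i _ => ?_
  have : pd i (fun y => e • φ (c • y)) = fun y => (e * c) • pd i φ (c • y) := by
    funext y; rw [pd_const_smul (φ := fun y => φ (c • y)), pd_comp_smul, smul_smul]
  rw [this, pd_const_smul (φ := fun y => pd i φ (c • y)), pd_comp_smul, smul_smul]; congr 1; ring

lemma fderiv_eq_sum_pd (φ : 𝔼 → F) (x v : 𝔼) : fderiv ℝ φ x v = ∑ i, v i • pd i φ x := by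
  conv_lhs => rw [← (EuclideanSpace.basisFun (Fin n) ℝ).sum_repr v]
  simp [pd, map_sum]

end Pd

lemma exists_le {k : 𝔼 → F} (hk : Continuous k) (hc : HasCompactSupport k) :
    ∃ C, 0 ≤ C ∧ ∀ x, ‖k x‖ ≤ C := by
  obtain ⟨C, hC⟩ := hk.bounded_above_of_compact_support hc
  exact ⟨max C 0, le_max_right _ _, fun x => (hC x).trans (le_max_left _ _)⟩

/-! ### A radial kernel -/

lemma deriv_expNegInvGlue_of_nonpos {t : ℝ} (ht : t ≤ 0) : deriv expNegInvGlue t = 0 := by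
  have hd : HasDerivAt expNegInvGlue (deriv expNegInvGlue t) t :=
    ((expNegInvGlue.contDiff (n := 1)).differentiable (by simp) t).hasDerivAt
  have h1 : HasDerivWithinAt expNegInvGlue (deriv expNegInvGlue t) (Set.Iic t) t :=
    hd.hasDerivWithinAt
  have h2 : HasDerivWithinAt expNegInvGlue 0 (Set.Iic t) t := (hasDerivWithinAt_const t (Set.Iic t)
    (0 : ℝ)).congr (fun s hs => expNegInvGlue.zero_of_nonpos (le_trans hs ht))
    (expNegInvGlue.zero_of_nonpos ht)
  exact (uniqueDiffWithinAt_Iic t).eq_deriv _ h1 h2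

lemma deriv_expNegInvGlue_nonneg (t : ℝ) : 0 ≤ deriv expNegInvGlue t :=
  expNegInvGlue.monotone.deriv_nonneg

/-- A radial bump function supported in the unit ball. -/
def radBump (x : 𝔼) : ℝ := expNegInvGlue (1 - ‖x‖ ^ 2)

/-- The radial function with `∇ radBump x = radKer x • x`. -/
def radKer (x : 𝔼) : ℝ := -2 * deriv expNegInvGlue (1 - ‖x‖ ^ 2)

lemma contDiff_radBump : ContDiff ℝ ∞ (radBump (n := n)) :=
  (expNegInvGlue.contDiff (n := ⊤)).comp (contDiff_const.sub (contDiff_norm_sq ℝ))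

lemma contDiff_radKer : ContDiff ℝ ∞ (radKer (n := n)) := by
  have h : ContDiff ℝ ∞ (deriv expNegInvGlue) :=
    (contDiff_infty_iff_deriv.1 (expNegInvGlue.contDiff (n := ⊤))).2
  exact contDiff_const.mul (h.comp (contDiff_const.sub (contDiff_norm_sq ℝ)))

lemma radBump_eq_zero {x : 𝔼} (h : 1 ≤ ‖x‖) : radBump x = 0 :=
  expNegInvGlue.zero_of_nonpos (by nlinarith)

lemma radKer_eq_zero {x : 𝔼} (h : 1 ≤ ‖x‖) : radKer x = 0 := by
  rw [radKer, deriv_expNegInvGlue_of_nonpos (by nlinarith), mul_zero]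

lemma hasCompactSupport_of {F : Type*} [Zero F] {k : 𝔼 → F} {R : ℝ}
    (h : ∀ x, R ≤ ‖x‖ → k x = 0) : HasCompactSupport k :=
  HasCompactSupport.of_support_subset_isCompact (isCompact_closedBall (0 : 𝔼) R) fun x hx => by
    rw [mem_closedBall_zero_iff]
    by_contra hlt
    exact hx (h x (le_of_lt (not_le.1 hlt)))

lemma hasCompactSupport_radBump : HasCompactSupport (radBump (n := n)) :=
  hasCompactSupport_of (R := 1) fun _ => radBump_eq_zero

lemma hasCompactSupport_radKer : HasCompactSupport (radKer (n := n)) :=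
  hasCompactSupport_of (R := 1) fun _ => radKer_eq_zero

lemma pd_radBump (i : Fin n) (x : 𝔼) : pd i radBump x = x i * radKer x := by
  have h1 : HasFDerivAt (fun x : 𝔼 => 1 - ‖x‖ ^ 2) (-(2 • innerSL ℝ x)) x := by
    simpa using ((hasStrictFDerivAt_norm_sq x).hasFDerivAt).const_sub 1
  have h2 : HasDerivAt expNegInvGlue (deriv expNegInvGlue (1 - ‖x‖ ^ 2)) (1 - ‖x‖ ^ 2) :=
    ((expNegInvGlue.contDiff (n := 1)).differentiable (by simp) _).hasDerivAt
  have h3 := h2.comp_hasFDerivAt x h1; have h4 : fderiv ℝ (radBump (n := n)) x = _ := h3.fderiv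
  rw [pd, h4]; simp [radKer, EuclideanSpace.inner_single_right]; ring

lemma lapl_radBump (x : 𝔼) : lapl radBump x = n * radKer x + fderiv ℝ radKer x x := by
  have hd : Differentiable ℝ (radKer (n := n)) := contDiff_radKer.differentiable (by simp)
  rw [fderiv_eq_sum_pd, lapl]
  have : ∀ i : Fin n, pd i (pd i radBump) x = radKer x + x i • pd i radKer x := by
    intro i; have e : pd i (radBump (n := n)) = fun x => x i * radKer x := funext (pd_radBump i)
    rw [e, pd]; have hc : HasFDerivAt (fun x : 𝔼 => x i) (pr ℝ i) x := (pr ℝ i).hasFDerivAt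
    rw [HasFDerivAt.fderiv (f := fun x : 𝔼 => x i * radKer x) (hc.mul (hd x).hasFDerivAt)]
    simp [pd]; ring
  rw [sum_congr rfl fun i _ => this i, sum_add_distrib]; simp

/-- The integral of the radial kernel. -/
def radMass (n : ℕ) : ℝ := ∫ x : RSpace n, radKer x

lemma radMass_ne_zero (hn : 0 < n) : radMass n ≠ 0 := by
  intro h
  have hnonneg : ∀ x : 𝔼, 0 ≤ -radKer x := fun x => by
    rw [radKer]; nlinarith [deriv_expNegInvGlue_nonneg (1 - ‖x‖ ^ 2)]
  have hint : Integrable (radKer (n := n)) :=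
    contDiff_radKer.continuous.integrable_of_hasCompactSupport hasCompactSupport_radKer
  have h0 : (fun x : 𝔼 => -radKer x) = 0 := by
    have h1 := (integral_eq_zero_iff_of_nonneg (μ := volume)
      hnonneg hint.neg).1 (by rw [integral_neg]; unfold radMass at h; rw [h, neg_zero])
    exact (contDiff_radKer.continuous.neg).ae_eq_iff_eq _ continuous_const |>.1 h1
  obtain ⟨t, ht, hs⟩ := exists_deriv_eq_slope expNegInvGlue (zero_lt_one (α := ℝ))
    (expNegInvGlue.contDiff (n := 1)).continuous.continuousOn
    ((expNegInvGlue.contDiff (n := 1)).differentiable (by simp)).differentiableOn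
  have h3 := congrFun h0 (EuclideanSpace.single ⟨0, hn⟩ (sqrt (1 - t)))
  simp only [radKer, PiLp.norm_single, norm_eq_abs, sq_abs,
    sq_sqrt (show 0 ≤ 1 - t by linarith [ht.2]), Pi.zero_apply, sub_sub_cancel] at h3
  rw [expNegInvGlue.zero, sub_zero, sub_zero, div_one] at hs
  linarith [expNegInvGlue.pos_of_pos (zero_lt_one (α := ℝ))]

/-! ### Finite differences -/

/-- The backward difference with step `a`. -/
def bdiff {F : Type*} [AddGroup F] (a : 𝔼) (k : 𝔼 → F) : 𝔼 → F := fun w => k w - k (w - a)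

lemma iterate_bdiff_contDiff [NormedSpace ℝ F] (a : 𝔼) (N : ℕ) {k : 𝔼 → F}
    (hk : ContDiff ℝ ∞ k) : ContDiff ℝ ∞ ((bdiff a)^[N] k) := by
  induction N with
  | zero => simpa using hk
  | succ N ih =>
    rw [iterate_succ_apply']; exact ih.sub (ih.comp (contDiff_id.sub contDiff_const))

lemma fderiv_iterate_bdiff [NormedSpace ℝ F] (a : 𝔼) (N : ℕ) {k : 𝔼 → F} (hk : ContDiff ℝ ∞ k) :
    fderiv ℝ ((bdiff a)^[N] k) = (bdiff a)^[N] (fderiv ℝ k) := by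
  induction N with
  | zero => rfl
  | succ N ih =>
    rw [iterate_succ_apply', iterate_succ_apply', ← ih]; funext w
    have hd := (iterate_bdiff_contDiff a N hk).differentiable (by simp)
    have h2 : DifferentiableAt ℝ (fun w => (bdiff a)^[N] k (w - a)) w :=
      (hd _).comp w (differentiableAt_id.sub_const a)
    have : bdiff a ((bdiff a)^[N] k) = fun w => (bdiff a)^[N] k w - (bdiff a)^[N] k (w - a) := rfl
    rw [this, fderiv_fun_sub (hd w) h2]; simp only [sub_eq_add_neg, fderiv_comp_add_right, bdiff]

lemma norm_iterate_bdiff_le (N : ℕ) : ∀ {F : Type} [NormedAddCommGroup F] [NormedSpace ℝ F]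
    {k : 𝔼 → F}, ContDiff ℝ ∞ k → HasCompactSupport k → ∃ C, 0 ≤ C ∧ ∀ a w, ‖(bdiff a)^[N] k w‖ ≤
    C * ‖a‖ ^ N := by
  induction N with
  | zero =>
    intro F _ _ k hk hc; obtain ⟨C, hC0, hC⟩ := exists_le hk.continuous hc
    exact ⟨C, hC0, fun a w => by simpa using hC w⟩
  | succ N ih =>
    intro F _ _ k hk hc
    obtain ⟨C, hC0, hC⟩ := ih (hk.fderiv_right (m := ∞) (by simp)) (hc.fderiv ℝ)
    refine ⟨C, hC0, fun a w => ?_⟩; rw [iterate_succ_apply']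
    have hd := (iterate_bdiff_contDiff a N hk).differentiable (by simp)
    have := Convex.norm_image_sub_le_of_norm_fderiv_le (𝕜 := ℝ) (f := (bdiff a)^[N] k)
      (C := C * ‖a‖ ^ N) (s := Set.univ) (fun x _ => hd x)
      (fun x _ => by rw [fderiv_iterate_bdiff a N hk]; exact hC a x) convex_univ
      (mem_univ (w - a)) (mem_univ w)
    rw [sub_sub_cancel] at this; rw [pow_succ, ← mul_assoc]; exact this

lemma iterate_bdiff_scale {F : Type*} [AddGroup F] (a : 𝔼) (N : ℕ) (k : 𝔼 → F) (c : ℝ) :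
    (bdiff a)^[N] (fun w => k (c • w)) = fun w => (bdiff (c • a))^[N] k (c • w) := by
  induction N with
  | zero => rfl
  | succ N ih =>
    rw [iterate_succ_apply', ih]; funext w; rw [iterate_succ_apply']; simp [bdiff, smul_sub]

lemma iterate_bdiff_const_mul (a : 𝔼) (N : ℕ) (k : 𝔼 → ℝ) (c : ℝ) :
    (bdiff a)^[N] (fun w => c * k w) = fun w => c * (bdiff a)^[N] k w := by
  induction N with
  | zero => rfl
  | succ N ih =>
    rw [iterate_succ_apply', ih]; funext w; rw [iterate_succ_apply']; simp [bdiff, mul_sub]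

lemma iterate_bdiff_sub {F : Type*} [AddCommGroup F] (a : 𝔼) (N : ℕ) (f g : 𝔼 → F) :
    (bdiff a)^[N] (fun w => f w - g w) = fun w => (bdiff a)^[N] f w - (bdiff a)^[N] g w := by
  induction N with
  | zero => rfl
  | succ N ih =>
    rw [iterate_succ_apply', ih]; funext w; rw [iterate_succ_apply', iterate_succ_apply']
    simp [bdiff]; abel

lemma iterate_bdiff_congr {F : Type*} [AddGroup F] (a : 𝔼) (N : ℕ) {f g : 𝔼 → F} : ∀ x,
    (∀ j : ℕ, j ≤ N → f (x - (j : ℝ) • a) = g (x - (j : ℝ) • a)) → (bdiff a)^[N] f x =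
    (bdiff a)^[N] g x := by
  induction N with
  | zero => intro x h; simpa using h 0 le_rfl
  | succ N ih =>
    intro x h; rw [iterate_succ_apply', iterate_succ_apply']; unfold bdiff
    have h1 := ih x fun j hj => h j (by omega)
    have h2 := ih (x - a) fun j hj => by
      have := h (j + 1) (by omega); push_cast at this; rw [add_smul, one_smul] at this
      rw [sub_sub, add_comm a, this]
    unfold bdiff at h1 h2; rw [h1, h2]

lemma norm_iterate_bdiff_le_of_forall (a : 𝔼) (N : ℕ) {f : 𝔼 → F} {C : ℝ} :
    ∀ x, (∀ j : ℕ, j ≤ N → ‖f (x - (j : ℝ) • a)‖ ≤ C) → ‖(bdiff a)^[N] f x‖ ≤ 2 ^ N * C := by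
  induction N with
  | zero => intro x h; simpa using h 0 le_rfl
  | succ N ih =>
    intro x h; rw [iterate_succ_apply']; have h1 := ih x fun j hj => h j (by omega)
    have h2 := ih (x - a) fun j hj => by
      have := h (j + 1) (by omega); push_cast at this; rw [add_smul, one_smul] at this
      rw [sub_sub, add_comm a]; exact this
    calc _ ≤ _ := norm_sub_le _ _
      _ ≤ _ := add_le_add h1 h2
      _ = _ := by ring

lemma iterate_bdiff_eq_of_shifts_zero {F : Type*} [AddGroup F] (a : 𝔼) (N : ℕ) {f : 𝔼 → F} :
    ∀ x, (∀ j : ℕ, 1 ≤ j → j ≤ N → f (x - (j : ℝ) • a) = 0) → (bdiff a)^[N] f x = f x := by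
  intro x h
  have key : ∀ (M : ℕ) (y : 𝔼), (∀ j : ℕ, j ≤ M → f (y - (j : ℝ) • a) = 0) →
      (bdiff a)^[M] f y = 0 := by
    intro M y hy; rw [iterate_bdiff_congr (g := fun _ => 0) a M y hy]; clear hy h
    induction M generalizing y with
    | zero => rfl
    | succ M ih =>
      rw [iterate_succ_apply']; simp [bdiff, ih]
  induction N with
  | zero => rfl
  | succ N ih =>
    rw [iterate_succ_apply']; unfold bdiff; have h1 := ih fun j hj hj' => h j hj (by omega)
    have h2 := key N (x - a) fun j hj => by
      have := h (j + 1) (by omega) (by omega); push_cast at this; rw [add_smul, one_smul] at this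
      rw [sub_sub, add_comm a]; exact this
    unfold bdiff at h1 h2; rw [h1, h2, sub_zero]

lemma hasDerivAt_iterate_bdiff [NormedSpace ℝ F] (a : 𝔼) (N : ℕ) {f f' : ℝ → 𝔼 → F} {s : ℝ}
    (h : ∀ x, HasDerivAt (fun s => f s x) (f' s x) s) :
    ∀ x, HasDerivAt (fun s => (bdiff a)^[N] (f s) x) ((bdiff a)^[N] (f' s) x) s := by
  induction N with
  | zero => exact h
  | succ N ih =>
    intro x; simp only [iterate_succ_apply']; exact (ih x).sub (ih (x - a))

/-! ### Convolution of an integrable function with a smooth kernel -/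

/-- The convolution of `Y` with the real kernel `k`. -/
def kconv (k : 𝔼 → ℝ) (Y : 𝔼 → ℂ) (x : 𝔼) : ℂ := ∫ y, (k (x - y) : ℂ) * Y y

lemma integrable_kconv {k : 𝔼 → ℝ} (hk : Continuous k) {C : ℝ} (hC : ∀ w, ‖k w‖ ≤ C) {Y : 𝔼 → ℂ}
    (hY : Integrable Y) (x : 𝔼) : Integrable fun y => (k (x - y) : ℂ) * Y y := by
  refine hY.bdd_mul (c := C) ?_ (.of_forall fun y => by simpa using hC (x - y))
  exact (continuous_ofReal.comp (hk.comp (continuous_const.sub continuous_id))).aestronglyMeasurable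

lemma iterate_bdiff_kconv (a : 𝔼) (N : ℕ) {k : 𝔼 → ℝ} (hk : Continuous k) {C : ℝ}
    (hC : ∀ w, ‖k w‖ ≤ C) {Y : 𝔼 → ℂ} (hY : Integrable Y) : (bdiff a)^[N] (kconv k Y) = kconv
    ((bdiff a)^[N] k) Y ∧ Continuous ((bdiff a)^[N] k) ∧ ∃ C', ∀ w, ‖(bdiff a)^[N] k w‖ ≤ C' := by
  induction N with
  | zero => exact ⟨rfl, hk, C, hC⟩
  | succ N ih =>
    obtain ⟨h1, h2, C', h3⟩ := ih; rw [iterate_succ_apply', iterate_succ_apply', h1]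
    refine ⟨?_, h2.sub (h2.comp (continuous_id.sub continuous_const)), C' + C', fun w =>
      (norm_sub_le _ _).trans (add_le_add (h3 _) (h3 _))⟩
    clear h1
    generalize (bdiff a)^[N] k = g at h2 h3 ⊢
    funext x; unfold bdiff kconv
    rw [← integral_sub (integrable_kconv h2 h3 hY x) (integrable_kconv h2 h3 hY (x - a))]; congr 1
    funext y; rw [show x - a - y = x - y - a by abel]; push_cast; ring

lemma norm_kconv_le {k : 𝔼 → ℝ} {C R : ℝ} (hC : ∀ w, ‖k w‖ ≤ C) (hR : ∀ w, R < ‖w‖ → k w = 0)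
    {Y : 𝔼 → ℂ} (hY : Integrable Y) (x : 𝔼) : ‖kconv k Y x‖ ≤ C * ∫ y in closedBall x R, ‖Y y‖ := by
  have hC0 : 0 ≤ C := (norm_nonneg _).trans (hC 0)
  rw [← integral_const_mul, ← integral_indicator isClosed_closedBall.measurableSet]
  refine norm_integral_le_of_norm_le ((hY.norm.const_mul C).indicator
    isClosed_closedBall.measurableSet) (.of_forall fun y => ?_)
  by_cases hy : y ∈ closedBall x R
  · rw [indicator_of_mem hy, norm_mul, norm_real]
    exact mul_le_mul_of_nonneg_right (hC _) (norm_nonneg _)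
  · rw [indicator_of_notMem hy, hR]
    · simp
    · rw [mem_closedBall, not_le, dist_comm, dist_eq_norm] at hy; exact hy

/-- The mollification kernel at scale `s`. -/
def moll (s : ℝ) (w : 𝔼) : ℝ := (s ^ n)⁻¹ * radKer (s⁻¹ • w)

/-- The function whose Laplacian is the derivative of `moll` with respect to the scale. -/
def mollPot (s : ℝ) (w : 𝔼) : ℝ := (-s * (s ^ n)⁻¹) * radBump (s⁻¹ • w)

lemma contDiff_moll (s : ℝ) : ContDiff ℝ ∞ (moll (n := n) s) :=
  contDiff_const.mul (contDiff_radKer.comp (contDiff_const_smul _))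

lemma contDiff_mollPot (s : ℝ) : ContDiff ℝ ∞ (mollPot (n := n) s) :=
  contDiff_const.mul (contDiff_radBump.comp (contDiff_const_smul _))

lemma moll_eq_zero {s : ℝ} (hs : 0 < s) {w : 𝔼} (h : s ≤ ‖w‖) : moll s w = 0 := by
  rw [moll, radKer_eq_zero, mul_zero]
  rw [norm_smul, norm_inv, norm_of_nonneg hs.le, inv_mul_eq_div]; exact (one_le_div hs).2 h

lemma mollPot_eq_zero {s : ℝ} (hs : 0 < s) {w : 𝔼} (h : s ≤ ‖w‖) : mollPot s w = 0 := by
  rw [mollPot, radBump_eq_zero, mul_zero]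
  rw [norm_smul, norm_inv, norm_of_nonneg hs.le, inv_mul_eq_div]; exact (one_le_div hs).2 h

lemma pd_mollPot {s : ℝ} (hs : 0 < s) (i : Fin n) (w : 𝔼) :
    pd i (mollPot s) w = -(s ^ n)⁻¹ * pd i radBump (s⁻¹ • w) := by
  have e : mollPot (n := n) s = fun w => (-s * (s ^ n)⁻¹) • (fun w => radBump (s⁻¹ • w)) w := rfl
  rw [e, pd_const_smul, pd_comp_smul, smul_smul, smul_eq_mul]; congr 1; field_simp

lemma lapl_mollPot {s : ℝ} (hs : 0 < s) (w : 𝔼) :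
    lapl (mollPot s) w = -(s ^ n)⁻¹ * s⁻¹ * lapl radBump (s⁻¹ • w) := by
  have e : mollPot (n := n) s = fun w => (-s * (s ^ n)⁻¹) • radBump (s⁻¹ • w) := rfl
  rw [e, lapl_scale, smul_eq_mul]; congr 1; field_simp

lemma hasDerivAt_moll {s : ℝ} (hs : 0 < s) (w : 𝔼) :
    HasDerivAt (fun s => moll s w) (lapl (mollPot s) w) s := by
  have hd : Differentiable ℝ (radKer (n := n)) := contDiff_radKer.differentiable (by simp)
  have h1 : HasDerivAt (fun s : ℝ => s⁻¹ • w) ((-(s ^ 2)⁻¹) • w) s :=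
    (hasDerivAt_inv hs.ne').smul_const w
  have h2 := (hd (s⁻¹ • w)).hasFDerivAt.comp_hasDerivAt s h1
  have h3 : HasDerivAt (fun s : ℝ => (s ^ n)⁻¹) (-(n * s ^ (n - 1)) / (s ^ n) ^ 2) s :=
    (hasDerivAt_pow n s).fun_inv (pow_ne_zero n hs.ne')
  have h4 := h3.mul h2
  have h5 : HasDerivAt (fun s => moll s w) (-(n * s ^ (n - 1)) / (s ^ n) ^ 2 * radKer (s⁻¹ • w) + (s
    ^ n)⁻¹ * (fderiv ℝ radKer (s⁻¹ • w)) (-(s ^ 2)⁻¹ • w)) s := h4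
  convert h5 using 1; rw [lapl_mollPot hs, lapl_radBump]
  have e : (fderiv ℝ radKer (s⁻¹ • w)) (-(s ^ 2)⁻¹ • w)
      = -s⁻¹ * (fderiv ℝ radKer (s⁻¹ • w)) (s⁻¹ • w) := by
    rw [map_smul, map_smul, smul_eq_mul, smul_eq_mul]; field_simp
  rw [e]; rcases n with _ | n
  · simp
  · simp only [Nat.add_sub_cancel]; field_simp; ring

lemma hasDerivAt_kconv_moll {Y : 𝔼 → ℂ} (hY : Integrable Y) {s : ℝ} (hs : 0 < s) (x : 𝔼) :
    HasDerivAt (fun s => kconv (moll s) Y x) (kconv (lapl (mollPot s)) Y x) s := by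
  obtain ⟨C, hC0, hC⟩ := exists_le (contDiff_lapl (contDiff_radBump (n := n))).continuous
    (hasCompactSupport_lapl hasCompactSupport_radBump)
  obtain ⟨C', hC0', hC'⟩ := exists_le (contDiff_radKer (n := n)).continuous hasCompactSupport_radKer
  have hm : ∀ k : 𝔼 → ℝ, Continuous k → AESM (fun y => (k (x - y) : ℂ) * Y y) volume := fun k hk =>
    (continuous_ofReal.comp (hk.comp (continuous_const.sub continuous_id))).aestronglyMeasurable.mul
    hY.aestronglyMeasurable
  refine (hasDerivAt_integral_of_dominated_loc_of_deriv_le (𝕜 := ℝ) (F := fun s y => (moll s (x - y)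
    : ℂ) * Y y) (F' := fun s y => ℂ(lapl (mollPot s) (x - y)) * Y y) (bound := fun y => (((s / 2) ^
    n)⁻¹ * (s / 2)⁻¹ * C) * ‖Y y‖) (s := Set.Ioi (s / 2)) (Ioi_mem_nhds (by linarith)) ?_ ?_ ?_ ?_
    ?_ ?_).2
  · exact .of_forall fun t => hm _ (contDiff_moll t).continuous
  · refine integrable_kconv (contDiff_moll s).continuous (C := |(s ^ n)⁻¹| * C') (fun w => ?_) hY x
    rw [moll, norm_mul, norm_eq_abs]; exact mul_le_mul_of_nonneg_left (hC' _) (abs_nonneg _)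
  · exact hm _ (contDiff_lapl (contDiff_mollPot s)).continuous
  · refine .of_forall fun y t ht => ?_; have ht' : s / 2 < t := ht
    have hs2 : 0 < s / 2 := by linarith
    have ht0 : 0 < t := by linarith
    rw [norm_mul, norm_real, lapl_mollPot ht0]; refine mul_le_mul_of_nonneg_right ?_ (norm_nonneg _)
    rw [norm_mul, norm_mul, norm_neg, norm_of_nonneg (by positivity),
      norm_of_nonneg (by positivity)]
    gcongr; exact hC _
  · exact hY.norm.const_mul _
  · refine .of_forall fun y t ht => ?_; have ht' : s / 2 < t := ht
    exact (hasDerivAt_moll (by linarith) (x - y)).ofReal_comp.mul_const (Y y)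

/-! ### The Poisson equation in the very weak sense -/

/-- `ΔY = -div F + G` in `U`, tested with smooth functions. -/
def VeryWeakPoisson (U : Set 𝔼) (Y : 𝔼 → ℂ) (F : 𝔼 → CSpace n) (G : 𝔼 → ℂ) : Prop :=
  ∀ b : 𝔼 → ℝ, IsTestFunction U b → ∫ x, ℂ(lapl b x) * Y x = ∫ x, ((∑ i, ℂ(pd i b x) * F x i) + (b x
    : ℂ) * G x)

lemma iterate_bdiff_sum {F : Type*} [AddCommGroup F] (a : 𝔼) (N : ℕ) (f : Fin n → 𝔼 → F) :
    (bdiff a)^[N] (fun w => ∑ i, f i w) = fun w => ∑ i, (bdiff a)^[N] (f i) w := by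
  induction N with
  | zero => rfl
  | succ N ih =>
    rw [iterate_succ_apply', ih]; funext w; simp only [iterate_succ_apply']; simp [bdiff]

lemma isTestFunction_mollPot {U : Set 𝔼} {x : 𝔼} {s : ℝ} (hs : 0 < s) (hU : closedBall x s ⊆ U) :
    IsTestFunction U fun y => mollPot s (x - y) := by
  have h0 : ∀ y, y ∉ closedBall x s → mollPot s (x - y) = 0 := fun y hy => by
    rw [mem_closedBall, not_le, dist_comm, dist_eq_norm] at hy; exact mollPot_eq_zero hs hy.le
  refine ⟨(contDiff_mollPot s).comp (contDiff_const.sub contDiff_id),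
    HasCompactSupport.intro (isCompact_closedBall x s) h0, ?_⟩
  refine (closure_minimal (fun y hy => ?_) isClosed_closedBall).trans hU
  by_contra h
  exact hy (h0 y h)

lemma integrable_coord {F : 𝔼 → CSpace n} (hF : Integrable F) (i : Fin n) :
    Integrable fun y => F y i :=
  (pr ℂ i).integrable_comp hF

lemma hasCompactSupport_mollPot {s : ℝ} (hs : 0 < s) : HasCompactSupport (mollPot (n := n) s) :=
  hasCompactSupport_of (R := s) fun _ => mollPot_eq_zero hs

lemma kconv_lapl_mollPot {U : Set 𝔼} {Y : 𝔼 → ℂ} {F : 𝔼 → CSpace n} {G : 𝔼 → ℂ}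
    (hF : Integrable F) (hG : Integrable G) (h : VeryWeakPoisson U Y F G) {x : 𝔼} {s : ℝ}
    (hs : 0 < s) (hU : closedBall x s ⊆ U) : kconv (lapl (mollPot s)) Y x = kconv (mollPot s) G x
    - ∑ i, kconv (pd i (mollPot s)) (fun y => F y i) x := by
  have h1 := h _ (isTestFunction_mollPot hs hU)
  simp only [lapl_comp_const_sub (mollPot s) x, pd_comp_const_sub (mollPot s)] at h1
  obtain ⟨C, -, hC⟩ := exists_le (contDiff_mollPot (n := n) s).continuous
    (hasCompactSupport_mollPot hs)
  have hp : ∀ i, Integrable fun y => ℂ(pd i (mollPot s) (x - y)) * F y i := fun i => by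
    obtain ⟨C, -, hC⟩ := exists_le (contDiff_pd (contDiff_mollPot (n := n) s) i).continuous
      (hasCompactSupport_pd (hasCompactSupport_mollPot hs) i)
    exact integrable_kconv (contDiff_pd (contDiff_mollPot s) i).continuous hC
      (integrable_coord hF i) x
  unfold kconv
  rw [h1, ← integral_finsetSum _ fun i _ => hp i, ← integral_sub (integrable_kconv (contDiff_mollPot
    s).continuous hC hG x) (integrable_finsetSum _ fun i _ => hp i)]
  congr 1; funext y; simp only [Complex.ofReal_neg, neg_mul, sum_neg_distrib]; ring

lemma norm_bdiff_scale_le (N : ℕ) {k : 𝔼 → ℝ} (hk : ContDiff ℝ ∞ k)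
    (h1 : ∀ x, 1 ≤ ‖x‖ → k x = 0) : ∃ C, 0 ≤ C ∧ ∀ (c s : ℝ) (a : 𝔼), 0 < s →
    (∀ w, ‖(bdiff a)^[N] (fun w => c * k (s⁻¹ • w)) w‖ ≤ |c| * (C * (‖a‖ / s) ^ N)) ∧
    (∀ w, s + N * ‖a‖ < ‖w‖ → (bdiff a)^[N] (fun w => c * k (s⁻¹ • w)) w = 0) := by
  obtain ⟨C, hC0, hC⟩ := norm_iterate_bdiff_le N hk (hasCompactSupport_of h1)
  refine ⟨C, hC0, fun c s a hs => ⟨fun w => ?_, fun w hw => ?_⟩⟩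
  · rw [iterate_bdiff_const_mul a N (fun w => k (s⁻¹ • w)), iterate_bdiff_scale a N k,
      norm_mul, norm_eq_abs]
    refine mul_le_mul_of_nonneg_left ((hC _ _).trans (le_of_eq ?_)) (abs_nonneg _)
    rw [norm_smul, norm_inv, norm_of_nonneg hs.le]; congr 2; ring
  · have := norm_iterate_bdiff_le_of_forall (C := 0) a N
      (f := fun w => c * k (s⁻¹ • w)) w fun j hj => by
        rw [h1, mul_zero, norm_zero]
        rw [norm_smul, norm_inv, norm_of_nonneg hs.le, inv_mul_eq_div, one_le_div hs]
        have h2 : ‖(j : ℝ) • a‖ ≤ N * ‖a‖ := by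
          rw [norm_smul, norm_of_nonneg (by positivity)]; gcongr
        linarith [norm_sub_norm_le w ((j : ℝ) • a)]
    rw [mul_zero] at this; exact norm_le_zero_iff.1 this

lemma pd_radBump_eq_zero (i : Fin n) {x : 𝔼} (h : 1 ≤ ‖x‖) : pd i radBump x = 0 := by
  rw [pd_radBump, radKer_eq_zero h, mul_zero]

lemma norm_iterate_bdiff_rhs_le (n N : ℕ) : ∃ C, 0 ≤ C ∧ ∀ (F : RSpace n → CSpace n)
    (G : RSpace n → ℂ), Integrable F → Integrable G → ∀ (a x : RSpace n) (s : ℝ), 0 < s →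
    ‖(bdiff a)^[N]
    (fun x => kconv (mollPot s) G x - ∑ i, kconv (pd i (mollPot s)) (fun y => F y i) x) x‖ ≤ C *
    (s ^ n)⁻¹ * (‖a‖ / s) ^ N * ∫ y in closedBall x (s + N * ‖a‖), (‖F y‖ + s * ‖G y‖) := by
  obtain ⟨C, hC0, hC⟩ := norm_bdiff_scale_le (n := n) N contDiff_radBump (fun _ => radBump_eq_zero)
  have := fun i => norm_bdiff_scale_le (n := n) N (contDiff_pd contDiff_radBump i)
    (fun _ => pd_radBump_eq_zero i)
  choose D hD0 hD using this
  refine ⟨C + ∑ i, D i, add_nonneg hC0 (sum_nonneg fun i _ => hD0 i), fun F G hF hG a x s hs => ?_⟩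
  set B := closedBall x (s + N * ‖a‖) with hB
  have eM : mollPot (n := n) s = fun w => (-s * (s ^ n)⁻¹) * radBump (s⁻¹ • w) := rfl
  have eP : ∀ i, pd i (mollPot (n := n) s) = fun w => -(s ^ n)⁻¹ * pd i radBump (s⁻¹ • w) :=
    fun i => funext (pd_mollPot hs i)
  have bG : ‖(bdiff a)^[N] (kconv (mollPot s) G) x‖ ≤
      (s ^ n)⁻¹ * (‖a‖ / s) ^ N * (C * (s * ∫ y in B, ‖G y‖)) := by
    obtain ⟨C', -, hC'⟩ := exists_le (contDiff_mollPot (n := n) s).continuous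
      (hasCompactSupport_mollPot hs)
    rw [(iterate_bdiff_kconv a N (contDiff_mollPot s).continuous hC' hG).1]
    obtain ⟨h1, h2⟩ := hC (-s * (s ^ n)⁻¹) s a hs; rw [eM]
    refine (norm_kconv_le h1 h2 hG x).trans (le_of_eq ?_)
    rw [abs_mul, abs_neg, abs_of_pos hs, abs_of_pos (by positivity)]; ring
  have bF : ∀ i, ‖(bdiff a)^[N] (kconv (pd i (mollPot s)) fun y => F y i) x‖ ≤
      (s ^ n)⁻¹ * (‖a‖ / s) ^ N * (D i * ∫ y in B, ‖F y‖) := by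
    intro i
    obtain ⟨C', -, hC'⟩ := exists_le (contDiff_pd (contDiff_mollPot (n := n) s) i).continuous
      (hasCompactSupport_pd (hasCompactSupport_mollPot hs) i)
    rw [(iterate_bdiff_kconv a N (contDiff_pd (contDiff_mollPot s) i).continuous hC'
      (integrable_coord hF i)).1]
    obtain ⟨h1, h2⟩ := hD i (-(s ^ n)⁻¹) s a hs; rw [eP i]
    refine (norm_kconv_le h1 h2 (integrable_coord hF i) x).trans ?_
    rw [abs_neg, abs_of_pos (by positivity)]
    have : ∫ y in B, ‖F y i‖ ≤ ∫ y in B, ‖F y‖ := integral_mono (integrable_coord hF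
      i).norm.integrableOn hF.norm.integrableOn fun y => PiLp.norm_apply_le (F y) i
    calc _ = (s ^ n)⁻¹ * (‖a‖ / s) ^ N * (D i * ∫ y in B, ‖F y i‖) := by ring
      _ ≤ _ := by
        have := hD0 i; gcongr
  rw [iterate_bdiff_sub, iterate_bdiff_sum]
  have hsum : ∫ y in B, (‖F y‖ + s * ‖G y‖) = (∫ y in B, ‖F y‖) + s * ∫ y in B, ‖G y‖ := by
    rw [integral_add hF.norm.integrableOn (hG.norm.integrableOn.const_mul s), integral_const_mul]
  have i1 : 0 ≤ ∫ y in B, ‖F y‖ := integral_nonneg fun _ => norm_nonneg _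
  have i2 : 0 ≤ ∫ y in B, ‖G y‖ := integral_nonneg fun _ => norm_nonneg _
  calc _ ≤ _ := norm_sub_le _ _
    _ ≤ (s ^ n)⁻¹ * (‖a‖ / s) ^ N * (C * (s * ∫ y in B, ‖G y‖)) +
        ∑ i, (s ^ n)⁻¹ * (‖a‖ / s) ^ N * (D i * ∫ y in B, ‖F y‖) :=
      add_le_add bG ((norm_sum_le _ _).trans (sum_le_sum fun i _ => bF i))
    _ = (s ^ n)⁻¹ * (‖a‖ / s) ^ N * (C * (s * ∫ y in B, ‖G y‖) + (∑ i, D i) * ∫ y in B, ‖F y‖) := by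
      rw [← mul_sum, ← Finset.sum_mul]; ring
    _ ≤ (s ^ n)⁻¹ * (‖a‖ / s) ^ N * ((C + ∑ i, D i) * ∫ y in B, (‖F y‖ + s * ‖G y‖)) := by
      rw [hsum]; refine mul_le_mul_of_nonneg_left ?_ (by positivity)
      have hS : 0 ≤ ∑ i, D i := sum_nonneg fun i _ => hD0 i
      nlinarith [mul_nonneg hC0 i1, mul_nonneg hS (mul_nonneg hs.le i2)]
    _ = _ := by ring

/-- The oscillation between two consecutive scales. -/
lemma norm_bdiff_moll_sub_le (n N : ℕ) : ∃ C, 0 ≤ C ∧ ∀ (U : Set (RSpace n)) (Y : RSpace n → ℂ)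
    (F : RSpace n → CSpace n) (G : RSpace n → ℂ), Integrable Y → Integrable F → Integrable G →
    VeryWeakPoisson U Y F G → ∀ (a x : RSpace n) (s : ℝ), 0 < s → closedBall x (s + N * ‖a‖) ⊆ U
    → ‖(bdiff a)^[N] (kconv (moll s) Y) x - (bdiff a)^[N] (kconv (moll (s / 2)) Y) x‖ ≤ C * s *
    (s ^ n)⁻¹ * (‖a‖ / s) ^ N * ∫ y in closedBall x (s + N * ‖a‖), (‖F y‖ + s * ‖G y‖) := by
  obtain ⟨C, hC0, hC⟩ := norm_iterate_bdiff_rhs_le n N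
  refine ⟨C * 2 ^ n * 2 ^ N / 2, by positivity, fun U Y F G hY hF hG h a x s hs hU => ?_⟩
  set J := ∫ y in closedBall x (s + N * ‖a‖), (‖F y‖ + s * ‖G y‖) with hJ
  have hd : ∀ t ∈ Set.Icc (s / 2) s, HasDerivWithinAt (fun t => (bdiff a)^[N] (kconv (moll t) Y) x)
      ((bdiff a)^[N] (kconv (lapl (mollPot t)) Y) x) (Set.Icc (s / 2) s) t := by
    intro t ht
    exact (hasDerivAt_iterate_bdiff a N (f := fun t => kconv (moll t) Y) (f' := fun t => kconv (lapl
      (mollPot t)) Y) (fun x => hasDerivAt_kconv_moll hY (by linarith [ht.1]) x) x).hasDerivWithinAt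
  have hb : ∀ t ∈ Set.Ico (s / 2) s, ‖(bdiff a)^[N] (kconv (lapl (mollPot t)) Y) x‖ ≤
      C * 2 ^ n * 2 ^ N * (s ^ n)⁻¹ * (‖a‖ / s) ^ N * J := by
    intro t ht; have ht0 : 0 < t := by linarith [ht.1]
    rw [iterate_bdiff_congr a N (g := fun x => kconv (mollPot t) G x -
          ∑ i, kconv (pd i (mollPot t)) (fun y => F y i) x) x fun j hj => by
      refine kconv_lapl_mollPot hF hG h ht0 (Set.Subset.trans (fun y hy => ?_) hU)
      rw [mem_closedBall] at hy ⊢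
      have h2 : dist (x - (j : ℝ) • a) x ≤ N * ‖a‖ := by
        rw [dist_eq_norm, sub_sub_cancel_left, norm_neg, norm_smul, norm_of_nonneg (by positivity)]
        gcongr
      linarith [dist_triangle y (x - (j : ℝ) • a) x, ht.2]]
    refine (hC F G hF hG a x t ht0).trans ?_
    have hJ' : ∫ y in closedBall x (t + N * ‖a‖), (‖F y‖ + t * ‖G y‖) ≤ J := by
      have hi : ∀ t : ℝ, Integrable fun y => ‖F y‖ + t * ‖G y‖ := fun t =>
        hF.norm.add (hG.norm.const_mul t)
      calc _ ≤ ∫ y in closedBall x (t + N * ‖a‖), (‖F y‖ + s * ‖G y‖) :=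
            integral_mono (hi t).integrableOn (hi s).integrableOn fun y => by
              have := ht.2.le; simp only; gcongr
        _ ≤ J := setIntegral_mono_set (hi s).integrableOn
            (.of_forall fun y => by simp only [Pi.zero_apply]; positivity)
            (closedBall_subset_closedBall (by linarith [ht.2])).eventuallyLE
    have hJ0 : 0 ≤ ∫ y in closedBall x (t + N * ‖a‖), (‖F y‖ + t * ‖G y‖) :=
      integral_nonneg fun y => by positivity
    have e1 : (t ^ n)⁻¹ ≤ 2 ^ n * (s ^ n)⁻¹ := by
      rw [← inv_pow, ← inv_pow, ← mul_pow]; refine pow_le_pow_left₀ (by positivity) ?_ n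
      rw [← div_eq_mul_inv, inv_le_comm₀ ht0 (by positivity), inv_div]; exact ht.1
    have e2 : (‖a‖ / t) ^ N ≤ 2 ^ N * (‖a‖ / s) ^ N := by
      rw [← mul_pow]; refine pow_le_pow_left₀ (by positivity) ?_ N; rw [div_le_iff₀ ht0]
      calc ‖a‖ = 2 * (‖a‖ / s) * (s / 2) := by field_simp
        _ ≤ _ := by gcongr; exact ht.1
    calc _ ≤ C * (2 ^ n * (s ^ n)⁻¹) * (2 ^ N * (‖a‖ / s) ^ N) * J := by gcongr
      _ = _ := by ring
  have := norm_image_sub_le_of_norm_deriv_le_segment' hd hb s (Set.right_mem_Icc.2 (by linarith))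
  refine this.trans (le_of_eq ?_); ring

lemma integral_moll {s : ℝ} (hs : 0 < s) (x : 𝔼) : ∫ y, moll s (x - y) = radMass n := by
  rw [integral_sub_left_eq_self (fun y => moll s y) volume x]; unfold moll
  rw [integral_const_mul, Measure.integral_comp_inv_smul, finrank_euclideanSpace_fin,
    abs_of_pos (by positivity), smul_eq_mul, radMass]
  field_simp

lemma ae_tendsto_kconv_moll {Y : 𝔼 → ℂ} (hY : Integrable Y) : ∀ᵐ x, ∀ δ : ℕ → ℝ, Tendsto δ atTop
    (𝓝[>] 0) → Tendsto (fun j => kconv (moll (δ j)) Y x) atTop (𝓝 (radMass n * Y x)) := by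
  obtain ⟨C, hC0, hC⟩ := exists_le (contDiff_radKer (n := n)).continuous hasCompactSupport_radKer
  filter_upwards [IsUnifLocDoublingMeasure.ae_tendsto_average_norm_sub volume
    hY.locallyIntegrable 1] with x hx δ hδ
  have hδ0 : ∀ᶠ j in atTop, 0 < δ j := by
    have := hδ.eventually self_mem_nhdsWithin; exact this
  have h1 := hx (fun _ => x) δ hδ (hδ0.mono fun j hj => by
    simpa using hj.le)
  rw [tendsto_iff_norm_sub_tendsto_zero]; set v := volume.real (closedBall (0 : 𝔼) 1) with hv
  have h2 := h1.const_mul (C * v); rw [mul_zero] at h2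
  refine squeeze_zero' (.of_forall fun _ => norm_nonneg _) ?_ h2; filter_upwards [hδ0] with j hj
  set s := δ j with hs
  have hCm : ∀ w : 𝔼, ‖moll s w‖ ≤ (s ^ n)⁻¹ * C := fun w => by
    rw [moll, norm_mul, norm_of_nonneg (by positivity)]; gcongr; exact hC _
  have hint := integrable_kconv (contDiff_moll s).continuous hCm hY x
  have hmi : Integrable fun y : 𝔼 => moll s (x - y) := ((contDiff_moll
    s).continuous.integrable_of_hasCompactSupport (hasCompactSupport_of (R := s) fun _ =>
    moll_eq_zero hj)).comp_sub_left x
  have e : kconv (moll s) Y x - radMass n * Y x = ∫ y, (moll s (x - y) : ℂ) * (Y y - Y x) := by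
    have hmi' : Integrable fun y => ℂ(moll s (x - y)) * Y x := hmi.ofReal.mul_const _
    simp only [mul_sub]
    rw [integral_sub hint hmi', integral_mul_const, integral_complex_ofReal, integral_moll hj]; rfl
  have hvol : volume.real (closedBall x s) = s ^ n * v := by
    rw [Measure.addHaar_real_closedBall' _ _ hj.le, finrank_euclideanSpace_fin]
  have hvpos : 0 < v := by
    rw [hv, Measure.real, ENNReal.toReal_pos_iff]
    exact ⟨measure_closedBall_pos _ _ one_pos, measure_closedBall_lt_top⟩
  have hB : IntegrableOn (fun y => ‖Y y - Y x‖) (closedBall x s) :=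
    (hY.integrableOn.sub (integrableOn_const (measure_closedBall_lt_top).ne)).norm
  rw [e, setAverage_eq, hvol, smul_eq_mul]
  calc _ ≤ ∫ y in closedBall x s, (s ^ n)⁻¹ * C * ‖Y y - Y x‖ := by
        rw [← integral_indicator isClosed_closedBall.measurableSet]
        refine norm_integral_le_of_norm_le ((integrable_indicator_iff
          isClosed_closedBall.measurableSet).2 (hB.const_mul _)) (.of_forall fun y => ?_)
        by_cases hy : y ∈ closedBall x s
        · rw [indicator_of_mem hy, norm_mul, norm_real]
          exact mul_le_mul_of_nonneg_right (hCm _) (norm_nonneg _)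
        · rw [indicator_of_notMem hy, moll_eq_zero hj]
          · simp
          · rw [mem_closedBall, not_le, dist_comm, dist_eq_norm] at hy; exact hy.le
    _ = _ := by
        rw [integral_const_mul]; field_simp

lemma eLpNorm_two_sq {α F : Type*} [MeasurableSpace α] [NormedAddCommGroup F] (f : α → F)
    (μ : Measure α) : eLpNorm f 2 μ ^ 2 = ∫⁻ x, ‖f x‖ₑ ^ 2 ∂μ := by
  have := eLpNorm_nnreal_pow_eq_lintegral (f := f) (μ := μ) (p := 2) (by norm_num); simpa using this

lemma lintegral_enorm_le {α F : Type*} [MeasurableSpace α] [NormedAddCommGroup F] {f : α → F}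
    {μ : Measure α} (hf : AESM f μ) : ∫⁻ x, ‖f x‖ₑ ∂μ ≤ eLpNorm f 2 μ * μ Set.univ ^ ½ := by
  have := eLpNorm_le_eLpNorm_mul_rpow_measure_univ (p := 1) (q := 2) (by norm_num) hf
  rw [eLpNorm_one_eq_lintegral_enorm] at this; refine this.trans (le_of_eq ?_); norm_num

lemma volume_closedBall_eq (x : 𝔼) {r : ℝ} (hr : 0 ≤ r) :
    volume (closedBall x r) = ofReal (r ^ n * volume.real (ball (0 : 𝔼) 1)) := by
  rw [Measure.addHaar_closedBall _ _ hr, finrank_euclideanSpace_fin,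
    ofReal_mul (by positivity), ofReal_measureReal]

lemma volume_ball_eq (x : 𝔼) {r : ℝ} (hr : 0 < r) :
    volume (ball x r) = ofReal (r ^ n * volume.real (ball (0 : 𝔼) 1)) := by
  rw [Measure.addHaar_ball_of_pos _ _ hr, finrank_euclideanSpace_fin,
    ofReal_mul (by positivity), ofReal_measureReal]

/-- Young's inequality for the averages over balls of radius `s`. -/
lemma eLpNorm_two_le_of_ball_integral {A A' : Set 𝔼} {s K : ℝ} (hs : 0 < s)
    (hAA' : ∀ x ∈ A, closedBall x s ⊆ A') {E : 𝔼 → ℂ} {g : 𝔼 → ℝ} (hA : MeasurableSet A)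
    (hg : AESM g volume) (hE : ∀ x ∈ A, ‖E x‖ₑ ≤ ofReal K * ∫⁻ y in closedBall x s, ‖g y‖ₑ) :
    eLpNorm E 2 vol A ≤ ofReal K * volume (closedBall (0 : 𝔼) s) * eLpNorm g 2 vol A' := by
  set v := volume (closedBall (0 : 𝔼) s) with hv
  have hvx : ∀ x : 𝔼, volume (closedBall x s) = v := fun x => by
    rw [hv, volume_closedBall_eq x hs.le, volume_closedBall_eq 0 hs.le]
  rw [← ENNReal.pow_le_pow_left_iff two_ne_zero, mul_pow, mul_pow, eLpNorm_two_sq, eLpNorm_two_sq]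
  have h1 : ∀ x, (∫⁻ y in closedBall x s, ‖g y‖ₑ) ^ 2 ≤ v * ∫⁻ y in closedBall x s, ‖g y‖ₑ ^ 2 := by
    intro x; have := lintegral_enorm_le (hg.restrict (s := closedBall x s))
    rw [Measure.restrict_apply_univ, hvx] at this
    refine (pow_le_pow_left' this 2).trans (le_of_eq ?_)
    rw [mul_pow, eLpNorm_two_sq, ← ENNReal.rpow_natCast, ← ENNReal.rpow_mul]; norm_num
    rw [mul_comm]
  set f : 𝔼 → 𝔼 → ℝ≥0∞ := fun x y =>
    (closedBall (0 : 𝔼) s).indicator (fun _ => ‖g y‖ₑ ^ 2) (y - x) with hf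
  have hfm : AEMeasurable (Function.uncurry f) ((vol A).prod (vol A')) := by
    have h2 : AEMeasurable (fun p : 𝔼 × 𝔼 => ‖g p.2‖ₑ ^ 2) ((vol A).prod (vol A')) := ((hg.restrict
      (s := A')).comp_snd).enorm.pow_const 2
    have h3 : MeasurableSet {p : 𝔼 × 𝔼 | p.2 - p.1 ∈ closedBall (0 : 𝔼) s} :=
      (measurable_snd.sub measurable_fst) isClosed_closedBall.measurableSet
    exact h2.indicator h3
  calc ∫⁻ x in A, ‖E x‖ₑ ^ 2
      ≤ ∫⁻ x in A, ofReal K ^ 2 * v * ∫⁻ y in A', f x y := by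
        refine setLIntegral_mono' hA fun x hx => ?_
        calc _ ≤ (ofReal K * ∫⁻ y in closedBall x s, ‖g y‖ₑ) ^ 2 := pow_le_pow_left' (hE x hx) 2
          _ ≤ ofReal K ^ 2 * (v * ∫⁻ y in closedBall x s, ‖g y‖ₑ ^ 2) := by
              rw [mul_pow]; exact mul_le_mul_right (h1 x) _
          _ = ofReal K ^ 2 * v * ∫⁻ y in A', f x y := by
              rw [mul_assoc]; congr 2
              have : ∀ y, f x y = (closedBall x s).indicator (fun y => ‖g y‖ₑ ^ 2) y := by
                intro y; simp only [hf, Set.indicator, mem_closedBall, dist_eq_norm, sub_zero]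
              simp only [this]
              rw [lintegral_indicator isClosed_closedBall.measurableSet, Measure.restrict_restrict
                isClosed_closedBall.measurableSet, Set.inter_eq_left.2 (hAA' x hx)]
    _ = ofReal K ^ 2 * v * ∫⁻ x in A, ∫⁻ y in A', f x y := by
        rw [lintegral_const_mul' _ _ (ENNReal.mul_ne_top (by simp)
          (by rw [hv]; exact measure_closedBall_lt_top.ne))]
    _ = ofReal K ^ 2 * v * ∫⁻ y in A', ∫⁻ x in A, f x y := by
        rw [lintegral_lintegral_swap hfm]
    _ ≤ ofReal K ^ 2 * v * ∫⁻ y in A', v * ‖g y‖ₑ ^ 2 := by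
        refine mul_le_mul_right (lintegral_mono fun y => ?_) _
        have : ∀ x, f x y = (closedBall y s).indicator (fun _ => ‖g y‖ₑ ^ 2) x := by
          intro x
          simp only [hf, Set.indicator, mem_closedBall, dist_comm x y, dist_eq_norm, sub_zero]
        simp only [this]; refine (setLIntegral_le_lintegral _ _).trans ?_
        rw [lintegral_indicator isClosed_closedBall.measurableSet, setLIntegral_const, hvx,
          mul_comm]
    _ = _ := by
        rw [lintegral_const_mul'' _ ((hg.restrict (s := A')).enorm.pow_const 2)]; ring

lemma continuous_kconv {k : 𝔼 → ℝ} (hk : Continuous k) {C : ℝ} (hC : ∀ w, ‖k w‖ ≤ C) {Y : 𝔼 → ℂ}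
    (hY : Integrable Y) : Continuous (kconv k Y) := by
  refine continuous_of_dominated (bound := fun y => C * ‖Y y‖) (fun x => (integrable_kconv hk hC hY
    x).aestronglyMeasurable) (fun x => .of_forall fun y => ?_) (hY.norm.const_mul C) (.of_forall fun
    y => ?_)
  · rw [norm_mul, norm_real]; exact mul_le_mul_of_nonneg_right (hC _) (norm_nonneg _)
  · exact (continuous_ofReal.comp (hk.comp (continuous_id.sub continuous_const))).mul
      continuous_const

lemma continuous_iterate_bdiff (a : 𝔼) (N : ℕ) {f : 𝔼 → ℂ} (hf : Continuous f) :
    Continuous ((bdiff a)^[N] f) := by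
  induction N with
  | zero => exact hf
  | succ N ih =>
    rw [iterate_succ_apply']; exact ih.sub (ih.comp (continuous_id.sub continuous_const))

lemma eLpNorm_iterate_bdiff_le (a : 𝔼) (N : ℕ) {f : 𝔼 → ℂ} (hf : Continuous f) (c : 𝔼) (h : ℝ) :
    eLpNorm ((bdiff a)^[N] f) 2 vol (ball c h) ≤ 2 ^ N * eLpNorm f 2 vol (ball c (h + N * ‖a‖)) := by
  induction N generalizing c h with
  | zero => simp
  | succ N ih =>
    rw [iterate_succ_apply']; set g := (bdiff a)^[N] f with hg
    have hgc : Continuous g := continuous_iterate_bdiff a N hf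
    have hgc' : Continuous fun w => g (w - a) := hgc.comp (continuous_id.sub continuous_const)
    have e1 : eLpNorm (fun w => g (w - a)) 2 vol (ball c h) = eLpNorm g 2 vol (ball (c - a) h) := by
      have hmp : MeasurePreserving (fun w : 𝔼 => w - a) vol (ball c h) vol (ball (c - a) h) := by
        have := (measurePreserving_sub_right volume a).restrict_preimage
          (s := ball (c - a) h) isOpen_ball.measurableSet
        convert this using 2; ext w; simp [dist_eq_norm]
      exact eLpNorm_comp_measurePreserving hgc.aestronglyMeasurable hmp
    have hmono : ∀ (c' : 𝔼), dist c' c ≤ ‖a‖ → eLpNorm f 2 vol (ball c' (h + N * ‖a‖)) ≤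
        eLpNorm f 2 vol (ball c (h + (N + 1 : ℕ) * ‖a‖)) := fun c' hc' => by
      refine eLpNorm_mono_measure _ (Measure.restrict_mono ?_ le_rfl); intro w hw
      rw [mem_ball] at hw ⊢; push_cast; linarith [dist_triangle w c' c]
    calc eLpNorm (bdiff a g) 2 vol (ball c h)
        ≤ eLpNorm g 2 vol (ball c h) + eLpNorm (fun w => g (w - a)) 2 vol (ball c h) :=
          eLpNorm_sub_le hgc.aestronglyMeasurable hgc'.aestronglyMeasurable (by norm_num)
      _ ≤ 2 ^ N * eLpNorm f 2 vol (ball c (h + (N + 1 : ℕ) * ‖a‖)) +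
          2 ^ N * eLpNorm f 2 vol (ball c (h + (N + 1 : ℕ) * ‖a‖)) := by
          rw [e1]; refine add_le_add ((ih c h).trans ?_) ((ih (c - a) h).trans ?_)
          · exact mul_le_mul_right (hmono c (by simp)) _
          · exact mul_le_mul_right (hmono (c - a) (by simp)) _
      _ = _ := by rw [pow_succ]; ring

lemma setIntegral_ball_le {g : 𝔼 → ℝ} (hg : Integrable g) (hg0 : ∀ y, 0 ≤ g y) {c : 𝔼} {ρ M : ℝ}
    (hρ : 0 < ρ) (hM : 0 ≤ M) (h : eLpNorm g 2 vol (ball c ρ) ≤ ofReal M) :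
    ∫ y in ball c ρ, g y ≤ M * (ρ ^ n * volume.real (ball (0 : 𝔼) 1)) ^ ½ := by
  rw [← ENNReal.ofReal_le_ofReal_iff (by positivity),
    ofReal_integral_eq_lintegral_ofReal hg.integrableOn (.of_forall hg0)]
  have h1 := lintegral_enorm_le (hg.aestronglyMeasurable.restrict (s := ball c ρ))
  have h2 : ∀ y, ‖g y‖ₑ = ofReal (g y) := fun y => by
    rw [← ofReal_norm, norm_of_nonneg (hg0 y)]
  simp only [h2] at h1; refine h1.trans ?_
  rw [Measure.restrict_apply_univ, volume_ball_eq c hρ, ofReal_mul hM,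
    ENNReal.ofReal_rpow_of_nonneg (by positivity) (by norm_num)]
  exact mul_le_mul_left h _

/-- The mollifications of a function vanishing in a half space do not see the shifts into it. -/
lemma tendsto_iterate_bdiff_kconv_moll {Y : 𝔼 → ℂ} (hY : Integrable Y) {N : ℕ} {c d : 𝔼}
    (hd : ‖d‖ = 1) (hN : N = 0 ∨ ∀ y, inner ℝ d (y - c) ≤ 0 → Y y = 0) {h : ℝ} {δ : ℕ → ℝ}
    (hδ : Tendsto δ atTop (𝓝[>] 0)) : ∀ᵐ x ∂vol (ball c h), Tendsto
    (fun k => (bdiff (h • d))^[N] (kconv (moll (δ k)) Y) x) atTop (𝓝 (radMass n * Y x)) := by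
  filter_upwards [ae_restrict_of_ae (ae_tendsto_kconv_moll hY),
    ae_restrict_mem isOpen_ball.measurableSet] with x hx hxc
  rw [mem_ball, dist_eq_norm] at hxc; refine (hx δ hδ).congr' ?_
  have hδ0 : ∀ᶠ j in atTop, 0 < δ j := hδ.eventually self_mem_nhdsWithin
  have hδ1 : ∀ᶠ j in atTop, δ j < h - ‖x - c‖ :=
    (hδ.mono_right nhdsWithin_le_nhds).eventually (gt_mem_nhds (by linarith))
  filter_upwards [hδ0, hδ1] with k hk0 hk1; rcases hN with rfl | hN
  · rfl
  refine (iterate_bdiff_eq_of_shifts_zero _ _ _ fun j hj _ => ?_).symm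
  refine integral_eq_zero_of_ae (.of_forall fun y => ?_); by_cases hy : inner ℝ d (y - c) ≤ 0
  · simp [hN y hy]
  · have hj' : (1 : ℝ) ≤ j := by exact_mod_cast hj
    have hh : 0 < h := by linarith [norm_nonneg (x - c)]
    simp only [Pi.zero_apply]; rw [moll_eq_zero hk0]
    · simp
    · have h1 : inner ℝ d (-(x - (j : ℝ) • h • d - y)) =
          inner ℝ d (y - c) - inner ℝ d (x - c) + j * h := by
        have e : -(x - (j : ℝ) • h • d - y) = (y - c) - (x - c) + (j * h) • d := by
          rw [smul_smul]; abel
        rw [e, inner_add_right, inner_sub_right, inner_smul_right, real_inner_self_eq_norm_sq, hd]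
        ring
      have h2 : inner ℝ d (-(x - (j : ℝ) • h • d - y)) ≤ ‖x - (j : ℝ) • h • d - y‖ := by
        have := real_inner_le_norm d (-(x - (j : ℝ) • h • d - y))
        rwa [hd, one_mul, norm_neg] at this
      have h3 : inner ℝ d (x - c) ≤ ‖x - c‖ := by
        have := real_inner_le_norm d (x - c); rwa [hd, one_mul] at this
      nlinarith

lemma sum_dyadic_le {θ : ℝ} (h0 : 0 ≤ θ) (h1 : θ < 1) (J k : ℕ) :
    ∑ j ∈ Finset.range k, θ ^ ((J - j) + (j - J)) ≤ 2 / (1 - θ) := by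
  have hg : ∀ m : ℕ, ∑ i ∈ Finset.range m, θ ^ i ≤ 1 / (1 - θ) := fun m => by
    have := (summable_geometric_of_lt_one h0 h1).sum_le_tsum (Finset.range m)
      (fun i _ => pow_nonneg h0 i)
    rw [tsum_geometric_of_lt_one h0 h1] at this; rwa [one_div]
  calc _ ≤ ∑ j ∈ Finset.range (J + k), θ ^ ((J - j) + (j - J)) :=
        Finset.sum_le_sum_of_subset_of_nonneg (Finset.range_mono (by omega))
          fun i _ _ => pow_nonneg h0 _
    _ = ∑ j ∈ Finset.range J, θ ^ ((J - j) + (j - J)) +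
        ∑ i ∈ Finset.range k, θ ^ ((J - (J + i)) + ((J + i) - J)) := Finset.sum_range_add _ _ _
    _ ≤ 1 / (1 - θ) + 1 / (1 - θ) := by
        refine add_le_add ?_ ?_
        · rw [← Finset.sum_range_reflect]; refine le_trans (sum_le_sum fun i hi => ?_) (hg J)
          rw [Finset.mem_range] at hi; exact pow_le_pow_of_le_one h0 h1.le (by omega)
        · refine le_trans (le_of_eq (sum_congr rfl fun i _ => ?_)) (hg k); congr 1; omega
    _ = _ := by ring

lemma ball_real_pos (n : ℕ) : 0 < volume.real (ball (0 : RSpace n) 1) := by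
  rw [Measure.real, ENNReal.toReal_pos_iff]
  exact ⟨measure_ball_pos _ _ one_pos, measure_ball_lt_top⟩

lemma enorm_le_of_norm_le_setIntegral {E : 𝔼 → ℂ} {g : 𝔼 → ℝ} (hg : Integrable g)
    (hg0 : ∀ y, 0 ≤ g y) {x : 𝔼} {K : ℝ} (hK : 0 ≤ K) {S : Set 𝔼}
    (h : ‖E x‖ ≤ K * ∫ y in S, g y) : ‖E x‖ₑ ≤ ofReal K * ∫⁻ y in S, ‖g y‖ₑ := by
  rw [← ofReal_norm]; refine (ofReal_le_ofReal h).trans (le_of_eq ?_)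
  rw [ofReal_mul hK, ofReal_integral_eq_lintegral_ofReal hg.integrableOn (.of_forall hg0)]
  congr 2; funext y; rw [← ofReal_norm, norm_of_nonneg (hg0 y)]

lemma rpow_ratio_identity {h lam P m : ℝ} (hh : 0 < h) (hl : 0 < lam) :
    (h * lam) ^ (1 + m - P) * h ^ P = h ^ (1 + m) * lam ^ (1 + m - P) := by
  rw [mul_rpow hh.le hl.le, mul_right_comm, ← rpow_add hh]; congr 2; ring

/-- Estimate at scales below the distance to the vertex. -/
lemma eLpNorm_scale_small (n N : ℕ) (R0 C0 m : ℝ) : ∃ K, 0 ≤ K ∧ ∀ (Y : RSpace n → ℂ)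
    (F : RSpace n → CSpace n) (G : RSpace n → ℂ) (c a : RSpace n), Integrable Y → Integrable F →
    Integrable G → VeryWeakPoisson (ball c R0) Y F G → 0 ≤ C0 → (∀ r, 0 < r → r ≤ R0 → eLpNorm
    (fun y => ‖F y‖ + r * ‖G y‖) 2 vol (ball c r) ≤ ofReal (C0 * r ^ m)) → ∀ s, 0 < s → s ≤ ‖a‖ →
    (N + 2) * ‖a‖ ≤ R0 → eLpNorm
    ((bdiff a)^[N] (fun x => kconv (moll s) Y x - kconv (moll (s / 2)) Y x)) 2 vol (ball c ‖a‖) ≤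
    ofReal (K * (s * ‖a‖ ^ m)) := by
  obtain ⟨C, hC0, hC⟩ := norm_bdiff_moll_sub_le n 0
  set vb := volume.real (ball (0 : RSpace n) 1) with hvb; have vbpos := ball_real_pos n
  refine ⟨2 ^ N * (C * vb * (C0 * ((N + 2 : ℕ) : ℝ) ^ m)) ⊔ 0, le_max_right _ _,
    fun Y F G c a hY hF hG hVW hC0' hdata s hs hsa haR => ?_⟩
  have ha : 0 < ‖a‖ := hs.trans_le hsa; set h := ‖a‖ with hh
  set E : RSpace n → ℂ := fun x => kconv (moll s) Y x - kconv (moll (s / 2)) Y x with hE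
  have hEc : Continuous E := by
    have : ∀ t, 0 < t → Continuous (kconv (moll t) Y) := fun t ht => by
      obtain ⟨C', -, hC'⟩ := exists_le (contDiff_moll (n := n) t).continuous
        (hasCompactSupport_of (R := t) fun _ => moll_eq_zero ht)
      exact continuous_kconv (contDiff_moll t).continuous hC' hY
    exact (this s hs).sub (this (s / 2) (by linarith))
  set g : RSpace n → ℝ := fun y => ‖F y‖ + s * ‖G y‖ with hg
  have hgi : Integrable g := hF.norm.add (hG.norm.const_mul s)
  have hg0 : ∀ y, 0 ≤ g y := fun y => by simp only [hg]; positivity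
  have hr : h + N * h + s ≤ (N + 2) * h := by linarith
  have h1 : eLpNorm E 2 vol (ball c (h + N * h)) ≤
      ofReal (C * s * (s ^ n)⁻¹) * volume (closedBall (0 : RSpace n) s) *
        eLpNorm g 2 vol (ball c ((N + 2) * h)) := by
    refine eLpNorm_two_le_of_ball_integral hs (fun x hx => ?_)
      isOpen_ball.measurableSet hgi.aestronglyMeasurable fun x hx => ?_
    · intro y hy; rw [mem_ball] at hx ⊢; rw [mem_closedBall] at hy; linarith [dist_triangle y x c]
    · refine enorm_le_of_norm_le_setIntegral hgi hg0 (by positivity) ?_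
      have := hC _ Y F G hY hF hG hVW 0 x s hs (fun y hy => by
        rw [mem_ball] at hx ⊢; rw [mem_closedBall] at hy
        simp only [Nat.cast_zero, zero_mul, add_zero] at hy; linarith [dist_triangle y x c])
      simpa using this
  have h2 : eLpNorm g 2 vol (ball c ((N + 2) * h)) ≤ ofReal (C0 * ((N + 2) * h) ^ m) := by
    refine le_trans (eLpNorm_mono_real fun y => ?_) (hdata ((N + 2) * h) (by positivity) haR)
    rw [norm_of_nonneg (hg0 y)]; have : s ≤ (N + 2) * h := by nlinarith [Nat.cast_nonneg (α := ℝ) N]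
    simp only [hg]; gcongr
  refine (eLpNorm_iterate_bdiff_le a N hEc c h).trans ((mul_le_mul_right
    (h1.trans (mul_le_mul_right h2 _)) _).trans ?_)
  rw [volume_closedBall_eq _ hs.le, ← hvb, ← ofReal_mul (by positivity),
    ← ofReal_mul (by positivity),
    show (2 : ℝ≥0∞) ^ N = ofReal (2 ^ N) by
      rw [ENNReal.ofReal_pow (by norm_num)]; simp, ← ofReal_mul (by positivity)]
  refine ofReal_le_ofReal ?_
  calc _ = 2 ^ N * (C * vb * (C0 * ((N + 2 : ℕ) : ℝ) ^ m)) * (s * h ^ m) := by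
        push_cast; rw [mul_rpow (by positivity) ha.le]; field_simp
    _ ≤ _ := by
        gcongr; exact le_max_left _ _

/-- Estimate at scales above the distance to the vertex. -/
lemma eLpNorm_scale_large (n N : ℕ) (R0 C0 m : ℝ) : ∃ K, 0 ≤ K ∧ ∀ (Y : RSpace n → ℂ)
    (F : RSpace n → CSpace n) (G : RSpace n → ℂ) (c a : RSpace n), Integrable Y → Integrable F →
    Integrable G → VeryWeakPoisson (ball c R0) Y F G → 0 ≤ C0 → (∀ r, 0 < r → r ≤ R0 → eLpNorm
    (fun y => ‖F y‖ + r * ‖G y‖) 2 vol (ball c r) ≤ ofReal (C0 * r ^ m)) → ∀ s, 0 < ‖a‖ → ‖a‖ ≤ s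
    → (N + 2) * s ≤ R0 → eLpNorm
    ((bdiff a)^[N] (fun x => kconv (moll s) Y x - kconv (moll (s / 2)) Y x)) 2 vol (ball c ‖a‖) ≤
    ofReal (K * (s ^ (1 + m - (N + n / 2)) * ‖a‖ ^ (N + n / 2 : ℝ))) := by
  obtain ⟨C, hC0, hC⟩ := norm_bdiff_moll_sub_le n N
  set vb := volume.real (ball (0 : RSpace n) 1) with hvb; have vbpos := ball_real_pos n
  refine ⟨C * C0 * (((N + 2 : ℕ) : ℝ) ^ m * ((((N + 2 : ℕ) : ℝ) ^ n * vb) ^ ½) * vb ^ ½) ⊔ 0,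
    le_max_right _ _, fun Y F G c a hY hF hG hVW hC0' hdata s ha hsa hsR => ?_⟩
  have hs : 0 < s := ha.trans_le hsa; set h := ‖a‖ with hh
  set E : RSpace n → ℂ := fun x => kconv (moll s) Y x - kconv (moll (s / 2)) Y x with hE
  set g : RSpace n → ℝ := fun y => ‖F y‖ + s * ‖G y‖ with hg
  have hgi : Integrable g := hF.norm.add (hG.norm.const_mul s)
  have hg0 : ∀ y, 0 ≤ g y := fun y => by simp only [hg]; positivity
  set ρ := (N + 2) * s with hρ; have hρ0 : 0 < ρ := by positivity
  have h2 : eLpNorm g 2 vol (ball c ρ) ≤ ofReal (C0 * ρ ^ m) := by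
    refine le_trans (eLpNorm_mono_real fun y => ?_) (hdata ρ hρ0 hsR); rw [norm_of_nonneg (hg0 y)]
    have : s ≤ ρ := by nlinarith [Nat.cast_nonneg (α := ℝ) N]
    simp only [hg]; gcongr
  have h3 := setIntegral_ball_le hgi hg0 hρ0 (by positivity) h2; rw [← hvb] at h3
  have hNh : N * h ≤ N * s := by gcongr
  have hpt : ∀ x ∈ ball c h, ‖(bdiff a)^[N] E x‖ ≤
      C * s * (s ^ n)⁻¹ * (h / s) ^ N * (C0 * ρ ^ m * (ρ ^ n * vb) ^ ½) := by
    intro x hx; rw [mem_ball] at hx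
    have hsub : closedBall x (s + N * h) ⊆ ball c ρ := fun y hy => by
      rw [mem_closedBall] at hy; rw [mem_ball]; have := dist_triangle y x c; rw [hρ]; nlinarith
    have h4 := hC _ Y F G hY hF hG hVW a x s hs (hsub.trans (ball_subset_ball hsR))
    rw [hE, iterate_bdiff_sub]
    refine h4.trans (mul_le_mul_of_nonneg_left (le_trans ?_ h3) (by positivity))
    exact setIntegral_mono_set hgi.integrableOn (.of_forall hg0) hsub.eventuallyLE
  refine (eLpNorm_le_of_ae_bound ((ae_restrict_iff' isOpen_ball.measurableSet).2
    (.of_forall hpt))).trans ?_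
  rw [Measure.restrict_apply_univ, volume_ball_eq c ha, ← hvb, ENNReal.ofReal_rpow_of_nonneg (by
    positivity) (by norm_num), ← ofReal_mul (by positivity)]
  refine ofReal_le_ofReal ?_
  have e1 : ∀ x : ℝ, 0 < x → (x ^ n * vb) ^ ½ = x ^ (n / 2 : ℝ) * vb ^ ½ := by
    intro x hx; rw [mul_rpow (by positivity) vbpos.le, ← rpow_natCast, ← rpow_mul hx.le]
    congr 2; ring
  have e2 : (s ^ n)⁻¹ = s ^ (-(n : ℝ)) := by rw [rpow_neg hs.le, rpow_natCast]
  have e3 : (h / s) ^ N = h ^ (N : ℝ) * s ^ (-(N : ℝ)) := by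
    rw [rpow_neg hs.le, rpow_natCast, rpow_natCast, div_pow]; rfl
  have e4 : s * s ^ (-(n : ℝ)) * s ^ (-(N : ℝ)) * s ^ m * s ^ (n / 2 : ℝ) =
      s ^ (1 + m - (N + n / 2)) := by
    nth_rw 1 [← rpow_one s]; rw [← rpow_add hs, ← rpow_add hs, ← rpow_add hs, ← rpow_add hs]
    congr 1; ring
  have e5 : h ^ (N : ℝ) * h ^ (n / 2 : ℝ) = h ^ (N + n / 2 : ℝ) := (rpow_add ha _ _).symm
  have hN2 : (0 : ℝ) < ((N + 2 : ℕ) : ℝ) := by positivity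
  calc _ = C * C0 * (((N + 2 : ℕ) : ℝ) ^ m * ((((N + 2 : ℕ) : ℝ) ^ n * vb) ^ ½) *
        vb ^ ½) * (s ^ (1 + m - (N + n / 2)) * h ^ (N + n / 2 : ℝ)) := by
        rw [show (2 : ℝ≥0∞).toReal⁻¹ = 1 / 2 by norm_num, e1 h ha, e1 ρ hρ0, e1 _ hN2, e2, e3,
          ← e4, ← e5]
        have : ρ = ((N + 2 : ℕ) : ℝ) * s := by push_cast; rfl
        rw [this, mul_rpow hN2.le hs.le, mul_rpow hN2.le hs.le]; ring
    _ ≤ _ := by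
        gcongr; exact le_max_left _ _

/-- One step of the decay iteration. -/
theorem eLpNorm_decay_step (hn : 0 < n) (N : ℕ) {R0 C0 m : ℝ} (hR0 : 0 < R0) (hC0 : 0 ≤ C0)
    (hm : 1 + m < N + n / 2) : ∃ C1, 0 ≤ C1 ∧ ∀ (Y : 𝔼 → ℂ) (F : 𝔼 → CSpace n) (G : 𝔼 → ℂ)
    (c d : 𝔼), ‖d‖ = 1 → Integrable Y → Integrable F → Integrable G → VeryWeakPoisson (ball c R0)
    Y F G → (N = 0 ∨ ∀ y, inner ℝ d (y - c) ≤ 0 → Y y = 0) → ∫ y, ‖Y y‖ ≤ C0 → eLpNorm Y 2 vol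
    (ball c R0) ≤ ofReal C0 → (∀ r, 0 < r → r ≤ R0 → eLpNorm (fun y => ‖F y‖ + r * ‖G y‖) 2 vol
    (ball c r) ≤ ofReal (C0 * r ^ m)) → ∀ r, 0 < r → r ≤ R0 → eLpNorm Y 2 vol (ball c r) ≤ ofReal
    (C1 * r ^ (1 + m)) := by
  obtain ⟨KA, hKA0, hKA⟩ := eLpNorm_scale_small n N R0 C0 m
  obtain ⟨KB, hKB0, hKB⟩ := eLpNorm_scale_large n N R0 C0 m
  obtain ⟨D, hD0, hD⟩ := norm_bdiff_scale_le (n := n) N contDiff_radKer (fun _ => radKer_eq_zero)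
  set P : ℝ := N + n / 2 with hP; set vb := volume.real (ball (0 : 𝔼) 1) with hvb
  have vbpos : 0 < vb := ball_real_pos n; set S0 := R0 / (N + 2) with hS0
  have hS0p : 0 < S0 := by positivity
  have hS0R : (N + 2) * S0 = R0 := by rw [hS0]; field_simp
  set θ : ℝ := max (2 ^ (1 + m - P)) (1 / 2) with hθ
  have hθ0 : 0 ≤ θ := le_max_of_le_right (by norm_num)
  have hθ1 : θ < 1 := max_lt (rpow_lt_one_of_one_lt_of_neg (by norm_num) (by linarith))
    (by norm_num)
  set KC := (S0 ^ n)⁻¹ * (D * (S0 ^ N)⁻¹) * C0 * vb ^ ½ * S0 ^ (P - (1 + m)) with hKC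
  have hKC0 : 0 ≤ KC := by positivity
  set K1 := ‖(radMass n : ℂ)⁻¹‖ * (KC + max KA KB * (2 / (1 - θ))) with hK1
  have hK10 : 0 ≤ K1 := by
    have : 0 < 1 - θ := by linarith
    have : 0 ≤ max KA KB := le_max_of_le_left hKA0; positivity
  set Lo := min (S0 ^ (1 + m)) (R0 ^ (1 + m)) with hLo; have hLop : 0 < Lo := by positivity
  set Hi : ℝ := max 1 (2 ^ (1 + m)) with hHi; have hHi1 : 1 ≤ Hi := le_max_left _ _
  refine ⟨K1 * Hi + C0 / Lo, by positivity,
    fun Y F G c d hd hY hF hG hVW hN hY1 hY2 hdata r hr hrR => ?_⟩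
  have hdy : ∀ J : ℕ, eLpNorm Y 2 vol (ball c (S0 / 2 ^ J)) ≤
      ofReal (K1 * (S0 / 2 ^ J) ^ (1 + m)) := by
    intro J; set h := S0 / 2 ^ J with hh; have hhp : 0 < h := by positivity
    have hhS : h ≤ S0 := div_le_self hS0p.le (one_le_pow₀ (by norm_num)); set a := h • d with ha
    have hna : ‖a‖ = h := by rw [ha, norm_smul, hd, mul_one, norm_of_nonneg hhp.le]
    set δ : ℕ → ℝ := fun k => S0 / 2 ^ k with hδ
    have hδp : ∀ k, 0 < δ k := fun k => by simp only [hδ]; positivity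
    have hδS : ∀ k, δ k ≤ S0 := fun k => div_le_self hS0p.le (one_le_pow₀ (by norm_num))
    have hδt : Tendsto δ atTop (𝓝[>] 0) := by
      refine tendsto_nhdsWithin_iff.2 ⟨?_, .of_forall hδp⟩
      have := (tendsto_pow_atTop_nhds_zero_of_lt_one (r := ½) (by norm_num)
        (by norm_num)).const_mul S0
      simp only [one_div, inv_pow, mul_zero] at this; exact this
    set μ := vol (ball c h) with hμ
    set f : ℕ → 𝔼 → ℂ := fun k => (bdiff a)^[N] (kconv (moll (δ k)) Y) with hf
    have hfc : ∀ k, Continuous (f k) := fun k => by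
      obtain ⟨C', -, hC'⟩ := exists_le (contDiff_moll (n := n) (δ k)).continuous
        (hasCompactSupport_of (R := δ k) fun _ => moll_eq_zero (hδp k))
      exact continuous_iterate_bdiff a N (continuous_kconv (contDiff_moll (δ k)).continuous hC' hY)
    set e : ℕ → 𝔼 → ℂ := fun k =>
      (bdiff a)^[N] (fun x => kconv (moll (δ k)) Y x - kconv (moll (δ k / 2)) Y x) with he
    have hefe : ∀ k, e k = fun x => f k x - f (k + 1) x := fun k => by
      have : δ (k + 1) = δ k / 2 := by simp only [hδ]; rw [pow_succ]; field_simp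
      simp only [he, hf, this]; rw [iterate_bdiff_sub]
    have hec : ∀ k, Continuous (e k) := fun k => by
      rw [hefe]; exact (hfc k).sub (hfc (k + 1))
    have hsum : ∀ k, eLpNorm (f k) 2 μ ≤
        eLpNorm (f 0) 2 μ + ∑ j ∈ Finset.range k, eLpNorm (e j) 2 μ := by
      intro k
      induction k with
      | zero => simp
      | succ k ih =>
        have e1 : f (k + 1) = f k - e k := by rw [hefe]; funext x; simp
        rw [e1, sum_range_succ, ← add_assoc]
        exact (eLpNorm_sub_le (hfc k).aestronglyMeasurable (hec k).aestronglyMeasurable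
          (by norm_num)).trans (by gcongr)
    have hej : ∀ j, eLpNorm (e j) 2 μ ≤
        ofReal (max KA KB * h ^ (1 + m) * θ ^ ((J - j) + (j - J))) := by
      intro j; rcases le_total j J with hj | hj
      · have hdj : δ j = h * 2 ^ (J - j) := by
          simp only [hδ, hh]
          rw [div_mul_eq_mul_div, div_eq_div_iff (by positivity) (by positivity), mul_assoc,
            ← pow_add, Nat.sub_add_cancel hj]
        have h1 : h ≤ δ j := by
          rw [hdj]; exact le_mul_of_one_le_right hhp.le (one_le_pow₀ (by norm_num))
        have := hKB Y F G c a hY hF hG hVW hC0 hdata (δ j) (by rw [hna]; exact hhp)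
          (by rw [hna]; exact h1) (by rw [← hS0R]; have := hδS j; gcongr)
        rw [hna] at this; refine this.trans (ofReal_le_ofReal ?_)
        rw [Nat.sub_eq_zero_of_le hj, add_zero, hdj, rpow_ratio_identity hhp (by positivity),
          ← mul_assoc]
        have h2 : ((2 : ℝ) ^ (J - j)) ^ (1 + m - P) ≤ θ ^ (J - j) := by
          rw [← rpow_natCast, ← rpow_mul (by norm_num), mul_comm,
            rpow_mul (by norm_num), rpow_natCast]
          exact pow_le_pow_left₀ (by positivity) (le_max_left _ _) _
        gcongr; exact le_max_right _ _
      · have hdj : δ j = h * (1 / 2) ^ (j - J) := by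
          have h2 : (2 : ℝ) ^ j = 2 ^ J * 2 ^ (j - J) := by rw [← pow_add, Nat.add_sub_cancel' hj]
          simp only [hδ, hh]
          rw [h2, div_mul_eq_div_div, one_div, inv_pow, div_eq_mul_inv (S0 / 2 ^ J)]
        have h1 : δ j ≤ h := by
          rw [hdj]; exact mul_le_of_le_one_right hhp.le (pow_le_one₀ (by norm_num) (by norm_num))
        have := hKA Y F G c a hY hF hG hVW hC0 hdata (δ j) (hδp j)
          (by rw [hna]; exact h1) (by rw [← hS0R, hna]; gcongr)
        rw [hna] at this; refine this.trans (ofReal_le_ofReal ?_)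
        rw [Nat.sub_eq_zero_of_le hj, zero_add, hdj]
        have h2 : ((1 : ℝ) / 2) ^ (j - J) ≤ θ ^ (j - J) :=
          pow_le_pow_left₀ (by norm_num) (le_max_right _ _) _
        calc KA * (h * (1 / 2) ^ (j - J) * h ^ m) = KA * h ^ (1 + m) * (1 / 2) ^ (j - J) := by
              rw [rpow_add hhp, rpow_one]; ring
          _ ≤ _ := by
              gcongr; exact le_max_left _ _
    have hf0 : eLpNorm (f 0) 2 μ ≤ ofReal (KC * h ^ (1 + m)) := by
      have hpt : ∀ x, ‖f 0 x‖ ≤ (S0 ^ n)⁻¹ * (D * (h / S0) ^ N) * C0 := by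
        intro x; have hδ0 : δ 0 = S0 := by simp [hδ]
        obtain ⟨C', -, hC'⟩ := exists_le (contDiff_moll (n := n) S0).continuous
          (hasCompactSupport_of (R := S0) fun _ => moll_eq_zero hS0p)
        simp only [hf, hδ0]; rw [(iterate_bdiff_kconv a N (contDiff_moll S0).continuous hC' hY).1]
        have e1 : moll (n := n) S0 = fun w => (S0 ^ n)⁻¹ * radKer (S0⁻¹ • w) := rfl
        obtain ⟨h1, h2⟩ := hD (S0 ^ n)⁻¹ S0 a hS0p; rw [e1]
        refine (norm_kconv_le h1 h2 hY x).trans ?_; rw [abs_of_pos (by positivity), hna]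
        refine mul_le_mul_of_nonneg_left (le_trans ?_ hY1) (by positivity)
        exact setIntegral_le_integral hY.norm (.of_forall fun y => norm_nonneg _)
      refine (eLpNorm_le_of_ae_bound (.of_forall hpt)).trans ?_
      rw [hμ, Measure.restrict_apply_univ, volume_ball_eq c hhp, ← hvb,
        ENNReal.ofReal_rpow_of_nonneg (by positivity) (by norm_num), ← ofReal_mul (by positivity)]
      refine ofReal_le_ofReal ?_
      have e1 : (h ^ n * vb) ^ (2 : ℝ≥0∞).toReal⁻¹ = h ^ (n / 2 : ℝ) * vb ^ ½ := by
        rw [show (2 : ℝ≥0∞).toReal⁻¹ = 1 / 2 by norm_num,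
          mul_rpow (by positivity) vbpos.le, ← rpow_natCast, ← rpow_mul hhp.le]
        congr 2; ring
      have e2 : h ^ (n / 2 : ℝ) * h ^ N = h ^ (P - (1 + m)) * h ^ (1 + m) := by
        rw [← rpow_natCast, ← rpow_add hhp, ← rpow_add hhp, hP]; congr 1; ring
      have e3 : h ^ (P - (1 + m)) ≤ S0 ^ (P - (1 + m)) := rpow_le_rpow hhp.le hhS (by linarith)
      rw [e1, div_pow]
      calc _ = (S0 ^ n)⁻¹ * (D * (S0 ^ N)⁻¹) * C0 * vb ^ ½ * (h ^ (n / 2 : ℝ) * h ^ N) := by ring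
        _ ≤ (S0 ^ n)⁻¹ * (D * (S0 ^ N)⁻¹) * C0 * vb ^ ½ * (S0 ^ (P - (1 + m)) * h ^ (1 + m)) := by
            rw [e2]; gcongr
        _ = _ := by rw [hKC]; ring
    have hlim : eLpNorm (fun x => (radMass n : ℂ) * Y x) 2 μ ≤
        ofReal ((KC + max KA KB * (2 / (1 - θ))) * h ^ (1 + m)) := by
      refine Lp.eLpNorm_le_of_ae_tendsto (u := atTop) (.of_forall fun k => ?_) (fun k => (hfc
        k).aestronglyMeasurable) (tendsto_iterate_bdiff_kconv_moll hY hd hN hδt)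
      have hM0 : 0 ≤ max KA KB := le_max_of_le_left hKA0
      calc eLpNorm (f k) 2 μ ≤ _ := hsum k
        _ ≤ ofReal (KC * h ^ (1 + m)) + ∑ j ∈ Finset.range k,
            ofReal (max KA KB * h ^ (1 + m) * θ ^ ((J - j) + (j - J))) :=
            add_le_add hf0 (sum_le_sum fun j _ => hej j)
        _ = ofReal (KC * h ^ (1 + m) + max KA KB * h ^ (1 + m) *
            ∑ j ∈ Finset.range k, θ ^ ((J - j) + (j - J))) := by
            rw [← ENNReal.ofReal_sum_of_nonneg (fun j _ => by positivity), ← ENNReal.ofReal_add (by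
              positivity) (sum_nonneg fun j _ => by positivity), mul_sum]
        _ ≤ _ := by
            refine ofReal_le_ofReal ?_; have := sum_dyadic_le hθ0 hθ1 J k
            calc _ ≤ KC * h ^ (1 + m) + max KA KB * h ^ (1 + m) * (2 / (1 - θ)) := by gcongr
              _ = _ := by ring
    have hrad : (radMass n : ℂ) ≠ 0 := by exact_mod_cast radMass_ne_zero hn
    have e1 : Y = (radMass n : ℂ)⁻¹ • fun x => (radMass n : ℂ) * Y x := by
      funext x; simp [hrad]
    have e2 : eLpNorm Y 2 μ = ‖(radMass n : ℂ)⁻¹‖ₑ *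
        eLpNorm (fun x => (radMass n : ℂ) * Y x) 2 μ := by
      conv_lhs => rw [e1]
      exact eLpNorm_const_smul _ _ _ _
    rw [e2, ← ofReal_norm, hK1, mul_assoc, ofReal_mul (norm_nonneg _)]
    exact mul_le_mul_right hlim _
  rcases le_or_gt r S0 with hrS | hrS
  · obtain ⟨J, hJ1, hJ2⟩ := exists_nat_pow_near ((one_le_div hr).2 hrS) (one_lt_two (α := ℝ))
    have h1 : r ≤ S0 / 2 ^ J := by
      rw [le_div_iff₀ (by positivity), mul_comm]; exact (le_div_iff₀ hr).1 hJ1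
    have h2 : S0 / 2 ^ J ≤ 2 * r := by
      rw [div_le_iff₀ (by positivity)]; have := (div_lt_iff₀ hr).1 hJ2; rw [pow_succ] at this
      linarith
    refine (eLpNorm_mono_measure _ (Measure.restrict_mono (ball_subset_ball h1)
      le_rfl)).trans ((hdy J).trans (ofReal_le_ofReal ?_))
    have h3 : (S0 / 2 ^ J) ^ (1 + m) ≤ Hi * r ^ (1 + m) := by
      rcases le_total 0 (1 + m) with hm0 | hm0
      · calc _ ≤ (2 * r) ^ (1 + m) := rpow_le_rpow (by positivity) h2 hm0
          _ = 2 ^ (1 + m) * r ^ (1 + m) := mul_rpow (by norm_num) hr.le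
          _ ≤ _ := by gcongr; exact le_max_right _ _
      · calc _ ≤ r ^ (1 + m) := rpow_le_rpow_of_nonpos hr h1 hm0
          _ ≤ _ := le_mul_of_one_le_left (rpow_nonneg hr.le _) hHi1
    calc _ ≤ K1 * (Hi * r ^ (1 + m)) := by gcongr
      _ ≤ _ := by
        rw [add_mul, mul_assoc K1]
        exact le_add_of_nonneg_right (mul_nonneg (div_nonneg hC0 hLop.le) (rpow_nonneg hr.le _))
  · refine (eLpNorm_mono_measure _ (Measure.restrict_mono (ball_subset_ball hrR)
      le_rfl)).trans (hY2.trans (ofReal_le_ofReal ?_))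
    have h3 : Lo ≤ r ^ (1 + m) := by
      rcases le_total 0 (1 + m) with hm0 | hm0
      · exact (min_le_left _ _).trans (rpow_le_rpow hS0p.le hrS.le hm0)
      · exact (min_le_right _ _).trans (rpow_le_rpow_of_nonpos hr hrR hm0)
    calc C0 = C0 / Lo * Lo := by field_simp
      _ ≤ C0 / Lo * r ^ (1 + m) := by gcongr
      _ ≤ _ := by
        rw [add_mul]
        exact le_add_of_nonneg_left (mul_nonneg (mul_nonneg hK10 (zero_le_one.trans hHi1))
          (rpow_nonneg hr.le _))

lemma rpow_le_const_mul_rpow {R0 m m' : ℝ} (hm : m' ≤ m) {r : ℝ} (hr : 0 < r) (hrR : r ≤ R0) :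
    r ^ m ≤ R0 ^ (m - m') * r ^ m' := by
  calc r ^ m = r ^ (m - m') * r ^ m' := by rw [← rpow_add hr]; congr 1; ring
    _ ≤ _ := mul_le_mul_of_nonneg_right (rpow_le_rpow hr.le hrR (by linarith)) (rpow_nonneg hr.le _)

lemma eLpNorm_data_le {μ : Measure 𝔼} {Y : 𝔼 → ℂ} {F : 𝔼 → CSpace n} {G : 𝔼 → ℂ} {F0 G0 : 𝔼 → ℝ}
    {C r : ℝ} (hC : 0 ≤ C) (hr : 0 ≤ r) (hY : AESM Y μ) (hF0 : AESM F0 μ) (hG0 : AESM G0 μ)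
    (hF : ∀ᵐ y ∂μ, ‖F y‖ ≤ C * ‖Y y‖ + F0 y) (hG : ∀ᵐ y ∂μ, ‖G y‖ ≤ C * ‖Y y‖ + G0 y) : eLpNorm
    (fun y => ‖F y‖ + r * ‖G y‖) 2 μ ≤ ofReal (C * (1 + r)) * eLpNorm Y 2 μ + eLpNorm F0 2 μ +
    ofReal r * eLpNorm G0 2 μ := by
  have h1 : eLpNorm (fun y => ‖F y‖ + r * ‖G y‖) 2 μ ≤
      eLpNorm (((fun y => (C * (1 + r)) * ‖Y y‖) + F0) + fun y => r * G0 y) 2 μ := by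
    refine eLpNorm_mono_ae ?_; filter_upwards [hF, hG] with y h2 h3
    rw [norm_of_nonneg (by positivity)]; refine le_trans ?_ (le_abs_self _)
    have := mul_le_mul_of_nonneg_left h3 hr; simp only [Pi.add_apply]; linarith
  have e1 : eLpNorm (fun y => (C * (1 + r)) * ‖Y y‖) 2 μ =
      ofReal (C * (1 + r)) * eLpNorm Y 2 μ := by
    rw [← eLpNorm_norm Y]; refine (eLpNorm_const_smul (C * (1 + r)) (fun y => ‖Y y‖) 2 μ).trans ?_
    rw [← ofReal_norm, norm_of_nonneg (by positivity)]
  have e2 : eLpNorm (fun y => r * G0 y) 2 μ = ofReal r * eLpNorm G0 2 μ := by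
    refine (eLpNorm_const_smul r G0 2 μ).trans ?_; rw [← ofReal_norm, norm_of_nonneg hr]
  refine h1.trans ((eLpNorm_add_le ((hY.norm.const_mul _).add hF0) (hG0.const_mul r)
    (by norm_num)).trans ?_)
  rw [e2]; gcongr; refine (eLpNorm_add_le (hY.norm.const_mul _) hF0 (by norm_num)).trans ?_; rw [e1]

/-- Iterated decay, uniformly over a set of centers. -/
theorem eLpNorm_decay (hn : 0 < n) (N : ℕ) {R0 f g E C : ℝ} (hR0 : 0 < R0) (hE0 : 0 ≤ E)
    (hE1 : E ≤ f + 1) (hE2 : E ≤ g + 2) (hE3 : E < N + n / 2) (hC : 0 ≤ C) {Y : 𝔼 → ℂ}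
    {F : 𝔼 → CSpace n} {G : 𝔼 → ℂ} {F0 G0 : 𝔼 → ℝ} {d : 𝔼} (hd : ‖d‖ = 1) (hY : Integrable Y)
    (hF : Integrable F) (hG : Integrable G) (hY2 : MemLp Y 2) {Cs : Set 𝔼}
    (hVW : ∀ c ∈ Cs, VeryWeakPoisson (ball c R0) Y F G)
    (hN : ∀ c ∈ Cs, N = 0 ∨ ∀ y, inner ℝ d (y - c) ≤ 0 → Y y = 0)
    (hFb : ∀ᵐ y, ‖F y‖ ≤ C * ‖Y y‖ + F0 y) (hGb : ∀ᵐ y, ‖G y‖ ≤ C * ‖Y y‖ + G0 y)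
    (hF0m : AESM F0 volume) (hG0m : AESM G0 volume)
    (hF0 : ∀ c ∈ Cs, ∀ r, 0 < r → r ≤ R0 → eLpNorm F0 2 vol (ball c r) ≤ ofReal (C * r ^ f))
    (hG0 : ∀ c ∈ Cs, ∀ r, 0 < r → r ≤ R0 → eLpNorm G0 2 vol (ball c r) ≤ ofReal (C * r ^ g)) : ∃
    C1, 0 ≤ C1 ∧ ∀ c ∈ Cs, ∀ r, 0 < r → r ≤ R0 → eLpNorm Y 2 vol (ball c r) ≤ ofReal (C1 * r ^ E) := by
  have key : ∀ k : ℕ, ∃ C1, 0 ≤ C1 ∧ ∀ c ∈ Cs, ∀ r, 0 < r → r ≤ R0 → eLpNorm Y 2 vol (ball c r) ≤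
        ofReal (C1 * r ^ (min (k : ℝ) E)) := by
    set C2 := (eLpNorm Y 2 volume).toReal with hC2
    have hle : ∀ S : Set 𝔼, eLpNorm Y 2 vol S ≤ ofReal C2 :=
      fun S => by
        rw [hC2, ENNReal.ofReal_toReal hY2.2.ne]
        exact eLpNorm_mono_measure _ Measure.restrict_le_self
    intro k
    induction k with
    | zero =>
      refine ⟨C2, ENNReal.toReal_nonneg, fun c _ r hr _ => ?_⟩
      rw [Nat.cast_zero, min_eq_left hE0, rpow_zero, mul_one]; exact hle _
    | succ k ih =>
      obtain ⟨C1, hC10, hC1⟩ := ih; set m : ℝ := min (k : ℝ) (E - 1) with hm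
      have e1 : 1 + m = min ((k + 1 : ℕ) : ℝ) E := by
        rw [hm, ← min_add_add_left]; push_cast; ring_nf
      have hmk : m ≤ min (k : ℝ) E := le_min (min_le_left _ _) ((min_le_right _ _).trans
        (by linarith))
      have hmE : m ≤ E - 1 := min_le_right _ _
      set D : ℝ := C * (1 + R0) * C1 * R0 ^ (min (k : ℝ) E - m) + C * R0 ^ (f - m)
        + C * R0 ^ (g + 1 - m) with hD
      have hD0 : 0 ≤ D := by positivity
      set C0 : ℝ := max D (max C2 (∫ y, ‖Y y‖)) with hC0
      obtain ⟨C3, hC30, hC3⟩ := eLpNorm_decay_step (m := m) hn N hR0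
        (le_max_of_le_left hD0 : 0 ≤ C0)
        (by rw [e1]; exact (min_le_right _ _).trans_lt hE3)
      refine ⟨C3, hC30, fun c hc r hr hrR => ?_⟩; rw [← e1]
      refine hC3 Y F G c d hd hY hF hG (hVW c hc) (hN c hc) ((le_max_right _ _).trans (le_max_right
        _ _)) ((hle _).trans (ofReal_le_ofReal ((le_max_left _ _).trans (le_max_right _ _)))) (fun s
        hs hsR => ?_) r hr hrR
      refine (eLpNorm_data_le hC hs.le hY.aestronglyMeasurable.restrict hF0m.restrict
        hG0m.restrict (ae_restrict_of_ae hFb) (ae_restrict_of_ae hGb)).trans ?_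
      calc _ ≤ ofReal (C * (1 + s)) * ofReal (C1 * s ^ (min (k : ℝ) E))
            + ofReal (C * s ^ f) + ofReal s * ofReal (C * s ^ g) := by
            gcongr
            · exact hC1 c hc s hs hsR
            · exact hF0 c hc s hs hsR
            · exact hG0 c hc s hs hsR
        _ = ofReal (C * (1 + s) * (C1 * s ^ (min (k : ℝ) E)) + C * s ^ f + s * (C * s ^ g)) := by
            rw [← ofReal_mul (by positivity), ← ofReal_mul hs.le, ← ENNReal.ofReal_add (by
              positivity) (by positivity), ← ENNReal.ofReal_add (by positivity) (by positivity)]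
        _ ≤ _ := by
            refine ofReal_le_ofReal (le_trans ?_ (mul_le_mul_of_nonneg_right
              (le_max_left D _) (rpow_nonneg hs.le _)))
            have h1 := rpow_le_const_mul_rpow hmk hs hsR
            have h2 := rpow_le_const_mul_rpow (m := f) (m' := m) (by linarith) hs hsR
            have h3 := rpow_le_const_mul_rpow (m := g + 1) (m' := m) (by linarith) hs hsR
            have e2 : s * (C * s ^ g) = C * s ^ (g + 1) := by
              rw [rpow_add hs, rpow_one]; ring
            rw [e2, hD, add_mul, add_mul]
            have h4 : C * (1 + s) * (C1 * s ^ (min (k : ℝ) E)) ≤ C * (1 + R0) * (C1 * (R0 ^ (min (k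
              : ℝ) E - m) * s ^ m)) := by gcongr
            have h5 := mul_le_mul_of_nonneg_left h2 hC; have h6 := mul_le_mul_of_nonneg_left h3 hC
            linarith
  obtain ⟨C1, h0, h1⟩ := key ⌈E⌉₊; rw [min_eq_right (Nat.le_ceil E)] at h1; exact ⟨C1, h0, h1⟩

lemma VeryWeakPoisson.mono {U U' : Set 𝔼} {Y : 𝔼 → ℂ} {F : 𝔼 → CSpace n} {G : 𝔼 → ℂ}
    (h : VeryWeakPoisson U Y F G) (hU : U' ⊆ U) : VeryWeakPoisson U' Y F G :=
  fun b hb => h b ⟨hb.1, hb.2.1, hb.2.2.trans hU⟩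

/-- Interior boundedness of very weak solutions with bounded data. -/
theorem ae_bounded_of_veryWeakPoisson (hn : 0 < n) {R0 C : ℝ} (hR0 : 0 < R0) (hC : 0 ≤ C)
    {Y : 𝔼 → ℂ} {F : 𝔼 → CSpace n} {G : 𝔼 → ℂ} (hY : Integrable Y) (hF : Integrable F)
    (hG : Integrable G) (hY2 : MemLp Y 2) (hVW : VeryWeakPoisson (ball 0 R0) Y F G)
    (hFb : ∀ᵐ y, ‖F y‖ ≤ C * ‖Y y‖ + C) (hGb : ∀ᵐ y, ‖G y‖ ≤ C * ‖Y y‖ + C) :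
    ∃ M, ∀ᵐ x, ‖x‖ ≤ R0 / 2 → ‖Y x‖ ≤ M := by
  set vb := volume.real (ball (0 : 𝔼) 1) with hvb; have vbpos : 0 < vb := ball_real_pos n
  have hn1 : (1 : ℝ) ≤ n := by exact_mod_cast hn
  set C' := C * (1 + vb ^ ½) with hC'
  have hCC : C ≤ C' := le_mul_of_one_le_right hC (by linarith [rpow_nonneg vbpos.le (1 / 2)])
  have hC'0 : 0 ≤ C' := hC.trans hCC; set E : ℝ := n / 2 - 1 / 4 with hE
  have hE0 : 0 ≤ E := by rw [hE]; linarith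
  have hconst : ∀ (c : 𝔼) (r : ℝ), 0 < r → eLpNorm (fun _ : 𝔼 => C) 2
      vol (ball c r) ≤ ofReal (C' * r ^ (n / 2 : ℝ)) := by
    intro c r hr
    refine (eLpNorm_le_of_ae_bound (C := C) (.of_forall fun _ => (norm_of_nonneg hC).le)).trans ?_
    rw [Measure.restrict_apply_univ, volume_ball_eq c hr, ← hvb, ENNReal.ofReal_rpow_of_nonneg (by
      positivity) (by norm_num), ← ofReal_mul (by positivity)]
    refine ofReal_le_ofReal ?_
    have e1 : (r ^ n * vb) ^ (2 : ℝ≥0∞).toReal⁻¹ = r ^ (n / 2 : ℝ) * vb ^ ½ := by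
      rw [show (2 : ℝ≥0∞).toReal⁻¹ = 1 / 2 by norm_num,
        mul_rpow (by positivity) vbpos.le, ← rpow_natCast, ← rpow_mul hr.le]
      congr 2; ring
    rw [e1, hC']; have : 0 ≤ C * r ^ (n / 2 : ℝ) := by positivity
    nlinarith
  obtain ⟨C1, hC10, hC1⟩ := eLpNorm_decay (R0 := R0 / 2) (f := n / 2) (g := n / 2) (E := E)
    (C := C') (F0 := fun _ => C) (G0 := fun _ => C) (d := EuclideanSpace.single ⟨0, hn⟩ 1)
    (Cs := closedBall 0 (R0 / 2)) hn 0 (by positivity) hE0 (by rw [hE]; linarith)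
    (by rw [hE]; linarith) (by rw [hE]; push_cast; linarith) hC'0 (by simp) hY hF hG hY2
    (fun c hc => hVW.mono (ball_subset_ball' (by
      rw [mem_closedBall] at hc; linarith)))
    (fun _ _ => Or.inl rfl)
    (hFb.mono fun y hy => hy.trans (by gcongr)) (hGb.mono fun y hy => hy.trans (by gcongr))
    aestronglyMeasurable_const aestronglyMeasurable_const
    (fun c _ r hr _ => hconst c r hr) (fun c _ r hr _ => hconst c r hr)
  obtain ⟨C2, hC20, hC2⟩ := norm_bdiff_moll_sub_le n 0
  obtain ⟨C3, hC30, hC3⟩ := exists_le (contDiff_moll (n := n) (R0 / 4)).continuous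
    (hasCompactSupport_of (R := R0 / 4) fun _ => moll_eq_zero (by positivity : 0 < R0 / 4))
  set D := C' * (1 + R0) * C1 + C' * (1 + R0) * R0 ^ (1 / 4 : ℝ) with hD
  set K := C2 * D * 2 ^ E * (2 ^ (n / 2 : ℝ) * vb ^ ½) * (R0 / 4) ^ (3 / 4 : ℝ) with hK
  have hD0 : 0 ≤ D := by positivity
  have hK0 : 0 ≤ K := by positivity
  set q : ℝ := (1 / 2) ^ (3 / 4 : ℝ) with hq; have hq0 : 0 ≤ q := by positivity
  have hq1 : q < 1 := rpow_lt_one (by norm_num) (by norm_num) (by norm_num)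
  set δ : ℕ → ℝ := fun j => R0 / 4 * (1 / 2) ^ j with hδ
  have hδp : ∀ j, 0 < δ j := fun j => by simp only [hδ]; positivity
  have hδle : ∀ j, δ j ≤ R0 / 4 := fun j =>
    mul_le_of_le_one_right (by positivity) (pow_le_one₀ (by norm_num) (by norm_num))
  have hδt : Tendsto δ atTop (𝓝[>] 0) := by
    refine tendsto_nhdsWithin_iff.2 ⟨?_, .of_forall hδp⟩
    have := (tendsto_pow_atTop_nhds_zero_of_lt_one (r := ½) (by norm_num)
      (by norm_num)).const_mul (R0 / 4)
    rwa [mul_zero] at this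
  have hstep : ∀ x : 𝔼, ‖x‖ ≤ R0 / 2 → ∀ j,
      ‖kconv (moll (δ j)) Y x - kconv (moll (δ (j + 1))) Y x‖ ≤ K * q ^ j := by
    intro x hx j; set s := δ j with hs; have hsp : 0 < s := hδp j; have hsR : s ≤ R0 / 4 := hδle j
    have e1 : δ (j + 1) = s / 2 := by simp only [hs, hδ]; rw [pow_succ]; ring
    have hxs : closedBall x s ⊆ ball 0 R0 := by
      refine closedBall_subset_ball' ?_; rw [dist_zero_right]; linarith
    have h1 := hC2 (ball 0 R0) Y F G hY hF hG hVW 0 x s hsp (by simpa using hxs)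
    simp only [Function.iterate_zero, id, pow_zero, mul_one, CharP.cast_eq_zero, zero_mul,
      add_zero] at h1
    rw [e1]; refine h1.trans ?_
    have hint : Integrable (fun y => ‖F y‖ + s * ‖G y‖) := hF.norm.add (hG.norm.const_mul s)
    have h2 : ∫ y in closedBall x s, (‖F y‖ + s * ‖G y‖) ≤ ∫ y in ball x (2 * s), (‖F y‖ + s * ‖G
      y‖) := setIntegral_mono_set hint.integrableOn (.of_forall fun y => by positivity)
      (closedBall_subset_ball (by linarith)).eventuallyLE
    have hxC : x ∈ closedBall (0 : 𝔼) (R0 / 2) := by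
      rwa [mem_closedBall_zero_iff]
    have h3 : eLpNorm (fun y => ‖F y‖ + s * ‖G y‖) 2 vol (ball x (2 * s)) ≤
        ofReal (D * (2 * s) ^ E) := by
      refine (eLpNorm_data_le (C := C') (F0 := fun _ => C) (G0 := fun _ => C) hC'0 hsp.le
        hY.aestronglyMeasurable.restrict aestronglyMeasurable_const aestronglyMeasurable_const
        (ae_restrict_of_ae (hFb.mono fun y hy => hy.trans (by gcongr)))
        (ae_restrict_of_ae (hGb.mono fun y hy => hy.trans (by gcongr)))).trans ?_
      calc _ ≤ ofReal (C' * (1 + s)) * ofReal (C1 * (2 * s) ^ E)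
            + ofReal (C' * (2 * s) ^ (n / 2 : ℝ))
            + ofReal s * ofReal (C' * (2 * s) ^ (n / 2 : ℝ)) := by
            gcongr
            · exact hC1 x hxC _ (by positivity) (by linarith)
            · exact hconst x _ (by positivity)
            · exact hconst x _ (by positivity)
        _ = ofReal (C' * (1 + s) * (C1 * (2 * s) ^ E) + C' * (2 * s) ^ (n / 2 : ℝ)
            + s * (C' * (2 * s) ^ (n / 2 : ℝ))) := by
            rw [← ofReal_mul (by positivity), ← ofReal_mul hsp.le, ← ENNReal.ofReal_add (by
              positivity) (by positivity), ← ENNReal.ofReal_add (by positivity) (by positivity)]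
        _ ≤ _ := by
            refine ofReal_le_ofReal ?_
            have h4 := rpow_le_const_mul_rpow (R0 := R0) (m := n / 2) (m' := E)
              (by rw [hE]; linarith) (by positivity : 0 < 2 * s) (by linarith)
            rw [show (n / 2 : ℝ) - E = 1 / 4 by rw [hE]; ring] at h4
            calc _ = C' * (1 + s) * C1 * (2 * s) ^ E + C' * (1 + s) * (2 * s) ^ (n / 2 : ℝ) := by
                  ring
              _ ≤ C' * (1 + R0) * C1 * (2 * s) ^ E +
                  C' * (1 + R0) * (R0 ^ (1 / 4 : ℝ) * (2 * s) ^ E) := by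
                  gcongr <;> linarith
              _ = _ := by rw [hD]; ring
    have h4 := setIntegral_ball_le hint (fun y => by positivity) (by positivity) (by positivity) h3
    have e2 : ((2 * s) ^ n * vb) ^ ½ = 2 ^ (n / 2 : ℝ) * s ^ (n / 2 : ℝ) * vb ^ ½ := by
      rw [mul_rpow (by positivity) vbpos.le, ← rpow_natCast,
        ← rpow_mul (by positivity), ← mul_rpow (by positivity) hsp.le]
      congr 2; ring
    have e3 : s * (s ^ n)⁻¹ * (s ^ E * s ^ (n / 2 : ℝ)) = s ^ (3 / 4 : ℝ) := by
      rw [← rpow_natCast, ← rpow_neg hsp.le, ← rpow_add hsp]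
      nth_rewrite 1 [← rpow_one s]
      rw [← rpow_add hsp, ← rpow_add hsp, hE]; congr 1; ring
    have e4 : s ^ (3 / 4 : ℝ) = (R0 / 4) ^ (3 / 4 : ℝ) * q ^ j := by
      simp only [hs, hδ]
      rw [mul_rpow (by positivity) (by positivity), hq, ← rpow_natCast, ← rpow_natCast, ← rpow_mul
        (by norm_num), ← rpow_mul (by norm_num), mul_comm (j : ℝ)]
    calc _ ≤ C2 * s * (s ^ n)⁻¹ * (D * (2 * s) ^ E * ((2 * s) ^ n * vb) ^ ½) := by
          gcongr; exact h2.trans h4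
      _ = C2 * D * 2 ^ E * (2 ^ (n / 2 : ℝ) * vb ^ ½) *
          (s * (s ^ n)⁻¹ * (s ^ E * s ^ (n / 2 : ℝ))) := by
          rw [e2, mul_rpow (by norm_num) hsp.le]; ring
      _ = _ := by rw [e3, e4, hK]; ring
  have hall : ∀ x : 𝔼, ‖x‖ ≤ R0 / 2 → ∀ j,
      ‖kconv (moll (δ j)) Y x‖ ≤ C3 * (∫ y, ‖Y y‖) + K * (1 - q)⁻¹ := by
    intro x hx j
    have h0 : ‖kconv (moll (δ 0)) Y x‖ ≤ C3 * ∫ y, ‖Y y‖ := by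
      have e0 : δ 0 = R0 / 4 := by simp [hδ]
      rw [e0]
      refine (norm_kconv_le hC3 (R := R0 / 4) (fun w hw => moll_eq_zero (by positivity) hw.le)
        hY x).trans ?_
      exact mul_le_mul_of_nonneg_left
        (setIntegral_le_integral hY.norm (.of_forall fun y => norm_nonneg _)) hC30
    have h1 : ‖kconv (moll (δ j)) Y x‖ ≤ ‖kconv (moll (δ 0)) Y x‖ +
        ∑ i ∈ Finset.range j, K * q ^ i := by
      induction j with
      | zero => simp
      | succ j ih =>
        rw [sum_range_succ]; have h2 := hstep x hx j
        have h3 := norm_sub_norm_le (kconv (moll (δ (j + 1))) Y x) (kconv (moll (δ j)) Y x)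
        rw [norm_sub_rev] at h3; linarith
    have h2 : ∑ i ∈ Finset.range j, K * q ^ i ≤ K * (1 - q)⁻¹ := by
      rw [← mul_sum]; gcongr; rw [← tsum_geometric_of_lt_one hq0 hq1]
      exact (summable_geometric_of_lt_one hq0 hq1).sum_le_tsum _ fun i _ => by positivity
    linarith
  have hrad : (radMass n : ℂ) ≠ 0 := by exact_mod_cast radMass_ne_zero hn
  refine ⟨(C3 * (∫ y, ‖Y y‖) + K * (1 - q)⁻¹) / ‖(radMass n : ℂ)‖, ?_⟩
  filter_upwards [ae_tendsto_kconv_moll hY] with x hx hxR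
  rw [le_div_iff₀ (norm_pos_iff.2 hrad), mul_comm, ← norm_mul]
  exact le_of_tendsto (hx δ hδt).norm (.of_forall (hall x hxR))

lemma dir_coe_smul (θ : USphere n) {t : ℝ} (ht : 0 < t) : dir (t • (θ : 𝔼)) = θ := by
  have h : ‖(θ : 𝔼)‖ = 1 := by simp
  rw [dir, norm_smul, h, mul_one, norm_of_nonneg ht.le, smul_smul, inv_mul_cancel₀ ht.ne', one_smul]

lemma dir_smul (x : 𝔼) {t : ℝ} (ht : 0 < t) : dir (t • x) = dir x := by
  rw [dir, dir, norm_smul, norm_of_nonneg ht.le, smul_smul, mul_inv, mul_right_comm,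
    inv_mul_cancel₀ ht.ne', one_mul]

lemma mem_cone_iff {x : 𝔼} : x ∈ cone K ↔ x ≠ 0 ∧ ∃ θ ∈ K, (θ : 𝔼) = dir x := by
  constructor
  · rintro ⟨θ, hθ, t, ht, rfl⟩; have h : ‖(θ : 𝔼)‖ = 1 := by simp
    refine ⟨smul_ne_zero ht.ne' fun h0 => by simp [h0] at h, θ, hθ, (dir_coe_smul θ ht).symm⟩
  · rintro ⟨hx, θ, hθ, h⟩; refine ⟨θ, hθ, ‖x‖, norm_pos_iff.2 hx, ?_⟩
    rw [h, dir, smul_smul, mul_inv_cancel₀ (norm_ne_zero_iff.2 hx), one_smul]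

lemma smul_mem_cone_iff {x : 𝔼} {t : ℝ} (ht : 0 < t) : t • x ∈ cone K ↔ x ∈ cone K := by
  rw [mem_cone_iff, mem_cone_iff, dir_smul x ht, smul_ne_zero_iff]; simp [ht.ne']

/-- The direction, as a map from the punctured space to the sphere. -/
def sphereDir (x : ({0}ᶜ : Set 𝔼)) : USphere n := (homeomorphUnitSphereProd 𝔼 x).1

lemma coe_sphereDir (x : ({0}ᶜ : Set 𝔼)) : (sphereDir x : 𝔼) = dir (x : 𝔼) :=
  homeomorphUnitSphereProd_apply_fst_coe 𝔼 x

lemma continuous_sphereDir : Continuous (sphereDir (n := n)) :=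
  continuous_fst.comp (homeomorphUnitSphereProd 𝔼).continuous

lemma coe_mem_cone_iff (x : ({0}ᶜ : Set 𝔼)) : (x : 𝔼) ∈ cone K ↔ sphereDir x ∈ K := by
  rw [mem_cone_iff]; constructor
  · rintro ⟨-, θ, hθ, h⟩; rw [← coe_sphereDir] at h; rwa [← Subtype.ext h]
  · exact fun h => ⟨x.2, _, h, coe_sphereDir x⟩

lemma cone_eq_image : cone K = Subtype.val '' (sphereDir ⁻¹' K) := by
  ext x; constructor
  · intro h; have h0 : x ∈ ({0}ᶜ : Set 𝔼) := (mem_cone_iff.1 h).1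
    exact ⟨⟨x, h0⟩, (coe_mem_cone_iff ⟨x, h0⟩).1 h, rfl⟩
  · rintro ⟨y, hy, rfl⟩; exact (coe_mem_cone_iff y).2 hy

lemma isOpen_cone (hK : IsOpen K) : IsOpen (cone K) := by
  rw [cone_eq_image]
  exact isOpen_compl_singleton.isOpenMap_subtype_val _ (hK.preimage continuous_sphereDir)

lemma isOpen_truncCone (hK : IsOpen K) (ε : ℝ) : IsOpen (truncCone K ε) :=
  (isOpen_cone hK).inter isOpen_ball

lemma measurableSet_cone (hK : MeasurableSet K) : MeasurableSet (cone K) := by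
  rw [cone_eq_image]
  exact (MeasurableEmbedding.subtype_coe (measurableSet_singleton 0).compl).measurableSet_image.2
    (hK.preimage continuous_sphereDir.measurable)

lemma meas_truncCone (hK : MeasurableSet K) (ε : ℝ) : MeasurableSet (truncCone K ε) :=
  (measurableSet_cone hK).inter measurableSet_ball

lemma vol_truncCone_lt_top (K : Set (USphere n)) (ε : ℝ) : volume (truncCone K ε) < ⊤ :=
  (measure_mono inter_subset_right).trans_lt measure_ball_lt_top

instance (K : Set (USphere n)) (ε : ℝ) : IsFiniteMeasure vol (truncCone K ε) :=
  ⟨by rw [Measure.restrict_apply_univ]; exact vol_truncCone_lt_top K ε⟩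

lemma norm_pos_of_mem {x : 𝔼} (h : x ∈ cone K) : 0 < ‖x‖ := norm_pos_iff.2 (mem_cone_iff.1 h).1

lemma norm_lt_of_mem {x : 𝔼} (h : x ∈ 𝒞) : ‖x‖ < ε := by
  simpa using h.2

lemma le_inner_of_mem_cone (hd : d ∈ 𝒟) {x : 𝔼} (h : x ∈ cone K) : δ * ‖x‖ ≤ inner ℝ (d : 𝔼) x := by
  obtain ⟨θ, hθ, t, ht, rfl⟩ := h; have h1 : ‖(θ : 𝔼)‖ = 1 := by simp
  rw [norm_smul, h1, mul_one, norm_of_nonneg ht.le, inner_smul_right, mul_comm]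
  exact mul_le_mul_of_nonneg_left (hd θ hθ).le ht.le

lemma exists_measure_dir (K : Set (USphere n)) : ∃ μ : Measure ({0}ᶜ : Set 𝔼),
    Measure.QuasiMeasurePreserving sphereDir μ (volume.toSphere.restrict K) ∧ vol (cone K) =
    μ.map Subtype.val := by
  have hm := MeasurableEmbedding.subtype_coe (measurableSet_singleton (0 : 𝔼)).compl
  set μ0 : Measure ({0}ᶜ : Set 𝔼) := Measure.comap Subtype.val volume
  have h1 : Measure.QuasiMeasurePreserving sphereDir μ0 volume.toSphere :=
    Measure.quasiMeasurePreserving_fst.comp (Measure.measurePreserving_homeomorphUnitSphereProd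
    volume).quasiMeasurePreserving
  refine ⟨μ0.restrict (sphereDir ⁻¹' K), h1.restrict (fun x hx => hx), ?_⟩
  have h2 : (Subtype.val : ({0}ᶜ : Set 𝔼) → 𝔼) ⁻¹' cone K = sphereDir ⁻¹' K := by
    ext x; exact coe_mem_cone_iff x
  rw [← h2, ← hm.restrict_map, hm.map_comap, Subtype.range_coe_subtype, Set.ofPred_mem_eq,
    Measure.restrict_restrict_of_subset]
  exact fun x hx => (mem_cone_iff.1 hx).1

lemma ae_cone_of_ae_sphere {P : 𝔼 → Prop}
    (h : ∀ᵐ θ : USphere n ∂volume.toSphere.restrict K, P θ) : ∀ᵐ x ∂vol (cone K), P (dir x) := by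
  obtain ⟨μ, h1, h2⟩ := exists_measure_dir K
  rw [h2, (MeasurableEmbedding.subtype_coe (measurableSet_singleton (0 : 𝔼)).compl).ae_map_iff]
  exact (h1.ae h).mono fun x hx => by rwa [← coe_sphereDir]

lemma aesm_comp_dir {F : Type*} [TopologicalSpace F] {f : 𝔼 → F}
    (h : AESM (fun θ : USphere n => f θ) (volume.toSphere.restrict K)) :
    AESM (fun x => f (dir x)) vol (cone K) := by
  obtain ⟨μ, h1, h2⟩ := exists_measure_dir K
  rw [h2, (MeasurableEmbedding.subtype_coe
    (measurableSet_singleton (0 : 𝔼)).compl).aestronglyMeasurable_map_iff]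
  have h3 : (fun x => f (dir x)) ∘ (Subtype.val : ({0}ᶜ : Set 𝔼) → 𝔼) =
      (fun θ : USphere n => f θ) ∘ sphereDir := by
    funext x; simp [coe_sphereDir]
  rw [h3]; exact h.comp_quasiMeasurePreserving h1

lemma ae_le_linftyNorm {f : 𝔼 → F} (hf : MemLinfty K f) :
    ∀ᵐ x ∂vol (cone K), ‖f (dir x)‖ ≤ linftyNorm K f := by
  refine ae_cone_of_ae_sphere (P := fun x => ‖f x‖ ≤ linftyNorm K f) ?_; have h1 := hf.2.ne
  filter_upwards [ae_le_eLpNormEssSup (f := fun θ : USphere n => f θ)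
    (μ := volume.toSphere.restrict K)] with θ hθ
  rw [← eLpNorm_exponent_top] at hθ; rw [linftyNorm, ← toReal_enorm]
  exact ENNReal.toReal_mono h1 hθ

lemma linftyNorm_nonneg (f : 𝔼 → F) : 0 ≤ linftyNorm K f := ENNReal.toReal_nonneg

open scoped Pointwise in
lemma truncCone_one_eq (E : Set (USphere n)) :
    Set.Ioo (0 : ℝ) 1 • (Subtype.val '' E : Set 𝔼) = truncCone E 1 := by
  ext x; constructor
  · rintro ⟨t, ht, _, ⟨θ, hθ, rfl⟩, rfl⟩; refine ⟨⟨θ, hθ, t, ht.1, rfl⟩, ?_⟩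
    have h1 : ‖(θ : 𝔼)‖ = 1 := by simp
    simp only [mem_ball_zero_iff, norm_smul, h1, mul_one, norm_of_nonneg ht.1.le]; exact ht.2
  · rintro ⟨⟨θ, hθ, t, ht, rfl⟩, h⟩; have h1 : ‖(θ : 𝔼)‖ = 1 := by simp
    simp only [mem_ball_zero_iff, norm_smul, h1, mul_one, norm_of_nonneg ht.le] at h
    exact ⟨t, ⟨ht, h⟩, θ, ⟨θ, hθ, rfl⟩, rfl⟩

open scoped Pointwise in
lemma truncCone_eq_smul (E : Set (USphere n)) {h : ℝ} (hh : 0 < h) :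
    truncCone E h = h • truncCone E 1 := by
  ext x
  rw [mem_smul_set_iff_inv_smul_mem₀ hh.ne', truncCone, truncCone, mem_inter_iff,
    mem_inter_iff, smul_mem_cone_iff (inv_pos.2 hh), mem_ball_zero_iff, mem_ball_zero_iff,
    norm_smul, norm_of_nonneg (inv_pos.2 hh).le, inv_mul_lt_iff₀ hh, mul_one]

open scoped Pointwise in
lemma volume_truncCone_eq (E : Set (USphere n)) {h : ℝ} (hh : 0 < h) :
    volume (truncCone E h) = ofReal (h ^ n) * volume (truncCone E 1) := by
  rw [truncCone_eq_smul E hh, Measure.addHaar_smul, finrank_euclideanSpace, Fintype.card_fin,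
    abs_of_pos (by positivity)]

lemma volume_truncCone_pos {E : Set (USphere n)} (hE : MeasurableSet E)
    (h : volume.toSphere E ≠ 0) : volume (truncCone E 1) ≠ 0 := by
  rw [Measure.toSphere_apply' _ hE, truncCone_one_eq] at h; exact fun h0 => h (by rw [h0, mul_zero])

/-- The volume of a conical shell. -/
lemma volume_shell_ge (hn : 0 < n) {E : Set (USphere n)} (hE : MeasurableSet E) {h : ℝ}
    (hh : 0 < h) : ofReal (h ^ n * (volume.real (truncCone E 1) / 2)) ≤ volume
    (truncCone E h \ truncCone E (h / 2)) := by
  have hsub : truncCone E (h / 2) ⊆ truncCone E h :=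
    inter_subset_inter_right _ (ball_subset_ball (by linarith))
  rw [measure_sdiff hsub (meas_truncCone hE _).nullMeasurableSet (vol_truncCone_lt_top _ _).ne,
    volume_truncCone_eq E hh, volume_truncCone_eq E (half_pos hh), ← ENNReal.ofReal_toReal
    (vol_truncCone_lt_top E 1).ne, ← ofReal_mul (by positivity), ← ofReal_mul (by positivity), ←
    ENNReal.ofReal_sub _ (by positivity), Measure.real]
  refine ofReal_le_ofReal ?_
  have h1 : (h / 2) ^ n ≤ h ^ n / 2 := by
    rw [div_pow]
    have : (2 : ℝ) ≤ 2 ^ n := by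
      simpa using pow_le_pow_right₀ (one_le_two (α := ℝ)) hn
    gcongr
  have h2 := mul_le_mul_of_nonneg_right h1
    (ENNReal.toReal_nonneg (a := volume (truncCone E (1 : ℝ))))
  linarith

/-- A function with a nonzero leading term is bounded below on a part of positive density of
every small shell. -/
lemma exists_shell_lower_bound (hn : 0 < n) (hK : MeasurableSet K) (hε : 0 < ε) [NormedSpace ℝ F]
    {f f₀ : 𝔼 → F} {m σ : ℝ} (hσ : 0 < σ) (hf₀ : MemLinfty K f₀) (hne : linftyNorm K f₀ ≠ 0)
    (hf : HasLeadingTerm 𝒞 f f₀ m σ) : ∃ κ > 0, ∃ c > 0, ∃ h₀ > 0, h₀ ≤ ε ∧ ∀ h, 0 < h → h ≤ h₀ →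
    ∃ S : Set 𝔼, MeasurableSet S ∧ S ⊆ 𝒞 ∧ (∀ x ∈ S, ‖x‖ < h ∧ h / 2 ≤ ‖x‖) ∧ ofReal (c * h ^ n)
    ≤ volume S ∧ ∀ᵐ x ∂vol S, κ * ‖x‖ ^ m ≤ ‖f x‖ := by
  set μ := volume.toSphere.restrict K with hμ; obtain ⟨g, hgm, hg⟩ := hf₀.1
  have h1 : ∃ j : ℕ, μ {θ : USphere n | 1 / ((j : ℝ) + 1) < ‖g θ‖} ≠ 0 := by
    by_contra! h0
    apply hne
    have h2 : g =ᵐ[μ] 0 := by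
      have h3 : ∀ᵐ θ ∂μ, ∀ j : ℕ, ¬ 1 / ((j : ℝ) + 1) < ‖g θ‖ := by
        rw [ae_all_iff]; intro j; rw [ae_iff]; simpa using h0 j
      filter_upwards [h3] with θ hθ
      by_contra hne
      obtain ⟨j, hj⟩ := exists_nat_one_div_lt (norm_pos_iff.2 hne); exact hθ j hj
    rw [linftyNorm, eLpNorm_congr_ae (hg.trans h2)]; simp
  obtain ⟨j, hj⟩ := h1; set κ0 : ℝ := 1 / ((j : ℝ) + 1) with hκ0
  have hκ0p : 0 < κ0 := by positivity
  set E : Set (USphere n) := K ∩ {θ : USphere n | κ0 < ‖g θ‖} with hE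
  have hEm : MeasurableSet E := hK.inter (measurableSet_lt measurable_const hgm.norm.measurable)
  have hEpos : volume.toSphere E ≠ 0 := by
    rw [hμ, Measure.restrict_apply (measurableSet_lt measurable_const hgm.norm.measurable),
      Set.inter_comm] at hj
    exact hj
  have hcE : ∀ᵐ x ∂vol (cone E), κ0 < ‖f₀ (dir x)‖ := by
    refine ae_cone_of_ae_sphere (P := fun x => κ0 < ‖f₀ x‖) ?_
    have h2 : ∀ᵐ θ : USphere n ∂volume.toSphere.restrict E, f₀ θ = g θ :=
      ae_restrict_of_ae_restrict_of_subset inter_subset_left hg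
    filter_upwards [h2, ae_restrict_mem hEm] with θ h3 h4; rw [h3]; exact h4.2
  obtain ⟨C, hC⟩ := hf
  have hlim : ∀ᶠ h : ℝ in 𝓝[>] 0, |C| * h ^ σ < κ0 / 2 := by
    have h2 : Tendsto (fun h : ℝ => |C| * h ^ σ) (𝓝[>] 0) (𝓝 (|C| * 0 ^ σ)) :=
      (((continuousAt_rpow_const 0 σ (Or.inr hσ.le)).tendsto).mono_left
      nhdsWithin_le_nhds).const_mul _
    rw [zero_rpow hσ.ne', mul_zero] at h2; exact h2.eventually_lt_const (by positivity)
  obtain ⟨h₁, hh₁, hlt⟩ := (nhdsGT_basis (0 : ℝ)).eventually_iff.1 hlim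
  have hv : 0 < volume.real (truncCone E 1) :=
    ENNReal.toReal_pos (volume_truncCone_pos hEm hEpos) (vol_truncCone_lt_top E 1).ne
  refine ⟨κ0 / 2, by positivity, _, half_pos hv, min (h₁ / 2) ε, lt_min (by linarith) hε,
    min_le_right _ _, fun h hh hhle => ⟨truncCone E h \ truncCone E (h / 2),
    (meas_truncCone hEm _).diff (meas_truncCone hEm _), ?_, ?_, ?_, ?_⟩⟩
  · rintro x ⟨⟨⟨θ, hθ, hx⟩, hxb⟩, -⟩
    exact ⟨⟨θ, hθ.1, hx⟩, ball_subset_ball (hhle.trans (min_le_right _ _)) hxb⟩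
  · rintro x ⟨hx, hx'⟩; refine ⟨norm_lt_of_mem hx, ?_⟩; by_contra! h2
    exact hx' ⟨hx.1, by simpa using h2⟩
  · rw [mul_comm]; exact volume_shell_ge hn hEm hh
  · have hS : truncCone E h \ truncCone E (h / 2) ⊆ 𝒞 := by
      rintro x ⟨⟨⟨θ, hθ, hx⟩, hxb⟩, -⟩
      exact ⟨⟨θ, hθ.1, hx⟩, ball_subset_ball (hhle.trans (min_le_right _ _)) hxb⟩
    filter_upwards [ae_restrict_of_ae_restrict_of_subset hS hC, ae_restrict_of_ae_restrict_of_subset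
      (fun x hx => hx.1.1) hcE, ae_restrict_mem ((meas_truncCone hEm _).diff (meas_truncCone hEm
      _))] with x h2 h3 h4
    have hx0 : 0 < ‖x‖ := norm_pos_of_mem h4.1.1
    have hxh : ‖x‖ < h₁ := (norm_lt_of_mem h4.1).trans_le
      (hhle.trans ((min_le_left _ _).trans (by linarith)))
    have h5 := hlt ⟨hx0, hxh⟩
    have h6 : C * ‖x‖ ^ (m + σ) ≤ ‖x‖ ^ m * (κ0 / 2) := by
      rw [rpow_add hx0]
      calc C * (‖x‖ ^ m * ‖x‖ ^ σ) ≤ |C| * (‖x‖ ^ m * ‖x‖ ^ σ) := by gcongr; exact le_abs_self C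
        _ = ‖x‖ ^ m * (|C| * ‖x‖ ^ σ) := by ring
        _ ≤ _ := by gcongr
    have h7 : ‖‖x‖ ^ m • f₀ (dir x)‖ = ‖x‖ ^ m * ‖f₀ (dir x)‖ := by
      rw [norm_smul, norm_of_nonneg (by positivity)]
    have h8 := norm_sub_norm_le (‖x‖ ^ m • f₀ (dir x)) (f x); rw [norm_sub_rev, h7] at h8
    have h9 : ‖x‖ ^ m * κ0 ≤ ‖x‖ ^ m * ‖f₀ (dir x)‖ := by gcongr
    linarith

lemma nonneg_of_leadingTerm_bounded (hn : 0 < n) (hK : MeasurableSet K) (hε : 0 < ε)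
    [NormedSpace ℝ F] {f f₀ : 𝔼 → F} {m σ M : ℝ} (hσ : 0 < σ) (hf₀ : MemLinfty K f₀)
    (hne : linftyNorm K f₀ ≠ 0) (hf : HasLeadingTerm 𝒞 f f₀ m σ) (hM : ∀ᵐ x ∂vol 𝒞, ‖f x‖ ≤ M) :
    0 ≤ m := by
  by_contra! hm
  obtain ⟨κ, hκ, c, hc, h₀, hh₀, -, H⟩ := exists_shell_lower_bound hn hK hε hσ hf₀ hne hf
  have h1 : Tendsto (fun h : ℝ => h ^ m) (𝓝[>] 0) atTop := tendsto_rpow_neg_nhdsGT_zero hm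
  obtain ⟨h, h2, h3, h4⟩ := ((h1.eventually_gt_atTop (M / κ)).and (Ioc_mem_nhdsGT hh₀)).exists
  obtain ⟨S, hSm, hSs, hS1, hS2, hS3⟩ := H h h3 h4
  have h5 : ∀ᵐ x ∂vol S, False := by
    filter_upwards [hS3, ae_restrict_of_ae_restrict_of_subset hSs hM, ae_restrict_mem hSm]
      with x h6 h7 h8
    have h9 : h ^ m ≤ ‖x‖ ^ m := rpow_le_rpow_of_nonpos
      (norm_pos_of_mem (hSs h8).1) (hS1 x h8).1.le hm.le
    rw [div_lt_iff₀ hκ] at h2; nlinarith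
  rw [eventually_false_iff_eq_bot, ae_eq_bot, Measure.restrict_eq_zero] at h5
  rw [h5, nonpos_iff_eq_zero, ENNReal.ofReal_eq_zero] at hS2; have : 0 < c * h ^ n := by positivity
  linarith

lemma neg_half_lt_of_memLp (hn : 0 < n) (hK : MeasurableSet K) (hε : 0 < ε) [NormedSpace ℝ F]
    {f f₀ : 𝔼 → F} {m σ : ℝ} (hσ : 0 < σ) (hf₀ : MemLinfty K f₀) (hne : linftyNorm K f₀ ≠ 0)
    (hf : HasLeadingTerm 𝒞 f f₀ m σ) (hf2 : MemLp f 2 vol 𝒞) : -(n / 2 : ℝ) < m := by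
  by_contra! hm
  obtain ⟨κ, hκ, c, hc, h₀, hh₀, hhε, H⟩ := exists_shell_lower_bound hn hK hε hσ hf₀ hne hf
  have hm0 : m ≤ 0 := hm.trans (by simp; positivity)
  set c1 : ℝ := κ ^ 2 * c * min 1 (h₀ ^ (2 * m + n)) with hc1; have hc1p : 0 < c1 := by positivity
  have hfin : ∫⁻ x in 𝒞, ‖f x‖ₑ ^ 2 ≠ ⊤ := by
    have := hf2.2.ne; intro h0; apply this
    rw [eLpNorm_eq_lintegral_rpow_enorm_toReal (by norm_num) (by norm_num)]
    have : ∀ x, ‖f x‖ₑ ^ (2 : ℝ≥0∞).toReal = ‖f x‖ₑ ^ 2 := fun x => by norm_num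
    simp only [this, h0]; simp
  set ν := vol 𝒞 with hν
  obtain ⟨δ, hδ, hsmall⟩ := exists_pos_setLIntegral_lt_of_measure_lt hfin
    (ENNReal.ofReal_pos.2 hc1p).ne'
  have hvol : Tendsto (fun h : ℝ => volume (ball (0 : 𝔼) h)) (𝓝[>] 0) (𝓝 0) := by
    have h1 : Tendsto (fun h : ℝ => ofReal (h ^ n) * volume (ball (0 : 𝔼) 1)) (𝓝[>] 0)
        (𝓝 (ofReal (0 ^ n) * volume (ball (0 : 𝔼) 1))) := by
      refine ENNReal.Tendsto.mul_const ?_ (Or.inr measure_ball_lt_top.ne)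
      exact ((ENNReal.continuous_ofReal.comp (continuous_pow n)).tendsto 0).mono_left
        nhdsWithin_le_nhds
    rw [zero_pow hn.ne', ENNReal.ofReal_zero, zero_mul] at h1; refine h1.congr' ?_
    filter_upwards [self_mem_nhdsWithin] with h hh
    rw [Measure.addHaar_ball_of_pos _ _ hh, finrank_euclideanSpace, Fintype.card_fin]
  obtain ⟨h, h2, h3, h4⟩ := ((hvol.eventually_lt_const hδ).and (Ioc_mem_nhdsGT hh₀)).exists
  obtain ⟨S, hSm, hSs, hS1, hS2, hS3⟩ := H h h3 h4
  have h5 : ∫⁻ x in S, ‖f x‖ₑ ^ 2 < ofReal c1 := by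
    have h6 := hsmall (ball 0 h) ((Measure.restrict_apply_le _ _).trans_lt h2)
    refine lt_of_le_of_lt ?_ h6; rw [hν, Measure.restrict_restrict measurableSet_ball]
    exact lintegral_mono_set fun x hx => ⟨by simpa using (hS1 x hx).1, hSs hx⟩
  have h7 : ofReal ((κ * h ^ m) ^ 2) * volume S ≤ ∫⁻ x in S, ‖f x‖ₑ ^ 2 := by
    rw [← setLIntegral_const]; refine lintegral_mono_ae ?_
    filter_upwards [hS3, ae_restrict_mem hSm] with x h8 h9
    have h10 : h ^ m ≤ ‖x‖ ^ m := rpow_le_rpow_of_nonpos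
      (norm_pos_of_mem (hSs h9).1) (hS1 x h9).1.le hm0
    rw [← ofReal_norm, ← ENNReal.ofReal_pow (norm_nonneg _)]
    refine ofReal_le_ofReal (pow_le_pow_left₀ (by positivity) ?_ 2)
    exact (mul_le_mul_of_nonneg_left h10 hκ.le).trans h8
  have h11 : ofReal c1 ≤ ofReal ((κ * h ^ m) ^ 2) * volume S := by
    refine le_trans ?_ (mul_le_mul_right hS2 _); rw [← ofReal_mul (by positivity)]
    refine ofReal_le_ofReal ?_
    have e1 : (h ^ m) ^ 2 * h ^ n = h ^ (2 * m + n) := by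
      rw [← rpow_natCast, ← rpow_natCast, ← rpow_mul h3.le, ← rpow_add h3]; congr 1; push_cast; ring
    have e2 : min 1 (h₀ ^ (2 * m + n)) ≤ h ^ (2 * m + n) :=
      (min_le_right _ _).trans (rpow_le_rpow_of_nonpos h3 h4 (by linarith))
    calc c1 ≤ κ ^ 2 * c * h ^ (2 * m + n) := by rw [hc1]; gcongr
      _ = _ := by rw [← e1]; ring
  exact absurd (h11.trans h7) (not_le.2 h5)

lemma norm_cdot_le (a b : CSpace n) : ‖cdot a b‖ ≤ ‖a‖ * ‖b‖ := by
  have h1 : cdot a b = inner ℂ (WithLp.toLp 2 fun i => (starRingEnd ℂ) (a i) : CSpace n) b := by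
    rw [PiLp.inner_apply, cdot]; refine sum_congr rfl fun i _ => ?_; simp [mul_comm]
  rw [h1]; refine (norm_inner_le_norm _ _).trans (le_of_eq ?_); congr 1
  rw [EuclideanSpace.norm_eq, EuclideanSpace.norm_eq]; simp

lemma cdot_add_left (a b c : CSpace n) : cdot (a + b) c = cdot a c + cdot b c := by
  simp [cdot, add_mul, sum_add_distrib]

lemma cdot_add_right (a b c : CSpace n) : cdot a (b + c) = cdot a b + cdot a c := by
  simp [cdot, mul_add, sum_add_distrib]

lemma cdot_sub_left (a b c : CSpace n) : cdot (a - b) c = cdot a c - cdot b c := by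
  simp [cdot, sub_mul, sum_sub_distrib]

lemma cdot_smul_left (t : ℂ) (a b : CSpace n) : cdot (t • a) b = t * cdot a b := by
  simp [cdot, mul_sum, mul_assoc]

lemma cdot_smul_right (t : ℂ) (a b : CSpace n) : cdot a (t • b) = t * cdot a b := by
  simp [cdot, mul_sum, mul_left_comm]

lemma cdot_comm (a b : CSpace n) : cdot a b = cdot b a := by
  simp [cdot, mul_comm]

lemma eta_eq_smul (d d' : USphere n) (τ : ℝ) : eta d d' τ = (τ : ℂ) • eta d d' 1 := by
  ext i; simp [eta]; ring

lemma norm_eta_le (d d' : USphere n) (τ : ℝ) : ‖eta d d' τ‖ ≤ 2 * |τ| := by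
  have hC : ∀ e : USphere n, ‖(WithLp.toLp 2 fun i => ℂ((e : 𝔼) i) : CSpace n)‖ = 1 := by
    intro e; have h1 : ‖(e : 𝔼)‖ = 1 := by simp
    refine Eq.trans ?_ h1; rw [EuclideanSpace.norm_eq, EuclideanSpace.norm_eq]; simp
  have h : eta d d' τ = (-(τ : ℂ)) • ((WithLp.toLp 2 fun i => ℂ((d : 𝔼) i) : CSpace n)
      + Complex.I • (WithLp.toLp 2 fun i => ℂ((d' : 𝔼) i) : CSpace n)) := by
    ext i; simp [eta]; ring
  rw [h, norm_smul, norm_neg, norm_real, norm_eq_abs, mul_comm]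
  refine mul_le_mul_of_nonneg_right ((norm_add_le _ _).trans ?_) (abs_nonneg τ)
  rw [norm_smul, hC, hC]; simp; norm_num

lemma cdot_eta_eta (h : inner ℝ (d : 𝔼) (d' : 𝔼) = 0) (τ : ℝ) :
    cdot (eta d d' τ) (eta d d' τ) = 0 := by
  have h1 : ∀ e : USphere n, ∑ i, ℂ((e : 𝔼) i) * ℂ((e : 𝔼) i) = 1 := by
    intro e
    have h2 : inner ℝ (e : 𝔼) (e : 𝔼) = 1 := by
      rw [real_inner_self_eq_norm_sq]; simp
    rw [PiLp.inner_apply] at h2; simp only [RCLike.inner_apply, conj_trivial] at h2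
    exact_mod_cast h2
  have h3 : ∑ i, ℂ((d : 𝔼) i) * ℂ((d' : 𝔼) i) = 0 := by
    rw [PiLp.inner_apply] at h; simp only [RCLike.inner_apply, conj_trivial] at h
    simp only [mul_comm] at h ⊢; exact_mod_cast h
  have h4 : cdot (eta d d' τ) (eta d d' τ) = (τ : ℂ) ^ 2 * (∑ i, ℂ((d : 𝔼) i) * ℂ((d : 𝔼) i)
        - ∑ i, ℂ((d' : 𝔼) i) * ℂ((d' : 𝔼) i)
        + 2 * Complex.I * ∑ i, ℂ((d : 𝔼) i) * ℂ((d' : 𝔼) i)) := by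
    rw [cdot, mul_sum, ← sum_sub_distrib, ← sum_add_distrib, mul_sum]
    refine sum_congr rfl fun i _ => ?_; simp only [eta]
    linear_combination (τ : ℂ) ^ 2 * ℂ((d' : 𝔼) i) ^ 2 * Complex.I_sq
  rw [h4, h1, h1, h3]; ring

lemma norm_cexpDot_eta (d d' : USphere n) (τ : ℝ) (x : 𝔼) :
    ‖cexpDot (eta d d' τ) x‖ = exp (-(τ * inner ℝ (d : 𝔼) x)) := by
  rw [cexpDot, Complex.norm_exp, Complex.re_sum, PiLp.inner_apply, mul_sum, ← sum_neg_distrib]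
  congr 1; refine sum_congr rfl fun i _ => ?_; simp [eta]; ring

lemma norm_cexpDot_eta_le (hd : d ∈ 𝒟) {τ : ℝ} (hτ : 0 ≤ τ) {x : 𝔼} (hx : x ∈ cone K) :
    ‖𝐞 τ x‖ ≤ exp (-(δ * (τ * ‖x‖))) := by
  rw [norm_cexpDot_eta]; refine exp_le_exp.2 (neg_le_neg ?_)
  have := mul_le_mul_of_nonneg_left (le_inner_of_mem_cone hd hx) hτ; linarith

lemma cexpDot_eta_smul (d d' : USphere n) (τ : ℝ) (x : 𝔼) :
    cexpDot (eta d d' 1) (τ • x) = cexpDot (eta d d' τ) x := by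
  rw [cexpDot, cexpDot]; congr 1; refine sum_congr rfl fun i _ => ?_; simp [eta]; ring

lemma contDiff_cexpDot (η : CSpace n) : ContDiff ℝ ∞ (cexpDot η) := by
  unfold cexpDot
  have h : ∀ i : Fin n, ContDiff ℝ ∞ (fun x : 𝔼 => (x i : ℂ)) := fun i =>
    ofRealCLM.contDiff.comp (pr ℝ i).contDiff
  refine ContDiff.cexp (ContDiff.sum fun i _ => contDiff_const.mul (h i))

lemma integrable_rpow_exp (hn : 0 < n) {m c : ℝ} (hm : -(n : ℝ) < m) (hc : 0 < c) :
    Integrable (fun x : 𝔼 => ‖x‖ ^ m * exp (-(c * ‖x‖))) := by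
  have : Nonempty (Fin n) := ⟨⟨0, hn⟩⟩
  rw [integrable_fun_norm_addHaar volume
    (f := fun t : ℝ => t ^ m * exp (-(c * t))), finrank_euclideanSpace, Fintype.card_fin]
  have hn1 : ((n - 1 : ℕ) : ℝ) = n - 1 := by rw [Nat.cast_sub hn]; simp
  have h := integrableOn_rpow_mul_exp_neg_mul_rpow (s := m + (n - 1)) (p := 1) (b := c)
    (by linarith) one_pos hc
  refine h.congr_fun (fun t ht => ?_) measurableSet_Ioi; have ht' : (0 : ℝ) < t := ht
  simp only [rpow_one, smul_eq_mul]; rw [rpow_add ht', ← hn1, rpow_natCast, neg_mul]; ring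

lemma integral_rpow_exp (m c : ℝ) {τ : ℝ} (hτ : 0 < τ) : ∫ x : 𝔼, ‖x‖ ^ m * exp
    (-(c * (τ * ‖x‖))) = τ ^ (-((n : ℝ) + m)) * ∫ x : 𝔼, ‖x‖ ^ m * exp (-(c * ‖x‖)) := by
  have h := Measure.integral_comp_smul (volume : Measure 𝔼) (fun x => ‖x‖ ^ m * exp (-(c * ‖x‖))) τ
  simp only [norm_smul, norm_of_nonneg hτ.le, finrank_euclideanSpace, Fintype.card_fin,
    smul_eq_mul] at h
  have e1 : ∀ x : 𝔼, ‖x‖ ^ m * exp (-(c * (τ * ‖x‖))) =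
      τ ^ (-m) * ((τ * ‖x‖) ^ m * exp (-(c * (τ * ‖x‖)))) := fun x => by
    rw [mul_rpow hτ.le (norm_nonneg _), rpow_neg hτ.le]
    have : τ ^ m ≠ 0 := (rpow_pos_of_pos hτ m).ne'; field_simp
  simp only [e1]
  rw [integral_const_mul, h, abs_of_pos (by positivity), ← mul_assoc, ← rpow_natCast,
    ← rpow_neg hτ.le, ← rpow_add hτ]
  congr 2; ring

lemma isBigO_rpow_mul_exp_neg {c : ℝ} (hc : 0 < c) (s L : ℝ) :
    (fun τ : ℝ => τ ^ s * exp (-(c * τ))) =𝒪 (-L) := by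
  have h := (isLittleO_exp_neg_mul_rpow_atTop hc (-L - s)).isBigO
  have h2 := (isBigO_refl (fun τ : ℝ => τ ^ s) atTop).mul h; refine (h2.congr' ?_ ?_)
  · exact .of_forall fun τ => by simp
  · filter_upwards [eventually_gt_atTop 0] with τ hτ; rw [← rpow_add hτ]; congr 1; ring

lemma isBigO_rpow {s t : ℝ} (h : s ≤ t) : (fun τ : ℝ => τ ^ s) =𝒪 t := by
  refine IsBigO.of_bound 1 ?_; filter_upwards [eventually_ge_atTop 1] with τ hτ
  rw [one_mul, norm_of_nonneg (by positivity), norm_of_nonneg (by positivity)]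
  exact rpow_le_rpow_of_exponent_le hτ h

/-- Contributions away from the vertex are negligible. -/
lemma isBigO_integral_of_ae_le_exp [NormedSpace ℝ E] {S : Set 𝔼} {c s : ℝ} (hc : 0 < c)
    {H : 𝔼 → ℝ} (hH : IntegrableOn H S) {g : ℝ → 𝔼 → E}
    (h : ∀ᶠ τ in atTop, ∀ᵐ x ∂vol S, ‖g τ x‖ ≤ τ ^ s * exp (-(c * τ)) * H x) (L : ℝ) :
    (fun τ => ∫ x in S, g τ x) =𝒪 (-L) := by
  refine IsBigO.trans (IsBigO.of_bound (∫ x in S, H x) ?_) (isBigO_rpow_mul_exp_neg hc s L)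
  filter_upwards [h, eventually_gt_atTop 0] with τ h1 hτ
  refine (norm_integral_le_of_norm_le (hH.const_mul _) h1).trans ?_
  rw [integral_const_mul, norm_of_nonneg (by positivity), mul_comm]

lemma integrableOn_norm_rpow (hn : 0 < n) {m : ℝ} (hm : -(n : ℝ) < m) (ε : ℝ) :
    IntegrableOn (fun x : 𝔼 => ‖x‖ ^ m) (ball 0 ε) := by
  have h := (integrable_rpow_exp hn hm one_pos).integrableOn (s := ball 0 ε)
  refine (h.const_mul (exp ε)).mono' ?_ ?_
  · exact (measurable_norm.pow_const m).aestronglyMeasurable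
  · filter_upwards [ae_restrict_mem measurableSet_ball] with x hx
    rw [norm_of_nonneg (by positivity)]; have hx' : ‖x‖ < ε := by simpa using hx
    have h1 : 1 ≤ exp ε * exp (-(1 * ‖x‖)) := by
      rw [← exp_add]; exact one_le_exp (by linarith)
    calc ‖x‖ ^ m = 1 * ‖x‖ ^ m := (one_mul _).symm
      _ ≤ (exp ε * exp (-(1 * ‖x‖))) * ‖x‖ ^ m := by gcongr
      _ = _ := by ring

/-- The asymptotics of Laplace integrals of homogeneous functions over a truncated cone. -/
theorem exists_homogeneous_asymptotics (hn : 0 < n) (hK : MeasurableSet K) (hε : 0 < ε)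
    (hδ : 0 < δ) (hd : d ∈ 𝒟) {m C : ℝ} (hm : -(n : ℝ) < m) {Q : 𝔼 → ℂ}
    (hQm : AESM Q vol (cone K)) (hQ : ∀ᵐ x ∂vol (cone K), ‖Q x‖ ≤ C * ‖x‖ ^ m)
    (hom : ∀ t : ℝ, 0 < t → ∀ x, Q (t • x) = ℂ(t ^ m) * Q x) : ∃ c : ℂ, ∀ L : ℝ,
    (fun τ : ℝ => (∫ x in 𝒞, Q x * 𝐞 τ x) - c * ℂ(τ ^ (-((n : ℝ) + m)))) =O[atTop] fun τ : ℝ => τ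
    ^ (-L) := by
  have hmeas := measurableSet_cone hK; refine ⟨∫ x in cone K, Q x * 𝐞 1 x, fun L => ?_⟩
  have hscale : ∀ τ : ℝ, 0 < τ → ∫ x in cone K, Q x * 𝐞 τ x =
      (∫ x in cone K, Q x * 𝐞 1 x) * ℂ(τ ^ (-((n : ℝ) + m))) := by
    intro τ hτ; rw [← integral_indicator hmeas, ← integral_indicator hmeas]
    have h := Measure.integral_comp_smul volume ((cone K).indicator fun x => Q x * 𝐞 1 x) τ
    have e1 : ∀ x, (cone K).indicator (fun x => Q x * 𝐞 1 x) (τ • x) =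
        ℂ(τ ^ m) * (cone K).indicator (fun x => Q x * 𝐞 τ x) x := by
      intro x; by_cases hx : x ∈ cone K
      · rw [indicator_of_mem hx, indicator_of_mem ((smul_mem_cone_iff hτ).2 hx), hom τ hτ,
          cexpDot_eta_smul, mul_assoc]
      · rw [indicator_of_notMem hx, indicator_of_notMem
          (fun h => hx ((smul_mem_cone_iff hτ).1 h)), mul_zero]
    simp only [e1] at h
    rw [integral_const_mul, finrank_euclideanSpace, Fintype.card_fin,
      abs_of_pos (by positivity), real_smul] at h
    have h0 : ℂ(τ ^ m) ≠ 0 := by exact_mod_cast (rpow_pos_of_pos hτ m).ne'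
    rw [← mul_right_inj' h0, h]
    have e2 : (τ ^ n)⁻¹ = τ ^ m * τ ^ (-((n : ℝ) + m)) := by
      rw [← rpow_add hτ, ← rpow_natCast, ← rpow_neg hτ.le]; congr 1; ring
    rw [e2]; push_cast; ring
  have hbound : ∀ τ : ℝ, 0 < τ → ∀ᵐ x ∂vol (cone K),
      ‖Q x * 𝐞 τ x‖ ≤ C * (‖x‖ ^ m * exp (-(δ * (τ * ‖x‖)))) := by
    intro τ hτ; filter_upwards [hQ, ae_restrict_mem hmeas] with x h1 h2; rw [norm_mul, ← mul_assoc]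
    exact mul_le_mul h1 (norm_cexpDot_eta_le hd hτ.le h2) (norm_nonneg _) ((norm_nonneg _).trans h1)
  have hint : ∀ τ : ℝ, 0 < τ → IntegrableOn (fun x => Q x * 𝐞 τ x) (cone K) := by
    intro τ hτ; have hi := integrable_rpow_exp hn hm (mul_pos hδ hτ); simp only [mul_assoc] at hi
    exact Integrable.mono' (hi.const_mul C).integrableOn
      (hQm.mul (contDiff_cexpDot _).continuous.aestronglyMeasurable) (hbound τ hτ)
  have hH : IntegrableOn (fun x : 𝔼 => (|C| * exp (δ * ε)) * (‖x‖ ^ m * exp (-(δ * ‖x‖)))) (cone K \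
    ball 0 ε) := ((integrable_rpow_exp hn hm hδ).const_mul _).integrableOn
  have htail := isBigO_integral_of_ae_le_exp (mul_pos hδ hε) (s := 0) hH
    (g := fun τ x => Q x * 𝐞 τ x) (by
      filter_upwards [eventually_ge_atTop 1] with τ hτ; have h0 : (0 : ℝ) < τ := by linarith
      filter_upwards [ae_restrict_of_ae_restrict_of_subset Set.sdiff_subset (hbound τ h0),
        ae_restrict_mem (hmeas.diff measurableSet_ball)] with x h1 h2
      refine h1.trans ?_; have hx : ε ≤ ‖x‖ := by simpa using h2.2
      have e1 : exp (-(δ * (τ * ‖x‖))) ≤ exp (-(δ * ε * τ)) * (exp (δ * ε) * exp (-(δ * ‖x‖))) := by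
        rw [← exp_add, ← exp_add]; refine exp_le_exp.2 ?_
        have := mul_nonneg hδ.le (mul_nonneg (sub_nonneg.2 hτ) (sub_nonneg.2 hx)); nlinarith
      rw [rpow_zero, one_mul]
      calc _ ≤ |C| * (‖x‖ ^ m * (exp (-(δ * ε * τ)) * (exp (δ * ε) * exp (-(δ * ‖x‖))))) := by
            gcongr; exact le_abs_self C
        _ = _ := by ring) L
  refine htail.neg_left.congr' ?_ EventuallyEq.rfl; filter_upwards [eventually_gt_atTop 0] with τ hτ
  rw [← hscale τ hτ, ← integral_inter_add_sdiff (s := cone K) (t := ball 0 ε)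
    measurableSet_ball (hint τ hτ), truncCone]
  ring

lemma grad_apply {𝕜 : Type*} [RCLike 𝕜] (φ : 𝔼 → 𝕜) (x : 𝔼) (i : Fin n) :
    ∇ φ x i = pd i φ x := rfl

lemma contDiff_grad {φ : 𝔼 → ℂ} (h : ContDiff ℝ ∞ φ) : Continuous (∇ φ) := by
  refine (PiLp.continuous_toLp 2 _).comp (continuous_pi fun i => ?_)
  exact (contDiff_pd h i).continuous

lemma pd_mul_of {φ ψ : 𝔼 → ℂ} {x : 𝔼} (h1 : DifferentiableAt ℝ φ x) (h2 : DifferentiableAt ℝ ψ x)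
    (i : Fin n) : pd i (fun y => φ y * ψ y) x = φ x * pd i ψ x + ψ x * pd i φ x := by
  rw [pd, pd, pd, fderiv_fun_mul h1 h2]; simp

lemma pd_mul {φ ψ : 𝔼 → ℂ} (hφ : ContDiff ℝ ∞ φ) (hψ : ContDiff ℝ ∞ ψ) (i : Fin n) (x : 𝔼) :
    pd i (fun y => φ y * ψ y) x = φ x * pd i ψ x + ψ x * pd i φ x :=
  pd_mul_of ((hφ.differentiable (by simp)) x) ((hψ.differentiable (by simp)) x) i

lemma grad_mul {φ ψ : 𝔼 → ℂ} (hφ : ContDiff ℝ ∞ φ) (hψ : ContDiff ℝ ∞ ψ) (x : 𝔼) :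
    ∇ (fun y => φ y * ψ y) x = φ x • ∇ ψ x + ψ x • ∇ φ x := by
  ext i; exact pd_mul hφ hψ i x

lemma IsTestFunction.mul_left {χ φ : 𝔼 → ℂ} (hχ : ContDiff ℝ ∞ χ) (hφ : IsTestFunction Ω φ) :
    IsTestFunction Ω (fun x => χ x * φ x) :=
  ⟨hχ.mul hφ.1, hφ.2.1.mul_left, (tsupport_mul_subset_right).trans hφ.2.2⟩

lemma IsTestFunction.pd {φ : 𝔼 → ℂ} (hφ : IsTestFunction Ω φ) (i : Fin n) :
    IsTestFunction Ω (pd i φ) :=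
  ⟨contDiff_pd hφ.1 i, hasCompactSupport_pd hφ.2.1 i, (tsupport_pd_subset φ i).trans hφ.2.2⟩

lemma IsTestFunction.ofReal {b : 𝔼 → ℝ} (hb : IsTestFunction Ω b) :
    IsTestFunction Ω (fun x => (b x : ℂ)) :=
  ⟨ofRealCLM.contDiff.comp hb.1, hb.2.1.comp_left (g := fun t : ℝ => (t : ℂ)) (by simp),
    (closure_mono (Function.support_comp_subset (g := fun t : ℝ => (t : ℂ)) (by simp) b)).trans hb.2.2⟩

lemma pd_ofReal_of {b : 𝔼 → ℝ} {x : 𝔼} (h1 : DifferentiableAt ℝ b x) (i : Fin n) :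
    pd i (fun y => (b y : ℂ)) x = ℂ(pd i b x) := by
  have h2 : HasFDerivAt (fun y => (b y : ℂ)) (ofRealCLM.comp (fderiv ℝ b x)) x :=
    (ofRealCLM.hasFDerivAt).comp x h1.hasFDerivAt
  rw [pd, h2.fderiv]; rfl

lemma pd_ofReal {b : 𝔼 → ℝ} (hb : ContDiff ℝ ∞ b) (i : Fin n) (x : 𝔼) :
    pd i (fun y => (b y : ℂ)) x = ℂ(pd i b x) :=
  pd_ofReal_of ((hb.differentiable (by simp)) x) i

lemma lapl_ofReal {b : 𝔼 → ℝ} (hb : ContDiff ℝ ∞ b) (x : 𝔼) :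
    lapl (fun y => (b y : ℂ)) x = ℂ(lapl b x) := by
  unfold lapl; push_cast; refine sum_congr rfl fun i _ => ?_
  have : pd i (fun y => (b y : ℂ)) = fun y => ℂ(pd i b y) := funext (pd_ofReal hb i)
  rw [this, pd_ofReal (contDiff_pd hb i)]

lemma integrable_coord_mul {μ : Measure 𝔼} {G : 𝔼 → CSpace n} (hG : Integrable G μ) {φ : 𝔼 → ℂ}
    (hφ : Continuous φ) {C : ℝ} (hC : ∀ x, ‖φ x‖ ≤ C) (i : Fin n) :
    Integrable (fun x => G x i * φ x) μ := by
  have h : Integrable (fun x => G x i) μ := (pr ℂ i).integrable_comp hG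
  exact h.mul_bdd hφ.aestronglyMeasurable (.of_forall hC)

lemma IsTestFunction.exists_bound {φ : 𝔼 → ℂ} (hφ : IsTestFunction Ω φ) :
    ∃ C, 0 ≤ C ∧ ∀ x, ‖φ x‖ ≤ C := by
  obtain ⟨C, h1, h2⟩ := exists_le hφ.1.continuous hφ.2.1; exact ⟨C, h1, h2⟩

lemma IsH1.integrableOn [IsFiniteMeasure vol Ω] {f : 𝔼 → ℂ} {Df : 𝔼 → CSpace n}
    (h : IsH1 Ω f Df) : IntegrableOn f Ω :=
  h.1.integrable (by norm_num)

lemma IsH1.integrableOn_grad [IsFiniteMeasure vol Ω] {f : 𝔼 → ℂ} {Df : 𝔼 → CSpace n}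
    (h : IsH1 Ω f Df) : IntegrableOn Df Ω :=
  h.2.1.integrable (by norm_num)

lemma IsH1.add {f g : 𝔼 → ℂ} {Df Dg : 𝔼 → CSpace n} [IsFiniteMeasure vol Ω] (hf : IsH1 Ω f Df)
    (hg : IsH1 Ω g Dg) : IsH1 Ω (f + g) (Df + Dg) := by
  refine ⟨hf.1.add hg.1, hf.2.1.add hg.2.1, hf.2.2.1.add hg.2.2.1, hf.2.2.2.1.add hg.2.2.2.1,
    fun φ hφ i => ?_⟩
  obtain ⟨C, -, hC⟩ := hφ.exists_bound; obtain ⟨C', -, hC'⟩ := (hφ.pd i).exists_bound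
  simp only [Pi.add_apply, PiLp.add_apply, add_mul]
  rw [integral_add, integral_add, hf.2.2.2.2 φ hφ i, hg.2.2.2.2 φ hφ i]
  · ring
  · exact integrable_coord_mul hf.integrableOn_grad hφ.1.continuous hC i
  · exact integrable_coord_mul hg.integrableOn_grad hφ.1.continuous hC i
  · exact hf.integrableOn.mul_bdd (hφ.pd i).1.continuous.aestronglyMeasurable (.of_forall hC')
  · exact hg.integrableOn.mul_bdd (hφ.pd i).1.continuous.aestronglyMeasurable (.of_forall hC')

lemma setIntegral_eq_integral [NormedSpace ℝ F] {g : 𝔼 → F} {φ : 𝔼 → ℂ} (hφ : tsupport φ ⊆ Ω)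
    (h : ∀ x, x ∉ tsupport φ → g x = 0) : ∫ x in Ω, g x = ∫ x, g x :=
  setIntegral_eq_integral_of_forall_compl_eq_zero fun x hx => h x fun h' => hx (hφ h')

lemma integral_pd_eq_zero {φ : 𝔼 → ℂ} (hφ : ContDiff ℝ ∞ φ) (hc : HasCompactSupport φ)
    (i : Fin n) : ∫ x, pd i φ x = 0 := by
  have h := integral_smul_fderiv_eq_neg_fderiv_smul_of_integrable (𝕜 := ℝ) (μ := volume)
    (f := fun _ : 𝔼 => (1 : ℝ)) (g := φ) (v := EuclideanSpace.single i 1)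
    (by simp) (by
      simp only [one_smul]
      exact (contDiff_pd hφ i).continuous.integrable_of_hasCompactSupport
        (hasCompactSupport_pd hc i))
    (by simpa using hφ.continuous.integrable_of_hasCompactSupport hc)
    (fun x _ => differentiableAt_const _) (fun x _ => hφ.differentiable (by simp) x)
  simpa [pd] using h

lemma isH1_one [IsFiniteMeasure vol Ω] : IsH1 Ω (fun _ => (1 : ℂ)) (fun _ => (0 : CSpace n)) := by
  refine ⟨memLp_const _, memLp_const _, (locallyIntegrable_const _).locallyIntegrableOn _,
    (locallyIntegrable_const _).locallyIntegrableOn _, fun φ hφ i => ?_⟩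
  simp only [one_mul, PiLp.zero_apply, zero_mul, integral_zero, neg_zero]
  rw [setIntegral_eq_integral hφ.2.2 fun x hx => ?_]
  · exact integral_pd_eq_zero hφ.1 hφ.2.1 i
  · exact pd_eq_zero hx i

/-- Multiplication of an `H¹` function by a smooth function. -/
lemma IsH1.smooth_mul (hΩ : MeasurableSet Ω) [IsFiniteMeasure vol Ω] {f : 𝔼 → ℂ}
    {Df : 𝔼 → CSpace n} (hf : IsH1 Ω f Df) {χ : 𝔼 → ℂ} (hχ : ContDiff ℝ ∞ χ) {C : ℝ}
    (hC : ∀ x ∈ Ω, ‖χ x‖ ≤ C) (hC' : ∀ x ∈ Ω, ‖∇ χ x‖ ≤ C) :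
    IsH1 Ω (fun x => χ x * f x) (fun x => χ x • Df x + f x • ∇ χ x) := by
  have hm1 := hχ.continuous.aestronglyMeasurable (μ := vol Ω)
  have hm2 := (contDiff_grad hχ).aestronglyMeasurable (μ := vol Ω)
  have h1 : MemLp (fun x => χ x * f x) 2 vol Ω := by
    refine MemLp.of_le_mul (c := C) hf.1 (hm1.mul hf.1.1) ?_
    filter_upwards [ae_restrict_mem hΩ] with x hx; rw [norm_mul]
    exact mul_le_mul_of_nonneg_right (hC x hx) (norm_nonneg _)
  have h2 : MemLp (fun x => χ x • Df x) 2 vol Ω := by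
    refine MemLp.of_le_mul (c := C) hf.2.1 (hm1.smul hf.2.1.1) ?_
    filter_upwards [ae_restrict_mem hΩ] with x hx; rw [norm_smul]
    exact mul_le_mul_of_nonneg_right (hC x hx) (norm_nonneg _)
  have h3 : MemLp (fun x => f x • ∇ χ x) 2 vol Ω := by
    refine MemLp.of_le_mul (c := C) hf.1 (hf.1.1.smul hm2) ?_
    filter_upwards [ae_restrict_mem hΩ] with x hx; rw [norm_smul, mul_comm]
    exact mul_le_mul_of_nonneg_right (hC' x hx) (norm_nonneg _)
  have h23 : MemLp (fun x => χ x • Df x + f x • ∇ χ x) 2 vol Ω := h2.add h3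
  have hi1 : IntegrableOn (fun x => χ x * f x) Ω := h1.integrable (by norm_num)
  have hi2 : IntegrableOn (fun x => χ x • Df x) Ω := h2.integrable (by norm_num)
  have hi3 : IntegrableOn (fun x => f x • ∇ χ x) Ω := h3.integrable (by norm_num)
  refine ⟨h1, h23, hi1.locallyIntegrableOn, (hi2.add hi3).locallyIntegrableOn, fun φ hφ i => ?_⟩
  have h4 := hf.2.2.2.2 _ (hφ.mul_left hχ) i; obtain ⟨B, -, hB⟩ := hφ.exists_bound
  obtain ⟨B', -, hB'⟩ := (hφ.pd i).exists_bound
  have e1 : ∀ x, f x * ∇ (fun y => χ y * φ y) x i =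
      χ x * f x * pd i φ x + (f x • ∇ χ x) i * φ x := by
    intro x; rw [grad_apply, pd_mul hχ hφ.1]
    simp only [PiLp.smul_apply, smul_eq_mul, grad_apply]; ring
  have i1 : IntegrableOn (fun x => χ x * f x * pd i φ x) Ω :=
    hi1.mul_bdd (hφ.pd i).1.continuous.aestronglyMeasurable (.of_forall hB')
  have i2 : IntegrableOn (fun x => (f x • ∇ χ x) i * φ x) Ω :=
    integrable_coord_mul hi3 hφ.1.continuous hB i
  have i3 : IntegrableOn (fun x => (χ x • Df x) i * φ x) Ω :=
    integrable_coord_mul hi2 hφ.1.continuous hB i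
  simp only [e1] at h4; rw [integral_add i1 i2] at h4
  have e2 : ∀ x, (χ x • Df x + f x • ∇ χ x) i * φ x =
      (χ x • Df x) i * φ x + (f x • ∇ χ x) i * φ x := fun x => by
    rw [PiLp.add_apply, add_mul]
  simp only [e2]; rw [integral_add i3 i2]
  have e3 : ∀ x, (χ x • Df x) i * φ x = Df x i * (χ x * φ x) := fun x => by
    simp only [PiLp.smul_apply, smul_eq_mul]; ring
  simp only [e3] at i3 ⊢; simp only [grad_apply] at *; linear_combination h4

/-- Weak gradients are unique. -/
lemma HasWeakGradient.ae_eq (hΩ : IsOpen Ω) {f : 𝔼 → ℂ} {G G' : 𝔼 → CSpace n}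
    (h : HasWeakGradient Ω f G) (h' : HasWeakGradient Ω f G') : ∀ᵐ x ∂vol Ω, G x = G' x := by
  have hc : ∀ i : Fin n, ∀ᵐ x, x ∈ Ω → G x i - G' x i = 0 := by
    intro i
    have hl : ∀ {H : 𝔼 → CSpace n}, LocallyIntegrableOn H Ω →
        LocallyIntegrableOn (fun x => H x i) Ω := fun {H} hH x hx => by
      obtain ⟨s, hs, hi⟩ := hH x hx; exact ⟨s, hs, (pr ℂ i).integrable_comp hi⟩
    have hdiff := (hl h.2.1).sub (hl h'.2.1)
    refine hΩ.ae_eq_zero_of_integral_contDiff_smul_eq_zero hdiff fun g g1 g2 g3 => ?_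
    have hg : IsTestFunction Ω g := ⟨g1, g2, g3⟩; have hgc := hg.ofReal; have e1 := h.2.2 _ hgc i
    rw [h'.2.2 _ hgc i, neg_inj] at e1
    have hint : ∀ {H : 𝔼 → CSpace n}, LocallyIntegrableOn H Ω →
        Integrable (fun x => H x i * (g x : ℂ)) := fun {H} hH => by
      have h1 : IntegrableOn (fun x => H x i) (tsupport g) :=
        (hl hH).integrableOn_compact_subset g3 g2
      obtain ⟨C, -, hC⟩ := hgc.exists_bound
      have h2 : IntegrableOn (fun x => H x i * (g x : ℂ)) (tsupport g) :=
        h1.mul_bdd hgc.1.continuous.aestronglyMeasurable (.of_forall hC)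
      rw [integrableOn_iff_integrable_of_support_subset] at h2
      · exact h2
      · intro x hx; by_contra h0; exact hx (by simp [image_eq_zero_of_notMem_tsupport h0])
    have hset : ∀ {H : 𝔼 → CSpace n}, ∫ x in Ω, H x i * (g x : ℂ) =
        ∫ x, H x i * (g x : ℂ) := fun {H} =>
      setIntegral_eq_integral_of_forall_compl_eq_zero fun x hx => by
        rw [image_eq_zero_of_notMem_tsupport fun h0 => hx (g3 h0)]; simp
    rw [hset, hset] at e1
    have e2 : ∀ x, g x • (G x i - G' x i) = G x i * (g x : ℂ) - G' x i * (g x : ℂ) := fun x => by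
      rw [real_smul]; ring
    simp only [e2]; rw [integral_sub (hint h.2.1) (hint h'.2.1), e1, sub_self]
  rw [ae_restrict_iff' hΩ.measurableSet]; filter_upwards [ae_all_iff.2 hc] with x hx hxΩ; ext i
  exact sub_eq_zero.1 (hx i hxΩ)

/-- A smooth approximate identity. -/
def approxId (n m : ℕ) : ContDiffBump (0 : RSpace n) where
  rIn := 1 / (2 * ((m : ℝ) + 1))
  rOut := 1 / ((m : ℝ) + 1)
  rIn_pos := by positivity
  rIn_lt_rOut := by
    have : (0 : ℝ) < (m : ℝ) + 1 := by positivity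
    exact one_div_lt_one_div_of_lt this (by linarith)

/-- The mollification of a function. -/
def mollify (m : ℕ) (g : 𝔼 → ℝ) (x : 𝔼) : ℝ := ∫ t, (approxId n m).normed volume (x - t) * g t

lemma ae_tendsto_mollify {g : 𝔼 → ℝ} (hg : LocallyIntegrable g) :
    ∀ᵐ x, Tendsto (fun m => mollify m g x) atTop (𝓝 (g x)) := by
  have h := ContDiffBump.ae_convolution_tendsto_right_of_locallyIntegrable (φ := approxId n)
    (l := atTop) (K := 2) (μ := volume)
    (by
      have : (fun m : ℕ => (approxId n m).rOut) = fun m : ℕ => 1 / ((m : ℝ) + 1) := rfl; rw [this]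
      exact tendsto_one_div_add_atTop_nhds_zero_nat)
    (.of_forall fun m => by
      change 1 / ((m : ℝ) + 1) ≤ 2 * (1 / (2 * ((m : ℝ) + 1))); field_simp; rfl) hg
  filter_upwards [h] with x hx; simp only [convolution_lsmul_swap, smul_eq_mul] at hx; exact hx

lemma contDiff_mollify (m : ℕ) {g : 𝔼 → ℝ} (hg : LocallyIntegrable g) :
    ContDiff ℝ ∞ (mollify m g) := by
  have h := ((approxId n m).hasCompactSupport_normed (μ := volume)).contDiff_convolution_left
    (ContinuousLinearMap.lsmul ℝ ℝ) ((approxId n m).contDiff_normed (n := ⊤) (μ := volume)) hg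
  have e : (convolution ((approxId n m).normed volume) g (ContinuousLinearMap.lsmul ℝ ℝ)
      volume) = mollify m g := by
    funext x; rw [convolution_lsmul_swap]; rfl
  rw [← e]; exact h

lemma integrable_mollify (m : ℕ) {g : 𝔼 → ℝ} (hg : LocallyIntegrable g) (x : 𝔼) :
    Integrable (fun t => (approxId n m).normed volume (x - t) * g t) := by
  have h : HasCompactSupport (fun t => (approxId n m).normed volume (x - t)) :=
    ((approxId n m).hasCompactSupport_normed (μ := volume)).comp_homeomorph (Homeomorph.subLeft x)
  exact hg.integrable_smul_left_of_hasCompactSupport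
    (((approxId n m).contDiff_normed (n := ⊤)).continuous.comp (continuous_const.sub continuous_id)) h

lemma abs_mollify_le (m : ℕ) {g : 𝔼 → ℝ} {M : ℝ} (hM : ∀ᵐ t, |g t| ≤ M) (x : 𝔼) :
    |mollify m g x| ≤ M := by
  have hk : Integrable (fun t => (approxId n m).normed volume (x - t)) :=
    ((approxId n m).integrable_normed).comp_sub_left x
  have h1 : ∫ t, (approxId n m).normed volume (x - t) = 1 := by
    rw [integral_sub_left_eq_self (fun t => (approxId n m).normed volume t) volume x,
      (approxId n m).integral_normed]
  have h2 := norm_integral_le_of_norm_le (f := fun t => (approxId n m).normed volume (x - t) * g t)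
    (hk.mul_const M) (by
      filter_upwards [hM] with t ht; rw [norm_mul, norm_of_nonneg ((approxId n m).nonneg_normed _)]
      exact mul_le_mul_of_nonneg_left ht ((approxId n m).nonneg_normed _))
  rw [integral_mul_const, h1, one_mul] at h2; exact h2

lemma le_mollify {m : ℕ} {g : 𝔼 → ℝ} (hg : LocallyIntegrable g) {lam : ℝ}
    (h : ∀ᵐ t, t ∈ Ω → lam ≤ g t) {x : 𝔼} (hx : closedBall x (1 / ((m : ℝ) + 1)) ⊆ Ω) :
    lam ≤ mollify m g x := by
  have hk : Integrable (fun t => (approxId n m).normed volume (x - t)) :=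
    ((approxId n m).integrable_normed).comp_sub_left x
  have h1 : ∫ t, (approxId n m).normed volume (x - t) = 1 := by
    rw [integral_sub_left_eq_self (fun t => (approxId n m).normed volume t) volume x,
      (approxId n m).integral_normed]
  have h2 : ∫ t, (approxId n m).normed volume (x - t) * lam ≤ mollify m g x := by
    refine integral_mono_ae (hk.mul_const lam) (integrable_mollify m hg x) ?_
    filter_upwards [h] with t ht; by_cases hs : t ∈ closedBall x (1 / ((m : ℝ) + 1))
    · exact mul_le_mul_of_nonneg_left (ht (hx hs)) ((approxId n m).nonneg_normed _)
    · have h0 : (approxId n m).normed volume (x - t) = 0 := by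
        refine image_eq_zero_of_notMem_tsupport fun h' => hs ?_
        rw [(approxId n m).tsupport_normed_eq] at h'
        have h3 : ‖x - t‖ ≤ 1 / ((m : ℝ) + 1) := by simpa [approxId] using h'
        rwa [mem_closedBall, dist_comm, dist_eq_norm]
      simp [h0]
  rwa [integral_mul_const, h1, one_mul] at h2

lemma pd_mollify (m : ℕ) {g : 𝔼 → ℝ} {G : 𝔼 → 𝔼} (h : HasWeakGradient Set.univ g G) (i : Fin n)
    (x : 𝔼) : pd i (mollify m g) x = mollify m (fun t => G t i) x := by
  have hg : LocallyIntegrable g := locallyIntegrableOn_univ.1 h.1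
  have hk := (approxId n m).hasCompactSupport_normed (μ := volume)
  have hkc := (approxId n m).contDiff_normed (n := ⊤) (μ := volume)
  have h1 := hk.hasFDerivAt_convolution_right (ContinuousLinearMap.lsmul ℝ ℝ) hg
    (hkc.of_le (by simp)) x
  have e : (convolution g ((approxId n m).normed volume) (ContinuousLinearMap.lsmul ℝ ℝ)
      volume) = mollify m g := by
    funext x; rw [convolution_lsmul, mollify]
    exact integral_congr_ae (.of_forall fun t => mul_comm _ _)
  rw [e] at h1
  rw [pd, h1.fderiv, convolution_precompR_apply _ hg (hk.fderiv ℝ)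
    (hkc.continuous_fderiv (by simp)), convolution_lsmul]
  have h2 := h.2.2 (fun t => (approxId n m).normed volume (x - t)) ⟨hkc.comp (contDiff_const.sub
    contDiff_id), hk.comp_homeomorph (Homeomorph.subLeft x), subset_univ _⟩ i
  simp only [grad_apply, Measure.restrict_univ, pd_comp_const_sub] at h2; rw [mollify]
  simp only [mul_neg, integral_neg, neg_inj, smul_eq_mul] at h2 ⊢
  refine h2.trans (integral_congr_ae (.of_forall fun t => mul_comm _ _))

/-- A bounded function with bounded weak gradient agrees near the origin with a constant up to a
linear error. -/
lemma exists_linear_bound {g : 𝔼 → ℝ} {G : 𝔼 → 𝔼} {M : ℝ} (h : HasWeakGradient Set.univ g G)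
    (hg : ∀ᵐ t, |g t| ≤ M) (hG : ∀ᵐ t, ∀ i, |G t i| ≤ M) : ∃ a L : ℝ, ∀ᵐ x, |g x - a| ≤ L * ‖x‖ := by
  have hli : LocallyIntegrable g := locallyIntegrableOn_univ.1 h.1
  have hlip : ∀ m x, |mollify m g x - mollify m g 0| ≤ (n * M) * ‖x‖ := by
    intro m x
    have hd : ∀ y ∈ (Set.univ : Set 𝔼), ‖fderiv ℝ (mollify m g) y‖ ≤ n * M := by
      intro y _
      have hM : 0 ≤ M := by
        obtain ⟨t, ht⟩ := hg.exists; exact (abs_nonneg _).trans ht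
      refine ContinuousLinearMap.opNorm_le_bound _ (by positivity) fun v => ?_
      rw [fderiv_eq_sum_pd]; refine (norm_sum_le _ _).trans ?_
      have h1 : ∀ i ∈ (Finset.univ : Finset (Fin n)), ‖v i • pd i (mollify m g) y‖ ≤ M * ‖v‖ := by
        intro i _; rw [norm_smul, mul_comm, pd_mollify m h]
        exact mul_le_mul (abs_mollify_le m (hG.mono fun t ht => ht i) y) (PiLp.norm_apply_le v i)
          (norm_nonneg _) hM
      refine (sum_le_sum h1).trans (le_of_eq ?_); simp; ring
    have h2 := convex_univ.norm_image_sub_le_of_norm_fderiv_le (𝕜 := ℝ) (fun y _ =>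
      ((contDiff_mollify m hli).differentiable (by simp)) y) hd (mem_univ 0) (mem_univ x)
    rwa [sub_zero] at h2
  have hb : ∀ m, mollify m g 0 ∈ Set.Icc (-M) M := fun m => abs_le.1 (abs_mollify_le m hg 0)
  obtain ⟨a, -, s, hs, ha⟩ := isCompact_Icc.tendsto_subseq hb; refine ⟨a, n * M, ?_⟩
  filter_upwards [ae_tendsto_mollify hli] with x hx
  exact le_of_tendsto ((hx.comp hs.tendsto_atTop).sub ha).abs (.of_forall fun m => hlip (s m) x)

/-- The inclusion of `ℝⁿ` into `ℂⁿ`. -/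
def toC (v : 𝔼) : CSpace n := WithLp.toLp 2 fun i => (v i : ℂ)

lemma norm_toC (v : 𝔼) : ‖toC v‖ = ‖v‖ := by
  rw [EuclideanSpace.norm_eq, EuclideanSpace.norm_eq]; simp [toC]

lemma continuous_toC : Continuous (toC (n := n)) := by
  refine (PiLp.continuous_toLp 2 _).comp (continuous_pi fun i => ?_)
  exact continuous_ofReal.comp (pr ℝ i).continuous

/-- `γ` is bounded by `M` and has a weak gradient `G` bounded by `M`. -/
structure IsW1Bounded (γ : RSpace n → ℝ) (G : RSpace n → RSpace n) (M : ℝ) : Prop where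
  meas : AESM γ volume
  meas_grad : AESM G volume
  bound : ∀ᵐ x, |γ x| ≤ M
  bound_grad : ∀ᵐ x, ‖G x‖ ≤ M
  grad : HasWeakGradient Set.univ γ G

lemma ae_norm_le_of_memLp_top {α F : Type*} [MeasurableSpace α] {μ : Measure α}
    [NormedAddCommGroup F] {f : α → F} (hf : MemLp f ⊤ μ) :
    ∀ᵐ x ∂μ, ‖f x‖ ≤ (eLpNorm f ⊤ μ).toReal := by
  filter_upwards [ae_le_eLpNormEssSup (f := f) (μ := μ)] with x hx
  rw [← eLpNorm_exponent_top] at hx; rw [← toReal_enorm]; exact ENNReal.toReal_mono hf.2.ne hx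

lemma IsW1Infty.exists_isW1Bounded {γ : 𝔼 → ℝ} (h : IsW1Infty γ) :
    ∃ G M, 0 ≤ M ∧ IsW1Bounded γ G M := by
  obtain ⟨h1, G, h2, h3⟩ := h
  refine ⟨G, max (eLpNorm γ ⊤ volume).toReal (eLpNorm G ⊤ volume).toReal,
    le_max_of_le_left ENNReal.toReal_nonneg, h1.1, h2.1, ?_, ?_, h3⟩
  · exact (ae_norm_le_of_memLp_top h1).mono fun x hx => hx.trans (le_max_left _ _)
  · exact (ae_norm_le_of_memLp_top h2).mono fun x hx => hx.trans (le_max_right _ _)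

lemma IsW1Bounded.bound_coord {γ : 𝔼 → ℝ} {G : 𝔼 → 𝔼} {M : ℝ} (h : IsW1Bounded γ G M) :
    ∀ᵐ x, ∀ i, |G x i| ≤ M :=
  h.bound_grad.mono fun x hx i => (PiLp.norm_apply_le (G x) i).trans hx

lemma rpow_le_add_of_mem {lam M t : ℝ} (hlam : 0 < lam) (h1 : lam ≤ t) (h2 : t ≤ M) (s : ℝ) :
    t ^ s ≤ lam ^ s + M ^ s := by
  have h0 : 0 < t := hlam.trans_le h1; have h3 : 0 < M := h0.trans_le h2
  rcases le_total 0 s with hs | hs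
  · exact (rpow_le_rpow h0.le h2 hs).trans (le_add_of_nonneg_left (by positivity))
  · exact (rpow_le_rpow_of_nonpos hlam h1 hs).trans (le_add_of_nonneg_right (by positivity))

lemma IsTestFunction.eventually_closedBall_subset (hΩ : IsOpen Ω) {φ : 𝔼 → ℂ}
    (hφ : IsTestFunction Ω φ) :
    ∀ᶠ m : ℕ in atTop, ∀ x ∈ tsupport φ, closedBall x (1 / ((m : ℝ) + 1)) ⊆ Ω := by
  obtain ⟨δ, hδ, h⟩ := hφ.2.1.isCompact.exists_cthickening_subset_open hΩ hφ.2.2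
  filter_upwards [tendsto_one_div_add_atTop_nhds_zero_nat.eventually_le_const hδ] with m hm x hx
  exact (closedBall_subset_closedBall hm).trans ((closedBall_subset_cthickening hx δ).trans h)

lemma isTestFunction_rpow_mul {g : 𝔼 → ℝ} (hg : ContDiff ℝ ∞ g) {lam : ℝ} (hlam : 0 < lam)
    {φ : 𝔼 → ℂ} (hφ : IsTestFunction Ω φ) (h : ∀ x ∈ tsupport φ, lam ≤ g x) (s : ℝ) :
    IsTestFunction Ω (fun x => ℂ(g x ^ s) * φ x) ∧ ∀ (i : Fin n) (x : 𝔼), pd i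
    (fun x => ℂ(g x ^ s) * φ x) x = ℂ(g x ^ s) * pd i φ x + φ x * ℂ(s * g x ^ (s - 1) * pd i g x) := by
  have hts : tsupport (fun x => ℂ(g x ^ s) * φ x) ⊆ tsupport φ := tsupport_mul_subset_right
  have hpow : ∀ x ∈ tsupport φ, ContDiffAt ℝ ∞ (fun x => g x ^ s) x := fun x hx =>
    hg.contDiffAt.rpow_const_of_ne (hlam.trans_le (h x hx)).ne'
  refine ⟨⟨contDiff_iff_contDiffAt.2 fun x => ?_, hφ.2.1.mul_left, hts.trans hφ.2.2⟩, fun i x => ?_⟩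
  · by_cases hx : x ∈ tsupport φ
    · exact (ofRealCLM.contDiff.contDiffAt.comp x (hpow x hx)).mul hφ.1.contDiffAt
    · refine (contDiffAt_const (c := (0 : ℂ))).congr_of_eventuallyEq ?_
      filter_upwards [(isClosed_tsupport φ).isOpen_compl.mem_nhds hx] with y hy
      rw [image_eq_zero_of_notMem_tsupport hy, mul_zero]
  · by_cases hx : x ∈ tsupport φ
    · have hd : DifferentiableAt ℝ (fun x => g x ^ s) x := (hpow x hx).differentiableAt (by simp)
      have hd2 : DifferentiableAt ℝ (fun x => ℂ(g x ^ s)) x :=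
        (ofRealCLM.differentiableAt).comp x hd
      rw [pd_mul_of hd2 ((hφ.1.differentiable (by simp)) x), pd_ofReal_of hd]
      have hg' : HasFDerivAt g (fderiv ℝ g x) x := ((hg.differentiable (by simp)) x).hasFDerivAt
      have h1 := hg'.rpow_const (p := s) (Or.inl (hlam.trans_le (h x hx)).ne')
      have h2 : pd i (fun x => g x ^ s) x = s * g x ^ (s - 1) * pd i g x := by
        rw [pd, h1.fderiv]; simp [pd]
      rw [h2]
    · rw [pd_eq_zero (fun h' => hx (hts h')), pd_eq_zero hx, image_eq_zero_of_notMem_tsupport hx]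
      simp

/-- Multiplication of an `H¹` function by a power of a uniformly positive `W^{1,∞}` function. -/
theorem IsH1.rpow_mul (hΩ : IsOpen Ω) [IsFiniteMeasure vol Ω] {γ : 𝔼 → ℝ} {G : 𝔼 → 𝔼} {M lam : ℝ}
    (hγ : IsW1Bounded γ G M) (hlam : 0 < lam) (hell : ∀ᵐ x ∂vol Ω, lam ≤ γ x) {f : 𝔼 → ℂ}
    {Df : 𝔼 → CSpace n} (hf : IsH1 Ω f Df) (s : ℝ) : IsH1 Ω (fun x => ℂ(γ x ^ s) * f x)
    (fun x => ℂ(γ x ^ s) • Df x + (f x * ℂ(s * γ x ^ (s - 1))) • toC (G x)) := by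
  have hm : ∀ t : ℝ, AESM (fun x => ℂ(γ x ^ t)) vol Ω := fun t =>
    continuous_ofReal.comp_aestronglyMeasurable (hγ.meas.aemeasurable.pow_const
    t).aestronglyMeasurable.restrict
  have hG : AESM (fun x => toC (G x)) vol Ω :=
    continuous_toC.comp_aestronglyMeasurable hγ.meas_grad.restrict
  have hb : ∀ t : ℝ, ∀ᵐ x ∂vol Ω, ‖ℂ(γ x ^ t)‖ ≤ lam ^ t + M ^ t := fun t => by
    filter_upwards [hell, ae_restrict_of_ae hγ.bound] with x h1 h2
    have h3 := (le_abs_self _).trans h2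
    rw [norm_real, norm_of_nonneg (rpow_nonneg (hlam.le.trans h1) _)]
    exact rpow_le_add_of_mem hlam h1 h3 t
  have m1 : MemLp (fun x => ℂ(γ x ^ s) * f x) 2 vol Ω := by
    refine MemLp.of_le_mul (c := lam ^ s + M ^ s) hf.1 ((hm s).mul hf.1.1) ?_
    filter_upwards [hb s] with x hx; rw [norm_mul]
    exact mul_le_mul_of_nonneg_right hx (norm_nonneg _)
  have m2 : MemLp (fun x => ℂ(γ x ^ s) • Df x) 2 vol Ω := by
    refine MemLp.of_le_mul (c := lam ^ s + M ^ s) hf.2.1 ((hm s).smul hf.2.1.1) ?_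
    filter_upwards [hb s] with x hx; rw [norm_smul]
    exact mul_le_mul_of_nonneg_right hx (norm_nonneg _)
  have m3 : MemLp (fun x => (f x * ℂ(s * γ x ^ (s - 1))) • toC (G x)) 2 vol Ω := by
    refine MemLp.of_le_mul (c := |s| * (lam ^ (s - 1) + M ^ (s - 1)) * M) hf.1 ?_ ?_
    · refine (hf.1.1.mul ?_).smul hG; simp only [Complex.ofReal_mul]; exact (hm (s - 1)).const_mul _
    · filter_upwards [hb (s - 1), ae_restrict_of_ae hγ.bound_grad] with x h1 h2
      rw [norm_smul, norm_mul, Complex.ofReal_mul, norm_mul, norm_toC, norm_real, norm_eq_abs]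
      have h3 : |s| * ‖ℂ(γ x ^ (s - 1))‖ * ‖G x‖ ≤
          |s| * (lam ^ (s - 1) + M ^ (s - 1)) * M :=
        mul_le_mul (mul_le_mul_of_nonneg_left h1 (abs_nonneg s)) h2 (norm_nonneg _)
          (mul_nonneg (abs_nonneg s) ((norm_nonneg _).trans h1))
      calc _ = |s| * ‖ℂ(γ x ^ (s - 1))‖ * ‖G x‖ * ‖f x‖ := by ring
        _ ≤ _ := mul_le_mul_of_nonneg_right h3 (norm_nonneg _)
  have i1 : IntegrableOn (fun x => ℂ(γ x ^ s) * f x) Ω := m1.integrable (by norm_num)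
  have i2 : IntegrableOn (fun x => ℂ(γ x ^ s) • Df x) Ω := m2.integrable (by norm_num)
  have i3 : IntegrableOn (fun x => (f x * ℂ(s * γ x ^ (s - 1))) • toC (G x)) Ω :=
    m3.integrable (by norm_num)
  refine ⟨m1, m2.add m3, i1.locallyIntegrableOn, (i2.add i3).locallyIntegrableOn, fun φ hφ i => ?_⟩
  have hli : LocallyIntegrable γ := locallyIntegrableOn_univ.1 hγ.grad.1
  have hliG : LocallyIntegrable (fun x => G x i) := fun x => by
    obtain ⟨S, hS, hi⟩ := (locallyIntegrableOn_univ.1 hγ.grad.2.1) x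
    exact ⟨S, hS, (pr ℝ i).integrable_comp hi⟩
  obtain ⟨B, hB0, hB⟩ := hφ.exists_bound; obtain ⟨B', hB'0, hB'⟩ := (hφ.pd i).exists_bound
  have hev : ∀ᶠ m : ℕ in atTop, ∀ x ∈ tsupport φ, lam ≤ mollify m γ x := by
    filter_upwards [hφ.eventually_closedBall_subset hΩ] with m hm x hx
    exact le_mollify hli ((ae_restrict_iff' hΩ.measurableSet).1 hell) (hm x hx)
  have hMm : ∀ m x, |mollify m γ x| ≤ M := fun m x => abs_mollify_le m hγ.bound x
  have hM0 : 0 ≤ M := (abs_nonneg _).trans (hMm 0 0)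
  have hdm : ∀ m x, |pd i (mollify m γ) x| ≤ M := fun m x => by
    rw [pd_mollify m hγ.grad]; exact abs_mollify_le m (hγ.bound_coord.mono fun t ht => ht i) x
  have hlimγ : ∀ᵐ x ∂vol Ω, ∀ t : ℝ, Tendsto (fun m => mollify m γ x ^ t) atTop (𝓝 (γ x ^ t)) := by
    filter_upwards [hell, ae_restrict_of_ae (ae_tendsto_mollify hli)] with x h1 h2 t
    exact h2.rpow_const (Or.inl (hlam.trans_le h1).ne')
  have hlimG : ∀ᵐ x ∂vol Ω, Tendsto (fun m => pd i (mollify m γ) x) atTop (𝓝 (G x i)) := by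
    filter_upwards [ae_restrict_of_ae (ae_tendsto_mollify hliG)] with x h2
    simpa only [pd_mollify _ hγ.grad] using h2
  have hsm : ∀ m, ContDiff ℝ ∞ (mollify m γ) := fun m => contDiff_mollify m hli
  have hmeasm : ∀ m (t : ℝ), AESM (fun x => ℂ(mollify m γ x ^ t)) vol Ω := fun m t =>
    continuous_ofReal.comp_aestronglyMeasurable ((hsm m).continuous.measurable.pow_const
    t).aestronglyMeasurable
  have hbm : ∀ᶠ m : ℕ in atTop, ∀ (t : ℝ), ∀ x ∈ tsupport φ,
      ‖ℂ(mollify m γ x ^ t)‖ ≤ lam ^ t + M ^ t := by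
    filter_upwards [hev] with m h1 t x hx
    rw [norm_real, norm_of_nonneg (rpow_nonneg (hlam.le.trans (h1 x hx)) _)]
    exact rpow_le_add_of_mem hlam (h1 x hx) ((le_abs_self _).trans (hMm m x)) t
  have hb0 : ∀ t : ℝ, lam ≤ M → 0 ≤ lam ^ t + M ^ t := fun t h => by positivity
  have hs0 : ∀ t : ℝ, 0 ≤ lam ^ t + M ^ t := fun t => by positivity
  set T1 := fun (m : ℕ) (x : 𝔼) => f x * (ℂ(mollify m γ x ^ s) * pd i φ x
    + φ x * ℂ(s * mollify m γ x ^ (s - 1) * pd i (mollify m γ) x)) with hT1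
  set T2 := fun (m : ℕ) (x : 𝔼) => Df x i * (ℂ(mollify m γ x ^ s) * φ x) with hT2
  have hT : ∀ᶠ m in atTop, ∫ x in Ω, T1 m x = -∫ x in Ω, T2 m x := by
    filter_upwards [hev] with m h1; obtain ⟨h2, h3⟩ := isTestFunction_rpow_mul (hsm m) hlam hφ h1 s
    have h4 := hf.2.2.2.2 _ h2 i; simpa only [grad_apply, h3] using h4
  have hDf : IntegrableOn (fun x => Df x i) Ω := (pr ℂ i).integrable_comp hf.integrableOn_grad
  have hl1 : Tendsto (fun m => ∫ x in Ω, T1 m x) atTop (𝓝 (∫ x in Ω,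
      f x * (ℂ(γ x ^ s) * pd i φ x + φ x * ℂ(s * γ x ^ (s - 1) * G x i)))) := by
    refine tendsto_integral_filter_of_dominated_convergence
      (fun x => ‖f x‖ * ((lam ^ s + M ^ s) * B' + B * (|s| * (lam ^ (s - 1) + M ^ (s - 1)) * M)))
      (.of_forall fun m => ?_) ?_ (hf.integrableOn.norm.mul_const _) ?_
    · refine hf.1.1.mul (((hmeasm m s).mul (hφ.pd i).1.continuous.aestronglyMeasurable).add
        (hφ.1.continuous.aestronglyMeasurable.mul ?_))
      simp only [Complex.ofReal_mul]
      exact ((hmeasm m (s - 1)).const_mul _).mul (continuous_ofReal.comp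
        (contDiff_pd (hsm m) i).continuous).aestronglyMeasurable
    · filter_upwards [hbm] with m h1; refine .of_forall fun x => ?_; by_cases hx : x ∈ tsupport φ
      · simp only [hT1]; rw [norm_mul]
        refine mul_le_mul_of_nonneg_left ((norm_add_le _ _).trans (add_le_add ?_ ?_))
          (norm_nonneg _)
        · rw [norm_mul]; exact mul_le_mul (h1 s x hx) (hB' x) (norm_nonneg _) (hs0 s)
        · rw [norm_mul, Complex.ofReal_mul, Complex.ofReal_mul, norm_mul, norm_mul,
            norm_real s, norm_real (pd i _ x), norm_eq_abs, norm_eq_abs]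
          refine mul_le_mul (hB x) ?_ (by positivity) hB0
          exact mul_le_mul (mul_le_mul_of_nonneg_left (h1 _ x hx) (abs_nonneg s)) (hdm m x)
            (abs_nonneg _) (mul_nonneg (abs_nonneg s) (hs0 _))
      · simp only [hT1]; rw [pd_eq_zero hx, image_eq_zero_of_notMem_tsupport hx]
        simp only [mul_zero, zero_mul, add_zero, norm_zero]; have := hs0 s; have := hs0 (s - 1)
        positivity
    · filter_upwards [hlimγ, hlimG] with x h1 h2
      refine ((((continuous_ofReal.tendsto _).comp (h1 s)).mul_const _).add
        (((continuous_ofReal.tendsto _).comp (((h1 (s - 1)).const_mul s).mul h2)).const_mul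
        _)).const_mul _
  have hl2 : Tendsto (fun m => ∫ x in Ω, T2 m x) atTop (𝓝 (∫ x in Ω,
      Df x i * (ℂ(γ x ^ s) * φ x))) := by
    refine tendsto_integral_filter_of_dominated_convergence (fun x => ‖Df x i‖ * ((lam ^ s + M ^ s)
      * B)) (.of_forall fun m => ?_) ?_ (hDf.norm.mul_const _) ?_
    · exact hDf.1.mul ((hmeasm m s).mul hφ.1.continuous.aestronglyMeasurable)
    · filter_upwards [hbm] with m h1; refine .of_forall fun x => ?_; by_cases hx : x ∈ tsupport φ
      · simp only [hT2]; rw [norm_mul, norm_mul]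
        exact mul_le_mul_of_nonneg_left (mul_le_mul (h1 s x hx) (hB x) (norm_nonneg _) (hs0 s))
          (norm_nonneg _)
      · simp only [hT2]; rw [image_eq_zero_of_notMem_tsupport hx]; simp only [mul_zero, norm_zero]
        have := hs0 s; positivity
    · filter_upwards [hlimγ] with x h1
      exact (((continuous_ofReal.tendsto _).comp (h1 s)).mul_const _).const_mul _
  have hfin := tendsto_nhds_unique (hl1.congr' hT) hl2.neg
  have e1 : ∀ x, f x * (ℂ(γ x ^ s) * pd i φ x + φ x * ℂ(s * γ x ^ (s - 1) * G x i)) =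
      ℂ(γ x ^ s) * f x * pd i φ x
        + ((f x * ℂ(s * γ x ^ (s - 1))) • toC (G x)) i * φ x := fun x => by
    simp only [PiLp.smul_apply, smul_eq_mul, toC]; push_cast; ring
  have e2 : ∀ x, Df x i * (ℂ(γ x ^ s) * φ x) = (ℂ(γ x ^ s) • Df x) i * φ x := fun x => by
    simp only [PiLp.smul_apply, smul_eq_mul]; ring
  simp only [e1, e2] at hfin
  have j1 := i1.mul_bdd (hφ.pd i).1.continuous.aestronglyMeasurable (.of_forall hB')
  have j2 := integrable_coord_mul i2 hφ.1.continuous hB i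
  have j3 := integrable_coord_mul i3 hφ.1.continuous hB i; rw [integral_add j1 j3] at hfin
  simp only [PiLp.add_apply, add_mul, grad_apply]; rw [integral_add j2 j3]
  linear_combination hfin

lemma tendsto_integral_bilin {α E F : Type*} [MeasurableSpace α] {μ : Measure α}
    [NormedAddCommGroup E] [NormedAddCommGroup F] {b : E → F → ℂ}
    (hb : ∀ x x' y, ‖b x y - b x' y‖ ≤ ‖x - x'‖ * ‖y‖) {f : α → E} {fj : ℕ → α → E} {g : α → F}
    (hf : AESM f μ) (hfj : ∀ j, AESM (fj j) μ) (hg : MemLp g 2 μ)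
    (hint : Integrable (fun x => b (f x) (g x)) μ)
    (hintj : ∀ j, Integrable (fun x => b (fj j x) (g x)) μ)
    (h : Tendsto (fun j => eLpNorm (fun x => f x - fj j x) 2 μ) atTop (𝓝 0)) :
    Tendsto (fun j => ∫ x, b (fj j x) (g x) ∂μ) atTop (𝓝 (∫ x, b (f x) (g x) ∂μ)) := by
  refine tendsto_integral_of_L1 _ hint.1 (.of_forall hintj) ?_
  have hz : Tendsto (fun j => eLpNorm (fun x => f x - fj j x) 2 μ * eLpNorm g 2 μ) atTop (𝓝 0) := by
    have := ENNReal.Tendsto.mul_const h (Or.inr hg.2.ne); rwa [zero_mul] at this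
  refine tendsto_of_tendsto_of_tendsto_of_le_of_le tendsto_const_nhds hz (fun _ => zero_le) ?_
  intro j
  have h1 : ∀ x, ‖b (fj j x) (g x) - b (f x) (g x)‖ₑ ≤ ‖f x - fj j x‖ₑ * ‖g x‖ₑ := fun x => by
    rw [← ofReal_norm, ← ofReal_norm, ← ofReal_norm, ← ofReal_mul (norm_nonneg _), norm_sub_rev]
    exact ofReal_le_ofReal (hb _ _ _)
  refine (lintegral_mono h1).trans ?_
  have h2 := ENNReal.lintegral_mul_le_Lp_mul_Lq μ (HolderConjugate.two_two)
    (hf.sub (hfj j)).enorm hg.1.enorm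
  refine h2.trans (le_of_eq ?_); change _ = eLpNorm (fun x => f x - fj j x) 2 μ * eLpNorm g 2 μ
  rw [eLpNorm_eq_lintegral_rpow_enorm_toReal (by norm_num) (by norm_num),
    eLpNorm_eq_lintegral_rpow_enorm_toReal (by norm_num) (by norm_num)]
  simp

lemma norm_mul_sub_mul_le (x x' y : ℂ) : ‖x * y - x' * y‖ ≤ ‖x - x'‖ * ‖y‖ := by
  rw [← sub_mul, norm_mul]

lemma norm_cdot_sub_cdot_le (x x' y : CSpace n) : ‖cdot x y - cdot x' y‖ ≤ ‖x - x'‖ * ‖y‖ := by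
  rw [← cdot_sub_left]; exact norm_cdot_le _ _

lemma aesm_cdot {μ : Measure 𝔼} {F G : 𝔼 → CSpace n} (hF : AESM F μ) (hG : AESM G μ) :
    AESM (fun x => cdot (F x) (G x)) μ := by
  have h : ∀ {H : 𝔼 → CSpace n}, AESM H μ → ∀ i : Fin n, AESM (fun x => H x i) μ := fun {H} hH i =>
    (pr ℂ i).continuous.comp_aestronglyMeasurable hH
  unfold cdot; exact Finset.aestronglyMeasurable_fun_sum _ fun i _ => (h hF i).mul (h hG i)

lemma memLp_smul_of_bound {α F : Type*} [MeasurableSpace α] {μ : Measure α}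
    [NormedAddCommGroup F] [NormedSpace ℂ F] {f : α → ℂ} {g : α → F} {C : ℝ} (hf : MemLp f 2 μ)
    (hg : AESM g μ) (hC : ∀ᵐ x ∂μ, ‖g x‖ ≤ C) : MemLp (fun x => f x • g x) 2 μ := by
  refine MemLp.of_le_mul (c := C) hf (hf.1.smul hg) (hC.mono fun x hx => ?_)
  rw [norm_smul, mul_comm]; exact mul_le_mul_of_nonneg_right hx (norm_nonneg _)

lemma memLp_cdot_of_bound {μ : Measure 𝔼} {F g : 𝔼 → CSpace n} {C : ℝ} (hF : MemLp F 2 μ)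
    (hg : AESM g μ) (hC : ∀ᵐ x ∂μ, ‖g x‖ ≤ C) : MemLp (fun x => cdot (F x) (g x)) 2 μ := by
  refine MemLp.of_le_mul (c := C) hF (aesm_cdot hF.1 hg) (hC.mono fun x hx => ?_)
  refine (norm_cdot_le _ _).trans ?_; rw [mul_comm]
  exact mul_le_mul_of_nonneg_right hx (norm_nonneg _)

lemma MemLp.integrable_cdot {μ : Measure 𝔼} {F G : 𝔼 → CSpace n} (hF : MemLp F 2 μ)
    (hG : MemLp G 2 μ) : Integrable (fun x => cdot (F x) (G x)) μ := by
  have h : Integrable (fun x => ‖F x‖ * ‖G x‖) μ := MemLp.integrable_mul hF.norm hG.norm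
  refine h.mono' (aesm_cdot hF.1 hG.1) (.of_forall fun x => ?_); exact norm_cdot_le _ _

lemma memLp_of_continuous {φ : 𝔼 → F} (hφ : Continuous φ) (hc : HasCompactSupport φ) (p : ℝ≥0∞)
    (S : Set 𝔼) : MemLp φ p vol S :=
  (hφ.memLp_of_hasCompactSupport hc).restrict S

lemma hasCompactSupport_grad {φ : 𝔼 → ℂ} (h : HasCompactSupport φ) : HasCompactSupport (∇ φ) := by
  refine h.of_isClosed_subset (isClosed_tsupport _) (closure_minimal (fun x hx => ?_)
    (isClosed_tsupport φ))
  by_contra h0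
  refine hx ?_; ext i; exact pd_eq_zero h0 i

lemma cdot_grad_sum (F : CSpace n) (ψ : 𝔼 → ℂ) (x : 𝔼) :
    cdot F (∇ ψ x) = ∑ i, F i * pd i ψ x := rfl

/-- Integration by parts against a function with zero lateral trace. -/
theorem HasZeroLateralTrace.integral_by_parts {z : 𝔼 → ℂ} {Dz : 𝔼 → CSpace n}
    (ht : HasZeroLateralTrace K ε z Dz) (hz : MemLp z 2 vol 𝒞) (hDz : MemLp Dz 2 vol 𝒞)
    {h : 𝔼 → ℂ} {Dh : 𝔼 → CSpace n} (hh : IsH1 𝒞 h Dh) {ψ : 𝔼 → ℂ}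
    (hψ : IsTestFunction (ball 0 ε) ψ) : ∫ x in 𝒞, h x * cdot (Dz x) (∇ ψ x) = -∫ x in 𝒞, z x *
    (cdot (Dh x) (∇ ψ x) + h x * lapl ψ x) := by
  obtain ⟨φ, hφ, h1, h2⟩ := ht; set μ := vol 𝒞 with hμ
  obtain ⟨C, -, hC⟩ := exists_le (contDiff_grad hψ.1) (hasCompactSupport_grad hψ.2.1)
  obtain ⟨C', -, hC'⟩ := exists_le (contDiff_lapl hψ.1).continuous (hasCompactSupport_lapl hψ.2.1)
  have hmg := (contDiff_grad hψ.1).aestronglyMeasurable (μ := μ)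
  have m1 := memLp_smul_of_bound hh.1 hmg (.of_forall hC)
  have m2a := memLp_cdot_of_bound hh.2.1 hmg (.of_forall hC)
  have m2b : MemLp (fun x => h x * lapl ψ x) 2 μ := memLp_smul_of_bound hh.1
    (contDiff_lapl hψ.1).continuous.aestronglyMeasurable (.of_forall hC')
  have m2 : MemLp (fun x => cdot (Dh x) (∇ ψ x) + h x * lapl ψ x) 2 μ := m2a.add m2b
  have hφ2 : ∀ j, MemLp (φ j) 2 μ := fun j => memLp_of_continuous (hφ j).1.continuous (hφ j).2.1 2 _
  have hgφ2 : ∀ j, MemLp (∇ (φ j)) 2 μ := fun j => memLp_of_continuous (contDiff_grad (hφ j).1)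
    (hasCompactSupport_grad (hφ j).2.1) 2 _
  have e1 : ∀ (D : CSpace n) x, h x * cdot D (∇ ψ x) = cdot D (h x • ∇ ψ x) := fun D x =>
    (cdot_smul_right _ _ _).symm
  have hj : ∀ j, ∫ x, h x * cdot (∇ (φ j) x) (∇ ψ x) ∂μ =
      -∫ x, φ j x * (cdot (Dh x) (∇ ψ x) + h x * lapl ψ x) ∂μ := by
    intro j
    have htest : ∀ i, IsTestFunction 𝒞 (fun x => φ j x * pd i ψ x) := fun i => by
      refine ⟨(hφ j).1.mul (contDiff_pd hψ.1 i), (hφ j).2.1.mul_right, subset_inter ?_ ?_⟩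
      · exact tsupport_mul_subset_left.trans (hφ j).2.2
      · exact tsupport_mul_subset_right.trans ((tsupport_pd_subset ψ i).trans hψ.2.2)
    have hw : ∀ i, ∫ x, h x * (φ j x * pd i (pd i ψ) x + pd i ψ x * pd i (φ j) x) ∂μ =
        -∫ x, Dh x i * (φ j x * pd i ψ x) ∂μ := fun i => by
      have := hh.2.2.2.2 _ (htest i) i
      simpa only [grad_apply, pd_mul (hφ j).1 (contDiff_pd hψ.1 i)] using this
    have hi1 : ∀ i, Integrable (fun x => h x * (φ j x * pd i (pd i ψ) x + pd i ψ x * pd i (φ j) x))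
        μ := fun i => by
      have hc : Continuous (fun x => φ j x * pd i (pd i ψ) x + pd i ψ x * pd i (φ j) x) := ((hφ
        j).1.continuous.mul (contDiff_pd (contDiff_pd hψ.1 i) i).continuous).add ((contDiff_pd hψ.1
        i).continuous.mul (contDiff_pd (hφ j).1 i).continuous)
      have hs : HasCompactSupport (fun x => φ j x * pd i (pd i ψ) x + pd i ψ x * pd i (φ j) x) :=
        ((hφ j).2.1.mul_right).add ((hasCompactSupport_pd (hφ j).2.1 i).mul_left)
      obtain ⟨B, -, hB⟩ := exists_le hc hs
      exact hh.integrableOn.mul_bdd hc.aestronglyMeasurable (.of_forall hB)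
    have hi2 : ∀ i, Integrable (fun x => Dh x i * (φ j x * pd i ψ x)) μ := fun i => by
      obtain ⟨B, -, hB⟩ := (htest i).exists_bound
      exact integrable_coord_mul hh.integrableOn_grad (htest i).1.continuous hB i
    have hsum := sum_congr rfl fun i (_ : i ∈ (Finset.univ : Finset (Fin n))) => hw i
    rw [← integral_finsetSum _ fun i _ => hi1 i, sum_neg_distrib,
      ← integral_finsetSum _ fun i _ => hi2 i] at hsum
    have e2 : ∀ x, ∑ i, h x * (φ j x * pd i (pd i ψ) x + pd i ψ x * pd i (φ j) x) =
        φ j x * (h x * lapl ψ x) + h x * cdot (∇ (φ j) x) (∇ ψ x) := by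
      intro x; rw [lapl, cdot_grad_sum, mul_sum, mul_sum, mul_sum, ← sum_add_distrib]
      refine sum_congr rfl fun i _ => ?_; rw [grad_apply]; ring
    have e3 : ∀ x, ∑ i, Dh x i * (φ j x * pd i ψ x) = φ j x * cdot (Dh x) (∇ ψ x) := by
      intro x; rw [cdot_grad_sum, mul_sum]; exact sum_congr rfl fun i _ => by ring
    simp only [e2, e3] at hsum
    have k1 : Integrable (fun x => φ j x * (h x * lapl ψ x)) μ := (hφ2 j).integrable_mul m2b
    have k2 : Integrable (fun x => h x * cdot (∇ (φ j) x) (∇ ψ x)) μ := by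
      simp only [e1]; exact MemLp.integrable_cdot (hgφ2 j) m1
    have k3 : Integrable (fun x => φ j x * cdot (Dh x) (∇ ψ x)) μ := (hφ2 j).integrable_mul m2a
    rw [integral_add k1 k2] at hsum; simp only [mul_add]; rw [integral_add k3 k1]
    linear_combination hsum
  have l1 : Tendsto (fun j => ∫ x, h x * cdot (∇ (φ j) x) (∇ ψ x) ∂μ)
      atTop (𝓝 (∫ x, h x * cdot (Dz x) (∇ ψ x) ∂μ)) := by
    simp only [e1]
    exact tendsto_integral_bilin (b := cdot) norm_cdot_sub_cdot_le hDz.1 (fun j => (hgφ2 j).1) m1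
      (MemLp.integrable_cdot hDz m1) (fun j => MemLp.integrable_cdot (hgφ2 j) m1) h2
  have l2 := tendsto_integral_bilin (b := fun x y : ℂ => x * y) norm_mul_sub_mul_le hz.1
    (fun j => (hφ2 j).1) m2 (hz.integrable_mul m2) (fun j => (hφ2 j).integrable_mul m2) h1
  exact tendsto_nhds_unique (l1.congr hj) l2.neg

lemma IsH1.congr {f g : 𝔼 → ℂ} {Df Dg : 𝔼 → CSpace n} (h : IsH1 Ω f Df) (h1 : ∀ x, f x = g x)
    (h2 : ∀ x, Df x = Dg x) : IsH1 Ω g Dg := by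
  rwa [← funext h1, ← funext h2]

lemma IsTestFunction.isH1 {Ω U : Set 𝔼} (hΩ : MeasurableSet Ω) [IsFiniteMeasure vol Ω]
    {ψ : 𝔼 → ℂ} (hψ : IsTestFunction U ψ) : IsH1 Ω ψ (∇ ψ) := by
  obtain ⟨C, -, hC⟩ := hψ.exists_bound
  obtain ⟨C', -, hC'⟩ := exists_le (contDiff_grad hψ.1) (hasCompactSupport_grad hψ.2.1)
  refine (isH1_one.smooth_mul hΩ hψ.1 (C := max C C') (fun x _ => (hC x).trans (le_max_left _ _))
    (fun x _ => (hC' x).trans (le_max_right _ _))).congr (fun x => mul_one _) fun x => ?_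
  rw [smul_zero, zero_add, one_smul]

lemma IsH1.sub [IsFiniteMeasure vol Ω] {f g : 𝔼 → ℂ} {Df Dg : 𝔼 → CSpace n} (hf : IsH1 Ω f Df)
    (hg : IsH1 Ω g Dg) : IsH1 Ω (f - g) (Df - Dg) := by
  have h : IsH1 Ω (-g) (-Dg) := by
    refine ⟨hg.1.neg, hg.2.1.neg, hg.2.2.1.neg, hg.2.2.2.1.neg, fun φ hφ i => ?_⟩
    simp only [Pi.neg_apply, PiLp.neg_apply, neg_mul, integral_neg, hg.2.2.2.2 φ hφ i]
  rw [sub_eq_add_neg, sub_eq_add_neg]; exact hf.add h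

/-- The problem solved by the difference `z = u - v` of the solutions of the transmission
problem. -/
structure DifferenceProblem (K : Set (USphere n)) (ε k lam M : ℝ) (γ ρ : RSpace n → ℝ)
    (G : RSpace n → RSpace n) (z v : RSpace n → ℂ) (Dz Dv : RSpace n → CSpace n) : Prop where
  isOpen : IsOpen K
  eps_pos : 0 < ε
  lam_pos : 0 < lam
  M_nonneg : 0 ≤ M
  w1 : IsW1Bounded γ G M
  ell : ∀ᵐ x ∂vol (truncCone K ε), lam ≤ γ x
  rho_meas : AESM ρ volume
  rho_bound : ∀ᵐ x, |ρ x| ≤ M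
  z_mem : IsH1 (truncCone K ε) z Dz
  v_mem : MemLp v 2 vol (truncCone K ε)
  Dv_mem : MemLp Dv 2 vol (truncCone K ε)
  trace : HasZeroLateralTrace K ε z Dz
  eqn : ∀ (ψ : RSpace n → ℂ) (Dψ : RSpace n → CSpace n), IsH1 (truncCone K ε) ψ Dψ → VanishesNearCap
    K ε ψ → ∫ x in truncCone K ε, (ℂ(γ x) * cdot (Dz x) (Dψ x) - ℂ(k) ^ 2 * ℂ(ρ x) * z x * ψ x) = -∫
    x in truncCone K ε, (ℂ(γ x - 1) * cdot (Dv x) (Dψ x) - ℂ(k) ^ 2 * ℂ(ρ x - 1) * v x * ψ x)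

lemma integrable_fun_sub {α E : Type*} [MeasurableSpace α] {μ : Measure α} [NormedAddCommGroup E]
    {f g : α → E} (hf : Integrable f μ) (hg : Integrable g μ) : Integrable (fun x => f x - g x) μ := hf.sub hg

lemma integrable_mul_cdot {μ : Measure 𝔼} {c : 𝔼 → ℝ} {M : ℝ} (hc : AESM c μ)
    (hM : ∀ᵐ x ∂μ, |c x| ≤ M) {F H : 𝔼 → CSpace n} (hF : MemLp F 2 μ) (hH : MemLp H 2 μ) :
    Integrable (fun x => (c x : ℂ) * cdot (F x) (H x)) μ :=
  (MemLp.integrable_cdot hF hH).bdd_mul (continuous_ofReal.comp_aestronglyMeasurable hc)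
    (hM.mono fun x hx => by rwa [norm_real])

lemma integrable_mul_mul {μ : Measure 𝔼} {c : 𝔼 → ℝ} {M : ℝ} (hc : AESM c μ)
    (hM : ∀ᵐ x ∂μ, |c x| ≤ M) (a : ℂ) {f h : 𝔼 → ℂ} (hf : MemLp f 2 μ) (hh : MemLp h 2 μ) :
    Integrable (fun x => a * (c x : ℂ) * f x * h x) μ := by
  have h1 : Integrable (fun x => f x * h x) μ := hf.integrable_mul hh
  have h2 := (h1.bdd_mul (continuous_ofReal.comp_aestronglyMeasurable hc)
    (hM.mono fun x hx => by rwa [norm_real])).const_mul a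
  exact h2.congr (.of_forall fun x => by simp only; ring)

/-- The transmission problem yields the problem of the difference. -/
theorem LocalTransmission.differenceProblem {k lam M : ℝ} {γ ρ : 𝔼 → ℝ} {G : 𝔼 → 𝔼} {u v : 𝔼 → ℂ}
    {Du Dv : 𝔼 → CSpace n} (hK : IsOpen K) (hε : 0 < ε) (hlam : 0 < lam) (hM : 0 ≤ M)
    (hγ : IsW1Bounded γ G M) (hell : ∀ᵐ x ∂vol 𝒞, lam ≤ γ x) (hρm : AESM ρ volume)
    (hρ : ∀ᵐ x, |ρ x| ≤ M) (h : LocalTransmission k γ ρ K ε u v Du Dv) :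
    DifferenceProblem K ε k lam M γ ρ G (u - v) v (Du - Dv) Dv := by
  refine ⟨hK, hε, hlam, hM, hγ, hell, hρm, hρ, h.sol_u.1.sub h.sol_v.1, h.sol_v.1.1, h.sol_v.1.2.1,
    h.dirichlet, fun ψ Dψ hψ hcap => ?_⟩
  have h1 := h.conormal ψ Dψ hψ hcap; set μ := vol 𝒞 with hμ
  have b1 : ∀ᵐ x ∂μ, |γ x| ≤ M := ae_restrict_of_ae hγ.bound
  have b2 : ∀ᵐ x ∂μ, |ρ x| ≤ M := ae_restrict_of_ae hρ
  have b0 : ∀ᵐ x ∂μ, |(1 : 𝔼 → ℝ) x| ≤ 1 := .of_forall fun x => by simp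
  have m0 : AESM (1 : 𝔼 → ℝ) μ := aestronglyMeasurable_one; have m1 := hγ.meas.restrict (s := 𝒞)
  have m2 := hρm.restrict (s := 𝒞); have i1 := integrable_mul_cdot m1 b1 h.sol_u.1.2.1 hψ.2.1
  have i2 := integrable_mul_mul m2 b2 (ℂ(k) ^ 2) h.sol_u.1.1 hψ.1
  have i3 := integrable_mul_cdot m0 b0 h.sol_v.1.2.1 hψ.2.1
  have i4 := integrable_mul_mul m0 b0 (ℂ(k) ^ 2) h.sol_v.1.1 hψ.1
  have i5 := integrable_mul_cdot m1 b1 h.sol_v.1.2.1 hψ.2.1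
  have i6 := integrable_mul_mul m2 b2 (ℂ(k) ^ 2) h.sol_v.1.1 hψ.1; unfold energyForm at h1
  have e1 : ∀ x, ℂ(γ x) * cdot ((Du - Dv) x) (Dψ x) - ℂ(k) ^ 2 * ℂ(ρ x) * (u - v) x * ψ x =
      (ℂ(γ x) * cdot (Du x) (Dψ x) - ℂ(k) ^ 2 * ℂ(ρ x) * u x * ψ x)
      - (ℂ(γ x) * cdot (Dv x) (Dψ x) - ℂ(k) ^ 2 * ℂ(ρ x) * v x * ψ x) := fun x => by
    simp only [Pi.sub_apply, cdot_sub_left]; ring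
  have e2 : ∀ x, ℂ(γ x - 1) * cdot (Dv x) (Dψ x) - ℂ(k) ^ 2 * ℂ(ρ x - 1) * v x * ψ x =
      (ℂ(γ x) * cdot (Dv x) (Dψ x) - ℂ(k) ^ 2 * ℂ(ρ x) * v x * ψ x)
      - (ℂ((1 : 𝔼 → ℝ) x) * cdot (Dv x) (Dψ x)
        - ℂ(k) ^ 2 * ℂ((1 : 𝔼 → ℝ) x) * v x * ψ x) := fun x => by
    simp only [Pi.one_apply]; push_cast; ring
  simp only [e1, e2]
  rw [integral_sub (integrable_fun_sub i1 i2) (integrable_fun_sub i5 i6),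
    integral_sub (integrable_fun_sub i5 i6) (integrable_fun_sub i3 i4)]
  linear_combination h1

variable {k lam M : ℝ} {γ ρ : RSpace n → ℝ} {G : RSpace n → RSpace n} {z v L₂ : RSpace n → ℂ}
  {Dz Dv L₁ : RSpace n → CSpace n} {A B m₁ m₂ σ C : ℝ}
  (D : DifferenceProblem K ε k lam M γ ρ G z v Dz Dv)

lemma IsTestFunction.vanishesNearCap {ψ : 𝔼 → ℂ} (hψ : IsTestFunction (ball 0 ε) ψ) :
    VanishesNearCap K ε ψ := by
  obtain ⟨r, hr, h⟩ := exists_lt_subset_ball hψ.2.1.isCompact.isClosed hψ.2.2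
  refine ⟨r, hr, .of_forall fun x hx => ?_⟩; refine image_eq_zero_of_notMem_tsupport fun h' => ?_
  have := h h'; rw [mem_ball_zero_iff] at this; exact absurd this (not_lt.2 hx)

namespace DifferenceProblem

include D

lemma gamma_bound : ∀ᵐ x ∂vol 𝒞, |γ x| ≤ M := ae_restrict_of_ae D.w1.bound

lemma rho_bound' : ∀ᵐ x ∂vol 𝒞, |ρ x| ≤ M := ae_restrict_of_ae D.rho_bound

lemma measurableSet : MeasurableSet 𝒞 := (isOpen_truncCone D.isOpen ε).measurableSet

lemma gamma_mem : IsH1 𝒞 (fun x => ℂ(γ x)) (fun x => toC (G x)) := by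
  refine ((isH1_one).rpow_mul (isOpen_truncCone D.isOpen ε) D.w1 D.lam_pos D.ell 1).congr
    (fun x => ?_) fun x => ?_
  · simp
  · simp

/-- The weak formulation for smooth test functions, with all derivatives of `z` moved to the test
function. -/
theorem test_identity {ψ : 𝔼 → ℂ} (hψ : IsTestFunction (ball 0 ε) ψ) : ∫ x in 𝒞, z x *
    (ℂ(γ x) * lapl ψ x + cdot (toC (G x)) (∇ ψ x) + ℂ(k) ^ 2 * ℂ(ρ x) * ψ x) = ∫ x in 𝒞,
    (ℂ(γ x - 1) * cdot (Dv x) (∇ ψ x) - ℂ(k) ^ 2 * ℂ(ρ x - 1) * v x * ψ x) := by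
  have hH := hψ.isH1 (Ω := 𝒞) D.measurableSet; have h1 := D.eqn ψ _ hH hψ.vanishesNearCap
  have h2 := D.trace.integral_by_parts D.z_mem.1 D.z_mem.2.1 D.gamma_mem hψ
  have i1 := integrable_mul_cdot (D.w1.meas.restrict (s := 𝒞)) D.gamma_bound D.z_mem.2.1 hH.2.1
  have i2 := integrable_mul_mul (D.rho_meas.restrict (s := 𝒞)) D.rho_bound'
    (ℂ(k) ^ 2) D.z_mem.1 hH.1
  rw [integral_sub i1 i2, h2] at h1
  obtain ⟨C, -, hC⟩ := exists_le (contDiff_grad hψ.1) (hasCompactSupport_grad hψ.2.1)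
  obtain ⟨C', -, hC'⟩ := exists_le (contDiff_lapl hψ.1).continuous (hasCompactSupport_lapl hψ.2.1)
  have i3 : IntegrableOn (fun x => z x * (cdot (toC (G x)) (∇ ψ x) + ℂ(γ x) * lapl ψ x)) 𝒞 := by
    refine D.z_mem.integrableOn.mul_bdd (c := M * C + M * C') ?_ ?_
    · exact (aesm_cdot (continuous_toC.comp_aestronglyMeasurable
        D.w1.meas_grad.restrict) (contDiff_grad hψ.1).aestronglyMeasurable).add
        ((continuous_ofReal.comp_aestronglyMeasurable D.w1.meas.restrict).mul
          (contDiff_lapl hψ.1).continuous.aestronglyMeasurable)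
    · filter_upwards [D.gamma_bound, ae_restrict_of_ae D.w1.bound_grad] with x h3 h4
      refine (norm_add_le _ _).trans (add_le_add ?_ ?_)
      · refine (norm_cdot_le _ _).trans ?_; rw [norm_toC]
        exact mul_le_mul h4 (hC x) (norm_nonneg _) D.M_nonneg
      · rw [norm_mul, norm_real]; exact mul_le_mul h3 (hC' x) (norm_nonneg _) D.M_nonneg
  have e1 : ∀ x, z x * (ℂ(γ x) * lapl ψ x + cdot (toC (G x)) (∇ ψ x) + ℂ(k) ^ 2 * ℂ(ρ x) * ψ x) = z
    x * (cdot (toC (G x)) (∇ ψ x) + ℂ(γ x) * lapl ψ x) + ℂ(k) ^ 2 * ℂ(ρ x) * z x * ψ x := fun x =>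
    by ring
  simp only [e1]; rw [integral_add i3 i2]; linear_combination -h1

lemma veryWeakPoisson : VeryWeakPoisson (ball 0 ε) ((𝒞).indicator fun x => ℂ(γ x) * z x)
    ((𝒞).indicator fun x => ℂ(γ x - 1) • Dv x - z x • toC (G x))
    ((𝒞).indicator fun x => -(ℂ(k) ^ 2 * (ℂ(ρ x) * z x + ℂ(ρ x - 1) * v x))) := by
  intro b hb; have h := D.test_identity hb.ofReal; have hms := D.measurableSet; set Ω := 𝒞 with hΩ
  have e1 : ∀ x, ℂ(lapl b x) * Ω.indicator (fun x => ℂ(γ x) * z x) x =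
      Ω.indicator (fun x => ℂ(lapl b x) * (ℂ(γ x) * z x)) x := fun x => by
    by_cases hx : x ∈ Ω <;> simp [hx]
  have e2 : ∀ x, (∑ i, ℂ(pd i b x) * Ω.indicator (fun x => ℂ(γ x - 1) • Dv x - z x • toC (G x)) x i)
      + (b x : ℂ) * Ω.indicator (fun x => -(ℂ(k) ^ 2 * (ℂ(ρ x) * z x
      + ℂ(ρ x - 1) * v x))) x =
      Ω.indicator (fun x => (∑ i, ℂ(pd i b x) * (ℂ(γ x - 1) * Dv x i - z x * toC (G x) i))
      + (b x : ℂ) * -(ℂ(k) ^ 2 * (ℂ(ρ x) * z x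
      + ℂ(ρ x - 1) * v x))) x := fun x => by
    by_cases hx : x ∈ Ω <;> simp [hx]
  simp only [e1, e2]; rw [integral_indicator hms, integral_indicator hms]
  have hH := hb.ofReal.isH1 (Ω := Ω) hms
  obtain ⟨C, -, hC⟩ := exists_le (contDiff_grad hb.ofReal.1) (hasCompactSupport_grad hb.ofReal.2.1)
  obtain ⟨C0, -, hC0⟩ := hb.ofReal.exists_bound
  obtain ⟨C', -, hC'⟩ := exists_le (contDiff_lapl hb.ofReal.1).continuous
    (hasCompactSupport_lapl hb.ofReal.2.1)
  have mγ := continuous_ofReal.comp_aestronglyMeasurable (D.w1.meas.restrict (s := Ω))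
  have mρ := continuous_ofReal.comp_aestronglyMeasurable (D.rho_meas.restrict (s := Ω))
  have i1 : IntegrableOn (fun x => z x * (ℂ(γ x) * lapl (fun y => (b y : ℂ)) x)) Ω := by
    refine D.z_mem.integrableOn.mul_bdd (c := M * C')
      (mγ.mul (contDiff_lapl hb.ofReal.1).continuous.aestronglyMeasurable) ?_
    filter_upwards [D.gamma_bound] with x h3; rw [norm_mul, norm_real]
    exact mul_le_mul h3 (hC' x) (norm_nonneg _) D.M_nonneg
  have i2 : IntegrableOn (fun x => z x * (cdot (toC (G x)) (∇ (fun y => (b y : ℂ)) x)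
      + ℂ(k) ^ 2 * ℂ(ρ x) * (b x : ℂ))) Ω := by
    refine D.z_mem.integrableOn.mul_bdd (c := M * C + ‖ℂ(k) ^ 2‖ * M * C0) ((aesm_cdot
      (continuous_toC.comp_aestronglyMeasurable D.w1.meas_grad.restrict) (contDiff_grad
      hb.ofReal.1).aestronglyMeasurable).add ((mρ.const_mul _).mul
      hb.ofReal.1.continuous.aestronglyMeasurable)) ?_
    filter_upwards [D.rho_bound', ae_restrict_of_ae D.w1.bound_grad] with x h3 h4
    refine (norm_add_le _ _).trans (add_le_add ?_ ?_)
    · refine (norm_cdot_le _ _).trans ?_; rw [norm_toC]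
      exact mul_le_mul h4 (hC x) (norm_nonneg _) D.M_nonneg
    · rw [norm_mul, norm_mul, norm_real (ρ x)]
      exact mul_le_mul (mul_le_mul_of_nonneg_left h3 (norm_nonneg _)) (hC0 x) (norm_nonneg _)
        (mul_nonneg (norm_nonneg _) D.M_nonneg)
  have i3 : IntegrableOn (fun x => ℂ(γ x - 1) * cdot (Dv x) (∇ (fun y => (b y : ℂ)) x) - ℂ(k) ^ 2 *
    ℂ(ρ x - 1) * v x * (b x : ℂ)) Ω := (integrable_mul_cdot (M := M + 1) (D.w1.meas.restrict.sub
    aestronglyMeasurable_const) (D.gamma_bound.mono fun x hx => (abs_sub _ _).trans (by simpa using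
    hx)) D.Dv_mem hH.2.1).sub (integrable_mul_mul (M := M + 1) (D.rho_meas.restrict.sub
    aestronglyMeasurable_const) (D.rho_bound'.mono fun x hx => (abs_sub _ _).trans (by simpa using
    hx)) _ D.v_mem hH.1)
  have e3 : ∀ x, z x * (ℂ(γ x) * lapl (fun y => (b y : ℂ)) x + cdot (toC (G x)) (∇ (fun y => (b y :
    ℂ)) x) + ℂ(k) ^ 2 * ℂ(ρ x) * (b x : ℂ)) = z x * (ℂ(γ x) * lapl (fun y => (b y : ℂ)) x) + z x *
    (cdot (toC (G x)) (∇ (fun y => (b y : ℂ)) x) + ℂ(k) ^ 2 * ℂ(ρ x) * (b x : ℂ)) := fun x => by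
    ring
  simp only [e3] at h; rw [integral_add i1 i2, ← eq_sub_iff_add_eq, ← integral_sub i3 i2] at h
  refine Eq.trans ?_ (h.trans ?_)
  · refine integral_congr_ae (.of_forall fun x => ?_); simp only [lapl_ofReal hb.1]; ring
  · refine integral_congr_ae (.of_forall fun x => ?_)
    simp only [cdot, grad_apply, pd_ofReal hb.1, mul_sub, sum_sub_distrib,
      mul_sum, mul_add]
    have e4 : ∀ i, ℂ(γ x - 1) * (Dv x i * ℂ(pd i b x)) = ℂ(pd i b x) * (ℂ(γ x - 1) * Dv x i) := fun
      i => by ring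
    have e5 : ∀ i, z x * (toC (G x) i * ℂ(pd i b x)) = ℂ(pd i b x) * (z x * toC (G x) i) := fun i =>
      by ring
    simp only [e4, e5]; ring

end DifferenceProblem

lemma exists_rpow_mul_exp_neg_le (s : ℝ) (hs : 0 ≤ s) {c : ℝ} (hc : 0 < c) :
    ∃ C, 0 ≤ C ∧ ∀ y : ℝ, 0 ≤ y → y ^ s * exp (-(c * y)) ≤ C := by
  obtain ⟨N, hN⟩ := exists_nat_ge s
  refine ⟨1 + (c⁻¹) ^ N * N.factorial, by positivity, fun y hy => ?_⟩
  have h1 : y ^ s ≤ 1 + y ^ N := by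
    rcases le_total y 1 with h | h
    · exact (rpow_le_one hy h hs).trans (le_add_of_nonneg_right (by positivity))
    · rw [← rpow_natCast]
      exact (rpow_le_rpow_of_exponent_le h hN).trans (le_add_of_nonneg_left zero_le_one)
  have h2 := pow_div_factorial_le_exp (c * y) (by positivity) N
  rw [div_le_iff₀ (by positivity), mul_pow] at h2
  have h3 : y ^ N ≤ (c⁻¹) ^ N * N.factorial * exp (c * y) := by
    calc y ^ N = (c⁻¹) ^ N * (c ^ N * y ^ N) := by
          rw [← mul_assoc, ← mul_pow, inv_mul_cancel₀ hc.ne', one_pow, one_mul]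
      _ ≤ (c⁻¹) ^ N * (exp (c * y) * N.factorial) := by gcongr
      _ = _ := by ring
  have h4 : 1 ≤ exp (c * y) := one_le_exp (by positivity)
  rw [exp_neg, ← div_eq_mul_inv, div_le_iff₀ (exp_pos _), add_mul]; linarith

lemma lintegral_exp_tail {b : ℝ} (hb : 0 < b) (t : ℝ) :
    ∫⁻ r in Set.Ioi t, ofReal (b * exp (-(b * r))) = ofReal (exp (-(b * t))) := by
  have h1 : IntegrableOn (fun r : ℝ => b * exp (-(b * r))) (Set.Ioi t) := by
    have := (integrableOn_exp_mul_Ioi (neg_lt_zero.2 hb) t).const_mul b; simp only [neg_mul] at this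
    exact this
  rw [← ofReal_integral_eq_lintegral_ofReal h1 (.of_forall fun r => by positivity)]
  have h2 := integral_exp_mul_Ioi (neg_lt_zero.2 hb) t; simp only [neg_mul] at h2
  rw [integral_const_mul, h2]; congr 1; field_simp

/-- Laplace integrals of functions with controlled mass near the origin. -/
lemma lintegral_mul_exp_le {S : Set 𝔼} {g : 𝔼 → E} (hg : AESM g vol S) {q C : ℝ} (hq : 0 ≤ q)
    (hC : 0 ≤ C) (h : ∀ r, 0 < r → ∫⁻ x in ball 0 r, ‖g x‖ₑ ∂vol S ≤ ofReal (C * r ^ q)) {b : ℝ}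
    (hb : 0 < b) :
    ∫⁻ x in S, ‖g x‖ₑ * ofReal (exp (-(b * ‖x‖))) ≤ ofReal (C * Gamma (q + 1) * b ^ (-q)) := by
  set μ := vol S with hμ; set w : ℝ → ℝ≥0∞ := fun r => ofReal (b * exp (-(b * r))) with hw
  have hwm : Measurable w := by fun_prop
  have e1 : ∀ x : 𝔼, ‖g x‖ₑ * ofReal (exp (-(b * ‖x‖))) =
      ∫⁻ r in Set.Ioi 0, ‖g x‖ₑ * (Set.Ioi ‖x‖).indicator w r := by
    intro x
    rw [lintegral_const_mul _ (hwm.indicator measurableSet_Ioi), lintegral_indicator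
      measurableSet_Ioi, Measure.restrict_restrict measurableSet_Ioi,
      Set.inter_eq_left.2 (Set.Ioi_subset_Ioi (norm_nonneg x)), lintegral_exp_tail hb]
  simp only [e1]; rw [lintegral_lintegral_swap]
  · have e2 : ∀ r : ℝ, ∫⁻ x, ‖g x‖ₑ * (Set.Ioi ‖x‖).indicator w r ∂μ =
        (∫⁻ x in ball 0 r, ‖g x‖ₑ ∂μ) * w r := by
      intro r
      rw [← lintegral_mul_const' _ _ ENNReal.ofReal_ne_top, ← lintegral_indicator measurableSet_ball]
      refine lintegral_congr fun x => ?_; by_cases hx : ‖x‖ < r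
      · rw [indicator_of_mem (by exact hx), indicator_of_mem (by simpa using hx)]
      · rw [indicator_of_notMem (by exact hx), indicator_of_notMem (by simpa using hx), mul_zero]
    simp only [e2]
    have h1 : IntegrableOn (fun r : ℝ => C * b * (r ^ q * exp (-(b * r)))) (Set.Ioi 0) := by
      have := integrableOn_rpow_mul_exp_neg_mul_rpow (s := q) (p := 1) (b := b) (by linarith)
        one_pos hb
      simp only [rpow_one, neg_mul] at this; exact this.const_mul _
    calc ∫⁻ r in Set.Ioi 0, (∫⁻ x in ball 0 r, ‖g x‖ₑ ∂μ) * w r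
        ≤ ∫⁻ r in Set.Ioi 0, ofReal (C * b * (r ^ q * exp (-(b * r)))) := by
          refine setLIntegral_mono' measurableSet_Ioi fun r hr => ?_; have hr' : (0 : ℝ) < r := hr
          refine (mul_le_mul_left (h r hr) _).trans (le_of_eq ?_)
          rw [hw, ← ofReal_mul (by positivity)]; congr 1; ring
      _ = ofReal (∫ r in Set.Ioi 0, C * b * (r ^ q * exp (-(b * r)))) := by
          rw [ofReal_integral_eq_lintegral_ofReal h1]
          filter_upwards [ae_restrict_mem measurableSet_Ioi] with r hr; have hr' : (0 : ℝ) < r := hr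
          positivity
      _ = _ := by
          have h2 := integral_rpow_mul_exp_neg_mul_Ioi (a := q + 1) (r := b) (by linarith) hb
          rw [add_sub_cancel_right] at h2
          rw [integral_const_mul, h2, one_div, inv_rpow hb.le, ← rpow_neg hb.le, neg_add,
            rpow_add hb, rpow_neg_one]
          congr 1; field_simp
  · have hset : MeasurableSet {p : 𝔼 × ℝ | ‖p.1‖ < p.2} :=
      measurableSet_lt (measurable_norm.comp measurable_fst) measurable_snd
    have e3 : (Function.uncurry fun (x : 𝔼) (r : ℝ) => ‖g x‖ₑ * (Set.Ioi ‖x‖).indicator w r) =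
        fun p => ‖g p.1‖ₑ * ({p : 𝔼 × ℝ | ‖p.1‖ < p.2}.indicator (fun p => w p.2) p) := by
      funext p; rfl
    rw [e3]; exact (hg.comp_fst.enorm).mul ((hwm.comp measurable_snd).indicator hset).aemeasurable

/-- The decay `‖f‖ ≤ c r^m` in `L²` of the truncated cones of radius `r ≤ ε`. -/
abbrev L2Decay (K : Set (USphere n)) (ε : ℝ) (f : 𝔼 → E) (c m : ℝ) : Prop :=
  ∀ r, 0 < r → r ≤ ε → eLpNorm f 2 vol (truncCone K r) ≤ ofReal (c * r ^ m)

/-- Weighted integrals of functions with `L²` decay at the vertex. -/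
theorem exists_integral_norm_mul_exp_le (hε : 0 < ε) {g : 𝔼 → E} (hg : MemLp g 2 vol 𝒞)
    {e s C c : ℝ} (he : 0 ≤ e) (hs : 0 ≤ s) (hC : 0 ≤ C) (hc : 0 < c) (h : L2Decay K ε g C e) : ∃
    C', 0 ≤ C' ∧ ∀ τ, 0 < τ → ∫ x in 𝒞, ‖g x‖ * (‖x‖ ^ s * exp (-(c * (τ * ‖x‖)))) ≤ C' * τ ^
    (-(s + e + n / 2)) := by
  set vb := volume.real (ball (0 : 𝔼) 1) with hvb; have vbpos : 0 < vb := ball_real_pos n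
  set C2 := C * vb ^ ½ with hC2; set q : ℝ := e + n / 2 with hq; have hq0 : 0 ≤ q := by positivity
  have hball : ∀ r, 0 < r → ∫⁻ x in ball 0 r, ‖g x‖ₑ ∂vol 𝒞 ≤ ofReal (C2 * r ^ q) := by
    have hsmall : ∀ r, 0 < r → r ≤ ε → ∫⁻ x in truncCone K r, ‖g x‖ₑ ≤ ofReal (C2 * r ^ q) := by
      intro r hr hrε
      have hsub : truncCone K r ⊆ 𝒞 := inter_subset_inter_right _ (ball_subset_ball hrε)
      refine (lintegral_enorm_le (hg.1.mono_measure (Measure.restrict_mono hsub le_rfl))).trans ?_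
      rw [Measure.restrict_apply_univ]
      have h1 : volume (truncCone K r) ≤ ofReal (r ^ n * vb) :=
        (measure_mono inter_subset_right).trans (volume_ball_eq 0 hr).le
      have e1 : C * r ^ e * (r ^ n * vb) ^ ½ = C2 * r ^ q := by
        rw [mul_rpow (by positivity) vbpos.le, ← rpow_natCast, ← rpow_mul hr.le, hq,
          rpow_add hr, hC2, mul_one_div]
        ring
      calc _ ≤ ofReal (C * r ^ e) * (ofReal (r ^ n * vb)) ^ ½ := by
            gcongr; exact h r hr hrε
        _ = _ := by
          rw [ENNReal.ofReal_rpow_of_nonneg (by positivity) (by norm_num),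
            ← ofReal_mul (by positivity), e1]
    intro r hr; rw [Measure.restrict_restrict measurableSet_ball]
    rcases le_total r ε with hrε | hrε
    · refine le_trans (lintegral_mono_set fun x hx => ?_) (hsmall r hr hrε); exact ⟨hx.2.1, hx.1⟩
    · refine (lintegral_mono_set inter_subset_right).trans ((hsmall ε hε le_rfl).trans
        (ofReal_le_ofReal ?_))
      gcongr
  obtain ⟨Cs, hCs0, hCs⟩ := exists_rpow_mul_exp_neg_le s hs (half_pos hc)
  refine ⟨Cs * (C2 * Gamma (q + 1) * (c / 2) ^ (-q)), ?_, fun τ hτ => ?_⟩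
  · have := Gamma_pos_of_pos (by linarith : 0 < q + 1); positivity
  have hb : 0 < c / 2 * τ := by positivity
  have h1 := lintegral_mul_exp_le hg.1 hq0 (by positivity) hball hb
  have hGam := Gamma_pos_of_pos (by linarith : 0 < q + 1)
  have hgi : Integrable (fun x => ‖g x‖ * exp (-(c / 2 * τ * ‖x‖))) vol 𝒞 := by
    refine (hg.integrable (by norm_num)).norm.mul_bdd (c := 1) (by fun_prop)
      (.of_forall fun x => ?_)
    rw [norm_of_nonneg (exp_pos _).le]; exact exp_le_one_iff.2 (neg_nonpos.2 (by positivity))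
  have h2 : ∫ x in 𝒞, ‖g x‖ * exp (-(c / 2 * τ * ‖x‖)) ≤
      C2 * Gamma (q + 1) * (c / 2 * τ) ^ (-q) := by
    rw [← ENNReal.ofReal_le_ofReal_iff (by positivity),
      ofReal_integral_eq_lintegral_ofReal hgi (.of_forall fun x => by positivity)]
    refine le_trans (le_of_eq (lintegral_congr fun x => ?_)) h1
    rw [ofReal_mul (norm_nonneg _), ofReal_norm]
  have h3 : ∫ x in 𝒞, ‖g x‖ * (‖x‖ ^ s * exp (-(c * (τ * ‖x‖)))) ≤
      ∫ x in 𝒞, Cs * τ ^ (-s) * (‖g x‖ * exp (-(c / 2 * τ * ‖x‖))) := by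
    refine integral_mono_of_nonneg (.of_forall fun x => by positivity)
      (hgi.const_mul _) (.of_forall fun x => ?_)
    have h4 := hCs (τ * ‖x‖) (by positivity); rw [mul_rpow hτ.le (norm_nonneg _)] at h4
    have e1 : exp (-(c * (τ * ‖x‖))) = exp (-(c / 2 * (τ * ‖x‖))) * exp (-(c / 2 * τ * ‖x‖)) := by
      rw [← exp_add]; congr 1; ring
    have e2 : τ ^ (-s) * τ ^ s = 1 := by rw [← rpow_add hτ]; simp
    simp only; rw [e1]
    calc _ = ‖g x‖ * exp (-(c / 2 * τ * ‖x‖)) * (τ ^ (-s) *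
          (τ ^ s * ‖x‖ ^ s * exp (-(c / 2 * (τ * ‖x‖))))) := by
          linear_combination (-(‖g x‖ * ‖x‖ ^ s * exp (-(c / 2 * (τ * ‖x‖))) *
            exp (-(c / 2 * τ * ‖x‖)))) * e2
      _ ≤ ‖g x‖ * exp (-(c / 2 * τ * ‖x‖)) * (τ ^ (-s) * Cs) := by gcongr
      _ = _ := by ring
  refine h3.trans ?_; rw [integral_const_mul]
  calc _ ≤ Cs * τ ^ (-s) * (C2 * Gamma (q + 1) * (c / 2 * τ) ^ (-q)) := by gcongr
    _ = _ := by
      rw [mul_rpow (by positivity) hτ.le, show -(s + e + n / 2) = -s + -q by rw [hq]; ring,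
        rpow_add hτ]
      ring

lemma truncCone_mono {r s : ℝ} (h : r ≤ s) : truncCone K r ⊆ truncCone K s :=
  inter_subset_inter_right _ (ball_subset_ball h)

lemma truncCone_inter_ball {r : ℝ} (h : r ≤ ε) : 𝒞 ∩ ball 0 r = truncCone K r := by
  rw [truncCone, truncCone, Set.inter_assoc, Set.inter_eq_right.2 (ball_subset_ball h)]

lemma eLpNorm_indicator_truncCone (hK : MeasurableSet K) {r : ℝ} (h : r ≤ ε) (g : 𝔼 → E) :
    eLpNorm ((𝒞).indicator g) 2 vol (ball 0 r) = eLpNorm g 2 vol (truncCone K r) := by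
  have hm := meas_truncCone hK ε
  rw [eLpNorm_indicator_eq_eLpNorm_restrict hm, Measure.restrict_restrict hm,
    truncCone_inter_ball h]

lemma lintegral_rpow_norm_ball_le (hn : 0 < n) {m : ℝ} (hm : -(n : ℝ) < m) : ∃ C, 0 ≤ C ∧ ∀ r, 0
    < r → ∫⁻ x in ball (0 : 𝔼) r, ofReal (‖x‖ ^ m) ≤ ofReal (C * r ^ (n + m)) := by
  refine ⟨exp 1 * ∫ x : 𝔼, ‖x‖ ^ m * exp (-(1 * ‖x‖)),
    mul_nonneg (exp_pos _).le (integral_nonneg fun x => by positivity), fun r hr => ?_⟩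
  have h1 := integral_rpow_exp (n := n) m 1 (inv_pos.2 hr)
  have hi : Integrable (fun x : 𝔼 => ‖x‖ ^ m * exp (-(1 * (r⁻¹ * ‖x‖)))) := by
    have := integrable_rpow_exp hn hm (inv_pos.2 hr); simpa only [one_mul] using this
  calc ∫⁻ x in ball (0 : 𝔼) r, ofReal (‖x‖ ^ m) ≤ ∫⁻ x in ball (0 : 𝔼) r,
        ofReal (exp 1 * (‖x‖ ^ m * exp (-(1 * (r⁻¹ * ‖x‖))))) := by
        refine setLIntegral_mono' measurableSet_ball fun x hx => ofReal_le_ofReal ?_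
        have hx' : ‖x‖ < r := by simpa using hx
        have h2 : 1 ≤ exp 1 * exp (-(1 * (r⁻¹ * ‖x‖))) := by
          rw [← exp_add]; refine one_le_exp ?_
          have : r⁻¹ * ‖x‖ ≤ 1 := by
            rw [inv_mul_le_iff₀ hr]; linarith
          linarith
        calc ‖x‖ ^ m = ‖x‖ ^ m * 1 := (mul_one _).symm
          _ ≤ ‖x‖ ^ m * (exp 1 * exp (-(1 * (r⁻¹ * ‖x‖)))) := by gcongr
          _ = _ := by ring
    _ ≤ ∫⁻ x : 𝔼, ofReal (exp 1 * (‖x‖ ^ m * exp (-(1 * (r⁻¹ * ‖x‖))))) :=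
        setLIntegral_le_lintegral _ _
    _ = ofReal (∫ x : 𝔼, exp 1 * (‖x‖ ^ m * exp (-(1 * (r⁻¹ * ‖x‖))))) :=
        (ofReal_integral_eq_lintegral_ofReal (hi.const_mul _)
          (.of_forall fun x => by positivity)).symm
    _ = _ := by
        rw [integral_const_mul, h1, inv_rpow hr.le, ← rpow_neg hr.le, neg_neg]; congr 1; ring

lemma exists_eLpNorm_le_rpow (hn : 0 < n) {g : 𝔼 → E} (hg : MemLp g 2 vol 𝒞) {m C : ℝ}
    (h : ∀ᵐ x ∂vol 𝒞, ‖g x‖ ≤ C * ‖x‖ ^ m) : ∃ C', 0 ≤ C' ∧ L2Decay K ε g C' (max 0 (n / 2 + m)) := by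
  rcases le_or_gt (n / 2 + m) 0 with hm | hm
  · refine ⟨(eLpNorm g 2 vol 𝒞).toReal, ENNReal.toReal_nonneg, fun r _ hrε => ?_⟩
    rw [max_eq_left hm, rpow_zero, mul_one, ENNReal.ofReal_toReal hg.2.ne]
    exact eLpNorm_mono_measure _ (Measure.restrict_mono (truncCone_mono hrε) le_rfl)
  · obtain ⟨C1, hC10, hC1⟩ := lintegral_rpow_norm_ball_le hn (m := 2 * m) (by linarith)
    refine ⟨|C| * √C1, by positivity, fun r hr hrε => ?_⟩
    rw [max_eq_right hm.le, ← ENNReal.pow_le_pow_left_iff two_ne_zero, eLpNorm_two_sq,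
      ← ENNReal.ofReal_pow (by positivity)]
    have e1 : (|C| * √C1 * r ^ (n / 2 + m)) ^ 2 = |C| ^ 2 * (C1 * r ^ (n + 2 * m)) := by
      rw [mul_pow, mul_pow, sq_sqrt hC10, ← rpow_natCast (r ^ (n / 2 + m)) 2,
        ← rpow_mul hr.le, mul_assoc]
      congr 3; push_cast; ring
    rw [e1, ofReal_mul (by positivity)]
    calc ∫⁻ x in truncCone K r, ‖g x‖ₑ ^ 2
        ≤ ∫⁻ x in truncCone K r, ofReal (|C| ^ 2) * ofReal (‖x‖ ^ (2 * m)) := by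
          refine lintegral_mono_ae ?_
          filter_upwards [ae_restrict_of_ae_restrict_of_subset (truncCone_mono hrε) h] with x hx
          rw [← ofReal_mul (by positivity), ← ofReal_norm, ← ENNReal.ofReal_pow (norm_nonneg _)]
          refine ofReal_le_ofReal ?_
          have h2 : ‖g x‖ ≤ |C| * ‖x‖ ^ m := hx.trans (by gcongr; exact le_abs_self C)
          calc ‖g x‖ ^ 2 ≤ (|C| * ‖x‖ ^ m) ^ 2 := by gcongr
            _ = _ := by
              rw [mul_pow, ← rpow_natCast (‖x‖ ^ m) 2, ← rpow_mul (norm_nonneg _)]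
              congr 2; push_cast; ring
      _ = ofReal (|C| ^ 2) * ∫⁻ x in truncCone K r, ofReal (‖x‖ ^ (2 * m)) :=
          lintegral_const_mul' _ _ ENNReal.ofReal_ne_top
      _ ≤ ofReal (|C| ^ 2) * ofReal (C1 * r ^ (n + 2 * m)) := by
          gcongr; exact (lintegral_mono_set inter_subset_right).trans (hC1 r hr)

lemma memLp_ofReal_smul [NormedSpace ℂ F] {c : 𝔼 → ℝ} {f : 𝔼 → F} {C : ℝ} {μ : Measure 𝔼}
    (hf : MemLp f 2 μ) (hc : AESM c μ) (hC : ∀ᵐ x ∂μ, |c x| ≤ C) :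
    MemLp (fun x => (c x : ℂ) • f x) 2 μ := by
  refine hf.of_le_mul (c := C) ((continuous_ofReal.comp_aestronglyMeasurable hc).smul hf.1)
    (hC.mono fun x hx => ?_)
  rw [norm_smul, norm_real]; exact mul_le_mul_of_nonneg_right hx (norm_nonneg _)

namespace DifferenceProblem

include D

lemma gamma_sub_one_bound : ∀ᵐ x ∂vol 𝒞, |γ x - 1| ≤ M + 1 :=
  D.gamma_bound.mono fun x hx => (abs_sub _ _).trans (by simpa using hx)

lemma rho_sub_one_bound : ∀ᵐ x ∂vol 𝒞, |ρ x - 1| ≤ M + 1 :=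
  D.rho_bound'.mono fun x hx => (abs_sub _ _).trans (by simpa using hx)

lemma memLp_grad_data : MemLp (fun x => ℂ(γ x - 1) • Dv x) 2 vol 𝒞 :=
  memLp_ofReal_smul D.Dv_mem (D.w1.meas.restrict.sub aestronglyMeasurable_const)
    D.gamma_sub_one_bound

lemma memLp_pot_data : MemLp (fun x => ℂ(k) ^ 2 * (ℂ(ρ x - 1) * v x)) 2 vol 𝒞 :=
  MemLp.const_mul (memLp_ofReal_smul D.v_mem
    (D.rho_meas.restrict.sub aestronglyMeasurable_const) D.rho_sub_one_bound) _

lemma memLp_gamma_mul : MemLp (fun x => ℂ(γ x) * z x) 2 vol 𝒞 :=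
  memLp_ofReal_smul D.z_mem.1 D.w1.meas.restrict D.gamma_bound

lemma memLp_flux : MemLp (fun x => ℂ(γ x - 1) • Dv x - z x • toC (G x)) 2 vol 𝒞 :=
  D.memLp_grad_data.sub (memLp_smul_of_bound D.z_mem.1
    (continuous_toC.comp_aestronglyMeasurable D.w1.meas_grad.restrict)
    ((ae_restrict_of_ae D.w1.bound_grad).mono fun x hx => by rwa [norm_toC]))

lemma memLp_source : MemLp (fun x => -(ℂ(k) ^ 2 * (ℂ(ρ x) * z x + ℂ(ρ x - 1) * v x))) 2 vol 𝒞 := by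
  have h1 : MemLp (fun x => ℂ(ρ x) * z x) 2 vol 𝒞 :=
    memLp_ofReal_smul D.z_mem.1 D.rho_meas.restrict D.rho_bound'
  have h2 := ((h1.const_mul (ℂ(k) ^ 2)).add D.memLp_pot_data).neg
  refine (memLp_congr_ae (.of_forall fun x => ?_)).1 h2; simp only [Pi.neg_apply, Pi.add_apply]
  ring

lemma norm_z_le : ∀ᵐ x ∂vol 𝒞, ‖z x‖ ≤ lam⁻¹ * ‖ℂ(γ x) * z x‖ := by
  filter_upwards [D.ell] with x hx; have hl := D.lam_pos
  rw [norm_mul, norm_real, norm_of_nonneg (hl.le.trans hx), ← mul_assoc]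
  refine le_mul_of_one_le_left (norm_nonneg _) ?_; rw [inv_mul_eq_div, le_div_iff₀ hl, one_mul]
  exact hx

lemma ae_norm_flux_le : ∀ᵐ x ∂vol 𝒞, ‖ℂ(γ x - 1) • Dv x - z x • toC (G x)‖ ≤ M * lam⁻¹ * ‖ℂ(γ x)
    * z x‖ + ‖ℂ(γ x - 1) • Dv x‖ := by
  have hM := D.M_nonneg
  filter_upwards [D.norm_z_le, ae_restrict_of_ae D.w1.bound_grad] with x h1 h2
  refine (norm_sub_le _ _).trans ?_; rw [add_comm]; gcongr; rw [norm_smul, norm_toC, mul_comm]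
  calc ‖G x‖ * ‖z x‖ ≤ M * (lam⁻¹ * ‖ℂ(γ x) * z x‖) := by gcongr
    _ = _ := by ring

lemma ae_norm_source_le : ∀ᵐ x ∂vol 𝒞, ‖-(ℂ(k) ^ 2 * (ℂ(ρ x) * z x + ℂ(ρ x - 1) * v x))‖ ≤ k ^ 2
    * M * lam⁻¹ * ‖ℂ(γ x) * z x‖ + ‖ℂ(k) ^ 2 * (ℂ(ρ x - 1) * v x)‖ := by
  have hM := D.M_nonneg; filter_upwards [D.norm_z_le, D.rho_bound'] with x h1 h2
  rw [norm_neg, mul_add]; refine (norm_add_le _ _).trans ?_; gcongr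
  rw [norm_mul, norm_mul, norm_pow, norm_real, norm_real, norm_eq_abs, sq_abs]
  calc k ^ 2 * (|ρ x| * ‖z x‖) ≤ k ^ 2 * (M * (lam⁻¹ * ‖ℂ(γ x) * z x‖)) := by gcongr
    _ = _ := by ring

/-- Decay of the difference of the solutions at the vertex. -/
theorem exists_eLpNorm_le (hn : 0 < n) (hδ : 0 < δ) (hd : d ∈ 𝒟) {f g C : ℝ} (hf : 0 ≤ f)
    (hg : 0 ≤ g) (hF : L2Decay K ε (fun x => ℂ(γ x - 1) • Dv x) C f)
    (hG : L2Decay K ε (fun x => ℂ(k) ^ 2 * (ℂ(ρ x - 1) * v x)) C g) :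
    ∃ C', 0 ≤ C' ∧ L2Decay K ε z C' (min (f + 1) (g + 2)) := by
  have hM := D.M_nonneg; have hl := D.lam_pos; have hms := D.measurableSet
  have hKm := D.isOpen.measurableSet; set Ω := 𝒞 with hΩ; set E := min (f + 1) (g + 2) with hE
  obtain ⟨N, hN⟩ := exists_nat_gt E; set C2 := max C (M * lam⁻¹ + k ^ 2 * M * lam⁻¹) with hC2
  have hC20 : 0 ≤ C2 := le_max_of_le_right (by positivity)
  have hball : ∀ {E : Type} [NormedAddCommGroup E] {g : 𝔼 → E} {c e : ℝ},
      (L2Decay K ε g C e) → ∀ c ∈ ({0} : Set 𝔼), ∀ r, 0 < r → r ≤ ε →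
      eLpNorm (Ω.indicator fun x => ‖g x‖) 2 vol (ball c r) ≤ ofReal (C2 * r ^ e) := by
    intro E _ g c e h c hc r hr hrε
    rw [Set.mem_singleton_iff.1 hc, hΩ, eLpNorm_indicator_truncCone hKm hrε, eLpNorm_norm]
    refine (h r hr hrε).trans (ofReal_le_ofReal ?_); gcongr; exact le_max_left _ _
  obtain ⟨C1, hC10, hC1⟩ := eLpNorm_decay (R0 := ε) (f := f) (g := g) (E := E)
    (C := C2) (F0 := Ω.indicator fun x => ‖ℂ(γ x - 1) • Dv x‖)
    (G0 := Ω.indicator fun x => ‖ℂ(k) ^ 2 * (ℂ(ρ x - 1) * v x)‖) (d := d)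
    (Y := Ω.indicator fun x => ℂ(γ x) * z x)
    (F := Ω.indicator fun x => ℂ(γ x - 1) • Dv x - z x • toC (G x))
    (G := Ω.indicator fun x => -(ℂ(k) ^ 2 * (ℂ(ρ x) * z x + ℂ(ρ x - 1) * v x)))
    (Cs := {0}) hn N D.eps_pos (by positivity) (min_le_left _ _) (min_le_right _ _)
    (by have : (0 : ℝ) ≤ n / 2 := by positivity
        linarith) hC20 (by simp)
    ((integrable_indicator_iff hms).2 (D.memLp_gamma_mul.integrable (by norm_num)))
    ((integrable_indicator_iff hms).2 (D.memLp_flux.integrable (by norm_num)))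
    ((integrable_indicator_iff hms).2 (D.memLp_source.integrable (by norm_num)))
    ((memLp_indicator_iff_restrict hms).2 D.memLp_gamma_mul)
    (fun c hc => by rw [Set.mem_singleton_iff.1 hc]; exact D.veryWeakPoisson)
    (fun c hc => Or.inr fun y hy => by
      rw [Set.mem_singleton_iff.1 hc, sub_zero] at hy; refine indicator_of_notMem (fun hyΩ => ?_) _
      have h1 := le_inner_of_mem_cone hd hyΩ.1; have h2 := mul_pos hδ (norm_pos_of_mem hyΩ.1)
      linarith)
    (by
      filter_upwards [(ae_restrict_iff' hms).1 D.ae_norm_flux_le] with x hx; by_cases hxΩ : x ∈ Ω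
      · simp only [indicator_of_mem hxΩ]; refine (hx hxΩ).trans ?_; gcongr
        exact le_trans (le_add_of_nonneg_right (by positivity)) (le_max_right _ _)
      · simp [indicator_of_notMem hxΩ])
    (by
      filter_upwards [(ae_restrict_iff' hms).1 D.ae_norm_source_le] with x hx; by_cases hxΩ : x ∈ Ω
      · simp only [indicator_of_mem hxΩ]; refine (hx hxΩ).trans ?_; gcongr
        exact le_trans (le_add_of_nonneg_left (by positivity)) (le_max_right _ _)
      · simp [indicator_of_notMem hxΩ])
    ((aestronglyMeasurable_indicator_iff hms).2 D.memLp_grad_data.1.norm)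
    ((aestronglyMeasurable_indicator_iff hms).2 D.memLp_pot_data.1.norm)
    (hball (c := 0) hF) (hball (c := 0) hG)
  refine ⟨lam⁻¹ * C1, by positivity, fun r hr hrε => ?_⟩; have h1 := hC1 0 rfl r hr hrε
  rw [hΩ, eLpNorm_indicator_truncCone hKm hrε] at h1
  calc eLpNorm z 2 vol (truncCone K r)
      ≤ ofReal lam⁻¹ * eLpNorm (fun x => ℂ(γ x) * z x) 2 vol (truncCone K r) :=
        eLpNorm_le_mul_eLpNorm_of_ae_le_mul (ae_restrict_of_ae_restrict_of_subset (truncCone_mono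
        hrε) D.norm_z_le) _
    _ ≤ ofReal lam⁻¹ * ofReal (C1 * r ^ E) := by gcongr
    _ = _ := by rw [← ofReal_mul (by positivity)]; ring_nf

/-- The difference of the solutions is bounded if the data are bounded. -/
theorem ae_bounded (hn : 0 < n) {C : ℝ} (hC : 0 ≤ C) (hF : ∀ᵐ x ∂vol 𝒞, ‖ℂ(γ x - 1) • Dv x‖ ≤ C)
    (hG : ∀ᵐ x ∂vol 𝒞, ‖ℂ(k) ^ 2 * (ℂ(ρ x - 1) * v x)‖ ≤ C) :
    ∃ C', 0 ≤ C' ∧ ∀ᵐ x ∂vol 𝒞, ‖x‖ ≤ ε / 2 → ‖z x‖ ≤ C' := by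
  have hM := D.M_nonneg; have hl := D.lam_pos; have hms := D.measurableSet; set Ω := 𝒞 with hΩ
  set C2 := max C (M * lam⁻¹ + k ^ 2 * M * lam⁻¹) with hC2
  have hC20 : 0 ≤ C2 := le_max_of_le_left hC
  obtain ⟨M', hM'⟩ := ae_bounded_of_veryWeakPoisson (R0 := ε) (C := C2)
    (Y := Ω.indicator fun x => ℂ(γ x) * z x)
    (F := Ω.indicator fun x => ℂ(γ x - 1) • Dv x - z x • toC (G x))
    (G := Ω.indicator fun x => -(ℂ(k) ^ 2 * (ℂ(ρ x) * z x + ℂ(ρ x - 1) * v x)))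
    hn D.eps_pos hC20
    ((integrable_indicator_iff hms).2 (D.memLp_gamma_mul.integrable (by norm_num)))
    ((integrable_indicator_iff hms).2 (D.memLp_flux.integrable (by norm_num)))
    ((integrable_indicator_iff hms).2 (D.memLp_source.integrable (by norm_num)))
    ((memLp_indicator_iff_restrict hms).2 D.memLp_gamma_mul) D.veryWeakPoisson
    (by
      filter_upwards [(ae_restrict_iff' hms).1 D.ae_norm_flux_le, (ae_restrict_iff' hms).1 hF]
        with x hx hx'
      by_cases hxΩ : x ∈ Ω
      · simp only [indicator_of_mem hxΩ]
        refine (hx hxΩ).trans (add_le_add ?_ ((hx' hxΩ).trans (le_max_left _ _))); gcongr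
        exact le_trans (le_add_of_nonneg_right (by positivity)) (le_max_right _ _)
      · simp [indicator_of_notMem hxΩ, hC20])
    (by
      filter_upwards [(ae_restrict_iff' hms).1 D.ae_norm_source_le, (ae_restrict_iff' hms).1 hG]
        with x hx hx'
      by_cases hxΩ : x ∈ Ω
      · simp only [indicator_of_mem hxΩ]
        refine (hx hxΩ).trans (add_le_add ?_ ((hx' hxΩ).trans (le_max_left _ _))); gcongr
        exact le_trans (le_add_of_nonneg_left (by positivity)) (le_max_right _ _)
      · simp [indicator_of_notMem hxΩ, hC20])
  refine ⟨lam⁻¹ * |M'|, by positivity, ?_⟩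
  filter_upwards [D.norm_z_le, ae_restrict_of_ae hM', ae_restrict_mem hms] with x h1 h2 hxΩ hx
  have h3 := h2 hx; rw [indicator_of_mem hxΩ] at h3; refine h1.trans ?_; gcongr
  exact h3.trans (le_abs_self _)

end DifferenceProblem

lemma lapl_mul {φ ψ : 𝔼 → ℂ} (hφ : ContDiff ℝ ∞ φ) (hψ : ContDiff ℝ ∞ ψ) (x : 𝔼) :
    lapl (fun y => φ y * ψ y) x = φ x * lapl ψ x + ψ x * lapl φ x + 2 * cdot (∇ φ x) (∇ ψ x) := by
  unfold lapl cdot; rw [mul_sum, mul_sum, mul_sum, ← sum_add_distrib, ← sum_add_distrib]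
  refine sum_congr rfl fun i _ => ?_
  have h1 : pd i (fun y => φ y * ψ y) = fun y => φ y * pd i ψ y + ψ y * pd i φ y :=
    funext (pd_mul hφ hψ i)
  have hd : ∀ {g : 𝔼 → ℂ}, ContDiff ℝ ∞ g → Differentiable ℝ g :=
    fun h => h.differentiable (by simp)
  have h2 : pd i (fun y => φ y * pd i ψ y + ψ y * pd i φ y) x =
      pd i (fun y => φ y * pd i ψ y) x + pd i (fun y => ψ y * pd i φ y) x := by
    rw [pd, fderiv_fun_add (hd (hφ.mul (contDiff_pd hψ i)) x) (hd (hψ.mul (contDiff_pd hφ i)) x)]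
    rfl
  rw [h1, h2, pd_mul hφ (contDiff_pd hψ i), pd_mul hψ (contDiff_pd hφ i)]
  have e1 : ∇ φ x i = pd i φ x := rfl; have e2 : ∇ ψ x i = pd i ψ x := rfl; rw [e1, e2]; ring

lemma pd_cexpDot (η : CSpace n) (i : Fin n) (x : 𝔼) : pd i (cexpDot η) x = η i * cexpDot η x := by
  have h1 : ∀ j : Fin n, HasFDerivAt (fun x : 𝔼 => η j * (x j : ℂ)) (η j • (ofRealCLM.comp (pr ℝ
    j))) x := fun j => ((ofRealCLM.hasFDerivAt.comp x (pr ℝ j).hasFDerivAt).const_mul (η j))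
  have h2 : HasFDerivAt (fun x : 𝔼 => ∑ j, η j * (x j : ℂ)) (∑ j, η j • (ofRealCLM.comp (pr ℝ j))) x
    := HasFDerivAt.fun_sum fun j _ => h1 j
  have h3 : HasFDerivAt (cexpDot η) _ x := h2.cexp; rw [pd, h3.fderiv]
  simp [cexpDot, mul_comm, apply_ite Complex.ofReal]

lemma grad_cexpDot (η : CSpace n) (x : 𝔼) : ∇ (cexpDot η) x = cexpDot η x • η := by
  ext i; have h : ∇ (cexpDot η) x i = pd i (cexpDot η) x := rfl; rw [h, pd_cexpDot]; simp [mul_comm]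

lemma lapl_cexpDot {η : CSpace n} (h : cdot η η = 0) (x : 𝔼) : lapl (cexpDot η) x = 0 := by
  have h1 : ∀ i, pd i (pd i (cexpDot η)) x = cexpDot η x * (η i * η i) := fun i => by
    have : pd i (cexpDot η) = fun y => η i * cexpDot η y := funext (pd_cexpDot η i)
    rw [this, pd_mul contDiff_const (contDiff_cexpDot η), pd_cexpDot]
    have h0 : pd i (fun _ : 𝔼 => η i) x = 0 := by simp [pd]
    rw [h0]; ring
  rw [lapl, sum_congr rfl fun i _ => h1 i, ← mul_sum]
  rw [show ∑ i, η i * η i = cdot η η from rfl, h, mul_zero]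

/-- A cutoff function at the vertex whose derivatives vanish there to order `N`. -/
structure IsCutoff (ε N C : ℝ) (χ : RSpace n → ℂ) : Prop where
  test : IsTestFunction (ball 0 ε) χ
  norm_le_one : ∀ x, ‖χ x‖ ≤ 1
  norm_sub_le : ∀ x, ‖χ x - 1‖ ≤ C * ‖x‖ ^ N
  norm_grad_le : ∀ x, ‖∇ χ x‖ ≤ C * ‖x‖ ^ N
  norm_lapl_le : ∀ x, ‖lapl χ x‖ ≤ C * ‖x‖ ^ N
  grad_eq_zero : ∀ x, ε / 2 < ‖x‖ → ∇ χ x = 0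
  lapl_eq_zero : ∀ x, ε / 2 < ‖x‖ → lapl χ x = 0

lemma exists_isCutoff (n : ℕ) (hε : 0 < ε) {N : ℝ} (hN : 0 ≤ N) :
    ∃ (χ : RSpace n → ℂ) (C : ℝ), 0 ≤ C ∧ IsCutoff ε N C χ := by
  let b : ContDiffBump (0 : RSpace n) := ⟨ε / 4, ε / 2, by positivity, by linarith⟩
  set χ : RSpace n → ℂ := fun x => (b x : ℂ) with hχ
  have hb : IsTestFunction (ball 0 ε) (fun x => b x) :=
    ⟨b.contDiff, b.hasCompactSupport, by
      rw [b.tsupport_eq]; exact closedBall_subset_ball (by change ε / 2 < ε; linarith)⟩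
  have ht : IsTestFunction (ball 0 ε) χ := hb.ofReal
  have hsup : tsupport χ ⊆ closedBall 0 (ε / 2) := by
    refine (closure_mono (Function.support_comp_subset (g := fun t : ℝ => (t : ℂ)) (by simp)
      (fun x => b x))).trans ?_
    exact b.tsupport_eq.subset
  have hout : ∀ x, ε / 2 < ‖x‖ → x ∉ tsupport χ := fun x hx h => by
    have := hsup h; rw [mem_closedBall_zero_iff] at this; linarith
  obtain ⟨C1, hC10, hC1⟩ := exists_le (contDiff_grad ht.1) (hasCompactSupport_grad ht.2.1)
  obtain ⟨C2, hC20, hC2⟩ := exists_le (contDiff_lapl ht.1).continuous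
    (hasCompactSupport_lapl ht.2.1)
  have hle : ∀ x, ‖χ x‖ ≤ 1 := fun x => by
    simp only [hχ]; rw [norm_real, norm_of_nonneg b.nonneg]; exact b.le_one
  have hin : ∀ x, ‖x‖ < ε / 4 → χ =ᶠ[𝓝 x] fun _ => 1 := fun x hx => by
    filter_upwards [isOpen_ball.mem_nhds (show x ∈ ball (0 : RSpace n) (ε / 4) by
      simpa using hx)] with y hy
    simp only [hχ]; rw [b.one_of_mem_closedBall (ball_subset_closedBall hy), Complex.ofReal_one]
  have hgrad : ∀ x, ‖x‖ < ε / 4 → ∇ χ x = 0 := fun x hx => by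
    ext i; have h1 : ∇ χ x i = pd i χ x := rfl; rw [h1, pd, (hin x hx).fderiv_eq]; simp
  have hlap : ∀ x, ‖x‖ < ε / 4 → lapl χ x = 0 := fun x hx => by
    refine sum_eq_zero fun i _ => ?_
    have h1 : pd i χ =ᶠ[𝓝 x] fun _ => 0 := by
      filter_upwards [isOpen_ball.mem_nhds (show x ∈ ball (0 : RSpace n) (ε / 4) by
        simpa using hx)] with y hy
      have := congrArg (fun w : CSpace n => w i) (hgrad y (by simpa using hy)); exact this
    rw [pd, h1.fderiv_eq]; simp
  set C := (2 + C1 + C2) * (ε / 4) ^ (-N) with hC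
  have key : ∀ (t : ℝ) (x : RSpace n), t ≤ 2 + C1 + C2 → (‖x‖ < ε / 4 → t = 0) →
      t ≤ C * ‖x‖ ^ N := by
    intro t x ht0 ht1; rcases lt_or_ge ‖x‖ (ε / 4) with h | h
    · rw [ht1 h]; positivity
    · have h2 : 1 ≤ (ε / 4) ^ (-N) * ‖x‖ ^ N := by
        rw [rpow_neg (by positivity), inv_mul_eq_div, le_div_iff₀ (by positivity), one_mul]
        exact rpow_le_rpow (by positivity) h hN
      calc t ≤ (2 + C1 + C2) * 1 := by rw [mul_one]; exact ht0
        _ ≤ (2 + C1 + C2) * ((ε / 4) ^ (-N) * ‖x‖ ^ N) := by gcongr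
        _ = _ := by rw [hC]; ring
  refine ⟨χ, C, by positivity, ht, hle, fun x => key _ x ?_ fun h => ?_, fun x => key _ x ?_
    fun h => ?_, fun x => key _ x ?_ fun h => ?_, fun x hx => ?_, fun x hx => ?_⟩
  · refine (norm_sub_le _ _).trans ?_; rw [norm_one]; linarith [hle x]
  · rw [(hin x h).self_of_nhds, sub_self, norm_zero]
  · linarith [hC1 x]
  · rw [hgrad x h, norm_zero]
  · linarith [hC2 x]
  · rw [hlap x h, norm_zero]
  · ext i; exact pd_eq_zero (hout x hx) i
  · exact lapl_eq_zero (hout x hx)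

variable {N C : ℝ} {χ : RSpace n → ℂ}

lemma IsCutoff.grad_mul_cexpDot (h : IsCutoff ε N C χ) (η : CSpace n) (x : 𝔼) :
    ∇ (fun y => χ y * cexpDot η y) x = cexpDot η x • (χ x • η + ∇ χ x) := by
  rw [grad_mul h.test.1 (contDiff_cexpDot η), grad_cexpDot, smul_add, smul_smul,
    smul_smul, mul_comm]

lemma IsCutoff.lapl_mul_cexpDot (h : IsCutoff ε N C χ) {η : CSpace n} (hη : cdot η η = 0)
    (x : 𝔼) : lapl (fun y => χ y * cexpDot η y) x = cexpDot η x * (lapl χ x + 2 * cdot (∇ χ x) η) := by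
  rw [lapl_mul h.test.1 (contDiff_cexpDot η), lapl_cexpDot hη, grad_cexpDot,
    cdot_smul_right]
  ring

lemma IsCutoff.test_mul_cexpDot (h : IsCutoff ε N C χ) (η : CSpace n) :
    IsTestFunction (ball 0 ε) (fun y => χ y * cexpDot η y) :=
  ⟨h.test.1.mul (contDiff_cexpDot η), h.test.2.1.mul_right,
    (tsupport_mul_subset_left).trans h.test.2.2⟩

section Rate

/-- Sums of four powers with nonnegative coefficients. -/
def rate (p q r a b c e τ : ℝ) : ℝ := p * τ ^ (-a) + q * τ ^ (-b) + r * τ ^ (-c) + τ ^ (-e)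

variable {p q r a b c e : ℝ} {f : ℝ → E}

lemma isBigO_const_mul_rpow (p t : ℝ) : (fun τ : ℝ => p * τ ^ t) =𝒪 t :=
  (isBigO_refl (fun τ : ℝ => τ ^ t) atTop).const_mul_left p

lemma isBigO_rpow_mul {p : ℝ} (hp : p ≠ 0) (t : ℝ) :
    (fun τ : ℝ => τ ^ t) =O[atTop] fun τ : ℝ => p * τ ^ t :=
  (isBigO_const_mul_right_iff' (isUnit_iff_ne_zero.2 hp)).2 (isBigO_refl _ _)

lemma isBigO_of_le {f g : ℝ → ℝ} (h : ∀ᶠ τ in atTop, 0 ≤ f τ ∧ f τ ≤ g τ) : f =O[atTop] g := by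
  refine IsBigO.of_bound 1 (h.mono fun τ hτ => ?_)
  rw [one_mul, norm_of_nonneg hτ.1, norm_of_nonneg (hτ.1.trans hτ.2)]; exact hτ.2

variable (hp : 0 ≤ p) (hq : 0 ≤ q) (hr : 0 ≤ r)

include hp hq hr in
lemma isBigO_rate : (fun τ : ℝ => p * τ ^ (-a)) =O[atTop] rate p q r a b c e ∧
    (fun τ : ℝ => q * τ ^ (-b)) =O[atTop] rate p q r a b c e ∧
    (fun τ : ℝ => r * τ ^ (-c)) =O[atTop] rate p q r a b c e ∧
    (fun τ : ℝ => τ ^ (-e)) =O[atTop] rate p q r a b c e := by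
  refine ⟨isBigO_of_le ?_, isBigO_of_le ?_, isBigO_of_le ?_, isBigO_of_le ?_⟩
  all_goals
    filter_upwards [eventually_gt_atTop 0] with τ hτ; have h1 : 0 ≤ p * τ ^ (-a) := by positivity
    have h2 : 0 ≤ q * τ ^ (-b) := by positivity
    have h3 : 0 ≤ r * τ ^ (-c) := by positivity
    have h4 : 0 ≤ τ ^ (-e) := by positivity
    exact ⟨by assumption, by rw [rate]; linarith⟩

lemma rate_isBigO {g : ℝ → E} (h1 : (fun τ : ℝ => p * τ ^ (-a)) =O[atTop] g)
    (h2 : (fun τ : ℝ => q * τ ^ (-b)) =O[atTop] g) (h3 : (fun τ : ℝ => r * τ ^ (-c)) =O[atTop] g)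
    (h4 : (fun τ : ℝ => τ ^ (-e)) =O[atTop] g) : rate p q r a b c e =O[atTop] g :=
  ((h1.add h2).add h3).add h4

end Rate

section Estimates

variable [NormedSpace ℝ E]

lemma isBigO_integral_of_ae_le_add (hn : 0 < n) {S : Set 𝔼} {m m' c s A C : ℝ}
    (hm : A ≠ 0 → -(n : ℝ) < m) (hm' : -(n : ℝ) < m') (hc : 0 < c) (hA : 0 ≤ A) (hC : 0 ≤ C)
    {g : ℝ → 𝔼 → E} (h : ∀ᶠ τ in atTop, ∀ᵐ x ∂vol S, ‖g τ x‖ ≤ C * τ ^ s * ((A * ‖x‖ ^ m + ‖x‖ ^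
    m') * exp (-(c * (τ * ‖x‖))))) :
    (fun τ => ∫ x in S, g τ x) =O[atTop] fun τ : ℝ => A * τ ^ (s - (n + m)) + τ ^ (s - (n + m')) := by
  set J := fun m : ℝ => ∫ x : 𝔼, ‖x‖ ^ m * exp (-(c * ‖x‖)) with hJ
  have hJ0 : ∀ m, 0 ≤ J m := fun m => integral_nonneg fun x => by positivity
  refine IsBigO.of_bound (C * (J m + J m')) ?_
  filter_upwards [h, eventually_gt_atTop 0] with τ h1 hτ
  have hi : ∀ {m : ℝ}, -(n : ℝ) < m →
      Integrable (fun x : 𝔼 => ‖x‖ ^ m * exp (-(c * (τ * ‖x‖)))) := fun hm => by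
    have := integrable_rpow_exp hn hm (mul_pos hc hτ); simpa only [mul_assoc] using this
  have hi' : Integrable (fun x : 𝔼 => A * (‖x‖ ^ m * exp (-(c * (τ * ‖x‖))))) := by
    by_cases hA0 : A = 0
    · simp [hA0]
    · exact (hi (hm hA0)).const_mul A
  have h2 : ∀ᵐ x ∂vol S, ‖g τ x‖ ≤ C * τ ^ s * (A * (‖x‖ ^ m * exp (-(c * (τ * ‖x‖)))) + ‖x‖ ^ m' *
    exp (-(c * (τ * ‖x‖)))) := h1.mono fun x hx => hx.trans (le_of_eq (by ring))
  refine (norm_integral_le_of_norm_le (((hi'.add (hi hm')).const_mul _).integrableOn) h2).trans ?_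
  refine (setIntegral_le_integral ((hi'.add (hi hm')).const_mul _)
    (.of_forall fun x => by simp only [Pi.zero_apply, Pi.add_apply]; positivity)).trans ?_
  simp only [Pi.add_apply]
  rw [integral_const_mul, integral_add hi' (hi hm'), integral_const_mul, integral_rpow_exp _ _ hτ,
    integral_rpow_exp _ _ hτ, norm_of_nonneg (by positivity), sub_eq_add_neg, sub_eq_add_neg,
    rpow_add hτ, rpow_add hτ]
  have h3 := hJ0 m; have h4 := hJ0 m'
  have e1 : 0 ≤ C * J m' * (τ ^ s * (A * τ ^ (-((n : ℝ) + m)))) := by positivity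
  have e2 : 0 ≤ C * J m * (τ ^ s * τ ^ (-((n : ℝ) + m'))) := by positivity
  simp only [hJ] at e1 e2 ⊢; linarith

/-- Integrals of functions with a pointwise bound by a decaying exponential. -/
lemma isBigO_integral_of_ae_le (hn : 0 < n) {S : Set 𝔼} {m c s C : ℝ} (hm : -(n : ℝ) < m)
    (hc : 0 < c) (hC : 0 ≤ C) {g : ℝ → 𝔼 → E}
    (h : ∀ᶠ τ in atTop, ∀ᵐ x ∂vol S, ‖g τ x‖ ≤ C * τ ^ s * (‖x‖ ^ m * exp (-(c * (τ * ‖x‖))))) :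
    (fun τ => ∫ x in S, g τ x) =𝒪 (s - (n + m)) := by
  simpa using isBigO_integral_of_ae_le_add (A := 0) (m := 0) hn (absurd rfl) hm hc le_rfl hC
    (by simpa using h)

lemma integrableOn_mul_weight {g : 𝔼 → ℝ} (hg : IntegrableOn g 𝒞)
    {m c τ : ℝ} (hm : 0 ≤ m) (hc : 0 ≤ c) (hτ : 0 ≤ τ) :
    IntegrableOn (fun x => g x * (‖x‖ ^ m * exp (-(c * (τ * ‖x‖))))) 𝒞 := by
  refine hg.mul_bdd (c := ε ^ m)
    (((measurable_norm.pow_const m).mul (by fun_prop)).aestronglyMeasurable) ?_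
  filter_upwards [ae_restrict_of_ae_restrict_of_subset (inter_subset_right : 𝒞 ⊆ _)
    (ae_restrict_mem measurableSet_ball)] with x hx
  rw [norm_of_nonneg (by positivity)]
  refine (mul_le_of_le_one_right (by positivity) (exp_le_one_iff.2 ?_)).trans
    (rpow_le_rpow (norm_nonneg _) (mem_ball_zero_iff.1 hx).le hm)
  have : 0 ≤ c * (τ * ‖x‖) := by positivity
  linarith

lemma isBigO_integral_norm_mul (hε : 0 < ε) {z : 𝔼 → F} (hz : MemLp z 2 vol 𝒞) {e s t C C₁ c : ℝ}
    (he : 0 ≤ e) (ht : 0 ≤ t) (hC : 0 ≤ C) (hC₁ : 0 ≤ C₁) (hc : 0 < c) (hdec : L2Decay K ε z C e)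
    {g : ℝ → 𝔼 → E} (h : ∀ᶠ τ in atTop, ∀ᵐ x ∂vol 𝒞, ‖g τ x‖ ≤ C₁ * τ ^ s * (‖z x‖ * (‖x‖ ^ t *
    exp (-(c * (τ * ‖x‖)))))) : (fun τ => ∫ x in 𝒞, g τ x) =𝒪 (s - (t + e + n / 2)) := by
  obtain ⟨C', hC', hb⟩ := exists_integral_norm_mul_exp_le hε hz he ht hC hc hdec
  refine IsBigO.of_bound (C₁ * C') ?_; filter_upwards [h, eventually_gt_atTop 0] with τ h1 hτ
  have hi := integrableOn_mul_weight (hz.integrable (by norm_num)).norm ht hc.le hτ.le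
  refine (norm_integral_le_of_norm_le (hi.const_mul _) h1).trans ?_
  rw [integral_const_mul, norm_of_nonneg (by positivity), sub_eq_add_neg, rpow_add hτ]
  calc _ ≤ C₁ * τ ^ s * (C' * τ ^ (-(t + e + n / 2))) := by
        gcongr; exact hb τ hτ
    _ = _ := by ring

end Estimates

section LeadingTerms

variable {s : RSpace n → ℝ} {S g₀ C κ A m σ N Cχ : ℝ} {χ : RSpace n → ℂ}

lemma norm_cutoff_sub_le {s g₀ S C t Cχ : ℝ} {χ : ℂ} (hS : 0 ≤ S) (h1 : |s| ≤ S)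
    (h2 : |s - g₀| ≤ C * t) (h3 : ‖χ - 1‖ ≤ Cχ * t) : ‖(s : ℂ) * χ - g₀‖ ≤ (S * Cχ + C) * t := by
  have e1 : (s : ℂ) * χ - g₀ = (s : ℂ) * (χ - 1) + ℂ(s - g₀) := by push_cast; ring
  rw [e1]; refine (norm_add_le _ _).trans ?_
  rw [norm_mul, norm_real, norm_real, norm_eq_abs, norm_eq_abs]
  calc |s| * ‖χ - 1‖ + |s - g₀| ≤ S * (Cχ * t) + C * t := by gcongr
    _ = _ := by ring

/-- Replacing the gradient data by their leading term. -/
lemma isBigO_grad_term (hn : 0 < n) (hK : MeasurableSet K) (hε : 0 < ε) (hδ : 0 < δ) (hd : d ∈ 𝒟)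
    (hS0 : 0 ≤ S) (hC : 0 ≤ C) (hA : 0 ≤ A) (hκ : 0 ≤ κ) (hCχ : 0 ≤ Cχ) (hχ : IsCutoff ε κ Cχ χ)
    (hm : A ≠ 0 → -(n : ℝ) < m + κ) (hm' : -(n : ℝ) < m + σ) (hS : ∀ᵐ x ∂vol 𝒞, |s x| ≤ S)
    (hs : ∀ᵐ x ∂vol 𝒞, |s x - g₀| ≤ C * ‖x‖ ^ κ) {P L : 𝔼 → CSpace n}
    (hL : ∀ᵐ x ∂vol 𝒞, ‖L x‖ ≤ A * ‖x‖ ^ m) (hP : ∀ᵐ x ∂vol 𝒞, ‖P x - L x‖ ≤ C * ‖x‖ ^ (m + σ)) :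
    (fun τ : ℝ => ∫ x in 𝒞, ((s x : ℂ) * cdot (P x) (∇ (fun y => χ y * 𝐞 τ y) x) - (g₀ : ℂ) *
    (cdot (L x) (eta d d' τ) * 𝐞 τ x))) =O[atTop] fun τ => A * τ ^ (1 - (n + (m + κ))) + τ ^
    (1 - (n + (m + σ))) := by
  set C₁ := S * C * (2 + Cχ * ε ^ κ) + (S * Cχ + 2 * (S * Cχ + C)) with hC₁
  refine isBigO_integral_of_ae_le_add (C := C₁) hn hm hm' hδ hA (by positivity) ?_
  filter_upwards [eventually_ge_atTop 1] with τ hτ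
  filter_upwards [hS, hs, hL, hP, ae_restrict_mem (meas_truncCone hK ε)] with x h1 h2 h3 h4 hx
  have hx0 := norm_pos_of_mem hx.1; have hxε := norm_lt_of_mem hx
  have he := norm_cexpDot_eta_le (d' := d') hd (by linarith : 0 ≤ τ) hx.1
  set η := eta d d' τ with hη; set e := cexpDot η x with hedef
  have hηn : ‖η‖ ≤ 2 * τ := (norm_eta_le d d' τ).trans (by rw [abs_of_nonneg (by linarith)])
  have e1 : (s x : ℂ) * cdot (P x) (∇ (fun y => χ y * cexpDot η y) x)
        - (g₀ : ℂ) * (cdot (L x) η * e) =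
      ((s x : ℂ) * cdot (P x - L x) (χ x • η + ∇ χ x) + (s x : ℂ) * cdot (L x) (∇ χ x)
        + ((s x : ℂ) * χ x - g₀) * cdot (L x) η) * e := by
    rw [hχ.grad_mul_cexpDot, cdot_smul_right, cdot_sub_left, cdot_add_right,
      cdot_add_right, cdot_smul_right, cdot_smul_right]
    ring
  have hW : ‖χ x • η + ∇ χ x‖ ≤ (2 + Cχ * ε ^ κ) * τ := by
    refine (norm_add_le _ _).trans ?_; rw [norm_smul]
    have h5 : ‖∇ χ x‖ ≤ Cχ * ε ^ κ := (hχ.norm_grad_le x).trans (by gcongr)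
    have h6 : Cχ * ε ^ κ ≤ Cχ * ε ^ κ * τ := le_mul_of_one_le_right (by positivity) hτ
    have h7 : ‖χ x‖ * ‖η‖ ≤ 1 * (2 * τ) := by gcongr; exact hχ.norm_le_one x
    linarith
  have hsx : ‖(s x : ℂ)‖ ≤ S := by rwa [norm_real]
  have hLτ : 0 ≤ A * ‖x‖ ^ m := by positivity
  rw [e1, norm_mul]
  have t1 : ‖(s x : ℂ) * cdot (P x - L x) (χ x • η + ∇ χ x)‖ ≤
      S * (C * ‖x‖ ^ (m + σ) * ((2 + Cχ * ε ^ κ) * τ)) := by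
    rw [norm_mul]
    have := (norm_cdot_le (P x - L x) (χ x • η + ∇ χ x)).trans
      (mul_le_mul h4 hW (norm_nonneg _) (by positivity))
    gcongr
  have t2 : ‖(s x : ℂ) * cdot (L x) (∇ χ x)‖ ≤ S * (A * ‖x‖ ^ m * (Cχ * ‖x‖ ^ κ)) := by
    rw [norm_mul]
    have := (norm_cdot_le (L x) (∇ χ x)).trans
      (mul_le_mul h3 (hχ.norm_grad_le x) (norm_nonneg _) hLτ)
    gcongr
  have t3 : ‖((s x : ℂ) * χ x - g₀) * cdot (L x) η‖ ≤
      (S * Cχ + C) * ‖x‖ ^ κ * (A * ‖x‖ ^ m * (2 * τ)) := by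
    rw [norm_mul]; have := (norm_cdot_le (L x) η).trans (mul_le_mul h3 hηn (norm_nonneg _) hLτ)
    have h5 := norm_cutoff_sub_le hS0 h1 h2 (hχ.norm_sub_le x); gcongr
  have t4 : S * (A * ‖x‖ ^ m * (Cχ * ‖x‖ ^ κ)) ≤ S * (A * ‖x‖ ^ m * (Cχ * ‖x‖ ^ κ)) * τ :=
    le_mul_of_one_le_right (by positivity) hτ
  have hbound := (norm_add₃_le).trans (add_le_add (add_le_add t1 (t2.trans t4)) t3); rw [rpow_one]
  calc _ ≤ (S * (C * ‖x‖ ^ (m + σ) * ((2 + Cχ * ε ^ κ) * τ))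
        + S * (A * ‖x‖ ^ m * (Cχ * ‖x‖ ^ κ)) * τ
        + (S * Cχ + C) * ‖x‖ ^ κ * (A * ‖x‖ ^ m * (2 * τ))) * exp (-(δ * (τ * ‖x‖))) :=
        mul_le_mul hbound he (norm_nonneg _) (by positivity)
    _ = τ * (S * C * (2 + Cχ * ε ^ κ) * ‖x‖ ^ (m + σ)
        + (S * Cχ + 2 * (S * Cχ + C)) * (A * ‖x‖ ^ (m + κ))) * exp (-(δ * (τ * ‖x‖))) := by
        rw [rpow_add hx0 m κ]; ring
    _ ≤ τ * (C₁ * ‖x‖ ^ (m + σ) + C₁ * (A * ‖x‖ ^ (m + κ))) * exp (-(δ * (τ * ‖x‖))) := by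
        gcongr
        · exact le_add_of_nonneg_right (by positivity)
        · exact le_add_of_nonneg_left (by positivity)
    _ = _ := by ring

/-- Replacing the potential data by their leading term. -/
lemma isBigO_pot_term (hn : 0 < n) (hK : MeasurableSet K) (hδ : 0 < δ) (hd : d ∈ 𝒟) (hS0 : 0 ≤ S)
    (hC : 0 ≤ C) (hA : 0 ≤ A) (hCχ : 0 ≤ Cχ) (hχ : IsCutoff ε κ Cχ χ)
    (hm : A ≠ 0 → -(n : ℝ) < m + κ) (hm' : -(n : ℝ) < m + σ) (hS : ∀ᵐ x ∂vol 𝒞, |s x| ≤ S)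
    (hs : ∀ᵐ x ∂vol 𝒞, |s x - g₀| ≤ C * ‖x‖ ^ κ) {P L : 𝔼 → ℂ}
    (hL : ∀ᵐ x ∂vol 𝒞, ‖L x‖ ≤ A * ‖x‖ ^ m) (hP : ∀ᵐ x ∂vol 𝒞, ‖P x - L x‖ ≤ C * ‖x‖ ^ (m + σ)) :
    (fun τ : ℝ => ∫ x in 𝒞, ((s x : ℂ) * P x * (χ x * 𝐞 τ x) - (g₀ : ℂ) * (L x * 𝐞 τ x)))
    =O[atTop] fun τ => A * τ ^ (0 - (n + (m + κ))) + τ ^ (0 - (n + (m + σ))) := by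
  set C₁ := S * C + (S * Cχ + C) with hC₁
  refine isBigO_integral_of_ae_le_add (C := C₁) hn hm hm' hδ hA (by positivity) ?_
  filter_upwards [eventually_ge_atTop 0] with τ hτ
  filter_upwards [hS, hs, hL, hP, ae_restrict_mem (meas_truncCone hK ε)] with x h1 h2 h3 h4 hx
  have hx0 := norm_pos_of_mem hx.1; have he := norm_cexpDot_eta_le (d' := d') hd hτ hx.1
  set e := 𝐞 τ x with hedef
  have e1 : (s x : ℂ) * P x * (χ x * e) - (g₀ : ℂ) * (L x * e) = ((s x : ℂ) * χ x * (P x - L x) +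
    ((s x : ℂ) * χ x - g₀) * L x) * e := by ring
  have hsx : ‖(s x : ℂ)‖ ≤ S := by rwa [norm_real]
  rw [e1, norm_mul, rpow_zero, mul_one]
  have t1 : ‖(s x : ℂ) * χ x * (P x - L x)‖ ≤ S * 1 * (C * ‖x‖ ^ (m + σ)) := by
    rw [norm_mul, norm_mul]; have := hχ.norm_le_one x; gcongr
  have t3 : ‖((s x : ℂ) * χ x - g₀) * L x‖ ≤ (S * Cχ + C) * ‖x‖ ^ κ * (A * ‖x‖ ^ m) := by
    rw [norm_mul]; have h5 := norm_cutoff_sub_le hS0 h1 h2 (hχ.norm_sub_le x); gcongr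
  calc _ ≤ (S * 1 * (C * ‖x‖ ^ (m + σ)) + (S * Cχ + C) * ‖x‖ ^ κ * (A * ‖x‖ ^ m))
        * exp (-(δ * (τ * ‖x‖))) :=
        mul_le_mul ((norm_add_le _ _).trans (add_le_add t1 t3)) he (norm_nonneg _) (by positivity)
    _ = (S * C * ‖x‖ ^ (m + σ) + (S * Cχ + C) * (A * ‖x‖ ^ (m + κ)))
        * exp (-(δ * (τ * ‖x‖))) := by rw [rpow_add hx0 m κ]; ring
    _ ≤ (C₁ * ‖x‖ ^ (m + σ) + C₁ * (A * ‖x‖ ^ (m + κ))) * exp (-(δ * (τ * ‖x‖))) := by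
        gcongr
        · exact le_add_of_nonneg_right (by positivity)
        · exact le_add_of_nonneg_left (by positivity)
    _ = _ := by ring

end LeadingTerms

namespace DifferenceProblem

include D

/-- The contribution of the difference of the solutions. -/
lemma isBigO_diff_term {κ Cχ : ℝ} {χ : 𝔼 → ℂ} (hδ : 0 < δ) (hd : d ∈ 𝒟)
    (hdd' : inner ℝ (d : 𝔼) (d' : 𝔼) = 0) (hκ : 0 ≤ κ) (hCχ : 0 ≤ Cχ) (hχ : IsCutoff ε κ Cχ χ)
    {E C : ℝ} (hE : 0 ≤ E) (hC : 0 ≤ C) (hdec : L2Decay K ε z C E) : (fun τ : ℝ => ∫ x in 𝒞, z x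
    * (ℂ(γ x) * lapl (fun y => χ y * 𝐞 τ y) x + cdot (toC (G x)) (∇ (fun y => χ y * 𝐞 τ y) x) +
    ℂ(k) ^ 2 * ℂ(ρ x) * (χ x * 𝐞 τ x))) =𝒪 (1 - (0 + E + n / 2)) := by
  have hε := D.eps_pos; have hM := D.M_nonneg; set B := Cχ * ε ^ κ with hB
  have hB0 : 0 ≤ B := by positivity
  refine isBigO_integral_norm_mul (C₁ := M * (B + 4 * B) + M * (2 + B) + k ^ 2 * M)
    hε D.z_mem.1 hE le_rfl hC (by positivity) hδ hdec ?_
  filter_upwards [eventually_ge_atTop 1] with τ hτ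
  filter_upwards [D.gamma_bound, ae_restrict_of_ae D.w1.bound_grad, D.rho_bound',
    ae_restrict_mem D.measurableSet] with x h1 h2 h3 hx
  have hxε := norm_lt_of_mem hx
  have he := norm_cexpDot_eta_le (d' := d') hd (by linarith : 0 ≤ τ) hx.1
  set η := eta d d' τ with hη; set e := cexpDot η x with hedef
  have hηn : ‖η‖ ≤ 2 * τ := (norm_eta_le d d' τ).trans (by rw [abs_of_nonneg (by linarith)])
  have hpow : Cχ * ‖x‖ ^ κ ≤ B := by rw [hB]; gcongr
  have hg := (hχ.norm_grad_le x).trans hpow; have hl := (hχ.norm_lapl_le x).trans hpow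
  have hc := hχ.norm_le_one x
  have e1 : z x * (ℂ(γ x) * lapl (fun y => χ y * cexpDot η y) x
        + cdot (toC (G x)) (∇ (fun y => χ y * cexpDot η y) x)
        + ℂ(k) ^ 2 * ℂ(ρ x) * (χ x * e)) =
      z x * (ℂ(γ x) * (lapl χ x + 2 * cdot (∇ χ x) η)
        + cdot (toC (G x)) (χ x • η + ∇ χ x) + ℂ(k) ^ 2 * ℂ(ρ x) * χ x) * e := by
    rw [hχ.grad_mul_cexpDot, cdot_smul_right, hχ.lapl_mul_cexpDot (cdot_eta_eta hdd' τ)]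
    ring
  have hBτ : B ≤ B * τ := le_mul_of_one_le_right hB0 hτ
  have t1 : ‖ℂ(γ x) * (lapl χ x + 2 * cdot (∇ χ x) η)‖ ≤ M * ((B + 4 * B) * τ) := by
    rw [norm_mul, norm_real]
    have h4 : ‖lapl χ x + 2 * cdot (∇ χ x) η‖ ≤ (B + 4 * B) * τ := by
      refine (norm_add_le _ _).trans ?_; rw [norm_mul, Complex.norm_two]
      have h5 := (norm_cdot_le (∇ χ x) η).trans (mul_le_mul hg hηn (norm_nonneg _) hB0); linarith
    gcongr; exact h1
  have t2 : ‖cdot (toC (G x)) (χ x • η + ∇ χ x)‖ ≤ M * ((2 + B) * τ) := by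
    refine (norm_cdot_le _ _).trans ?_; rw [norm_toC]
    have h4 : ‖χ x • η + ∇ χ x‖ ≤ (2 + B) * τ := by
      refine (norm_add_le _ _).trans ?_; rw [norm_smul]
      have h7 : ‖χ x‖ * ‖η‖ ≤ 1 * (2 * τ) := by gcongr
      linarith
    gcongr
  have t3 : ‖ℂ(k) ^ 2 * ℂ(ρ x) * χ x‖ ≤ k ^ 2 * M * τ := by
    rw [norm_mul, norm_mul, norm_pow, norm_real, norm_real, norm_eq_abs, norm_eq_abs, sq_abs]
    calc k ^ 2 * |ρ x| * ‖χ x‖ ≤ k ^ 2 * M * 1 := by gcongr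
      _ ≤ k ^ 2 * M * τ := by gcongr
  rw [e1, norm_mul, norm_mul, rpow_zero, one_mul, rpow_one]
  calc _ ≤ ‖z x‖ * (M * ((B + 4 * B) * τ) + M * ((2 + B) * τ) + k ^ 2 * M * τ) *
        exp (-(δ * (τ * ‖x‖))) :=
        mul_le_mul (mul_le_mul_of_nonneg_left ((norm_add₃_le).trans
          (add_le_add (add_le_add t1 t2) t3)) (norm_nonneg _)) he (norm_nonneg _) (by positivity)
    _ = _ := by ring

end DifferenceProblem

/-- The expansions of the data at the vertex. -/
structure VertexExpansion (K : Set (USphere n)) (ε : ℝ) (γ ρ : RSpace n → ℝ) (v : RSpace n → ℂ)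
    (Dv : RSpace n → CSpace n) (A B m₁ m₂ σ C : ℝ) (L₁ : RSpace n → CSpace n)
    (L₂ : RSpace n → ℂ) : Prop where
  A_nonneg : 0 ≤ A
  B_nonneg : 0 ≤ B
  C_nonneg : 0 ≤ C
  sigma_pos : 0 < σ
  meas₁ : AESM L₁ vol (truncCone K ε)
  meas₂ : AESM L₂ vol (truncCone K ε)
  lead₁ : ∀ᵐ x ∂vol (truncCone K ε), ‖L₁ x‖ ≤ A * ‖x‖ ^ m₁
  lead₂ : ∀ᵐ x ∂vol (truncCone K ε), ‖L₂ x‖ ≤ B * ‖x‖ ^ m₂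
  rem₁ : ∀ᵐ x ∂vol (truncCone K ε), ‖ℂ((γ x - 1) * γ x ^ (-½)) • Dv x - L₁ x‖ ≤ C * ‖x‖ ^ (m₁ + σ)
  rem₂ : ∀ᵐ x ∂vol (truncCone K ε), ‖ℂ((ρ x - 1) * γ x ^ (-½)) * v x - L₂ x‖ ≤ C * ‖x‖ ^ (m₂ + σ)
  exp₁ : A ≠ 0 → -(n / 2 : ℝ) < m₁
  exp₂ : B ≠ 0 → -(n / 2 : ℝ) < m₂

lemma integrableOn_of_le_rpow (hn : 0 < n) {A m : ℝ} {L : 𝔼 → E} (hL : AESM L vol 𝒞)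
    (h : ∀ᵐ x ∂vol 𝒞, ‖L x‖ ≤ A * ‖x‖ ^ m) (hm : A ≠ 0 → -(n / 2 : ℝ) < m) : IntegrableOn L 𝒞 := by
  have h0 : (0 : ℝ) ≤ n / 2 := by positivity
  by_cases hA : A = 0
  · refine Integrable.mono' (integrable_zero _ _ _) hL (h.mono fun x hx => ?_); simpa [hA] using hx
  · refine Integrable.mono' (((integrableOn_norm_rpow hn (m := m)
      (by have := hm hA; linarith) ε).mono_set inter_subset_right).const_mul A) hL h

lemma integrableOn_mul_cexpDot' (hK : MeasurableSet K) {L : 𝔼 → ℂ} (hL : IntegrableOn L 𝒞)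
    (η : CSpace n) : IntegrableOn (fun x => L x * cexpDot η x) 𝒞 := by
  obtain ⟨C, hC⟩ := (isCompact_closedBall (0 : 𝔼) ε).exists_bound_of_continuousOn
    (contDiff_cexpDot η).continuous.continuousOn
  refine hL.mul_bdd (c := C) (contDiff_cexpDot η).continuous.aestronglyMeasurable ?_
  filter_upwards [ae_restrict_mem (meas_truncCone hK ε)] with x hx
  exact hC x (by simpa using (norm_lt_of_mem hx).le)

lemma rpow_half_mul_neg_half {t : ℝ} (ht : 0 < t) : t ^ ½ * t ^ (-½) = 1 := by
  rw [← rpow_add ht]; norm_num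

/-- The integrals of the leading terms, combined. -/
def leadIntegral (K : Set (USphere n)) (ε k : ℝ) (d d' : USphere n) (L₁ : 𝔼 → CSpace n)
    (L₂ : 𝔼 → ℂ) (τ : ℝ) : ℂ :=
  (∫ x in truncCone K ε, cdot (L₁ x) (eta d d' τ) * cexpDot (eta d d' τ) x)
    - ℂ(k) ^ 2 * ∫ x in truncCone K ε, L₂ x * cexpDot (eta d d' τ) x

variable (V : VertexExpansion K ε γ ρ v Dv A B m₁ m₂ σ C L₁ L₂)

namespace DifferenceProblem

include D

lemma sqrt_bound : ∀ᵐ x ∂vol 𝒞, |γ x ^ ½| ≤ M ^ ½ := by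
  filter_upwards [D.ell, D.gamma_bound] with x h1 h2; have h3 : 0 ≤ γ x := D.lam_pos.le.trans h1
  rw [abs_of_nonneg (by positivity)]; exact rpow_le_rpow h3 ((le_abs_self _).trans h2) (by norm_num)

lemma aesm_rpow (s : ℝ) : AESM (fun x => γ x ^ s) vol 𝒞 :=
  (D.w1.meas.restrict.aemeasurable.pow_const s).aestronglyMeasurable

lemma neg_sqrt_bound : ∀ᵐ x ∂vol 𝒞, |γ x ^ (-½)| ≤ lam ^ (-½) := by
  filter_upwards [D.ell] with x h1; have h3 : 0 ≤ γ x := D.lam_pos.le.trans h1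
  rw [abs_of_nonneg (by positivity)]; exact rpow_le_rpow_of_nonpos D.lam_pos h1 (by norm_num)

lemma memLp_weighted_grad_data : MemLp (fun x => ℂ((γ x - 1) * γ x ^ (-½)) • Dv x) 2 vol 𝒞 := by
  refine memLp_ofReal_smul (C := (M + 1) * lam ^ (-½)) D.Dv_mem
    ((D.w1.meas.restrict.sub aestronglyMeasurable_const).mul (D.aesm_rpow _)) ?_
  filter_upwards [D.gamma_sub_one_bound, D.neg_sqrt_bound] with x h1 h2; rw [abs_mul]
  have := D.M_nonneg; gcongr

lemma memLp_weighted_pot_data : MemLp (fun x => ℂ((ρ x - 1) * γ x ^ (-½)) * v x) 2 vol 𝒞 := by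
  refine memLp_ofReal_smul (C := (M + 1) * lam ^ (-½)) D.v_mem
    ((D.rho_meas.restrict.sub aestronglyMeasurable_const).mul (D.aesm_rpow _)) ?_
  filter_upwards [D.rho_sub_one_bound, D.neg_sqrt_bound] with x h1 h2; rw [abs_mul]
  have := D.M_nonneg; gcongr

lemma weighted_grad_data_eq :
    ∀ᵐ x ∂vol 𝒞, ℂ(γ x - 1) • Dv x = ℂ(γ x ^ ½) • (ℂ((γ x - 1) * γ x ^ (-½)) • Dv x) := by
  filter_upwards [D.ell] with x hx; rw [smul_smul, ← Complex.ofReal_mul]; congr 2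
  have := rpow_half_mul_neg_half (D.lam_pos.trans_le hx); linear_combination (-(γ x - 1)) * this

lemma weighted_pot_data_eq :
    ∀ᵐ x ∂vol 𝒞, ℂ(ρ x - 1) * v x = ℂ(γ x ^ ½) * (ℂ((ρ x - 1) * γ x ^ (-½)) * v x) := by
  filter_upwards [D.ell] with x hx; rw [← mul_assoc, ← Complex.ofReal_mul]; congr 2
  have := rpow_half_mul_neg_half (D.lam_pos.trans_le hx); linear_combination (-(ρ x - 1)) * this

include V

/-- The weighted data tested with `χ e^{η·x}` agree to leading order with the leading integrals. -/
lemma isBigO_weighted_data_term (hn : 0 < n) (hδ : 0 < δ) (hd : d ∈ 𝒟) {s : 𝔼 → ℝ}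
    {κ Cχ g₀ C' S : ℝ} {χ : 𝔼 → ℂ} (hκ : 0 ≤ κ) (hCχ : 0 ≤ Cχ) (hχ : IsCutoff ε κ Cχ χ)
    (hm₁ : -(n : ℝ) < m₁ + σ) (hm₂ : k = 0 ∨ -(n : ℝ) < m₂ + σ) (hS0 : 0 ≤ S)
    (hsm : AESM s vol 𝒞) (hS : ∀ᵐ x ∂vol 𝒞, |s x| ≤ S)
    (hs : ∀ᵐ x ∂vol 𝒞, |s x - g₀| ≤ C' * ‖x‖ ^ κ) : (fun τ : ℝ => (∫ x in 𝒞, ((s x : ℂ) * cdot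
    (ℂ((γ x - 1) * γ x ^ (-½)) • Dv x) (∇ (fun y => χ y * 𝐞 τ y) x) - ℂ(k) ^ 2 * ((s x : ℂ) *
    (ℂ((ρ x - 1) * γ x ^ (-½)) * v x) * (χ x * 𝐞 τ x)))) - (g₀ : ℂ) * leadIntegral K ε k d d' L₁
    L₂ τ) =O[atTop] rate (k ^ 2 * B) (k ^ 2) A (n + m₂ + κ) (n + m₂ + σ) (n + m₁ + κ - 1)
    (n + m₁ + σ - 1) := by
  have hA := V.A_nonneg; have hB := V.B_nonneg; have hC := V.C_nonneg
  have hKm := D.isOpen.measurableSet; have hn2 : (0 : ℝ) ≤ n / 2 := by positivity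
  have hC₁ : 0 ≤ max C C' := le_max_of_le_left hC
  have hs' : ∀ᵐ x ∂vol 𝒞,
      |s x - g₀| ≤ max C C' * ‖x‖ ^ κ :=
    hs.mono fun x hx => hx.trans (by gcongr; exact le_max_right _ _)
  have b1 := isBigO_grad_term (d' := d') (C := max C C') hn hKm D.eps_pos hδ hd hS0 hC₁ hA hκ hCχ hχ
    (fun h => by have := V.exp₁ h; linarith) hm₁ hS hs' V.lead₁
    (V.rem₁.mono fun x hx => hx.trans (by gcongr; exact le_max_left _ _))
  have i1 : ∀ τ, IntegrableOn (fun x => (g₀ : ℂ) *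
      (cdot (L₁ x) (eta d d' τ) * 𝐞 τ x)) 𝒞 := fun τ => by
    have hL := integrableOn_of_le_rpow hn V.meas₁ V.lead₁ V.exp₁
    refine (integrableOn_mul_cexpDot' hKm ?_ _).const_mul _
    refine (hL.norm.mul_const ‖eta d d' τ‖).mono' (aesm_cdot V.meas₁
      aestronglyMeasurable_const) (.of_forall fun x => norm_cdot_le _ _)
  have hψ : ∀ τ, IsH1 𝒞 (fun y => χ y * 𝐞 τ y) _ := fun τ =>
    (hχ.test_mul_cexpDot (eta d d' τ)).isH1 D.measurableSet
  have i2 : ∀ τ, IntegrableOn (fun x => (s x : ℂ) * cdot (ℂ((γ x - 1) * γ x ^ (-½)) • Dv x) (∇ (fun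
    y => χ y * 𝐞 τ y) x)) 𝒞 := fun τ => integrable_mul_cdot hsm hS D.memLp_weighted_grad_data (hψ
    τ).2.1
  have i3 : ∀ τ, IntegrableOn (fun x => (s x : ℂ) * (ℂ((ρ x - 1) * γ x ^ (-½)) * v x) *
      (χ x * 𝐞 τ x)) 𝒞 := fun τ => by
    have := integrable_mul_mul hsm hS 1 D.memLp_weighted_pot_data (hψ τ).1
    simp only [one_mul] at this; exact this
  have key : ∀ τ, (∫ x in 𝒞, ((s x : ℂ) *
          cdot (ℂ((γ x - 1) * γ x ^ (-½)) • Dv x) (∇ (fun y => χ y * 𝐞 τ y) x)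
        - ℂ(k) ^ 2 * ((s x : ℂ) * (ℂ((ρ x - 1) * γ x ^ (-½)) * v x) * (χ x * 𝐞 τ x))))
      - (g₀ : ℂ) * leadIntegral K ε k d d' L₁ L₂ τ = _ := fun τ => by
    rw [integral_sub (i2 τ) ((i3 τ).const_mul _), integral_const_mul, leadIntegral, mul_sub,
      ← integral_const_mul (g₀ : ℂ), sub_sub_sub_comm, ← integral_sub (i2 τ) (i1 τ)]
  simp only [key]; have hk2 : 0 ≤ k ^ 2 := by positivity
  refine IsBigO.sub (b1.trans (IsBigO.add ?_ ?_)) ?_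
  · rw [show 1 - ((n : ℝ) + (m₁ + κ)) = -(n + m₁ + κ - 1) by ring]
    exact (isBigO_rate (mul_nonneg hk2 hB) hk2 hA).2.2.1
  · rw [show 1 - ((n : ℝ) + (m₁ + σ)) = -(n + m₁ + σ - 1) by ring]
    exact (isBigO_rate (mul_nonneg hk2 hB) hk2 hA).2.2.2
  · simp only [mul_left_comm (g₀ : ℂ), ← mul_sub]; rcases eq_or_ne k 0 with hk | hk
    · simp only [hk, Complex.ofReal_zero, ne_eq, OfNat.ofNat_ne_zero, not_false_eq_true, zero_pow,
        zero_mul]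
      exact isBigO_zero _ _
    have hm₂' := hm₂.resolve_left hk
    have i4 : ∀ τ, IntegrableOn (fun x => (g₀ : ℂ) * (L₂ x * 𝐞 τ x)) 𝒞 := fun τ =>
      (integrableOn_mul_cexpDot' hKm (integrableOn_of_le_rpow hn V.meas₂ V.lead₂ V.exp₂)
      _).const_mul _
    have b2 := isBigO_pot_term (d' := d') (C := max C C') hn hKm hδ hd hS0 hC₁ hB hCχ hχ
      (fun h => by have := V.exp₂ h; linarith) hm₂' hS hs' V.lead₂
      (V.rem₂.mono fun x hx => hx.trans (by gcongr; exact le_max_left _ _))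
    have e2 : ∀ τ, (∫ x in 𝒞, (s x : ℂ) * (ℂ((ρ x - 1) * γ x ^ (-½)) * v x) * (χ x * 𝐞 τ x))
        - (g₀ : ℂ) * ∫ x in 𝒞, L₂ x * 𝐞 τ x =
        ∫ x in 𝒞, ((s x : ℂ) *
        (ℂ((ρ x - 1) * γ x ^ (-½)) * v x) * (χ x * 𝐞 τ x)
        - (g₀ : ℂ) * (L₂ x * 𝐞 τ x)) := fun τ => by
      rw [integral_sub (i3 τ) (i4 τ), integral_const_mul]
    simp only [e2]; refine (b2.const_mul_left _).trans (IsBigO.add ?_ ?_)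
    · rw [show 0 - ((n : ℝ) + (m₂ + κ)) = -(n + m₂ + κ) by ring]
      refine IsBigO.trans ?_ (isBigO_rate (mul_nonneg hk2 hB) hk2 hA).1
      have := (isBigO_refl (fun τ : ℝ => B * τ ^ (-((n : ℝ) + m₂ + κ))) atTop).const_mul_right
        (pow_ne_zero 2 hk)
      simpa only [mul_assoc] using this
    · rw [show 0 - ((n : ℝ) + (m₂ + σ)) = -(n + m₂ + σ) by ring]
      exact (isBigO_rpow_mul (pow_ne_zero 2 hk) _).trans (isBigO_rate (mul_nonneg hk2 hB) hk2 hA).2.1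

/-- The data tested with `χ e^{η·x}` agree to leading order with the leading integrals. -/
lemma isBigO_data_term (hn : 0 < n) (hδ : 0 < δ) (hd : d ∈ 𝒟) {κ Cχ g₀ C' : ℝ} {χ : 𝔼 → ℂ}
    (hκ : 0 ≤ κ) (hCχ : 0 ≤ Cχ) (hχ : IsCutoff ε κ Cχ χ) (hm₁ : -(n : ℝ) < m₁ + σ)
    (hm₂ : k = 0 ∨ -(n : ℝ) < m₂ + σ) (hs : ∀ᵐ x ∂vol 𝒞, |γ x ^ ½ - g₀| ≤ C' * ‖x‖ ^ κ) : (fun τ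
    : ℝ => (∫ x in 𝒞, (ℂ(γ x - 1) * cdot (Dv x) (∇ (fun y => χ y * 𝐞 τ y) x) - ℂ(k) ^ 2 * ℂ(ρ x -
    1) * v x * (χ x * 𝐞 τ x))) - (g₀ : ℂ) * leadIntegral K ε k d d' L₁ L₂ τ) =O[atTop] rate
    (k ^ 2 * B) (k ^ 2) A (n + m₂ + κ) (n + m₂ + σ) (n + m₁ + κ - 1) (n + m₁ + σ - 1) := by
  refine (D.isBigO_weighted_data_term (d' := d') V hn hδ hd hκ hCχ hχ hm₁ hm₂ (rpow_nonneg
    D.M_nonneg _) (D.aesm_rpow _) D.sqrt_bound hs).congr_left fun τ => ?_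
  congr 1; refine integral_congr_ae ?_
  filter_upwards [D.weighted_grad_data_eq, D.weighted_pot_data_eq] with x h1 h2
  rw [← cdot_smul_left, ← cdot_smul_left, ← h1, ← h2]; ring

end DifferenceProblem

lemma abs_rpow_half_sub_le {a b l : ℝ} (hl : 0 < l) (ha : l ≤ a) (hb : l ≤ b) :
    |a ^ ½ - b ^ ½| ≤ l ^ (-½) * |a - b| := by
  have h1 : l ^ ½ ≤ a ^ ½ := rpow_le_rpow hl.le ha (by norm_num)
  have hb0 : 0 < b ^ ½ := rpow_pos_of_pos (hl.trans_le hb) _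
  have hsq : ∀ {t : ℝ}, 0 < t → t ^ ½ * t ^ ½ = t := fun ht => by
    rw [← rpow_add ht]; norm_num
  have h3 : a - b = (a ^ ½ - b ^ ½) * (a ^ ½ + b ^ ½) := by
    linear_combination hsq (hl.trans_le hb) - hsq (hl.trans_le ha)
  have hl0 : 0 < l ^ ½ := rpow_pos_of_pos hl _
  rw [h3, abs_mul, rpow_neg hl.le, inv_mul_eq_div, le_div_iff₀ hl0,
    abs_of_pos (by linarith : 0 < a ^ ½ + b ^ ½)]
  gcongr; linarith

namespace DifferenceProblem

include D

/-- The square root of the conductivity has a positive value at the vertex. -/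
lemma exists_sqrt_at_vertex : ∃ g₀ C', g₀ ≠ 0 ∧ ∀ᵐ x ∂vol 𝒞, |γ x ^ ½ - g₀| ≤ C' * ‖x‖ ^ (1 : ℝ) := by
  obtain ⟨a, L, hL⟩ := exists_linear_bound D.w1.grad D.w1.bound D.w1.bound_coord
  have hl := D.lam_pos; have hmax : 0 < max a lam := lt_max_of_lt_right hl
  refine ⟨(max a lam) ^ ½, lam ^ (-½) * L, (rpow_pos_of_pos hmax _).ne', ?_⟩
  filter_upwards [D.ell, ae_restrict_of_ae hL] with x h1 h2
  refine (abs_rpow_half_sub_le hl h1 (le_max_right _ _)).trans ?_; rw [rpow_one, mul_assoc]; gcongr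
  refine le_trans ?_ h2
  have : |max (γ x) lam - max a lam| ≤ |γ x - a| := abs_max_sub_max_le_abs _ _ _
  rwa [max_eq_left h1] at this

lemma norm_le_of_expansion [NormedSpace ℂ E] {P L F : 𝔼 → E} {A m : ℝ} (hA : 0 ≤ A) (hC : 0 ≤ C)
    (hσ : 0 < σ) (hF : ∀ᵐ x ∂vol 𝒞, F x = ℂ(γ x ^ ½) • P x)
    (hL : ∀ᵐ x ∂vol 𝒞, ‖L x‖ ≤ A * ‖x‖ ^ m) (hP : ∀ᵐ x ∂vol 𝒞, ‖P x - L x‖ ≤ C * ‖x‖ ^ (m + σ)) :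
    ∃ C', 0 ≤ C' ∧ (∀ᵐ x ∂vol 𝒞, ‖P x‖ ≤ C' * ‖x‖ ^ (if A = 0 then m + σ else m)) ∧ ∀ᵐ x ∂vol 𝒞,
    ‖F x‖ ≤ C' * ‖x‖ ^ (if A = 0 then m + σ else m) := by
  have hM := D.M_nonneg; have hε := D.eps_pos
  have key : ∀ᵐ x ∂vol 𝒞, ‖P x‖ ≤ (A + C * ε ^ σ + C) * ‖x‖ ^ (if A = 0 then m + σ else m) := by
    filter_upwards [hL, hP, ae_restrict_mem D.measurableSet] with x h1 h2 hx
    have hx0 := norm_pos_of_mem hx.1; have hxε := norm_lt_of_mem hx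
    have h3 : ‖P x‖ ≤ A * ‖x‖ ^ m + C * ‖x‖ ^ (m + σ) := by
      have := norm_add_le (L x) (P x - L x); rw [add_sub_cancel] at this; linarith
    split_ifs with h0
    · rw [h0] at h3 ⊢; refine h3.trans ?_; rw [zero_mul, zero_add, zero_add]; gcongr
      exact le_add_of_nonneg_left (by positivity)
    · refine h3.trans ?_
      have h4 : C * ‖x‖ ^ (m + σ) ≤ C * ε ^ σ * ‖x‖ ^ m := by
        rw [rpow_add hx0, mul_comm (‖x‖ ^ m), mul_assoc]; gcongr
      have h5 : 0 ≤ C * ‖x‖ ^ m := by positivity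
      linarith
  refine ⟨(1 + M ^ ½) * (A + C * ε ^ σ + C), by positivity, ?_, ?_⟩
  · filter_upwards [key] with x h1; refine h1.trans ?_; gcongr
    exact le_mul_of_one_le_left (by positivity) (le_add_of_nonneg_right (by positivity))
  · filter_upwards [key, hF, D.sqrt_bound] with x h1 h2 h3
    rw [h2, norm_smul, norm_real, norm_eq_abs, mul_assoc]
    refine mul_le_mul (h3.trans (le_add_of_nonneg_left zero_le_one)) h1 (norm_nonneg _)
      (by positivity)

include V

lemma grad_data_le : ∃ C', 0 ≤ C' ∧ (∀ᵐ x ∂vol 𝒞, ‖ℂ((γ x - 1) * γ x ^ (-½)) • Dv x‖ ≤ C' * ‖x‖ ^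
    (if A = 0 then m₁ + σ else m₁)) ∧ ∀ᵐ x ∂vol 𝒞, ‖ℂ(γ x - 1) • Dv x‖ ≤ C' * ‖x‖ ^
    (if A = 0 then m₁ + σ else m₁) :=
  D.norm_le_of_expansion V.A_nonneg V.C_nonneg V.sigma_pos D.weighted_grad_data_eq V.lead₁ V.rem₁

lemma pot_data_le : ∃ C', 0 ≤ C' ∧
    (∀ᵐ x ∂vol 𝒞, ‖ℂ((ρ x - 1) * γ x ^ (-½)) * v x‖ ≤ C' * ‖x‖ ^ (if B = 0 then m₂ + σ else m₂))
    ∧ ∀ᵐ x ∂vol 𝒞, ‖ℂ(ρ x - 1) * v x‖ ≤ C' * ‖x‖ ^ (if B = 0 then m₂ + σ else m₂) :=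
  D.norm_le_of_expansion V.B_nonneg V.C_nonneg V.sigma_pos D.weighted_pot_data_eq V.lead₂ V.rem₂

lemma exists_grad_decay (hn : 0 < n) : ∃ C', 0 ≤ C' ∧ L2Decay K ε (fun x => ℂ(γ x - 1) • Dv x) C'
    (max 0 (n / 2 + if A = 0 then m₁ + σ else m₁)) := by
  obtain ⟨C₁, -, -, h₁⟩ := D.grad_data_le V; exact exists_eLpNorm_le_rpow hn D.memLp_grad_data h₁

lemma exists_pot_decay (hn : 0 < n) : ∃ C', 0 ≤ C' ∧ L2Decay K ε
    (fun x => ℂ(k) ^ 2 * (ℂ(ρ x - 1) * v x)) C' (max 0 (n / 2 + if B = 0 then m₂ + σ else m₂)) := by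
  obtain ⟨C₁, -, -, h₁⟩ := D.pot_data_le V
  refine exists_eLpNorm_le_rpow (C := ‖ℂ(k) ^ 2‖ * C₁) hn D.memLp_pot_data (h₁.mono fun x hx => ?_)
  rw [norm_mul, mul_assoc]; gcongr

/-- Decay of the difference at the vertex, in terms of the expansions of the data. -/
lemma exists_decay_rate (hn : 0 < n) (hδ : 0 < δ) (hd : d ∈ 𝒟) : ∃ E C' : ℝ, 0 ≤ E ∧ 0 ≤ C' ∧
    (L2Decay K ε z C' E) ∧ (fun τ : ℝ => τ ^ (1 - (0 + E + n / 2))) =O[atTop] rate (k ^ 2 * B)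
    (k ^ 2) A (n + m₂ + 1) (n + m₂ + σ) (n + m₁) (n + m₁ + σ - 1) := by
  have hA := V.A_nonneg; have hB := V.B_nonneg; have hk2 : 0 ≤ k ^ 2 := by positivity
  set f : ℝ := max 0 (n / 2 + if A = 0 then m₁ + σ else m₁) with hf
  obtain ⟨C₁, hC₁, hF⟩ := D.exists_grad_decay V hn
  have hfrate : ∀ t : ℝ, t ≤ 1 - (f + 1 + n / 2) → (fun τ : ℝ => τ ^ t) =O[atTop]
      rate (k ^ 2 * B) (k ^ 2) A (n + m₂ + 1) (n + m₂ + σ) (n + m₁) (n + m₁ + σ - 1) := by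
    intro t ht; have h1 : (n / 2 + if A = 0 then m₁ + σ else m₁) ≤ f := le_max_right _ _
    by_cases hA0 : A = 0
    · rw [if_pos hA0] at h1
      exact (isBigO_rpow (by linarith)).trans (isBigO_rate (mul_nonneg hk2 hB) hk2 hA).2.2.2
    · rw [if_neg hA0] at h1
      exact ((isBigO_rpow (t := -(n + m₁)) (by linarith)).trans
        (isBigO_rpow_mul hA0 _)).trans (isBigO_rate (mul_nonneg hk2 hB) hk2 hA).2.2.1
  rcases eq_or_ne k 0 with hk | hk
  · obtain ⟨C', hC', h⟩ := D.exists_eLpNorm_le hn hδ hd (f := f) (g := f) (C := C₁)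
      (le_max_left _ _) (le_max_left _ _) hF fun r _ _ => by simp [hk]
    refine ⟨_, C', by positivity, hC', h, hfrate _ ?_⟩; rw [min_eq_left (by linarith)]; linarith
  · set g : ℝ := max 0 (n / 2 + if B = 0 then m₂ + σ else m₂) with hg
    obtain ⟨C₂, hC₂, hG⟩ := D.exists_pot_decay V hn; have hf0 : 0 ≤ f := le_max_left _ _
    have hg0 : 0 ≤ g := le_max_left _ _
    obtain ⟨C', hC', h⟩ := D.exists_eLpNorm_le hn hδ hd (f := f) (g := g) (C := max C₁ C₂) hf0 hg0
      (fun r hr hrε => (hF r hr hrε).trans (ofReal_le_ofReal (mul_le_mul_of_nonneg_right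
      (le_max_left _ _) (by positivity)))) (fun r hr hrε => (hG r hr hrε).trans (ofReal_le_ofReal
      (mul_le_mul_of_nonneg_right (le_max_right _ _) (by positivity))))
    refine ⟨_, C', by positivity, hC', h, ?_⟩; rcases le_total (f + 1) (g + 2) with hfg | hfg
    · rw [min_eq_left hfg]; exact hfrate _ (by linarith)
    · rw [min_eq_right hfg]
      have h1 : (n / 2 + if B = 0 then m₂ + σ else m₂) ≤ g := le_max_right _ _; by_cases hB0 : B = 0
      · rw [if_pos hB0] at h1
        exact ((isBigO_rpow (t := -(n + m₂ + σ)) (by linarith)).trans (isBigO_rpow_mul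
          (pow_ne_zero 2 hk) _)).trans (isBigO_rate (mul_nonneg hk2 hB) hk2 hA).2.1
      · rw [if_neg hB0] at h1
        exact ((isBigO_rpow (t := -(n + m₂ + 1)) (by linarith)).trans (isBigO_rpow_mul
          (mul_ne_zero (pow_ne_zero 2 hk) hB0) _)).trans (isBigO_rate (mul_nonneg hk2 hB) hk2 hA).1

/-- The bound of the leading integrals that does not use the complex geometrical optics
solutions. -/
theorem isBigO_leadIntegral (hn : 0 < n) (hδ : 0 < δ) (hd : d ∈ 𝒟)
    (hdd' : inner ℝ (d : 𝔼) (d' : 𝔼) = 0) (hm₁ : -(n : ℝ) < m₁ + σ)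
    (hm₂ : k = 0 ∨ -(n : ℝ) < m₂ + σ) : leadIntegral K ε k d d' L₁ L₂ =O[atTop] rate (k ^ 2 * B)
    (k ^ 2) A (n + m₂ + 1) (n + m₂ + σ) (n + m₁) (n + m₁ + σ - 1) := by
  obtain ⟨g₀, C₀, hg₀, hs⟩ := D.exists_sqrt_at_vertex
  obtain ⟨χ, Cχ, hCχ, hχ⟩ := exists_isCutoff n D.eps_pos zero_le_one
  obtain ⟨E, C', hE, hC', hdec, hrate⟩ := D.exists_decay_rate V hn hδ hd
  have h1 := D.isBigO_data_term (d' := d') V hn hδ hd zero_le_one hCχ hχ hm₁ hm₂ hs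
  have h2 := (D.isBigO_diff_term (d' := d') hδ hd hdd' zero_le_one hCχ hχ hE hC' hdec).trans hrate
  simp only [D.test_identity (hχ.test_mul_cexpDot _)] at h2
  have h3 : (fun τ => (g₀ : ℂ) * leadIntegral K ε k d d' L₁ L₂ τ) =O[atTop]
      rate (k ^ 2 * B) (k ^ 2) A (n + m₂ + 1) (n + m₂ + σ) (n + m₁) (n + m₁ + σ - 1) := by
    rw [show (n : ℝ) + m₁ + 1 - 1 = n + m₁ by ring] at h1; refine (h2.sub h1).congr_left fun τ => ?_
    rw [sub_sub_cancel]
  exact (isBigO_const_mul_left_iff (by exact_mod_cast hg₀)).1 h3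

end DifferenceProblem

section Holder

variable {S : Set (RSpace n)}

lemma exists_lintegral_mul_weight_le (hn : 0 < n) {p m c : ℝ} (hp : 1 < p) (hm : 0 ≤ m)
    (hc : 0 < c) : ∃ C, 0 ≤ C ∧ ∀ (g : 𝔼 → F), AESM g vol S → ∀ τ, 0 < τ → ∫⁻ x in S, ‖g x‖ₑ *
    ofReal (‖x‖ ^ m * exp (-(c * (τ * ‖x‖)))) ≤ eLpNorm g (ofReal p) vol S * ofReal
    (C * τ ^ (-(m + n - n / p))) := by
  have hp0 : 0 < p := by linarith
  set q := p.conjExponent with hq; have hpq : p.HolderConjugate q := HolderConjugate.conjExponent hp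
  have hq0 : 0 < q := hpq.symm.pos
  have hqp : 1 / q = 1 - 1 / p := by have := hpq.inv_add_inv_eq_one; simp only [one_div]; linarith
  set J := ∫ x : 𝔼, ‖x‖ ^ (m * q) * exp (-(c * q * ‖x‖)) with hJ
  have hJ0 : 0 ≤ J := integral_nonneg fun x => by positivity
  have hmq : -(n : ℝ) < m * q := by
    have h1 : (0 : ℝ) < n := by exact_mod_cast hn
    have h2 : 0 ≤ m * q := by positivity
    linarith
  refine ⟨J ^ (1 / q), by positivity, fun g hg τ hτ => ?_⟩
  have hwm : Measurable fun x : 𝔼 => ofReal (‖x‖ ^ m * exp (-(c * (τ * ‖x‖)))) :=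
    ((measurable_norm.pow_const m).mul (by fun_prop)).ennreal_ofReal
  refine (ENNReal.lintegral_mul_le_Lp_mul_Lq _ hpq hg.enorm hwm.aemeasurable).trans ?_
  rw [eLpNorm_eq_lintegral_rpow_enorm_toReal (by simpa using hp0) ENNReal.ofReal_ne_top,
    ENNReal.toReal_ofReal hp0.le]
  gcongr
  have hi : Integrable (fun x : 𝔼 => ‖x‖ ^ (m * q) * exp (-(c * q * (τ * ‖x‖)))) := by
    have := integrable_rpow_exp hn hmq (by positivity : 0 < c * q * τ)
    simpa only [mul_assoc] using this
  have h1 : ∫⁻ x in S, ofReal (‖x‖ ^ m * exp (-(c * (τ * ‖x‖)))) ^ q ≤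
      ofReal (τ ^ (-((n : ℝ) + m * q)) * J) := by
    rw [← integral_rpow_exp _ _ hτ,
      ofReal_integral_eq_lintegral_ofReal hi (.of_forall fun x => by positivity)]
    refine (setLIntegral_le_lintegral _ _).trans (lintegral_mono fun x => le_of_eq ?_)
    rw [ENNReal.ofReal_rpow_of_nonneg (by positivity) hq0.le, mul_rpow (by positivity)
      (exp_pos _).le, ← rpow_mul (norm_nonneg _), ← exp_mul]
    congr 3; ring
  calc _ ≤ ofReal (τ ^ (-((n : ℝ) + m * q)) * J) ^ (1 / q) := by gcongr
    _ = _ := by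
      rw [ENNReal.ofReal_rpow_of_nonneg (by positivity) (by positivity),
        mul_rpow (by positivity) hJ0, ← rpow_mul hτ.le, mul_comm]
      congr 3; have : m * q * (1 / q) = m := by field_simp
      have e2 : (n : ℝ) / p = n * (1 / p) := by ring
      rw [neg_mul, add_mul, this, hqp, e2]; ring

/-- Laplace integrals of functions that decay in `L^p`. -/
lemma isBigO_integral_of_ae_le_Lp (hn : 0 < n) {E F : Type*} [NormedAddCommGroup E]
    [NormedSpace ℝ E] [NormedAddCommGroup F] {p m c s t C₁ C : ℝ} (hp : 1 < p) (hm : 0 ≤ m)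
    (hc : 0 < c) (hC₁ : 0 ≤ C₁) {g : ℝ → 𝔼 → F} {f : ℝ → 𝔼 → E}
    (hg : ∀ᶠ τ in atTop, AESM (g τ) vol S)
    (hgt : ∀ᶠ τ in atTop, eLpNorm (g τ) (ofReal p) vol S ≤ ofReal (C * τ ^ t)) (h : ∀ᶠ τ in
    atTop, ∀ᵐ x ∂vol S, ‖f τ x‖ ≤ C₁ * τ ^ s * (‖g τ x‖ * (‖x‖ ^ m * exp (-(c * (τ * ‖x‖)))))) :
    (fun τ => ∫ x in S, f τ x) =𝒪 (s + t - (m + n - n / p)) := by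
  obtain ⟨C₂, hC₂, hH⟩ := exists_lintegral_mul_weight_le (S := S) (F := F) hn hp hm hc
  refine IsBigO.of_bound (C₁ * |C| * C₂) ?_
  filter_upwards [hg, hgt, h, eventually_gt_atTop 0] with τ h1 h2 h3 hτ
  rw [norm_of_nonneg (by positivity), ← ENNReal.ofReal_le_ofReal_iff (by positivity), ofReal_norm]
  refine (enorm_integral_le_lintegral_enorm _).trans ?_
  calc ∫⁻ x in S, ‖f τ x‖ₑ ≤ ∫⁻ x in S, ofReal (C₁ * τ ^ s) * (‖g τ x‖ₑ *
          ofReal (‖x‖ ^ m * exp (-(c * (τ * ‖x‖))))) := by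
        refine lintegral_mono_ae (h3.mono fun x hx => ?_)
        rw [← ofReal_norm, ← ofReal_norm, ← ofReal_mul (norm_nonneg _),
          ← ofReal_mul (by positivity)]
        exact ofReal_le_ofReal hx
    _ ≤ ofReal (C₁ * τ ^ s) * (ofReal (|C| * τ ^ t) * ofReal (C₂ * τ ^ (-(m + n - n / p)))) := by
        rw [lintegral_const_mul' _ _ ENNReal.ofReal_ne_top]; gcongr; refine (hH _ h1 τ hτ).trans ?_
        gcongr; exact h2.trans (ofReal_le_ofReal (by gcongr; exact le_abs_self C))
    _ = _ := by
        rw [← ofReal_mul (by positivity), ← ofReal_mul (by positivity),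
          sub_eq_add_neg (s + t), rpow_add hτ, rpow_add hτ]
        congr 1; ring

end Holder

/-- A weak solution may be tested with cut off functions of zero lateral trace. -/
lemma HasZeroLateralTrace.energyForm_eq_zero {w χ : 𝔼 → ℂ} {Dw : 𝔼 → CSpace n}
    (ht : HasZeroLateralTrace K ε z Dz) (hz : IsH1 𝒞 z Dz) (hw : IsWeakSolution k γ ρ 𝒞 w Dw)
    (hγm : AESM γ vol 𝒞) (hρm : AESM ρ vol 𝒞) (hγ : ∀ᵐ x ∂vol 𝒞, |γ x| ≤ M)
    (hρ : ∀ᵐ x ∂vol 𝒞, |ρ x| ≤ M) (hχ : IsTestFunction (ball 0 ε) χ) : ∫ x in 𝒞,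
    (ℂ(γ x) * cdot (Dw x) (χ x • Dz x + z x • ∇ χ x) - ℂ(k) ^ 2 * ℂ(ρ x) * w x * (χ x * z x)) = 0 := by
  obtain ⟨φ, hφ, h1, h2⟩ := ht; set μ := vol 𝒞 with hμ; obtain ⟨C, -, hC⟩ := hχ.exists_bound
  obtain ⟨C', -, hC'⟩ := exists_le (contDiff_grad hχ.1) (hasCompactSupport_grad hχ.2.1)
  have mχ := hχ.1.continuous.aestronglyMeasurable (μ := μ)
  have mg := (contDiff_grad hχ.1).aestronglyMeasurable (μ := μ)
  have m1 : MemLp (fun x => (ℂ(γ x) * χ x) • Dw x) 2 μ := by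
    have h0 : MemLp (fun x => χ x • Dw x) 2 μ :=
      hw.1.2.1.of_le_mul (c := C) (mχ.smul hw.1.2.1.1) (.of_forall fun x => by
        rw [norm_smul]; exact mul_le_mul_of_nonneg_right (hC x) (norm_nonneg _))
    have h := memLp_ofReal_smul h0 hγm hγ; simp only [smul_smul] at h; exact h
  have m2a : MemLp (fun x => ℂ(γ x) * cdot (Dw x) (∇ χ x)) 2 μ :=
    memLp_ofReal_smul (memLp_cdot_of_bound hw.1.2.1 mg (.of_forall hC')) hγm hγ
  have m2b : MemLp (fun x => ℂ(k) ^ 2 * (ℂ(ρ x) * (w x * χ x))) 2 μ := MemLp.const_mul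
    (memLp_ofReal_smul (memLp_smul_of_bound hw.1.1 mχ (.of_forall hC)) hρm hρ) _
  have m2 : MemLp (fun x => ℂ(γ x) * cdot (Dw x) (∇ χ x) - ℂ(k) ^ 2 * (ℂ(ρ x) * (w x * χ x))) 2 μ :=
    m2a.sub m2b
  have hφ2 : ∀ j, MemLp (φ j) 2 μ := fun j => memLp_of_continuous (hφ j).1.continuous (hφ j).2.1 2 _
  have hgφ2 : ∀ j, MemLp (∇ (φ j)) 2 μ := fun j => memLp_of_continuous (contDiff_grad (hφ j).1)
    (hasCompactSupport_grad (hφ j).2.1) 2 _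
  have l1 := tendsto_integral_bilin (b := cdot) norm_cdot_sub_cdot_le hz.2.1.1 (fun j => (hgφ2 j).1)
    m1 (MemLp.integrable_cdot hz.2.1 m1) (fun j => MemLp.integrable_cdot (hgφ2 j) m1) h2
  have l2 := tendsto_integral_bilin (b := fun a b : ℂ => a * b) norm_mul_sub_mul_le hz.1.1
    (fun j => (hφ2 j).1) m2 (hz.1.integrable_mul m2) (fun j => (hφ2 j).integrable_mul m2) h1
  have split : ∀ (f : 𝔼 → ℂ) (Df : 𝔼 → CSpace n), MemLp f 2 μ → MemLp Df 2 μ →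
      ∫ x, (ℂ(γ x) * cdot (Dw x) (χ x • Df x + f x • ∇ χ x)
        - ℂ(k) ^ 2 * ℂ(ρ x) * w x * (χ x * f x)) ∂μ =
      (∫ x, cdot (Df x) ((ℂ(γ x) * χ x) • Dw x) ∂μ) + ∫ x, f x * (ℂ(γ x) * cdot (Dw x) (∇ χ x)
          - ℂ(k) ^ 2 * (ℂ(ρ x) * (w x * χ x))) ∂μ := by
    intro f Df hf hDf
    have hi : Integrable (fun x => f x * (ℂ(γ x) * cdot (Dw x) (∇ χ x) - ℂ(k) ^ 2 * (ℂ(ρ x) * (w x *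
      χ x)))) μ := hf.integrable_mul m2
    rw [← integral_add (MemLp.integrable_cdot hDf m1) hi]
    refine integral_congr_ae (.of_forall fun x => ?_); simp only
    rw [cdot_add_right, cdot_smul_right, cdot_smul_right, cdot_smul_right, cdot_comm (Df x)]; ring
  rw [split z Dz hz.1 hz.2.1]; refine tendsto_nhds_unique (l1.add l2) ?_
  refine tendsto_const_nhds.congr fun j => ?_; rw [← split _ _ (hφ2 j) (hgφ2 j)]
  have h3 := hw.2 (fun x => χ x * φ j x) ⟨hχ.1.mul (hφ j).1, (hφ j).2.1.mul_left, subset_inter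
    (tsupport_mul_subset_right.trans (hφ j).2.2) (tsupport_mul_subset_left.trans hχ.2.2)⟩
  rw [← h3, energyForm]; refine integral_congr_ae (.of_forall fun x => ?_)
  simp only [grad_mul hχ.1 (hφ j).1]

namespace DifferenceProblem

include D

/-- The integral identity for a solution `γ^{-1/2} f` of the perturbed equation. -/
theorem solution_identity {κ Cχ : ℝ} {χ f : 𝔼 → ℂ} {Df Dw : 𝔼 → CSpace n}
    (hχ : IsCutoff ε κ Cχ χ) (hf : IsH1 𝒞 f Df)
    (hw : IsWeakSolution k γ ρ 𝒞 (fun x => ℂ(γ x ^ (-½)) * f x) Dw) : ∫ x in 𝒞, (cdot (ℂ((γ x -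
    1) * γ x ^ (-½)) • Dv x) (χ x • Df x + f x • ∇ χ x - (χ x * f x * ℂ(1 / 2 * (γ x)⁻¹)) • toC
    (G x)) - ℂ(k) ^ 2 * (ℂ((ρ x - 1) * γ x ^ (-(1 / 2) : ℝ)) * v x) * (χ x * f x)) = ∫ x in 𝒞, z
    x * (ℂ(γ x ^ ½) * (2 * cdot (Df x) (∇ χ x) + f x * lapl χ x)) := by
  have hΩ := isOpen_truncCone D.isOpen ε; set μ := vol 𝒞 with hμ
  obtain ⟨C', -, hC'⟩ := exists_le (contDiff_grad hχ.test.1) (hasCompactSupport_grad hχ.test.2.1)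
  obtain ⟨C'', -, hC''⟩ := exists_le (contDiff_lapl hχ.test.1).continuous
    (hasCompactSupport_lapl hχ.test.2.1)
  have mg := (contDiff_grad hχ.test.1).aestronglyMeasurable (μ := μ)
  have ml := (contDiff_lapl hχ.test.1).continuous.aestronglyMeasurable (μ := μ)
  have hmul : ∀ {g : 𝔼 → ℂ} {Dg : 𝔼 → CSpace n}, IsH1 𝒞 g Dg → IsH1 𝒞 (fun x => χ x * g x) (fun x =>
    χ x • Dg x + g x • ∇ χ x) := fun h => h.smooth_mul hΩ.measurableSet hχ.test.1 (C := max 1 C')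
    (fun x _ => (hχ.norm_le_one x).trans (le_max_left _ _)) (fun x _ => (hC' x).trans (le_max_right
    _ _))
  set w := fun x => ℂ(γ x ^ (-½)) * f x with hwdef; have mγ := D.w1.meas.restrict (s := 𝒞)
  have mρ := D.rho_meas.restrict (s := 𝒞)
  have E1 := D.eqn _ _ (hmul hw.1) (by
    obtain ⟨r, hr, h⟩ := exists_lt_subset_ball hχ.test.2.1.isCompact.isClosed hχ.test.2.2
    refine ⟨r, hr, .of_forall fun x hx => ?_⟩
    have h0 : χ x = 0 := image_eq_zero_of_notMem_tsupport fun h' => by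
      have := h h'; rw [mem_ball_zero_iff] at this; linarith
    simp only [h0, zero_mul])
  have E2 := D.trace.energyForm_eq_zero D.z_mem hw mγ mρ D.gamma_bound D.rho_bound' hχ.test
  have hh := hf.rpow_mul hΩ D.w1 D.lam_pos D.ell (1 / 2)
  have E3 := D.trace.integral_by_parts D.z_mem.1 D.z_mem.2.1 hh hχ.test
  have hDw := hw.1.2.2.ae_eq hΩ (hf.rpow_mul hΩ D.w1 D.lam_pos D.ell (-(1 / 2))).2.2
  have e1 : ∀ᵐ x ∂μ, cdot (ℂ((γ x - 1) * γ x ^ (-½)) • Dv x)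
        (χ x • Df x + f x • ∇ χ x - (χ x * f x * ℂ(1 / 2 * (γ x)⁻¹)) • toC (G x))
        - ℂ(k) ^ 2 * (ℂ((ρ x - 1) * γ x ^ (-½)) * v x) * (χ x * f x) =
      ℂ(γ x - 1) * cdot (Dv x) (χ x • Dw x + w x • ∇ χ x)
        - ℂ(k) ^ 2 * ℂ(ρ x - 1) * v x * (χ x * w x) := by
    filter_upwards [hDw, D.ell] with x h1 h2
    rw [h1, hwdef, rpow_sub_one (D.lam_pos.trans_le h2).ne', sub_eq_add_neg (χ x • Df x + _),
      ← neg_smul]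
    simp only [cdot_smul_left, cdot_add_right, cdot_smul_right]; push_cast; ring
  rw [integral_congr_ae e1]
  have i1 := integrable_fun_sub (integrable_mul_cdot mγ D.gamma_bound D.z_mem.2.1 (hmul hw.1).2.1)
    (integrable_mul_mul mρ D.rho_bound' (ℂ(k) ^ 2) D.z_mem.1 (hmul hw.1).1)
  have i2 := integrable_fun_sub (integrable_mul_cdot mγ D.gamma_bound hw.1.2.1 (hmul D.z_mem).2.1)
    (integrable_mul_mul mρ D.rho_bound' (ℂ(k) ^ 2) hw.1.1 (hmul D.z_mem).1)
  have i3 : Integrable (fun x => z x * (cdot (ℂ(γ x ^ ½) • Df x + (f x * ℂ(1 / 2 * γ x ^ (½ - 1))) •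
    toC (G x)) (∇ χ x) + ℂ(γ x ^ ½) * f x * lapl χ x)) μ := D.z_mem.1.integrable_mul
    ((memLp_cdot_of_bound hh.2.1 mg (.of_forall hC')).add (memLp_smul_of_bound hh.1 ml
    (.of_forall hC'')))
  have i4 : Integrable (fun x => z x * (ℂ(γ x) * cdot (Dw x) (∇ χ x))) μ := D.z_mem.1.integrable_mul
    (memLp_ofReal_smul (memLp_cdot_of_bound hw.1.2.1 mg (.of_forall hC')) mγ D.gamma_bound)
  have i5 : Integrable (fun x => ℂ(γ x ^ ½) * f x * cdot (Dz x) (∇ χ x)) μ := hh.1.integrable_mul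
    (memLp_cdot_of_bound D.z_mem.2.1 mg (.of_forall hC'))
  have e2 : ∫ x, (ℂ(γ x) * cdot (Dz x) (χ x • Dw x + w x • ∇ χ x)
        - ℂ(k) ^ 2 * ℂ(ρ x) * z x * (χ x * w x)) ∂μ
      - ∫ x, (ℂ(γ x) * cdot (Dw x) (χ x • Dz x + z x • ∇ χ x)
        - ℂ(k) ^ 2 * ℂ(ρ x) * w x * (χ x * z x)) ∂μ =
      (∫ x, ℂ(γ x ^ ½) * f x * cdot (Dz x) (∇ χ x) ∂μ)
      - ∫ x, z x * (ℂ(γ x) * cdot (Dw x) (∇ χ x)) ∂μ := by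
    rw [← integral_sub i1 i2, ← integral_sub i5 i4]; refine integral_congr_ae ?_
    filter_upwards [D.ell] with x h2
    have h3 : γ x * γ x ^ (-½) = γ x ^ ½ := by
      have := D.lam_pos.trans_le h2; rw [← rpow_one_add' this.le (by norm_num)]; norm_num
    simp only [hwdef, cdot_add_right, cdot_smul_right]; rw [← h3, cdot_comm (Dz x) (Dw x)]
    push_cast; ring
  have e3 : (∫ x, z x * (cdot (ℂ(γ x ^ ½) • Df x + (f x *
      ℂ(1 / 2 * γ x ^ (½ - 1))) • toC (G x)) (∇ χ x) +
      ℂ(γ x ^ ½) * f x * lapl χ x) ∂μ)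
      + ∫ x, z x * (ℂ(γ x) * cdot (Dw x) (∇ χ x)) ∂μ =
      ∫ x, z x * (ℂ(γ x ^ ½) * (2 * cdot (Df x) (∇ χ x) + f x * lapl χ x)) ∂μ := by
    rw [← integral_add i3 i4]; refine integral_congr_ae ?_; filter_upwards [hDw, D.ell] with x h1 h2
    have h0 := D.lam_pos.trans_le h2
    have h3 : γ x * γ x ^ (-½) = γ x ^ ½ := by
      rw [← rpow_one_add' h0.le (by norm_num)]; norm_num
    rw [h1, rpow_sub_one h0.ne', rpow_sub_one h0.ne', ← h3]
    simp only [cdot_add_left, cdot_smul_left]; have h4 : ℂ(γ x) ≠ 0 := by exact_mod_cast h0.ne'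
    push_cast; field_simp; ring
  rw [E2, sub_zero, E1] at e2; rw [E3] at e2; linear_combination e3 - e2

end DifferenceProblem

/-- Complex geometrical optics solutions with decaying residuals. -/
structure CGOFamily (K : Set (USphere n)) (ε k : ℝ) (γ ρ : RSpace n → ℝ) (d d' : USphere n)
    (p q σ₀ Cp Cq : ℝ) (r : ℝ → RSpace n → ℂ) (Dr : ℝ → RSpace n → CSpace n) : Prop where
  one_lt_p : 1 < p
  one_lt_q : 1 < q
  mem : ∀ᶠ τ : ℝ in atTop, IsH1 (truncCone K ε) (r τ) (Dr τ)
  sol : ∀ᶠ τ : ℝ in atTop, ∃ Dw : RSpace n → CSpace n,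
    IsWeakSolution k γ ρ (truncCone K ε) (cgo γ (r τ) (eta d d' τ)) Dw
  decay : ∀ᶠ τ : ℝ in atTop, eLpNorm (r τ) (ofReal p) vol (truncCone K ε) ≤
    ofReal (Cp * τ ^ (-(n : ℝ) / p - σ₀))
  decay_grad : ∀ᶠ τ : ℝ in atTop, eLpNorm (Dr τ) (ofReal q) vol (truncCone K ε) ≤
    ofReal (Cq * τ ^ (1 - (n : ℝ) / q - σ₀))

/-- The decay of the residuals controls all remainder terms. -/
lemma CGOFamily.isBigO_remainder {p q σ₀ Cp Cq m₁ m₂ C s : ℝ} {r : ℝ → 𝔼 → ℂ}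
    {Dr : ℝ → 𝔼 → CSpace n} {F : ℝ → 𝔼 → ℂ} (R : CGOFamily K ε k γ ρ d d' p q σ₀ Cp Cq r Dr)
    (hn : 0 < n) (hδ : 0 < δ) (hm₁ : 0 ≤ m₁) (hm₂ : 0 ≤ m₂)
    (hs : s ≤ n + m₂ + σ₀) (hs₁ : s ≤ n + m₁) (hs₂ : s ≤ n + m₁ + σ₀ - 1) (hF : ∀ᶠ τ : ℝ in
    atTop, ∀ᵐ x ∂vol 𝒞, ‖F τ x‖ ≤ C * (((τ * ‖r τ x‖ + ‖Dr τ x‖ + 1) * ‖x‖ ^ m₁ + ‖r τ x‖ * ‖x‖ ^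
    m₂ + τ * ‖x‖ ^ (m₁ + 1)) * exp (-(δ * (τ * ‖x‖))))) : (fun τ => ∫ x in 𝒞, F τ x) =𝒪 (-s) := by
  set w : ℝ → ℝ → 𝔼 → ℝ := fun m τ x => ‖x‖ ^ m * exp (-(δ * (τ * ‖x‖))) with hw
  have hw0 : ∀ m τ x, 0 ≤ w m τ x := fun m τ x => by positivity
  have hn0 : (0 : ℝ) < n := by exact_mod_cast hn
  have hDm := R.mem.mono fun τ h => h.2.1.1
  have e0 : ∀ {a : ℝ}, 0 ≤ a → ∀ τ : ℝ, ‖a‖ ≤ 1 * τ ^ (0 : ℝ) * a := fun h τ => by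
    rw [norm_of_nonneg h, rpow_zero, one_mul, one_mul]
  have e1 : ∀ {a τ : ℝ}, 0 ≤ a → 0 ≤ τ → ‖τ * a‖ ≤ 1 * τ ^ (1 : ℝ) * a := fun h hτ => by
    rw [norm_of_nonneg (mul_nonneg hτ h), rpow_one, one_mul]
  have bp : ∀ {m t : ℝ} {f : ℝ → 𝔼 → ℝ}, 0 ≤ m → t - n - m - σ₀ ≤ -s →
      (∀ᶠ τ : ℝ in atTop, ∀ᵐ x ∂vol 𝒞, ‖f τ x‖ ≤ 1 * τ ^ t * (‖r τ x‖ * w m τ x)) →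
      (fun τ => ∫ x in 𝒞, f τ x) =𝒪 (-s) := fun hm ht hf =>
    (isBigO_integral_of_ae_le_Lp hn R.one_lt_p hm hδ zero_le_one (R.mem.mono fun τ h => h.1.1)
      R.decay hf).trans (isBigO_rpow (by rw [neg_div]; linarith))
  have b1 := bp (m := m₁) (t := 1) (f := fun τ x => τ * (‖r τ x‖ * w m₁ τ x)) hm₁ (by linarith) (by
    filter_upwards [eventually_ge_atTop 0] with τ hτ
    exact .of_forall fun x => e1 (mul_nonneg (norm_nonneg _) (hw0 _ _ _)) hτ)
  have b3 := bp (m := m₂) (t := 0) (f := fun τ x => ‖r τ x‖ * w m₂ τ x) hm₂ (by linarith)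
    (.of_forall fun τ => .of_forall fun x => e0 (mul_nonneg (norm_nonneg _) (hw0 _ _ _)) τ)
  have b2 : (fun τ => ∫ x in 𝒞, ‖Dr τ x‖ * w m₁ τ x) =𝒪 (-s) := (isBigO_integral_of_ae_le_Lp hn
    R.one_lt_q hm₁ hδ zero_le_one hDm R.decay_grad (.of_forall fun τ => .of_forall fun x => e0
    (mul_nonneg (norm_nonneg _) (hw0 _ _ _)) τ)).trans (isBigO_rpow (by linarith))
  have b4 : (fun τ => ∫ x in 𝒞, 1 * w m₁ τ x) =𝒪 (-s) :=
    (isBigO_integral_of_ae_le hn (m := m₁) (by linarith) hδ zero_le_one (.of_forall fun τ =>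
      .of_forall fun x => by rw [one_mul]; exact e0 (hw0 _ _ _) τ)).trans
      (isBigO_rpow (by linarith))
  have b5 : (fun τ => ∫ x in 𝒞, τ * w (m₁ + 1) τ x) =𝒪 (-s) :=
    (isBigO_integral_of_ae_le hn (m := m₁ + 1) (by linarith) hδ zero_le_one (by
      filter_upwards [eventually_ge_atTop 0] with τ hτ
      exact .of_forall fun x => e1 (hw0 _ _ _) hτ)).trans (isBigO_rpow (by linarith))
  refine IsBigO.trans (IsBigO.of_bound C ?_) ((((b1.add b2).add b3).add b4).add b5)
  filter_upwards [R.mem, hF, eventually_ge_atTop 0] with τ h1 h2 hτ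
  have ir : IntegrableOn (fun x => ‖r τ x‖) 𝒞 := h1.integrableOn.norm
  have iD : IntegrableOn (fun x => ‖Dr τ x‖) 𝒞 := h1.integrableOn_grad.norm
  have i1 := (integrableOn_mul_weight ir hm₁ hδ.le hτ).const_mul τ
  have i2 := integrableOn_mul_weight iD hm₁ hδ.le hτ
  have i3 := integrableOn_mul_weight ir hm₂ hδ.le hτ
  have i1' : IntegrableOn (fun _ : 𝔼 => (1 : ℝ)) 𝒞 := integrable_const (μ := vol 𝒞) 1
  have i4 := integrableOn_mul_weight i1' hm₁ hδ.le hτ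
  have i5 := (integrableOn_mul_weight i1' (by linarith : 0 ≤ m₁ + 1) hδ.le hτ).const_mul τ
  simp only [one_mul] at i5; have j2 := Integrable.fun_add i1 i2
  have j3 := Integrable.fun_add j2 i3; have j4 := Integrable.fun_add j3 i4
  rw [← integral_add i1 i2, ← integral_add j2 i3, ← integral_add j3 i4, ← integral_add j4 i5,
    norm_of_nonneg (integral_nonneg fun x => by simp only [Pi.zero_apply]; positivity),
    ← integral_const_mul]
  refine norm_integral_le_of_norm_le ((Integrable.fun_add j4 i5).const_mul C) ?_
  refine h2.mono fun x hx => hx.trans (le_of_eq ?_); ring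

namespace DifferenceProblem

lemma isH1_cexpDot_mul (hK : IsOpen K) {r : 𝔼 → ℂ} {Dr : 𝔼 → CSpace n} (hr : IsH1 𝒞 r Dr)
    (η : CSpace n) :
    IsH1 𝒞 (fun x => cexpDot η x * (1 + r x)) (fun x => cexpDot η x • (Dr x + (1 + r x) • η)) := by
  obtain ⟨C, hC⟩ := (isCompact_closedBall (0 : 𝔼) ε).exists_bound_of_continuousOn
    (contDiff_cexpDot η).continuous.continuousOn
  obtain ⟨C', hC'⟩ := (isCompact_closedBall (0 : 𝔼) ε).exists_bound_of_continuousOn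
    (contDiff_grad (contDiff_cexpDot η)).continuousOn
  have hx : ∀ x ∈ 𝒞, x ∈ closedBall (0 : 𝔼) ε := fun x h => ball_subset_closedBall h.2
  refine ((isH1_one.add hr).smooth_mul (isOpen_truncCone hK ε).measurableSet (contDiff_cexpDot η)
    (C := max C C') (fun x h => (hC x (hx x h)).trans (le_max_left _ _))
    (fun x h => (hC' x (hx x h)).trans (le_max_right _ _))).congr (fun x => rfl) fun x => ?_
  simp only [Pi.add_apply, grad_cexpDot, smul_add, smul_smul, zero_add]; rw [mul_comm]

include D V

set_option maxHeartbeats 1000000 in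
/-- The bound of the leading integrals that uses the complex geometrical optics solutions. -/
theorem isBigO_leadIntegral_of_cgo (hn : 0 < n) (hδ : 0 < δ) (hd : d ∈ 𝒟) {r : ℝ → 𝔼 → ℂ}
    {Dr : ℝ → 𝔼 → CSpace n} {p q σ₀ Cp Cq s : ℝ} (hA : A ≠ 0) (hB : B ≠ 0) (hm₁ : 0 ≤ m₁)
    (hm₂ : 0 ≤ m₂) (R : CGOFamily K ε k γ ρ d d' p q σ₀ Cp Cq r Dr) (hs : s ≤ n + m₂ + σ₀)
    (hs' : s ≤ n + m₂ + σ) (hs₁ : s ≤ n + m₁) (hs₂ : s ≤ n + m₁ + σ₀ - 1)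
    (hs₃ : s ≤ n + m₁ + σ - 1) : leadIntegral K ε k d d' L₁ L₂ =𝒪 (-s) := by
  have hε := D.eps_pos; have hM := D.M_nonneg; have hl := D.lam_pos; have hσ := V.sigma_pos
  have hn0 : (0 : ℝ) < n := by exact_mod_cast hn
  have hKm := D.isOpen.measurableSet; obtain ⟨C₁, hC₁, hP₁, hF₁⟩ := D.grad_data_le V
  obtain ⟨C₂, hC₂, hP₂, hF₂⟩ := D.pot_data_le V; rw [if_neg hA] at hP₁ hF₁
  rw [if_neg hB] at hP₂ hF₂
  obtain ⟨M', hM', hz⟩ := D.ae_bounded hn (C := C₁ * ε ^ m₁ + k ^ 2 * (C₂ * ε ^ m₂)) (by positivity)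
    (by
      filter_upwards [hF₁, ae_restrict_mem D.measurableSet] with x hx hxΩ
      have := (norm_lt_of_mem hxΩ).le
      refine hx.trans (le_trans (by gcongr) (le_add_of_nonneg_right (by positivity))))
    (by
      filter_upwards [hF₂, ae_restrict_mem D.measurableSet] with x hx hxΩ
      have := (norm_lt_of_mem hxΩ).le; rw [norm_mul, norm_pow, norm_real, norm_eq_abs, sq_abs]
      refine le_trans ?_ (le_add_of_nonneg_left (by positivity)); gcongr
      exact hx.trans (by gcongr))
  set κ := m₁ + 1 + σ with hκ; have hκ0 : 0 ≤ κ := by positivity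
  obtain ⟨χ, Cχ, hCχ, hχ⟩ := exists_isCutoff n hε hκ0
  have hY := D.isBigO_weighted_data_term (d' := d') (s := fun _ => 1) (g₀ := 1) (C' := 0) (S := 1) V
    hn hδ hd hκ0 hCχ hχ (by linarith) (Or.inr (by linarith)) zero_le_one aestronglyMeasurable_const
    (.of_forall fun x => by simp) (.of_forall fun x => by simp)
  have pow : ∀ {c t : ℝ}, t ≤ -s → (fun τ : ℝ => c * τ ^ t) =𝒪 (-s) :=
    fun ht => (isBigO_const_mul_rpow _ _).trans (isBigO_rpow ht)
  have hYR := hY.trans (rate_isBigO (pow (by linarith)) (pow (by linarith)) (pow (by linarith))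
    (isBigO_rpow (by linarith)))
  set P₁ := fun x => ℂ((γ x - 1) * γ x ^ (-½)) • Dv x with hP₁def
  set P₂ := fun x => ℂ((ρ x - 1) * γ x ^ (-½)) * v x with hP₂def
  have mP₁ : MemLp P₁ 2 vol 𝒞 := D.memLp_weighted_grad_data
  have mP₂ : MemLp P₂ 2 vol 𝒞 := D.memLp_weighted_pot_data
  set e : ℝ → 𝔼 → ℂ := fun τ => 𝐞 τ with he
  set f : ℝ → 𝔼 → ℂ := fun τ x => e τ x * (1 + r τ x) with hf
  set Df : ℝ → 𝔼 → CSpace n := fun τ x => e τ x • (Dr τ x + (1 + r τ x) • eta d d' τ) with hDf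
  set I : ℝ → 𝔼 → ℂ := fun τ x => cdot (P₁ x) (χ x • Df τ x + f τ x • ∇ χ x - (χ x * f τ x * ℂ(1 / 2
    * (γ x)⁻¹)) • toC (G x)) - ℂ(k) ^ 2 * P₂ x * (χ x * f τ x) with hI
  set J : ℝ → 𝔼 → ℂ := fun τ x => ℂ(1) * cdot (P₁ x) (∇ (fun y => χ y * e τ y) x) - ℂ(k) ^ 2 * (ℂ(1)
    * P₂ x * (χ x * e τ x)) with hJ
  have hYJ : (fun τ => (∫ x in 𝒞, J τ x) - ℂ(1) * leadIntegral K ε k d d' L₁ L₂ τ) =𝒪 (-s) := hYR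
  set Q : ℝ → 𝔼 → ℂ := fun τ x => z x * (ℂ(γ x ^ ½) * (2 * cdot (Df τ x) (∇ χ x) + f τ x * lapl χ
    x)) with hQ
  set Bχ := Cχ * ε ^ κ with hBχ; have hBχ0 : 0 ≤ Bχ := by positivity
  have hgB : ∀ x ∈ 𝒞, ‖∇ χ x‖ ≤ Bχ := fun x hx =>
    (hχ.norm_grad_le x).trans (by have := (norm_lt_of_mem hx).le; rw [hBχ]; gcongr)
  have hηn : ∀ τ : ℝ, 1 ≤ τ → ‖eta d d' τ‖ ≤ 2 * τ := fun τ hτ =>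
    (norm_eta_le d d' τ).trans (by rw [abs_of_nonneg (by linarith)])
  have hrest : (fun τ => ∫ x in 𝒞, (I τ x - J τ x)) =𝒪 (-s) := by
    refine R.isBigO_remainder hn hδ hm₁ hm₂ hs hs₁ hs₂
      (C := C₁ * (3 + Bχ + lam⁻¹ * M) + k ^ 2 * C₂) ?_
    filter_upwards [eventually_ge_atTop 1] with τ hτ
    filter_upwards [hP₁, hP₂, D.ell, ae_restrict_of_ae D.w1.bound_grad,
      ae_restrict_mem D.measurableSet] with x h1 h2 h3 h4 hx
    have hel := norm_cexpDot_eta_le (d' := d') hd (by linarith : 0 ≤ τ) hx.1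
    have e1 : I τ x - J τ x = (χ x * cdot (P₁ x) (Dr τ x)
        + r τ x * cdot (P₁ x) (χ x • eta d d' τ + ∇ χ x)
        + -((1 + r τ x) * (χ x * (ℂ(1 / 2 * (γ x)⁻¹) * cdot (P₁ x) (toC (G x)))))
        + -(ℂ(k) ^ 2 * (P₂ x * (χ x * r τ x)))) * e τ x := by
      simp only [hI, hJ, hf, hDf, he, hχ.grad_mul_cexpDot]
      rw [sub_eq_add_neg (χ x • _ + _), ← neg_smul]; simp only [cdot_add_right, cdot_smul_right]
      push_cast; ring
    have hc := hχ.norm_le_one x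
    have t1 : ‖χ x * cdot (P₁ x) (Dr τ x)‖ ≤ 1 * (C₁ * ‖x‖ ^ m₁ * ‖Dr τ x‖) := by
      rw [norm_mul]
      exact mul_le_mul hc ((norm_cdot_le _ _).trans (mul_le_mul_of_nonneg_right h1 (norm_nonneg _)))
        (norm_nonneg _) zero_le_one
    have t2 : ‖r τ x * cdot (P₁ x) (χ x • eta d d' τ + ∇ χ x)‖ ≤
        ‖r τ x‖ * (C₁ * ‖x‖ ^ m₁ * ((2 + Bχ) * τ)) := by
      rw [norm_mul]
      have h5 : ‖χ x • eta d d' τ + ∇ χ x‖ ≤ (2 + Bχ) * τ := by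
        refine (norm_add_le _ _).trans ?_; rw [norm_smul]
        have h6 : ‖χ x‖ * ‖eta d d' τ‖ ≤ 1 * (2 * τ) := by gcongr; exact hηn τ hτ
        have h7 : Bχ ≤ Bχ * τ := le_mul_of_one_le_right hBχ0 hτ; linarith [hgB x hx]
      exact mul_le_mul_of_nonneg_left ((norm_cdot_le _ _).trans
        (mul_le_mul h1 h5 (norm_nonneg _) (by positivity))) (norm_nonneg _)
    have t3 : ‖-((1 + r τ x) * (χ x * (ℂ(1 / 2 * (γ x)⁻¹) * cdot (P₁ x) (toC (G x)))))‖ ≤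
        (1 + ‖r τ x‖) * (1 * (lam⁻¹ * (C₁ * ‖x‖ ^ m₁ * M))) := by
      rw [norm_neg, norm_mul, norm_mul, norm_mul, norm_real]
      have h5 : ‖1 / 2 * (γ x)⁻¹‖ ≤ lam⁻¹ := by
        have h0 : 0 < γ x := hl.trans_le h3; rw [norm_of_nonneg (by positivity)]
        have := inv_anti₀ hl h3; have h0' : 0 < (γ x)⁻¹ := inv_pos.2 h0; linarith
      have h6 : ‖cdot (P₁ x) (toC (G x))‖ ≤ C₁ * ‖x‖ ^ m₁ * M :=
        (norm_cdot_le _ _).trans (mul_le_mul h1 (by rwa [norm_toC]) (norm_nonneg _) (by positivity))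
      have h7 : ‖1 + r τ x‖ ≤ 1 + ‖r τ x‖ := (norm_add_le _ _).trans (by rw [norm_one]); gcongr
    have t4 : ‖-(ℂ(k) ^ 2 * (P₂ x * (χ x * r τ x)))‖ ≤ k ^ 2 * (C₂ * ‖x‖ ^ m₂ * (1 * ‖r τ x‖)) := by
      rw [norm_neg, norm_mul, norm_mul (P₂ x), norm_mul (χ x), norm_pow, norm_real,
        norm_eq_abs, sq_abs]
      exact mul_le_mul_of_nonneg_left (mul_le_mul h2 (mul_le_mul_of_nonneg_right hc
        (norm_nonneg _)) (by positivity) (by positivity)) (sq_nonneg k)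
    rw [e1, norm_mul, ← mul_assoc (C₁ * (3 + Bχ + lam⁻¹ * M) + k ^ 2 * C₂)]
    refine mul_le_mul ?_ hel (norm_nonneg _) (by positivity)
    refine (norm_add_le _ _).trans ((add_le_add ((norm_add₃_le).trans
      (add_le_add (add_le_add t1 t2) t3)) t4).trans ?_)
    set X := ‖x‖ ^ m₁; set X₂ := ‖x‖ ^ m₂; set ra := ‖r τ x‖; set Da := ‖Dr τ x‖
    have hX : 0 ≤ X := by positivity
    have hX₂ : 0 ≤ X₂ := by positivity
    have hra : 0 ≤ ra := norm_nonneg _; have hDa : 0 ≤ Da := norm_nonneg _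
    have hlM : 0 ≤ lam⁻¹ * M := by positivity
    have hrτ : ra ≤ τ * ra := le_mul_of_one_le_left hra hτ; have g0 : 0 ≤ C₁ * X := by positivity
    have g1 : C₁ * X * Da ≤ C₁ * X * ((3 + Bχ + lam⁻¹ * M) * Da) := by
      gcongr; exact le_mul_of_one_le_left hDa (by linarith)
    have g2 : C₁ * X * (lam⁻¹ * M * 1) ≤ C₁ * X * ((3 + Bχ + lam⁻¹ * M) * 1) := by
      gcongr; linarith
    have g3 : C₁ * X * ((2 + Bχ) * (τ * ra) + lam⁻¹ * M * ra) ≤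
        C₁ * X * ((3 + Bχ + lam⁻¹ * M) * (τ * ra)) := by
      refine mul_le_mul_of_nonneg_left ?_ g0; have := mul_le_mul_of_nonneg_left hrτ hlM
      have h9 : 0 ≤ τ * ra := by positivity
      linarith
    have g4 : 0 ≤ C₁ * (3 + Bχ + lam⁻¹ * M) * (X₂ * ra) := by positivity
    have g5 : 0 ≤ k ^ 2 * C₂ * ((τ * ra + Da + 1) * X) := by positivity
    have g6 : 0 ≤ (C₁ * (3 + Bχ + lam⁻¹ * M) + k ^ 2 * C₂) * (τ * ‖x‖ ^ (m₁ + 1)) := by positivity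
    linarith
  have hright : (fun τ => ∫ x in 𝒞, Q τ x) =𝒪 (-s) := by
    set S := M ^ ½ with hS; set N := M' * S * Cχ with hN; have hN0 : 0 ≤ N := by positivity
    refine R.isBigO_remainder hn hδ hm₁ hm₂ hs hs₁ hs₂ (C := N * (5 * ε ^ (1 + σ) + 5 * ε ^ σ)) ?_
    filter_upwards [eventually_ge_atTop 1] with τ hτ
    filter_upwards [hz, D.sqrt_bound, ae_restrict_mem D.measurableSet] with x h1 h2 hx
    have hx0 := norm_pos_of_mem hx.1; have hxε := (norm_lt_of_mem hx).le
    have hel := norm_cexpDot_eta_le (d' := d') hd (by linarith : 0 ≤ τ) hx.1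
    rcases lt_or_ge (ε / 2) ‖x‖ with hcase | hcase
    · simp only [hQ, hχ.grad_eq_zero x hcase, hχ.lapl_eq_zero x hcase]
      have : cdot (Df τ x) 0 = 0 := by simp [cdot]
      rw [this]; simp only [mul_zero, add_zero, norm_zero]; positivity
    have e1 : Q τ x = z x * (ℂ(γ x ^ ½) * (2 * cdot (Dr τ x + (1 + r τ x) • eta d d' τ) (∇ χ x)
          + (1 + r τ x) * lapl χ x)) * e τ x := by
      simp only [hQ, hDf, hf, cdot_smul_left]; ring
    set ra := ‖r τ x‖; set Da := ‖Dr τ x‖; have hra : 0 ≤ ra := norm_nonneg _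
    have hDa : 0 ≤ Da := norm_nonneg _
    have h7 : ‖1 + r τ x‖ ≤ 1 + ra := (norm_add_le _ _).trans (by rw [norm_one])
    have h8 : ‖2 * cdot (Dr τ x + (1 + r τ x) • eta d d' τ) (∇ χ x) + (1 + r τ x) * lapl χ x‖ ≤
        (2 * (Da + (1 + ra) * (2 * τ)) + (1 + ra)) * (Cχ * ‖x‖ ^ κ) := by
      refine (norm_add_le _ _).trans ?_
      rw [norm_mul, norm_mul, Complex.norm_two, add_mul, mul_assoc 2]
      have h9 : ‖Dr τ x + (1 + r τ x) • eta d d' τ‖ ≤ Da + (1 + ra) * (2 * τ) := by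
        refine (norm_add_le _ _).trans ?_; rw [norm_smul]; have := hηn τ hτ; gcongr
      have h10 := (norm_cdot_le _ _).trans
        (mul_le_mul h9 (hχ.norm_grad_le x) (norm_nonneg _) (by positivity))
      have h11 := hχ.norm_lapl_le x; gcongr
    rw [e1, norm_mul, ← mul_assoc (N * (5 * ε ^ (1 + σ) + 5 * ε ^ σ))]
    refine mul_le_mul ?_ hel (norm_nonneg _) (by positivity); rw [norm_mul, norm_mul, norm_real]
    have p1 : ‖x‖ ^ κ ≤ ε ^ σ * ‖x‖ ^ (m₁ + 1) := by
      rw [hκ, rpow_add hx0, mul_comm]; gcongr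
    have p2 : ‖x‖ ^ κ ≤ ε ^ (1 + σ) * ‖x‖ ^ m₁ := by
      rw [hκ, add_assoc, rpow_add hx0, mul_comm]; gcongr
    have hrτ : ra ≤ τ * ra := le_mul_of_one_le_left hra hτ
    calc ‖z x‖ * (‖γ x ^ ½‖ * _)
        ≤ M' * (S * ((2 * (Da + (1 + ra) * (2 * τ)) + (1 + ra)) * (Cχ * ‖x‖ ^ κ))) := by
          have := h1 hcase; have h12 : ‖γ x ^ ½‖ ≤ S := h2; gcongr
      _ = N * ((2 * Da + 4 * (τ * ra) + ra) * ‖x‖ ^ κ + (4 * τ + 1) * ‖x‖ ^ κ) := by ring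
      _ ≤ N * ((5 * Da + 5 * (τ * ra)) * (ε ^ (1 + σ) * ‖x‖ ^ m₁)
          + 5 * τ * (ε ^ σ * ‖x‖ ^ (m₁ + 1))) := by
          refine mul_le_mul_of_nonneg_left (add_le_add (mul_le_mul (by linarith) p2 (by positivity)
            (by positivity)) (mul_le_mul (by linarith) p1 (by positivity) (by positivity))) hN0
      _ ≤ _ := by
          have q1 : 0 ≤ N * (5 * ε ^ σ) * ((τ * ra + Da + 1) * ‖x‖ ^ m₁ + ra * ‖x‖ ^ m₂) := by
            positivity
          have q2 : 0 ≤ N * (5 * ε ^ (1 + σ)) * (‖x‖ ^ m₁ + ra * ‖x‖ ^ m₂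
            + τ * ‖x‖ ^ (m₁ + 1)) := by positivity
          linarith
  refine ((hright.sub hrest).sub hYJ).congr' ?_ EventuallyEq.rfl
  filter_upwards [R.mem, R.sol] with τ h1 h2; obtain ⟨Dw, hDw⟩ := h2
  have hfH := isH1_cexpDot_mul D.isOpen h1 (eta d d' τ)
  have hcgo : cgo γ (r τ) (eta d d' τ) = fun x => ℂ(γ x ^ (-½)) * f τ x := by
    funext x; simp only [cgo, hf, he]; ring
  rw [hcgo] at hDw; have hid : ∫ x in 𝒞, I τ x = ∫ x in 𝒞, Q τ x := D.solution_identity hχ hfH hDw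
  have hψ : IsH1 𝒞 (fun y => χ y * e τ y) _ :=
    (hχ.test_mul_cexpDot (eta d d' τ)).isH1 D.measurableSet
  have iJ : IntegrableOn (J τ) 𝒞 := by
    refine (((MemLp.integrable_cdot mP₁ hψ.2.1).const_mul ℂ(1)).sub (((mP₂.integrable_mul
      hψ.1).const_mul (ℂ(k) ^ 2)))).congr (.of_forall fun x => ?_)
    simp only [hJ, Pi.sub_apply, Pi.mul_apply, Complex.ofReal_one]; ring
  have iI : IntegrableOn (I τ) 𝒞 := by
    have hχf := hfH.smooth_mul D.measurableSet hχ.test.1 (C := max 1 Bχ) (fun x _ => (hχ.norm_le_one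
      x).trans (le_max_left _ _)) (fun x hx => (hgB x hx).trans (le_max_right _ _))
    have hcf : MemLp (fun x => ℂ(1 / 2 * (γ x)⁻¹) • (χ x * f τ x)) 2 vol 𝒞 := by
      refine memLp_ofReal_smul (C := lam⁻¹) hχf.1
        (D.w1.meas.restrict.aemeasurable.inv.const_mul _).aestronglyMeasurable ?_
      filter_upwards [D.ell] with x h3; have h0 : 0 < γ x := hl.trans_le h3
      rw [abs_of_nonneg (by positivity)]; have := inv_anti₀ hl h3
      have h0' : 0 < (γ x)⁻¹ := inv_pos.2 h0; linarith
    have hG : MemLp (fun x => (ℂ(1 / 2 * (γ x)⁻¹) • (χ x * f τ x)) • toC (G x)) 2 vol 𝒞 :=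
      memLp_smul_of_bound (C := M) hcf (continuous_toC.comp_aestronglyMeasurable
      D.w1.meas_grad.restrict) ((ae_restrict_of_ae D.w1.bound_grad).mono fun x hx => by rwa
      [norm_toC])
    refine ((MemLp.integrable_cdot mP₁ (hχf.2.1.sub hG)).sub (((mP₂.integrable_mul hχf.1).const_mul
      (ℂ(k) ^ 2)))).congr (.of_forall fun x => ?_)
    simp only [hI, Pi.sub_apply, Pi.mul_apply, smul_eq_mul]; rw [mul_comm (ℂ(1 / 2 * (γ x)⁻¹))]
    ring
  rw [integral_sub iI iJ, hid, Complex.ofReal_one, one_mul]; ring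

end DifferenceProblem

section BlowUp

variable {m σ : ℝ}

open Pointwise in
lemma smul_cone {s : ℝ} (hs : 0 < s) : s • cone K = cone K := by
  ext x; rw [mem_smul_set_iff_inv_smul_mem₀ hs.ne', smul_mem_cone_iff (inv_pos.2 hs)]

open Pointwise in
lemma integral_cone_comp_smul [NormedSpace ℝ F] (f : 𝔼 → F) {s : ℝ} (hs : 0 < s) :
    ∫ x in cone K, f (s⁻¹ • x) = s ^ n • ∫ x in cone K, f x := by
  rw [Measure.setIntegral_comp_smul_of_pos _ _ _ (inv_pos.2 hs), smul_cone (inv_pos.2 hs),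
    finrank_euclideanSpace_fin, inv_pow, inv_inv]

lemma IsTestFunction.comp_smul_cone {φ : 𝔼 → ℂ} (hφ : IsTestFunction (cone K) φ) (hε : 0 < ε) :
    ∃ s₀ : ℝ, 0 < s₀ ∧ ∀ s, 0 < s → s < s₀ → IsTestFunction 𝒞 (fun x => φ (s⁻¹ • x)) := by
  obtain ⟨R, hR0, hR⟩ := hφ.2.1.isBounded.subset_ball_lt 0 (0 : 𝔼)
  refine ⟨ε / R, by positivity, fun s hs hsε => ?_⟩
  have hts : tsupport (fun x => φ (s⁻¹ • x)) ⊆ (fun x => s⁻¹ • x) ⁻¹' tsupport φ :=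
    tsupport_comp_subset_preimage φ (continuous_const_smul _)
  refine ⟨hφ.1.comp (contDiff_const_smul _), hφ.2.1.comp_homeomorph
    (Homeomorph.smulOfNeZero s⁻¹ (inv_ne_zero hs.ne')), fun x hx => ?_⟩
  have h1 := hts hx; refine ⟨(smul_mem_cone_iff (inv_pos.2 hs)).1 (hφ.2.2 h1), ?_⟩; have h2 := hR h1
  rw [mem_ball_zero_iff, norm_smul, norm_inv, norm_of_nonneg hs.le] at h2; rw [mem_ball_zero_iff]
  rw [lt_div_iff₀ hR0] at hsε
  calc ‖x‖ = s * (s⁻¹ * ‖x‖) := by field_simp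
    _ < s * R := by gcongr
    _ < ε := hsε

/-- The homogeneous function of degree `m` with the given angular part. -/
def homog (m : ℝ) (f₀ : 𝔼 → ℂ) (x : 𝔼) : ℂ := ℂ(‖x‖ ^ m) * f₀ (dir x)

lemma homog_smul (f₀ : 𝔼 → ℂ) {s : ℝ} (hs : 0 < s) (x : 𝔼) :
    homog m f₀ (s • x) = ℂ(s ^ m) * homog m f₀ x := by
  rw [homog, homog, dir_smul x hs, norm_smul, norm_of_nonneg hs.le,
    mul_rpow hs.le (norm_nonneg _), Complex.ofReal_mul, mul_assoc]

variable {f₀ : RSpace n → ℂ}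

lemma aestronglyMeasurable_homog (hf₀ : MemLinfty K f₀) (m : ℝ) : AESM (homog m f₀) vol (cone K) := by
  have h := aesm_comp_dir hf₀.1
  exact (Complex.measurable_ofReal.comp (measurable_norm.pow_const m)).aestronglyMeasurable.mul h

lemma norm_homog_le (hf₀ : MemLinfty K f₀) (m : ℝ) :
    ∀ᵐ x ∂vol (cone K), ‖homog m f₀ x‖ ≤ linftyNorm K f₀ * ‖x‖ ^ m := by
  filter_upwards [ae_le_linftyNorm hf₀] with x hx
  rw [homog, norm_mul, norm_real, norm_of_nonneg (by positivity), mul_comm]; gcongr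

lemma integrableOn_homog (hn : 0 < n) (hf₀ : MemLinfty K f₀) (hm : -(n : ℝ) < m) (R : ℝ) :
    IntegrableOn (homog m f₀) (truncCone K R) := by
  refine Integrable.mono' (g := fun x => linftyNorm K f₀ * ‖x‖ ^ m)
    (((integrableOn_norm_rpow hn hm R).mono_set inter_subset_right).const_mul _)
    ((aestronglyMeasurable_homog hf₀ m).mono_set inter_subset_left) ?_
  exact ae_restrict_of_ae_restrict_of_subset inter_subset_left (norm_homog_le hf₀ m)

lemma setIntegral_eq_cone [NormedSpace ℝ F] (hK : MeasurableSet K) {g : 𝔼 → F} {R : ℝ}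
    (h : ∀ x, R ≤ ‖x‖ → g x = 0) : ∫ x in truncCone K R, g x = ∫ x in cone K, g x := by
  refine (setIntegral_eq_of_subset_of_forall_sdiff_eq_zero (measurableSet_cone hK)
    inter_subset_left fun x hx => h x ?_).symm
  by_contra h1
  exact hx.2 ⟨hx.1, mem_ball_zero_iff.2 (not_le.1 h1)⟩

lemma IntegrableOn.mul_of_bound {f φ : 𝔼 → ℂ} (hf : IntegrableOn f Ω) (hφ : Continuous φ)
    (hc : HasCompactSupport φ) : IntegrableOn (fun x => f x * φ x) Ω := by
  obtain ⟨C, -, hC⟩ := exists_le hφ hc; exact hf.mul_bdd hφ.aestronglyMeasurable (.of_forall hC)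

/-- The leading term of `g` governs its integrals against rescaled test functions. -/
lemma exists_blowUp (hn : 0 < n) (hK : MeasurableSet K) (hε : 0 < ε) (hf₀ : MemLinfty K f₀)
    (hm : -(n : ℝ) < m) (hσ : 0 < σ) {g : 𝔼 → ℂ} (hg : IntegrableOn g 𝒞)
    (hlead : HasLeadingTerm 𝒞 g f₀ m σ) {φ : 𝔼 → ℂ} (hφ : IsTestFunction (cone K) φ) : ∃ C s₀ :
    ℝ, 0 < s₀ ∧ ∀ s, 0 < s → s < s₀ → ‖(∫ x in 𝒞, g x * φ (s⁻¹ • x)) - ℂ(s ^ (n + m)) * ∫ x in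
    cone K, homog m f₀ x * φ x‖ ≤ C * s ^ (n + m + σ) := by
  obtain ⟨s₀, hs₀, hs⟩ := hφ.comp_smul_cone hε; obtain ⟨C, hC⟩ := hlead
  refine ⟨C * ∫ x in cone K, ‖x‖ ^ (m + σ) * ‖φ x‖, s₀, hs₀, fun s h0 h1 => ?_⟩
  have ht := hs s h0 h1
  have hz : ∀ x, ε ≤ ‖x‖ → φ (s⁻¹ • x) = 0 := fun x hx => by
    by_contra h
    exact absurd (norm_lt_of_mem (ht.2.2 (subset_tsupport _ h))) (not_lt.2 hx)
  have e1 : ℂ(s ^ (n + m)) * ∫ x in cone K, homog m f₀ x * φ x =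
      ∫ x in 𝒞, homog m f₀ x * φ (s⁻¹ • x) := by
    rw [setIntegral_eq_cone hK (fun x hx => by rw [hz x hx, mul_zero])]
    have h2 := integral_cone_comp_smul (K := K) (fun x => ℂ(s ^ m) * (homog m f₀ x * φ x)) h0
    have h3 : ∀ x : 𝔼, ℂ(s ^ m) * (homog m f₀ (s⁻¹ • x) * φ (s⁻¹ • x)) =
        homog m f₀ x * φ (s⁻¹ • x) := fun x => by
      rw [← mul_assoc, ← homog_smul f₀ h0, smul_inv_smul₀ h0.ne']
    simp only [h3] at h2; rw [h2, integral_const_mul, rpow_add h0, rpow_natCast, real_smul]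
    push_cast; ring
  have i1 := IntegrableOn.mul_of_bound hg ht.1.continuous ht.2.1
  have i2 := IntegrableOn.mul_of_bound (integrableOn_homog hn hf₀ hm ε) ht.1.continuous ht.2.1
  rw [e1, ← integral_sub i1 i2]
  have e2 : C * (∫ x in cone K, ‖x‖ ^ (m + σ) * ‖φ x‖) * s ^ (n + m + σ) =
      ∫ x in 𝒞, C * ‖x‖ ^ (m + σ) * ‖φ (s⁻¹ • x)‖ := by
    rw [setIntegral_eq_cone hK (fun x hx => by rw [hz x hx, norm_zero, mul_zero])]
    have h2 := integral_cone_comp_smul (K := K)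
      (fun x => C * s ^ (m + σ) * (‖x‖ ^ (m + σ) * ‖φ x‖)) h0
    have h3 : ∀ x : 𝔼, C * s ^ (m + σ) * (‖s⁻¹ • x‖ ^ (m + σ) * ‖φ (s⁻¹ • x)‖) =
        C * ‖x‖ ^ (m + σ) * ‖φ (s⁻¹ • x)‖ := fun x => by
      rw [norm_smul, norm_inv, norm_of_nonneg h0.le, mul_rpow (by positivity)
        (norm_nonneg _), inv_rpow h0.le]
      have := (rpow_pos_of_pos h0 (m + σ)).ne'; field_simp
    simp only [h3] at h2
    rw [h2, integral_const_mul, add_assoc, rpow_add h0 (n : ℝ), rpow_natCast, smul_eq_mul]; ring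
  rw [e2]; refine norm_integral_le_of_norm_le ?_ ?_
  · obtain ⟨C', -, hC'⟩ := exists_le ht.1.continuous ht.2.1
    have := ((integrableOn_norm_rpow hn (m := m + σ) (by linarith) ε).mono_set
      (inter_subset_right : 𝒞 ⊆ _)).const_mul C
    exact Integrable.mul_bdd this ht.1.continuous.norm.aestronglyMeasurable
      (.of_forall fun x => by rw [norm_norm]; exact hC' x)
  · filter_upwards [hC] with x hx; rw [← sub_mul, norm_mul]; rw [← coe_smul, smul_eq_mul] at hx
    exact mul_le_mul_of_nonneg_right hx (norm_nonneg _)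

lemma linftyNorm_eq_zero_of (hn : 0 < n) (hK : IsOpen K) (hf₀ : MemLinfty K f₀) (hm : -(n : ℝ) < m)
    (h : ∀ φ : 𝔼 → ℂ, IsTestFunction (cone K) φ → ∫ x in cone K, homog m f₀ x * φ x = 0) :
    linftyNorm K f₀ = 0 := by
  by_contra hne
  have hl : LocallyIntegrableOn (homog m f₀) (cone K) := fun x hx => by
    refine ⟨truncCone K (‖x‖ + 1), ?_, integrableOn_homog hn hf₀ hm _⟩
    exact mem_nhdsWithin_of_mem_nhds ((isOpen_truncCone hK _).mem_nhds
      ⟨hx, mem_ball_zero_iff.2 (by linarith)⟩)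
  have h0 := (isOpen_cone hK).ae_eq_zero_of_integral_contDiff_smul_eq_zero hl fun g hg hgc hgs => by
    have h1 := h _ (IsTestFunction.ofReal ⟨hg, hgc, hgs⟩)
    rw [← h1, ← setIntegral_eq_integral (Ω := cone K) (φ := fun x => (g x : ℂ))]
    · refine integral_congr_ae (.of_forall fun x => ?_); simp only [real_smul]; ring
    · exact (IsTestFunction.ofReal ⟨hg, hgc, hgs⟩ : IsTestFunction (cone K) _).2.2
    · intro x hx; have := image_eq_zero_of_notMem_tsupport hx; rw [real_smul, this, zero_mul]
  obtain ⟨κ, hκ, c, hc, h₀, hh₀, hh1, hS⟩ := exists_shell_lower_bound hn hK.measurableSet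
    (one_pos) one_pos hf₀ hne (f := homog m f₀) (m := m) (σ := 1) ⟨0, .of_forall fun x => by
      rw [← coe_smul, smul_eq_mul, homog, sub_self, norm_zero, zero_mul]⟩
  obtain ⟨S, hSm, hSK, hSn, hSv, hSl⟩ := hS h₀ hh₀ le_rfl
  have hpos : 0 < volume S := lt_of_lt_of_le (ENNReal.ofReal_pos.2 (by positivity)) hSv
  refine hpos.ne' ?_
  rw [← Measure.restrict_eq_zero, ← ae_eq_bot, ← Filter.eventually_false_iff_eq_bot]
  filter_upwards [hSl, ae_restrict_mem hSm, ae_restrict_of_ae h0] with x h1 h2 h3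
  have hxK := hSK h2; rw [h3 hxK.1, norm_zero] at h1; have := norm_pos_of_mem hxK.1
  have : 0 < κ * ‖x‖ ^ m := by positivity
  linarith

/-- Euler's identity, in its weak form. -/
lemma integral_homog_fderiv (hn : 0 < n) (hK : MeasurableSet K) (hf₀ : MemLinfty K f₀)
    (hm : -(n : ℝ) < m) {φ : 𝔼 → ℂ} (hφ : IsTestFunction (cone K) φ) : ∫ x in cone K, homog m f₀
    x * fderiv ℝ φ x x = -((n : ℂ) + m) * ∫ x in cone K, homog m f₀ x * φ x := by
  obtain ⟨R, hR0, hR⟩ := hφ.2.1.isBounded.subset_ball_lt 0 (0 : 𝔼)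
  have hz : ∀ x, R ≤ ‖x‖ → x ∉ tsupport φ := fun x hx h =>
    absurd (mem_ball_zero_iff.1 (hR h)) (not_lt.2 hx)
  obtain ⟨C, hC0, hC⟩ := exists_le (hφ.1.continuous_fderiv (by simp)) (hφ.2.1.fderiv ℝ)
  have hD : HasDerivAt (fun s : ℝ => ∫ x in truncCone K (2 * R), homog m f₀ x * φ (s • x))
      (∫ x in truncCone K (2 * R), homog m f₀ x * fderiv ℝ φ ((1 : ℝ) • x) x) 1 := by
    refine (hasDerivAt_integral_of_dominated_loc_of_deriv_le (s := Set.Ioi (1 / 2)) (bound := fun x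
      => ‖homog m f₀ x‖ * (C * (2 * R))) (F' := fun s x => homog m f₀ x * fderiv ℝ φ (s • x) x)
      (Ioi_mem_nhds (by norm_num)) ?_ ?_ ?_ ?_ ?_ ?_).2
    · refine .of_forall fun s => ?_
      exact (integrableOn_homog hn hf₀ hm _).1.mul
        (hφ.1.continuous.comp (continuous_const_smul s)).aestronglyMeasurable
    · simp only [one_smul]
      exact IntegrableOn.mul_of_bound (integrableOn_homog hn hf₀ hm _) hφ.1.continuous hφ.2.1
    · refine (integrableOn_homog hn hf₀ hm _).1.mul (Continuous.aestronglyMeasurable ?_)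
      exact ((hφ.1.continuous_fderiv (by simp)).comp (continuous_const_smul _)).clm_apply
        continuous_id
    · filter_upwards [ae_restrict_mem (meas_truncCone hK _)] with x hx s hs; rw [norm_mul]
      refine mul_le_mul_of_nonneg_left (((fderiv ℝ φ (s • x)).le_opNorm x).trans ?_) (norm_nonneg _)
      exact mul_le_mul (hC _) (norm_lt_of_mem hx).le (norm_nonneg _) hC0
    · exact (integrableOn_homog hn hf₀ hm _).norm.mul_const _
    · refine .of_forall fun x s hs => HasDerivAt.const_mul _ ?_
      have h1 : HasFDerivAt φ (fderiv ℝ φ (s • x)) (s • x) :=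
        (hφ.1.differentiable (by simp) _).hasFDerivAt
      have h2 : HasDerivAt (fun s : ℝ => s • x) x s := by
        simpa using (hasDerivAt_id s).smul_const x
      exact h1.comp_hasDerivAt s h2
  have hE : (fun s : ℝ => ∫ x in truncCone K (2 * R), homog m f₀ x * φ (s • x)) =ᶠ[𝓝 1]
      fun s : ℝ => ℂ(s ^ (-(n + m))) * ∫ x in cone K, homog m f₀ x * φ x := by
    filter_upwards [Ioi_mem_nhds (show ½ < 1 by norm_num)] with s hs
    have hs0 : 0 < s := lt_trans (by norm_num) hs; rw [setIntegral_eq_cone hK]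
    · have h2 := integral_cone_comp_smul (K := K)
        (fun x => ℂ(s ^ (-m)) * (homog m f₀ x * φ x)) (inv_pos.2 hs0)
      have h3 : ∀ x : 𝔼, ℂ(s ^ (-m)) * (homog m f₀ (s • x) * φ (s • x)) =
          homog m f₀ x * φ (s • x) := fun x => by
        rw [homog_smul f₀ hs0, ← mul_assoc, ← mul_assoc, ← Complex.ofReal_mul, ← rpow_add hs0,
          neg_add_cancel, rpow_zero, Complex.ofReal_one, one_mul]
      simp only [inv_inv, h3] at h2
      rw [h2, integral_const_mul, neg_add, rpow_add hs0, rpow_neg hs0.le (n : ℝ),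
        rpow_natCast, real_smul, inv_pow]
      push_cast; ring
    · intro x hx; rw [image_eq_zero_of_notMem_tsupport (hz (s • x) ?_), mul_zero]
      rw [norm_smul, norm_of_nonneg hs0.le]; have : ½ < s := hs; nlinarith
  have h1 : HasDerivAt (fun s : ℝ => ℂ(s ^ (-(n + m))) *
      ∫ x in cone K, homog m f₀ x * φ x) (ℂ(-(n + m)) *
      ∫ x in cone K, homog m f₀ x * φ x) 1 := by
    have := (hasDerivAt_rpow_const (x := 1) (p := -((n : ℝ) + m)) (Or.inl one_ne_zero))
    rw [one_rpow, mul_one] at this; exact this.ofReal_comp.mul_const _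
  have h2 := hD.unique (h1.congr_of_eventuallyEq hE); rw [setIntegral_eq_cone hK] at h2
  · simp only [one_smul] at h2; rw [h2]; push_cast; ring
  · intro x hx
    rw [one_smul, (image_eq_zero_of_notMem_tsupport
      (fun h => hz x (by linarith) (tsupport_fderiv_subset ℝ h)) : fderiv ℝ φ x = 0)]
    simp

end BlowUp

section VertexRelations

variable {α α₀ σ : ℝ} {v₀ : RSpace n → ℂ}

lemma tendsto_mul_rpow (C : ℝ) {t : ℝ} (ht : 0 < t) :
    Tendsto (fun s : ℝ => C * s ^ t) (𝓝[>] 0) (𝓝 0) := by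
  have h := ((continuousAt_rpow_const 0 t (Or.inr ht.le)).tendsto.const_mul C).mono_left
    (nhdsWithin_le_nhds (s := Set.Ioi 0))
  rwa [zero_rpow ht.ne', mul_zero] at h

lemma eq_zero_of_norm_le {a : ℂ} {f : ℝ → ℝ} (hf : Tendsto f (𝓝[>] 0) (𝓝 0)) {s₀ : ℝ}
    (hs₀ : 0 < s₀) (h : ∀ s, 0 < s → s < s₀ → ‖a‖ ≤ f s) : a = 0 := by
  refine norm_le_zero_iff.1 (ge_of_tendsto hf ?_); filter_upwards [Ioo_mem_nhdsGT hs₀] with s hs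
  exact h s hs.1 hs.2

lemma norm_le_of_scaled {s N : ℝ} (hs : 0 < s) {a : ℂ} {b : ℝ} (h : ‖ℂ(s ^ N) * a‖ ≤ s ^ N * b) :
    ‖a‖ ≤ b := by
  rw [norm_mul, norm_real, norm_of_nonneg (by positivity)] at h
  exact le_of_mul_le_mul_left h (rpow_pos_of_pos hs N)

/-- The exponent of the gradient of a function whose leading term is not constant. -/
theorem le_sub_one_of_leadingTerm (hn : 0 < n) (hK : IsOpen K) (hε : 0 < ε)
    (hv : IntegrableOn v 𝒞) (hDv : IntegrableOn Dv 𝒞) (hw : HasWeakGradient 𝒞 v Dv)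
    (hv₀ : MemLinfty K v₀) (hne : linftyNorm K v₀ ≠ 0) (hlead : HasLeadingTerm 𝒞 v v₀ α₀ σ)
    (hσ : 0 < σ) (hα₀ : -(n : ℝ) < α₀) (h0 : α₀ ≠ 0) (hα : -(n : ℝ) < α - 1) {C : ℝ}
    (hgrad : ∀ᵐ x ∂vol 𝒞, ‖Dv x‖ ≤ C * ‖x‖ ^ α) : α ≤ α₀ - 1 := by
  by_contra! hlt
  have key : ∀ φ : 𝔼 → ℂ, IsTestFunction (cone K) φ → ∀ i : Fin n,
      ∫ x in cone K, homog α₀ v₀ x * pd i φ x = 0 := fun φ hφ i => by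
    obtain ⟨C₁, s₁, hs₁, h1⟩ := exists_blowUp hn hK.measurableSet hε hv₀ hα₀ hσ hv hlead (hφ.pd i)
    have hDi : IntegrableOn (fun x => Dv x i) 𝒞 := (pr ℂ i).integrable_comp hDv
    obtain ⟨C₂, s₂, hs₂, h2⟩ := exists_blowUp (f₀ := fun _ => 0) hn hK.measurableSet hε
      MemLp.zero' hα one_pos hDi ⟨C, hgrad.mono fun x hx => by
        rw [smul_zero, sub_zero, sub_add_cancel]; exact (PiLp.norm_apply_le _ _).trans hx⟩ hφ
    obtain ⟨s₃, hs₃, h3⟩ := hφ.comp_smul_cone hε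
    have hlim := (tendsto_mul_rpow C₁ hσ).add
      (tendsto_mul_rpow C₂ (show 0 < α + 1 - α₀ by linarith))
    rw [add_zero] at hlim
    refine eq_zero_of_norm_le hlim (lt_min hs₁ (lt_min hs₂ hs₃)) fun s h0 hs => ?_
    have e1 := h1 s h0 (hs.trans_le (min_le_left _ _))
    have e2 := h2 s h0 (hs.trans_le ((min_le_right _ _).trans (min_le_left _ _)))
    have e3 := hw.2.2 _ (h3 s h0 (hs.trans_le ((min_le_right _ _).trans (min_le_right _ _)))) i
    simp only [grad_apply, pd_comp_smul] at e3
    have e4 : ∫ x in 𝒞, v x * pd i φ (s⁻¹ • x) = -((s : ℂ) * ∫ x in 𝒞, Dv x i * φ (s⁻¹ • x)) := by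
      rw [← mul_neg, ← e3, ← integral_const_mul]; refine integral_congr_ae (.of_forall fun x => ?_)
      simp only [real_smul, Complex.ofReal_inv]
      have : (s : ℂ) ≠ 0 := Complex.ofReal_ne_zero.2 h0.ne'; field_simp
    have e5 : ∫ x in cone K, homog (α - 1) (fun _ => 0) x * φ x = 0 := by
      simp [homog]
    rw [e5, mul_zero, sub_zero] at e2; refine norm_le_of_scaled h0 (N := n + α₀) ?_; rw [e4] at e1
    calc _ = ‖-(-((s : ℂ) * ∫ x in 𝒞, Dv x i * φ (s⁻¹ • x))
          - ℂ(s ^ (n + α₀)) * ∫ x in cone K, homog α₀ v₀ x * pd i φ x)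
          - (s : ℂ) * ∫ x in 𝒞, Dv x i * φ (s⁻¹ • x)‖ := by congr 1; ring
      _ ≤ C₁ * s ^ (n + α₀ + σ) + s * (C₂ * s ^ (n + (α - 1) + 1)) := by
        refine (norm_sub_le _ _).trans (add_le_add (by rwa [norm_neg]) ?_)
        rw [norm_mul, norm_real, norm_of_nonneg h0.le]; exact mul_le_mul_of_nonneg_left e2 h0.le
      _ = s ^ (n + α₀) * (C₁ * s ^ σ + C₂ * s ^ (α + 1 - α₀)) := by
        have r1 : s ^ (n + α₀ + σ) = s ^ (n + α₀) * s ^ σ := rpow_add h0 _ _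
        have r2 : s * s ^ (n + (α - 1) + 1) = s ^ (n + α₀) * s ^ (α + 1 - α₀) := by
          nth_rw 1 [← rpow_one s]; rw [← rpow_add h0, ← rpow_add h0]; congr 1; ring
        rw [r1, mul_left_comm s, r2]; ring
  refine hne (linftyNorm_eq_zero_of hn hK hv₀ hα₀ fun φ hφ => ?_)
  have h1 : ∀ i : Fin n, IsTestFunction (cone K) (fun x : 𝔼 => ℂ(x i) * φ x) := fun i => hφ.mul_left
    (ofRealCLM.contDiff.comp (pr ℝ i).contDiff)
  have h2 : ∀ (i : Fin n) (x : 𝔼), pd i (fun x : 𝔼 => ℂ(x i) * φ x) x =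
      ℂ(x i) * pd i φ x + φ x := fun i x => by
    have h3 : HasFDerivAt (fun y : 𝔼 => ℂ(y i)) (ofRealCLM.comp (pr ℝ i)) x := (ofRealCLM.comp (pr ℝ
      i)).hasFDerivAt
    rw [pd_mul_of h3.differentiableAt (hφ.1.differentiable (by simp) x)]; congr 1
    rw [pd, h3.fderiv]; simp
  have i1 : ∀ i : Fin n, IntegrableOn (fun x => homog α₀ v₀ x *
      pd i (fun x : 𝔼 => ℂ(x i) * φ x) x) (cone K) := fun i => by
    obtain ⟨R, hR0, hR⟩ := ((h1 i).pd i).2.1.isBounded.subset_ball_lt 0 (0 : 𝔼)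
    have := IntegrableOn.mul_of_bound (integrableOn_homog hn hv₀ hα₀ R)
      ((h1 i).pd i).1.continuous ((h1 i).pd i).2.1
    refine this.of_forall_sdiff_eq_zero (measurableSet_cone hK.measurableSet) fun x hx => ?_
    rw [image_eq_zero_of_notMem_tsupport fun h => hx.2 ⟨hx.1, hR h⟩, mul_zero]
  have h4 : ∫ x in cone K, ∑ i : Fin n, homog α₀ v₀ x * pd i (fun x : 𝔼 => ℂ(x i) * φ x) x = 0 := by
    rw [integral_finsetSum _ fun i _ => i1 i]; exact sum_eq_zero fun i _ => key _ (h1 i) i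
  have h5 := integral_homog_fderiv hn hK.measurableSet hv₀ hα₀ hφ
  have i2 : IntegrableOn (fun x => homog α₀ v₀ x * φ x) (cone K) := by
    obtain ⟨R, hR0, hR⟩ := hφ.2.1.isBounded.subset_ball_lt 0 (0 : 𝔼)
    have := IntegrableOn.mul_of_bound (integrableOn_homog hn hv₀ hα₀ R) hφ.1.continuous hφ.2.1
    refine this.of_forall_sdiff_eq_zero (measurableSet_cone hK.measurableSet) fun x hx => ?_
    rw [image_eq_zero_of_notMem_tsupport fun h => hx.2 ⟨hx.1, hR h⟩, mul_zero]
  have e6 : ∀ x, ∑ i : Fin n, homog α₀ v₀ x * pd i (fun x : 𝔼 => ℂ(x i) * φ x) x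
      - (n : ℂ) * (homog α₀ v₀ x * φ x) = homog α₀ v₀ x * fderiv ℝ φ x x := fun x => by
    rw [fderiv_eq_sum_pd, ← mul_sum]
    simp only [h2, sum_add_distrib, Finset.sum_const, Finset.card_univ, Fintype.card_fin,
      nsmul_eq_mul, real_smul]
    ring
  have i3 := integrable_finsetSum Finset.univ fun i _ => i1 i
  rw [← integral_congr_ae (.of_forall e6), integral_sub i3 (i2.const_mul _), h4,
    integral_const_mul] at h5
  have h6 : (α₀ : ℂ) * ∫ x in cone K, homog α₀ v₀ x * φ x = 0 := by linear_combination h5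
  exact (mul_eq_zero.1 h6).resolve_left (Complex.ofReal_ne_zero.2 h0)

/-- The remainder of an expansion of a solution of the Helmholtz equation is at most quadratically
smaller than its leading term. -/
theorem sigma_le_two_of_isWeakSolution (hk : k ≠ 0) (hn : 0 < n) (hK : IsOpen K) (hε : 0 < ε)
    (hv : IntegrableOn v 𝒞) (hDv : IntegrableOn Dv 𝒞) (hw : IsWeakSolution k 1 1 𝒞 v Dv)
    (hv₀ : MemLinfty K v₀) (hne : linftyNorm K v₀ ≠ 0) (hlead : HasLeadingTerm 𝒞 v v₀ α₀ σ)
    (hσ : 0 < σ) (hα₀ : -(n : ℝ) < α₀) : σ ≤ 2 := by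
  by_contra! hlt
  refine hne (linftyNorm_eq_zero_of hn hK hv₀ hα₀ fun φ hφ => ?_)
  have hφl : IsTestFunction (cone K) (lapl φ) := ⟨contDiff_lapl hφ.1, hasCompactSupport_lapl hφ.2.1,
    (tsupport_lapl_subset φ).trans hφ.2.2⟩
  obtain ⟨C₁, s₁, hs₁, h1⟩ := exists_blowUp hn hK.measurableSet hε hv₀ hα₀ hσ hv hlead hφl
  obtain ⟨C₂, s₂, hs₂, h2⟩ := exists_blowUp hn hK.measurableSet hε hv₀ hα₀ hσ hv hlead hφ
  obtain ⟨s₃, hs₃, h3⟩ := hφ.comp_smul_cone hε; set a₁ := ∫ x in cone K, homog α₀ v₀ x * lapl φ x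
  set a₀ := ∫ x in cone K, homog α₀ v₀ x * φ x
  have key : ∀ s, 0 < s → s < min s₁ (min s₂ s₃) →
      ‖a₁ + ℂ(k ^ 2 * s ^ 2) * a₀‖ ≤ C₁ * s ^ σ + k ^ 2 * C₂ * s ^ (σ + 2) := fun s h0 hs => by
    have e1 := h1 s h0 (hs.trans_le (min_le_left _ _))
    have e2 := h2 s h0 (hs.trans_le ((min_le_right _ _).trans (min_le_left _ _)))
    have ht := h3 s h0 (hs.trans_le ((min_le_right _ _).trans (min_le_right _ _)))
    have hi : ∀ {g : 𝔼 → ℂ}, IntegrableOn g 𝒞 → ∀ {ψ : 𝔼 → ℂ}, IsTestFunction 𝒞 ψ → IntegrableOn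
      (fun x => g x * ψ x) 𝒞 := fun hg _ hψ => IntegrableOn.mul_of_bound hg hψ.1.continuous hψ.2.1
    have hDi : ∀ i : Fin n, IntegrableOn (fun x => Dv x i) 𝒞 := fun i =>
      (pr ℂ i).integrable_comp hDv
    have e3 : ∫ x in 𝒞, cdot (Dv x) (∇ (fun x => φ (s⁻¹ • x)) x) =
        -∫ x in 𝒞, v x * lapl (fun x => φ (s⁻¹ • x)) x := by
      simp only [cdot_grad_sum, lapl, mul_sum]
      rw [integral_finsetSum _ fun i _ => hi (hDi i) (ht.pd i),
        integral_finsetSum _ fun i _ => hi hv ((ht.pd i).pd i), ← sum_neg_distrib]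
      refine sum_congr rfl fun i _ => ?_; have := hw.1.2.2.2.2 _ (ht.pd i) i
      simp only [grad_apply] at this; rw [this, neg_neg]
    have e4 := hw.2 _ ht
    have hmg : IntegrableOn (fun x => cdot (Dv x) (∇ (fun x => φ (s⁻¹ • x)) x))
        𝒞 := by
      simp only [cdot_grad_sum]
      exact integrable_finsetSum _ fun i _ => hi (hDi i) (ht.pd i)
    simp only [energyForm, Pi.one_apply, Complex.ofReal_one, one_mul, mul_one, mul_assoc] at e4
    rw [integral_sub hmg ((hi hv ht).const_mul _), integral_const_mul, e3] at e4
    have e5 : ∫ x in 𝒞, v x * lapl (fun x => φ (s⁻¹ • x)) x =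
        ℂ(s⁻¹ ^ 2) * ∫ x in 𝒞, v x * lapl φ (s⁻¹ • x) := by
      rw [← integral_const_mul]; refine integral_congr_ae (.of_forall fun x => ?_)
      have := lapl_scale (φ := φ) s⁻¹ 1 x; simp only [one_smul, one_mul] at this
      simp only [this, real_smul]; ring
    rw [e5] at e4; set I₁ := ∫ x in 𝒞, v x * lapl φ (s⁻¹ • x); set I₀ := ∫ x in 𝒞, v x * φ (s⁻¹ • x)
    have hs0 : (s : ℂ) ≠ 0 := Complex.ofReal_ne_zero.2 h0.ne'
    have e6 : I₁ + ℂ(k ^ 2 * s ^ 2) * I₀ = 0 := by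
      push_cast at e4 ⊢
      have : (s : ℂ) ^ 2 * (-((s : ℂ)⁻¹ ^ 2 * I₁) - ℂ(k) ^ 2 * I₀) = 0 := by rw [e4, mul_zero]
      have hs1 : (s : ℂ) ^ 2 * (s : ℂ)⁻¹ ^ 2 = 1 := by field_simp
      linear_combination -this - I₁ * hs1
    refine norm_le_of_scaled h0 (N := n + α₀) ?_
    calc _ = ‖-((I₁ - ℂ(s ^ (n + α₀)) * a₁) + ℂ(k ^ 2 * s ^ 2) * (I₀ - ℂ(s ^ (n + α₀)) * a₀))‖ := by
          congr 1; linear_combination e6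
      _ ≤ C₁ * s ^ (n + α₀ + σ) + k ^ 2 * s ^ 2 * (C₂ * s ^ (n + α₀ + σ)) := by
        rw [norm_neg]; refine (norm_add_le _ _).trans (add_le_add e1 ?_)
        rw [norm_mul, norm_real, norm_of_nonneg (by positivity)]
        exact mul_le_mul_of_nonneg_left e2 (by positivity)
      _ = s ^ (n + α₀) * (C₁ * s ^ σ + k ^ 2 * C₂ * s ^ (σ + 2)) := by
        rw [rpow_add h0 (n + α₀), rpow_add h0 σ, rpow_two]; ring
  have hmin : 0 < min s₁ (min s₂ s₃) := lt_min hs₁ (lt_min hs₂ hs₃)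
  have ha₁ : a₁ = 0 := by
    have hlim := ((tendsto_mul_rpow C₁ hσ).add (tendsto_mul_rpow (k ^ 2 * C₂)
      (show 0 < σ + 2 by linarith))).add (tendsto_mul_rpow (k ^ 2 * ‖a₀‖) two_pos)
    rw [add_zero, add_zero] at hlim; refine eq_zero_of_norm_le hlim hmin fun s h0 hs => ?_
    have h4 := key s h0 hs
    have h5 := norm_sub_le (a₁ + ℂ(k ^ 2 * s ^ 2) * a₀) (ℂ(k ^ 2 * s ^ 2) * a₀)
    rw [add_sub_cancel_right, norm_mul, norm_real, norm_of_nonneg (by positivity)] at h5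
    rw [rpow_two]; linarith
  have hk2 : 0 < k ^ 2 := by positivity
  have hlim := (tendsto_mul_rpow ((k ^ 2)⁻¹ * C₁) (show 0 < σ - 2 by linarith)).add
    (tendsto_mul_rpow C₂ hσ)
  rw [add_zero] at hlim; refine eq_zero_of_norm_le hlim hmin fun s h0 hs => ?_
  have h4 := key s h0 hs
  rw [ha₁, zero_add, norm_mul, norm_real, norm_of_nonneg (by positivity)] at h4
  have h5 : s ^ σ = s ^ 2 * s ^ (σ - 2) := by
    rw [← rpow_two, ← rpow_add h0]; congr 1; ring
  have h6 : s ^ (σ + 2) = s ^ 2 * s ^ σ := by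
    rw [← rpow_two, ← rpow_add h0]; congr 1; ring
  have h7 : k ^ 2 * s ^ 2 * ((k ^ 2)⁻¹ * C₁ * s ^ (σ - 2) + C₂ * s ^ σ) =
      C₁ * s ^ σ + k ^ 2 * C₂ * s ^ (σ + 2) := by
    rw [h6]; nth_rw 2 [h5]; field_simp
  exact le_of_mul_le_mul_left (h4.trans_eq h7.symm) (by positivity)

end VertexRelations

/-- The conjugate of a vector of `ℂⁿ`. -/
def conjVec (v : CSpace n) : CSpace n := WithLp.toLp 2 fun i => starRingEnd ℂ (v i)

lemma norm_conjVec (v : CSpace n) : ‖conjVec v‖ = ‖v‖ := by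
  simp only [EuclideanSpace.norm_eq, conjVec, RCLike.norm_conj]

lemma continuous_conjVec : Continuous (conjVec (n := n)) :=
  (PiLp.continuous_toLp 2 _).comp (continuous_pi fun i => continuous_conj.comp (pr ℂ i).continuous)

lemma cdot_conjVec (v : CSpace n) : cdot v (conjVec v) = ℂ(‖v‖ ^ 2) := by
  simp only [cdot, conjVec, Complex.mul_conj, Complex.normSq_eq_norm_sq, EuclideanSpace.norm_sq_eq]
  push_cast; rfl

lemma IsH1.conj [IsFiniteMeasure vol Ω] {f : 𝔼 → ℂ} {Df : 𝔼 → CSpace n} (h : IsH1 Ω f Df) :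
    IsH1 Ω (fun x => starRingEnd ℂ (f x)) (fun x => conjVec (Df x)) := by
  have m1 : MemLp (fun x => starRingEnd ℂ (f x)) 2 vol Ω := h.1.of_le
    (continuous_conj.comp_aestronglyMeasurable h.1.1) (.of_forall fun x => (RCLike.norm_conj _).le)
  have m2 : MemLp (fun x => conjVec (Df x)) 2 vol Ω := h.2.1.of_le
    (continuous_conjVec.comp_aestronglyMeasurable h.2.1.1) (.of_forall fun x => (norm_conjVec _).le)
  refine ⟨m1, m2, IntegrableOn.locallyIntegrableOn (m1.integrable (by norm_num)),
    IntegrableOn.locallyIntegrableOn (m2.integrable (by norm_num)), fun φ hφ i => ?_⟩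
  have hd : ∀ x, pd i (fun y => starRingEnd ℂ (φ y)) x = starRingEnd ℂ (pd i φ x) := fun x => by
    have h1 : HasFDerivAt φ (fderiv ℝ φ x) x := (hφ.1.differentiable (by simp) x).hasFDerivAt
    have h2 : HasFDerivAt (fun y => starRingEnd ℂ (φ y)) (conjCLE.toContinuousLinearMap.comp (fderiv
      ℝ φ x)) x := (conjCLE.toContinuousLinearMap.hasFDerivAt (x := φ x)).comp x h1
    rw [pd, pd, h2.fderiv]; rfl
  have hφ' : IsTestFunction Ω (fun y => starRingEnd ℂ (φ y)) := ⟨conjCLE.contDiff.comp hφ.1,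
    hφ.2.1.comp_left (map_zero _), (tsupport_comp_subset (map_zero (starRingEnd ℂ)) φ).trans hφ.2.2⟩
  have h3 := congrArg (starRingEnd ℂ) (h.2.2.2.2 _ hφ' i); simp only [grad_apply, hd] at h3
  rw [map_neg, ← integral_conj, ← integral_conj] at h3; simp only [map_mul, Complex.conj_conj] at h3
  exact h3

lemma eLpNorm_two_le_iff {α F : Type*} [MeasurableSpace α] {μ : Measure α} [NormedAddCommGroup F]
    {f : α → F} (hf : MemLp f 2 μ) {b : ℝ} (hb : 0 ≤ b) :
    eLpNorm f 2 μ ≤ ofReal b ↔ ∫ x, ‖f x‖ ^ 2 ∂μ ≤ b ^ 2 := by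
  have h0 : 0 ≤ ∫ x, ‖f x‖ ^ 2 ∂μ := integral_nonneg fun x => by positivity
  have h1 := hf.eLpNorm_eq_integral_rpow_norm two_ne_zero ENNReal.ofNat_ne_top
  simp only [ENNReal.toReal_ofNat, rpow_ofNat] at h1
  rw [h1, ENNReal.ofReal_le_ofReal_iff hb, ← one_div, ← sqrt_eq_rpow, sqrt_le_left hb]

lemma exists_scaled_cutoff (n : ℕ) : ∃ C₀ : ℝ, 0 ≤ C₀ ∧ ∀ r : ℝ, 0 < r → ∃ χ : RSpace n → ℝ,
    ContDiff ℝ ∞ χ ∧ (∀ x, 0 ≤ χ x ∧ χ x ≤ 1) ∧ (∀ x, ‖x‖ ≤ r → χ x = 1) ∧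
    (∀ x, 2 * r ≤ ‖x‖ → χ x = 0) ∧ ∀ x, ‖∇ (fun y => (χ y : ℂ)) x‖ ≤ C₀ / r := by
  let b : ContDiffBump (0 : RSpace n) := ⟨1, 2, one_pos, one_lt_two⟩
  have hb : IsTestFunction Set.univ (fun x => ℂ(b x)) :=
    IsTestFunction.ofReal ⟨b.contDiff, b.hasCompactSupport, subset_univ _⟩
  obtain ⟨C₀, h0, hC⟩ := exists_le (contDiff_grad hb.1) (hasCompactSupport_grad hb.2.1)
  refine ⟨C₀, h0, fun r hr => ⟨fun x => b (r⁻¹ • x), b.contDiff.comp (contDiff_const_smul _),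
    fun x => ⟨b.nonneg, b.le_one⟩, fun x hx => b.one_of_mem_closedBall ?_,
    fun x hx => b.zero_of_le_dist ?_, fun x => ?_⟩⟩
  · rw [mem_closedBall_zero_iff, norm_smul, norm_inv, norm_of_nonneg hr.le]
    exact inv_mul_le_one_of_le₀ hx hr.le
  · rw [dist_zero_right, norm_smul, norm_inv, norm_of_nonneg hr.le, ← div_eq_inv_mul,
      le_div_iff₀ hr]
    exact hx
  · have : ∇ (fun y => ℂ(b (r⁻¹ • y))) x = r⁻¹ • ∇ (fun y => ℂ(b y)) (r⁻¹ • x) := by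
      ext i; exact pd_comp_smul (φ := fun y => ℂ(b y)) r⁻¹ i x
    rw [this, norm_smul, norm_inv, norm_of_nonneg hr.le, div_eq_inv_mul]
    exact mul_le_mul_of_nonneg_left (hC _) (inv_nonneg.2 hr.le)

lemma young_energy_le {l P a y q F g C₀ : ℝ} (hl : 0 < l) (ha : 0 ≤ a) : 2 * P * (y * q) + a * q
    ^ 2 + F * (y + 2 * C₀ * q) + g * q ≤ l / 2 * y ^ 2 + (4 * P ^ 2 / l + a + C₀ ^ 2 + 1 / l + 1)
    * (q ^ 2 + F ^ 2 + g ^ 2) := by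
  have h1 : 2 * P * (y * q) ≤ l / 4 * y ^ 2 + 4 * P ^ 2 / l * q ^ 2 := by
    have := sq_nonneg (l * y - 4 * P * q); rw [← sub_nonneg]
    have e : l / 4 * y ^ 2 + 4 * P ^ 2 / l * q ^ 2 - 2 * P * (y * q) =
        (l * y - 4 * P * q) ^ 2 / (4 * l) := by field_simp; ring
    rw [e]; positivity
  have h2 : F * y ≤ l / 4 * y ^ 2 + 1 / l * F ^ 2 := by
    rw [← sub_nonneg]
    have e : l / 4 * y ^ 2 + 1 / l * F ^ 2 - F * y = (l * y - 2 * F) ^ 2 / (4 * l) := by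
      field_simp; ring
    rw [e]; positivity
  have h3 := sq_nonneg (F - C₀ * q); have h4 := sq_nonneg (g - q)
  have h5 : 0 ≤ 4 * P ^ 2 / l + a + C₀ ^ 2 := by positivity
  have h6 : 0 ≤ 1 / l * (q ^ 2 + g ^ 2) := by positivity
  nlinarith [mul_nonneg h5 (add_nonneg (sq_nonneg F) (sq_nonneg g)), sq_nonneg q, sq_nonneg g]

namespace DifferenceProblem

include D

/-- The Caccioppoli inequality at the vertex. -/
lemma exists_energy_le : ∃ N : ℝ, 0 ≤ N ∧ ∀ r, 0 < r → 2 * r < ε → ∫ x in truncCone K r, ‖Dz x‖ ^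
    2 ≤ N * ∫ x in truncCone K (2 * r),
    ((‖z x‖ / r) ^ 2 + ‖ℂ(γ x - 1) • Dv x‖ ^ 2 + (r * ‖ℂ(k) ^ 2 * (ℂ(ρ x - 1) * v x)‖) ^ 2) := by
  obtain ⟨C₀, hC₀, hcut⟩ := exists_scaled_cutoff n; have hl := D.lam_pos; have hM := D.M_nonneg
  have hε := D.eps_pos; have hK := D.isOpen.measurableSet
  set N := 4 * (M * C₀) ^ 2 / lam + k ^ 2 * M * ε ^ 2 + C₀ ^ 2 + 1 / lam + 1 with hN
  have hN0 : 0 ≤ N := by positivity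
  refine ⟨2 * N / lam, by positivity, fun r hr hrε => ?_⟩
  obtain ⟨χ, hχ, h01, h1, h0, hgr⟩ := hcut r hr; set g : 𝔼 → ℂ := fun y => (χ y : ℂ) with hg
  have hgc : ContDiff ℝ ∞ g := ofRealCLM.contDiff.comp hχ
  have hgn : ∀ x, ‖g x‖ = χ x := fun x => by
    rw [hg, norm_real, norm_of_nonneg (h01 x).1]
  have hg2 : ∀ x, ∇ (fun y => g y * g y) x = (2 * g x) • ∇ g x := fun x => by
    rw [grad_mul hgc hgc, ← two_smul ℂ (g x • _), smul_smul]
  have hψ := D.z_mem.conj.smooth_mul D.measurableSet (hgc.mul hgc) (C := max 1 (2 * (C₀ / r)))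
    (fun x _ => by
      rw [norm_mul, hgn]; exact (mul_le_one₀ (h01 x).2 (h01 x).1 (h01 x).2).trans (le_max_left _ _))
    (fun x _ => by
      rw [hg2, norm_smul, norm_mul, Complex.norm_two, hgn]; refine le_trans ?_ (le_max_right _ _)
      have := h01 x; exact mul_le_mul (by linarith) (hgr x) (norm_nonneg _) zero_le_two)
  set ψ : 𝔼 → ℂ := fun x => g x * g x * starRingEnd ℂ (z x) with hψdef
  set Dψ : 𝔼 → CSpace n := fun x => (g x * g x) • conjVec (Dz x) + starRingEnd ℂ (z x) •
    ∇ (fun y => g y * g y) x with hDψ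
  have hg0 : ∀ x, 2 * r ≤ ‖x‖ → g x = 0 := fun x hx => by rw [hg]; simp only [h0 x hx]; simp
  have hψ0 : ∀ x, 2 * r ≤ ‖x‖ → ψ x = 0 ∧ Dψ x = 0 := fun x hx => by
    simp only [hψdef, hDψ, hg2, hg0 x hx]; simp
  have heq := D.eqn ψ Dψ hψ ⟨2 * r, hrε, .of_forall fun x hx => (hψ0 x hx).1⟩
  have hsub := truncCone_mono (K := K) hrε.le
  set P : 𝔼 → ℂ := fun x => ℂ(γ x) * cdot (Dz x) (Dψ x) - ℂ(k) ^ 2 * ℂ(ρ x) * z x * ψ x with hP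
  set Q : 𝔼 → ℂ := fun x => ℂ(γ x - 1) * cdot (Dv x) (Dψ x)
    - ℂ(k) ^ 2 * ℂ(ρ x - 1) * v x * ψ x with hQ
  have iP : IntegrableOn P 𝒞 := (integrable_mul_cdot D.w1.meas.restrict D.gamma_bound D.z_mem.2.1
    hψ.2.1).sub (integrable_mul_mul D.rho_meas.restrict D.rho_bound' _ D.z_mem.1 hψ.1)
  have iQ : IntegrableOn Q 𝒞 := (integrable_mul_cdot (D.w1.meas.restrict.sub
    aestronglyMeasurable_const) D.gamma_sub_one_bound D.Dv_mem hψ.2.1).sub (integrable_mul_mul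
    (D.rho_meas.restrict.sub aestronglyMeasurable_const) D.rho_sub_one_bound _ D.v_mem hψ.1)
  have hPQ : ∫ x in truncCone K (2 * r), (P x + Q x) = 0 := by
    rw [← setIntegral_eq_of_subset_of_forall_sdiff_eq_zero D.measurableSet hsub,
      integral_add iP iQ, heq, neg_add_cancel]
    intro x hx
    have hx2 : 2 * r ≤ ‖x‖ := by
      by_contra hc
      exact hx.2 ⟨hx.1.1, mem_ball_zero_iff.2 (not_le.1 hc)⟩
    simp only [hP, hQ, hψ0 x hx2]; simp [cdot]
  set μ := vol (truncCone K (2 * r)) with hμ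
  have hμle : μ ≤ vol 𝒞 := Measure.restrict_mono hsub le_rfl
  set T : 𝔼 → ℝ := fun x => γ x * (χ x * ‖Dz x‖) ^ 2 with hT
  set q : 𝔼 → ℝ := fun x => (‖z x‖ / r) ^ 2 + ‖ℂ(γ x - 1) • Dv x‖ ^ 2 + (r * ‖ℂ(k) ^ 2 * (ℂ(ρ x - 1)
    * v x)‖) ^ 2 with hq
  have sq_int : ∀ {F : Type} [NormedAddCommGroup F] {f : 𝔼 → F}, MemLp f 2 vol 𝒞 → Integrable (fun x
    => ‖f x‖ ^ 2) μ := fun hf => (hf.mono_measure hμle).integrable_norm_pow two_ne_zero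
  have iq : Integrable q μ := by
    refine (((sq_int D.z_mem.1).div_const (r ^ 2)).add (sq_int D.memLp_grad_data)).add
      ((sq_int D.memLp_pot_data).const_mul (r ^ 2)) |>.congr (.of_forall fun x => ?_)
    simp only [hq, Pi.add_apply, div_pow, mul_pow]
  have iT : Integrable T μ := by
    have := ((sq_int D.z_mem.2.1).bdd_mul (c := 1) (f := fun x => χ x ^ 2)
      (hχ.continuous.pow 2).aestronglyMeasurable (.of_forall fun x => by
        rw [norm_of_nonneg (sq_nonneg _)]; exact pow_le_one₀ (h01 x).1 (h01 x).2)).bdd_mul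
      (c := M) D.w1.meas.restrict (ae_mono hμle D.gamma_bound)
    refine this.congr (.of_forall fun x => ?_); simp only [hT]; ring
  have hb : ∀ᵐ x ∂μ, ‖P x + Q x - (T x : ℂ)‖ ≤ 1 / 2 * T x + N * q x := by
    filter_upwards [ae_mono hμle D.gamma_bound, ae_mono hμle D.rho_bound', ae_mono hμle D.ell,
      ae_restrict_mem (meas_truncCone hK (2 * r))] with x g1 g2 g3 hx
    have e1 : P x + Q x - (T x : ℂ) =
        ℂ(γ x) * (starRingEnd ℂ (z x) * (2 * g x) * cdot (Dz x) (∇ g x))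
        + -(ℂ(k) ^ 2 * ℂ(ρ x) * (z x * ψ x))
        + cdot (ℂ(γ x - 1) • Dv x) (Dψ x)
        + -(ℂ(k) ^ 2 * (ℂ(ρ x - 1) * v x) * ψ x) := by
      have e2 : (T x : ℂ) = ℂ(γ x) * (g x * g x * cdot (Dz x) (conjVec (Dz x))) := by
        rw [cdot_conjVec]; simp only [hT, hg]; push_cast; ring
      rw [e2]; simp only [hP, hQ, hDψ, hg2, cdot_smul_left, cdot_add_right, cdot_smul_right]; ring
    set y := χ x * ‖Dz x‖; set w := ‖z x‖ / r; set F := ‖ℂ(γ x - 1) • Dv x‖; have hc := h01 x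
    have hzw : ‖z x‖ = w * r := by simp only [w]; field_simp
    have hw0 : 0 ≤ w := by positivity
    have hgx := hgr x
    have hgw : ‖z x‖ * ‖∇ g x‖ ≤ C₀ * w := by
      calc _ ≤ ‖z x‖ * (C₀ / r) := by gcongr
        _ = _ := by rw [hzw]; field_simp
    have hψn : ‖ψ x‖ ≤ ‖z x‖ := by
      simp only [hψdef, norm_mul, hgn, RCLike.norm_conj]
      exact mul_le_of_le_one_left (norm_nonneg _) (mul_le_one₀ hc.2 hc.1 hc.2)
    have t1 : ‖ℂ(γ x) * (starRingEnd ℂ (z x) * (2 * g x) * cdot (Dz x) (∇ g x))‖ ≤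
        2 * (M * C₀) * (y * w) := by
      rw [norm_mul, norm_mul, norm_mul, norm_mul, norm_real, RCLike.norm_conj, hgn,
        Complex.norm_two]
      calc _ ≤ M * (‖z x‖ * (2 * χ x) * (‖Dz x‖ * ‖∇ g x‖)) := by
            have := norm_cdot_le (Dz x) (∇ g x); have := hc.1; gcongr; exact g1
        _ = 2 * M * y * (‖z x‖ * ‖∇ g x‖) := by simp only [y]; ring
        _ ≤ 2 * M * y * (C₀ * w) := by
            have : 0 ≤ y := mul_nonneg hc.1 (norm_nonneg _); gcongr
        _ = _ := by ring
    have t2 : ‖-(ℂ(k) ^ 2 * ℂ(ρ x) * (z x * ψ x))‖ ≤ k ^ 2 * M * ε ^ 2 * w ^ 2 := by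
      rw [norm_neg, norm_mul, norm_mul, norm_mul, norm_pow, norm_real, norm_real,
        norm_eq_abs k, sq_abs]
      calc _ ≤ k ^ 2 * M * (‖z x‖ * ‖z x‖) := by gcongr; exact g2
        _ = k ^ 2 * M * r ^ 2 * w ^ 2 := by rw [hzw]; ring
        _ ≤ _ := by
            have : r ≤ ε := by linarith
            gcongr
    have t3 : ‖cdot (ℂ(γ x - 1) • Dv x) (Dψ x)‖ ≤ F * (y + 2 * C₀ * w) := by
      refine (norm_cdot_le _ _).trans (mul_le_mul_of_nonneg_left ((norm_add_le _ _).trans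
        (add_le_add ?_ ?_)) (norm_nonneg _))
      · rw [norm_smul, norm_mul, hgn, norm_conjVec, mul_assoc]
        exact mul_le_of_le_one_left (mul_nonneg hc.1 (norm_nonneg _)) hc.2
      · rw [hg2, norm_smul, norm_smul, RCLike.norm_conj, norm_mul, Complex.norm_two, hgn]
        nlinarith [mul_nonneg (norm_nonneg (z x)) (norm_nonneg (∇ g x))]
    have t4 : ‖-(ℂ(k) ^ 2 * (ℂ(ρ x - 1) * v x) * ψ x)‖ ≤
        r * ‖ℂ(k) ^ 2 * (ℂ(ρ x - 1) * v x)‖ * w := by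
      rw [norm_neg, norm_mul]; refine (mul_le_mul_of_nonneg_left hψn (norm_nonneg _)).trans_eq ?_
      rw [hzw]; ring
    rw [e1]
    refine (norm_add_le _ _).trans ((add_le_add ((norm_add₃_le).trans
      (add_le_add (add_le_add t1 t2) t3)) t4).trans ((young_energy_le hl (by positivity)).trans ?_))
    refine add_le_add ?_ le_rfl; have : lam * y ^ 2 ≤ γ x * y ^ 2 := by gcongr
    change lam / 2 * y ^ 2 ≤ 1 / 2 * (γ x * y ^ 2); linarith
  have iC : Integrable (fun x => (T x : ℂ)) μ := iT.ofReal
  have hT1 : ∫ x, T x ∂μ ≤ 1 / 2 * ∫ x, T x ∂μ + N * ∫ x, q x ∂μ := by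
    have h3 := norm_integral_le_of_norm_le ((iT.const_mul (1 / 2)).add (iq.const_mul N)) hb
    rw [integral_sub ((Integrable.fun_add iP iQ).mono_measure hμle) iC] at h3
    simp only [Pi.add_apply] at h3
    rw [hPQ, zero_sub, norm_neg, integral_complex_ofReal, norm_real,
      integral_add (iT.const_mul _) (iq.const_mul _), integral_const_mul, integral_const_mul] at h3
    exact (le_norm_self _).trans h3
  have hT2 : lam * ∫ x in truncCone K r, ‖Dz x‖ ^ 2 ≤ ∫ x, T x ∂μ := by
    rw [← integral_const_mul]
    have hle : vol (truncCone K r) ≤ μ :=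
      Measure.restrict_mono (truncCone_mono (by linarith)) le_rfl
    refine (integral_mono_ae (((sq_int D.z_mem.2.1).mono_measure hle).const_mul lam)
      (iT.mono_measure hle) ?_).trans (integral_mono_measure hle ?_ iT)
    · filter_upwards [ae_mono (hle.trans hμle) D.ell, ae_restrict_mem (meas_truncCone hK r)]
        with x g1 hx
      simp only [hT, h1 x (norm_lt_of_mem hx).le, one_mul]; gcongr
    · filter_upwards [ae_mono hμle D.ell] with x g1; have := hl.trans_le g1
      simp only [hT, Pi.zero_apply]; positivity
  rw [div_mul_eq_mul_div, le_div_iff₀ hl]; linarith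

/-- The decay of the gradient of the difference of the solutions. -/
lemma exists_eLpNorm_grad_le {E C : ℝ} (hE : 1 ≤ E) (hC : 0 ≤ C) (hz : L2Decay K ε z C E)
    (hF : L2Decay K ε (fun x => ℂ(γ x - 1) • Dv x) C (E - 1))
    (hG : L2Decay K ε (fun x => ℂ(k) ^ 2 * (ℂ(ρ x - 1) * v x)) C (E - 2)) :
    ∃ C', 0 ≤ C' ∧ L2Decay K ε Dz C' (E - 1) := by
  obtain ⟨N, hN, hen⟩ := D.exists_energy_le; have hε := D.eps_pos
  have hm : ∀ {F : Type} [NormedAddCommGroup F] {f : 𝔼 → F} {r : ℝ}, r ≤ ε → MemLp f 2 vol 𝒞 → MemLp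
    f 2 vol (truncCone K r) := fun hr hf => hf.mono_measure (Measure.restrict_mono (truncCone_mono
    hr) le_rfl)
  set N₂ := (eLpNorm Dz 2 vol 𝒞).toReal; set C₁ := sqrt (N * (3 * (C * 2 ^ E) ^ 2)) with hC₁
  refine ⟨max C₁ (N₂ * ((ε / 4) ^ (E - 1))⁻¹), le_max_of_le_left (sqrt_nonneg _),
    fun r hr hrε => ?_⟩
  rcases lt_or_ge (2 * r) ε with hr2 | hr2
  · refine le_trans ?_ (ofReal_le_ofReal (mul_le_mul_of_nonneg_right (le_max_left _ _)
      (by positivity)))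
    rw [eLpNorm_two_le_iff (hm hrε D.z_mem.2.1) (by positivity)]; refine (hen r hr hr2).trans ?_
    have h2r : 0 < 2 * r := by positivity
    have a1 := (eLpNorm_two_le_iff (hm hr2.le D.z_mem.1) (by positivity)).1 (hz _ h2r hr2.le)
    have a2 := (eLpNorm_two_le_iff (hm hr2.le D.memLp_grad_data) (by positivity)).1
      (hF _ h2r hr2.le)
    have a3 := (eLpNorm_two_le_iff (hm hr2.le D.memLp_pot_data) (by positivity)).1 (hG _ h2r hr2.le)
    have i1 := (hm hr2.le D.z_mem.1).integrable_norm_pow two_ne_zero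
    have i2 := (hm hr2.le D.memLp_grad_data).integrable_norm_pow two_ne_zero
    have i3 := (hm hr2.le D.memLp_pot_data).integrable_norm_pow two_ne_zero
    have e : ∀ j : ℝ, 0 ≤ j → (2 * r) ^ (E - j) * r ^ j ≤ 2 ^ E * r ^ E := fun j hj => by
      rw [mul_rpow zero_le_two hr.le, mul_assoc, ← rpow_add hr, sub_add_cancel]; gcongr
      · exact one_le_two
      · linarith
    set X := C * (2 ^ E * r ^ E) with hX
    have b : ∀ j : ℝ, 0 ≤ j → (r ^ j) ^ 2 * (C * (2 * r) ^ (E - j)) ^ 2 ≤ X ^ 2 := fun j hj => by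
      rw [← mul_pow]; refine pow_le_pow_left₀ (by positivity) ?_ 2
      have := mul_le_mul_of_nonneg_left (e j hj) hC; linarith
    have b0 := b 0 le_rfl; have b1 := b 1 zero_le_one; have b2 := b 2 zero_le_two
    rw [rpow_zero, one_pow, one_mul, sub_zero] at b0; rw [rpow_one] at b1; rw [rpow_two] at b2
    rw [mul_pow, sq_sqrt (by positivity), mul_assoc N]; refine mul_le_mul_of_nonneg_left ?_ hN
    have e1 : r ^ E = r * r ^ (E - 1) := by
      nth_rw 2 [← rpow_one r]; rw [← rpow_add hr, add_sub_cancel]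
    simp only [div_pow, mul_pow r]
    rw [integral_add (Integrable.fun_add (i1.div_const _) i2) (i3.const_mul _), integral_add (i1.div_const _) i2,
      integral_div, integral_const_mul]
    refine le_of_mul_le_mul_left (a := r ^ 2) ?_ (by positivity)
    have e2 : r ^ 2 * (3 * (C * 2 ^ E) ^ 2 * (r ^ (E - 1)) ^ 2) = 3 * X ^ 2 := by
      rw [hX, e1]; ring
    rw [e2, mul_add, mul_add, mul_div_cancel₀ _ (by positivity)]
    have c1 := mul_le_mul_of_nonneg_left a2 (sq_nonneg r)
    have c2 := mul_le_mul_of_nonneg_left a3 (sq_nonneg (r ^ 2)); nlinarith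
  · refine le_trans ?_ (ofReal_le_ofReal (mul_le_mul_of_nonneg_right (le_max_right _ _)
      (by positivity)))
    refine (eLpNorm_mono_measure _ (Measure.restrict_mono (truncCone_mono hrε) le_rfl)).trans ?_
    rw [← ENNReal.ofReal_toReal D.z_mem.2.1.2.ne]; refine ofReal_le_ofReal ?_; rw [mul_assoc]
    refine le_mul_of_one_le_right ENNReal.toReal_nonneg ?_
    rw [← div_eq_inv_mul, one_le_div (by positivity)]
    exact rpow_le_rpow (by positivity) (by linarith) (by linarith)

end DifferenceProblem

namespace DifferenceProblem

include D

lemma integral_data_eq {ψ : 𝔼 → ℂ} (hψ : IsTestFunction (ball 0 ε) ψ) : ∫ x in 𝒞,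
    (ℂ(γ x - 1) * cdot (Dv x) (∇ ψ x) - ℂ(k) ^ 2 * ℂ(ρ x - 1) * v x * ψ x) =
    (∫ x in 𝒞, z x * lapl ψ x) - (∫ x in 𝒞, ℂ(γ x - 1) * cdot (Dz x) (∇ ψ x)) + ∫ x in 𝒞, ℂ(k) ^
    2 * ℂ(ρ x) * z x * ψ x := by
  have hψ1 : IsH1 𝒞 ψ (∇ ψ) := hψ.isH1 D.measurableSet; have h1 := D.eqn ψ _ hψ1 hψ.vanishesNearCap
  have h2 := D.trace.integral_by_parts D.z_mem.1 D.z_mem.2.1 isH1_one hψ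
  have e0 : ∀ F : CSpace n, cdot 0 F = 0 := fun F => by simp [cdot]
  simp only [one_mul, e0, zero_add] at h2; have i1 := MemLp.integrable_cdot D.z_mem.2.1 hψ1.2.1
  have i2 := integrable_mul_cdot (c := fun x => γ x - 1) (D.w1.meas.restrict.sub aestronglyMeasurable_const)
    D.gamma_sub_one_bound D.z_mem.2.1 hψ1.2.1
  have i3 := integrable_mul_mul D.rho_meas.restrict D.rho_bound' (ℂ(k) ^ 2) D.z_mem.1 hψ1.1
  have h3 : ∫ x in 𝒞, (ℂ(γ x) * cdot (Dz x) (∇ ψ x) - ℂ(k) ^ 2 * ℂ(ρ x) * z x * ψ x) =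
      (∫ x in 𝒞, cdot (Dz x) (∇ ψ x))
      + (∫ x in 𝒞, ℂ(γ x - 1) * cdot (Dz x) (∇ ψ x))
      - ∫ x in 𝒞, ℂ(k) ^ 2 * ℂ(ρ x) * z x * ψ x := by
    rw [← integral_add i1 i2, ← integral_sub (Integrable.fun_add i1 i2) i3]
    refine integral_congr_ae (.of_forall fun x => ?_); simp only; push_cast; ring
  rw [h3, h2] at h1; linear_combination h1

include V

/-- The bound of the leading integrals for a conductivity that is flat at the vertex. -/
theorem isBigO_leadIntegral_of_flat (hn : 0 < n) (hδ : 0 < δ) (hd : d ∈ 𝒟)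
    (hdd' : inner ℝ (d : 𝔼) (d' : 𝔼) = 0) (hA : A ≠ 0) (hB : B ≠ 0) (hm : m₂ + 1 ≤ m₁)
    {β Cγ s : ℝ} (hβ : 0 ≤ β) (hγ : ∀ᵐ x ∂vol 𝒞, |γ x - 1| ≤ Cγ * ‖x‖ ^ β) (h₁ : s ≤ n + m₂ + 2)
    (h₂ : s ≤ n + m₂ + β) (h₃ : s ≤ n + m₂ + σ) : leadIntegral K ε k d d' L₁ L₂ =𝒪 (-s) := by
  have hε := D.eps_pos; have hM := D.M_nonneg; have hσ := V.sigma_pos; have hm₁ := V.exp₁ hA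
  have hm₂ := V.exp₂ hB; have hn0 : (0 : ℝ) < n := by exact_mod_cast hn
  obtain ⟨C₁, hC₁, hF⟩ := D.exists_grad_decay V hn; obtain ⟨C₂, hC₂, hG⟩ := D.exists_pot_decay V hn
  rw [if_neg hA, max_eq_right (by linarith)] at hF; rw [if_neg hB, max_eq_right (by linarith)] at hG
  set E : ℝ := n / 2 + m₂ + 2 with hE; set C₃ := max (C₁ * ε ^ (m₁ - (m₂ + 1))) C₂ with hC₃
  have hC₃0 : 0 ≤ C₃ := le_max_of_le_right hC₂
  have hF' : L2Decay K ε (fun x => ℂ(γ x - 1) • Dv x) C₃ (E - 1) := fun r hr hrε => by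
    refine (hF r hr hrε).trans (ofReal_le_ofReal ?_)
    rw [show (n : ℝ) / 2 + m₁ = (m₁ - (m₂ + 1)) + (E - 1) by rw [hE]; ring, rpow_add hr,
      ← mul_assoc]
    refine mul_le_mul_of_nonneg_right (le_trans ?_ (le_max_left _ _)) (by positivity)
    have : 0 ≤ m₁ - (m₂ + 1) := by linarith
    gcongr
  have hG' : L2Decay K ε (fun x => ℂ(k) ^ 2 * (ℂ(ρ x - 1) * v x)) C₃ (E - 2) := fun r hr hrε => by
    refine (hG r hr hrε).trans (ofReal_le_ofReal ?_)
    rw [show (n : ℝ) / 2 + m₂ = E - 2 by rw [hE]; ring]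
    exact mul_le_mul_of_nonneg_right (le_max_right _ _) (by positivity)
  have hE2 : 0 < E - 2 := by rw [hE]; linarith
  obtain ⟨C₄, hC₄, hz⟩ := D.exists_eLpNorm_le hn hδ hd (by linarith) hE2.le hF' hG'
  rw [sub_add_cancel, sub_add_cancel, min_self] at hz; set C₅ := max C₃ C₄
  have hC₅ : 0 ≤ C₅ := le_max_of_le_left hC₃0
  have up : ∀ {C r s : ℝ} {X : ℝ≥0∞}, 0 < r → C ≤ C₅ → X ≤ ofReal (C * r ^ s) → X ≤ ofReal (C₅ * r ^
    s) := fun hr hC h => h.trans (ofReal_le_ofReal (mul_le_mul_of_nonneg_right hC (by positivity)))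
  obtain ⟨C₆, hC₆, hDz⟩ := D.exists_eLpNorm_grad_le (by linarith) hC₅ (fun r hr hrε => up hr
    (le_max_right _ _) (hz r hr hrε)) (fun r hr hrε => up hr (le_max_left _ _) (hF' r hr hrε)) (fun
    r hr hrε => up hr (le_max_left _ _) (hG' r hr hrε))
  obtain ⟨χ, Cχ, hCχ, hχ⟩ := exists_isCutoff n hε hβ; set b := Cχ * ε ^ β with hb
  have hb0 : 0 ≤ b := by positivity
  have h1 := D.isBigO_data_term (d' := d') (κ := β) (g₀ := 1) (C' := Cγ) V hn hδ hd hβ hCχ hχ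
    (by linarith) (Or.inr (by linarith)) (by
      filter_upwards [hγ, D.ell] with x hx hl; have h0 : 0 ≤ γ x := D.lam_pos.le.trans hl
      refine le_trans ?_ hx
      have h2 : γ x - 1 = (γ x ^ ½ - 1) * (γ x ^ ½ + 1) := by
        rw [← sqrt_eq_rpow]; linear_combination -(mul_self_sqrt h0)
      rw [h2, abs_mul]; refine le_mul_of_one_le_right (abs_nonneg _) ?_
      rw [abs_of_nonneg (by positivity)]; linarith [rpow_nonneg h0 (1 / 2)])
  have pow : ∀ {c t : ℝ}, t ≤ -s → (fun τ : ℝ => c * τ ^ t) =𝒪 (-s) :=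
    fun ht => (isBigO_const_mul_rpow _ _).trans (isBigO_rpow ht)
  have h2 := h1.trans (rate_isBigO (pow (by linarith)) (pow (by linarith)) (pow (by linarith))
    (isBigO_rpow (by linarith)))
  simp only [D.integral_data_eq (hχ.test_mul_cexpDot _)] at h2
  have hgrad : ∀ x ∈ 𝒞, ‖∇ χ x‖ ≤ b := fun x hx =>
    (hχ.norm_grad_le x).trans (by have := (norm_lt_of_mem hx).le; rw [hb]; gcongr)
  have hηn : ∀ τ : ℝ, 1 ≤ τ → ‖eta d d' τ‖ ≤ 2 * τ := fun τ hτ =>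
    (norm_eta_le d d' τ).trans (by rw [abs_of_nonneg (by linarith)])
  have b1 : (fun τ => ∫ x in 𝒞, z x * lapl (fun y => χ y * 𝐞 τ y) x) =𝒪 (-s) := by
    refine (isBigO_integral_norm_mul (s := 1) (C₁ := 5 * Cχ) hε D.z_mem.1
      (e := E) (by linarith) hβ hC₄ (by positivity) hδ hz ?_).trans (isBigO_rpow (by rw [hE]; linarith))
    filter_upwards [eventually_ge_atTop 1] with τ hτ
    filter_upwards [ae_restrict_mem D.measurableSet] with x hx
    have he := norm_cexpDot_eta_le (d' := d') hd (by linarith : 0 ≤ τ) hx.1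
    rw [hχ.lapl_mul_cexpDot (cdot_eta_eta hdd' τ), norm_mul, norm_mul, rpow_one]
    have h5 : ‖lapl χ x + 2 * cdot (∇ χ x) (eta d d' τ)‖ ≤ 5 * Cχ * τ * ‖x‖ ^ β := by
      refine (norm_add_le _ _).trans ?_; rw [norm_mul, Complex.norm_two]
      have h6 := (norm_cdot_le (∇ χ x) (eta d d' τ)).trans
        (mul_le_mul (hχ.norm_grad_le x) (hηn τ hτ) (norm_nonneg _) (by positivity))
      have h7 := hχ.norm_lapl_le x
      have h8 : Cχ * ‖x‖ ^ β ≤ Cχ * ‖x‖ ^ β * τ := le_mul_of_one_le_right (by positivity) hτ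
      linarith
    calc _ ≤ ‖z x‖ * (exp (-(δ * (τ * ‖x‖))) * (5 * Cχ * τ * ‖x‖ ^ β)) := by gcongr
      _ = _ := by ring
  have b2 : (fun τ => ∫ x in 𝒞, ℂ(γ x - 1) * cdot (Dz x) (∇ (fun y => χ y * 𝐞 τ y) x)) =𝒪 (-s) := by
    refine (isBigO_integral_norm_mul (s := 1) (C₁ := max Cγ 0 * (2 + b)) hε D.z_mem.2.1
      (e := E - 1) (by linarith) hβ hC₆ (by positivity) hδ hDz ?_).trans
      (isBigO_rpow (by rw [hE]; linarith))
    filter_upwards [eventually_ge_atTop 1] with τ hτ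
    filter_upwards [hγ, ae_restrict_mem D.measurableSet] with x h1 hx
    have he := norm_cexpDot_eta_le (d' := d') hd (by linarith : 0 ≤ τ) hx.1
    rw [hχ.grad_mul_cexpDot, cdot_smul_right, norm_mul, norm_mul, norm_real, rpow_one]
    have h5 : ‖χ x • eta d d' τ + ∇ χ x‖ ≤ (2 + b) * τ := by
      refine (norm_add_le _ _).trans ?_; rw [norm_smul]
      have h7 : ‖χ x‖ * ‖eta d d' τ‖ ≤ 1 * (2 * τ) :=
        mul_le_mul (hχ.norm_le_one x) (hηn τ hτ) (norm_nonneg _) zero_le_one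
      have h8 : b ≤ b * τ := le_mul_of_one_le_right hb0 hτ; linarith [hgrad x hx]
    have h6 := (norm_cdot_le (Dz x) _).trans (mul_le_mul_of_nonneg_left h5 (norm_nonneg _))
    have h9 : ‖γ x - 1‖ ≤ max Cγ 0 * ‖x‖ ^ β :=
      h1.trans (mul_le_mul_of_nonneg_right (le_max_left _ _) (by positivity))
    calc _ ≤ max Cγ 0 * ‖x‖ ^ β * (exp (-(δ * (τ * ‖x‖))) * (‖Dz x‖ * ((2 + b) * τ))) := by
          gcongr
      _ = _ := by ring
  have b3 : (fun τ => ∫ x in 𝒞, ℂ(k) ^ 2 * ℂ(ρ x) * z x * (χ x * 𝐞 τ x)) =𝒪 (-s) := by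
    refine (isBigO_integral_norm_mul (s := 0) (t := 0) (C₁ := k ^ 2 * M) hε D.z_mem.1
      (e := E) (by linarith) le_rfl hC₄ (by positivity) hδ hz ?_).trans
      (isBigO_rpow (by rw [hE]; linarith))
    filter_upwards [eventually_ge_atTop 1] with τ hτ
    filter_upwards [D.rho_bound', ae_restrict_mem D.measurableSet] with x h1 hx
    have he := norm_cexpDot_eta_le (d' := d') hd (by linarith : 0 ≤ τ) hx.1
    have hc := hχ.norm_le_one x
    rw [norm_mul, norm_mul, norm_mul, norm_mul, norm_pow, norm_real, norm_real,
      norm_eq_abs k, sq_abs, norm_eq_abs, rpow_zero, rpow_zero]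
    calc _ ≤ k ^ 2 * M * ‖z x‖ * (1 * exp (-(δ * (τ * ‖x‖)))) := by gcongr
      _ = _ := by ring
  refine (((b1.sub b2).add b3).sub h2).congr_left fun τ => ?_
  rw [sub_sub_cancel, Complex.ofReal_one, one_mul]

end DifferenceProblem

section Powers

lemma isBigO_const_mul_ofReal (c : ℂ) (s : ℝ) : (fun τ : ℝ => c * ℂ(τ ^ s)) =𝒪 s :=
  IsBigO.of_bound ‖c‖ (.of_forall fun τ => by rw [norm_mul, norm_real])

lemma le_of_isBigO_rpow {c : ℂ} (hc : c ≠ 0) {u s : ℝ}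
    (h : (fun τ : ℝ => c * ℂ(τ ^ (-u))) =𝒪 (-s)) : s ≤ u := by
  by_contra! hs
  have h1 : (fun τ : ℝ => τ ^ (-s)) =o[atTop] fun τ : ℝ => τ ^ (-u) := by
    refine (isLittleO_iff_tendsto' ?_).2 ?_
    · filter_upwards [eventually_gt_atTop 0] with τ hτ h0
      exact absurd h0 (rpow_pos_of_pos hτ _).ne'
    · refine (tendsto_rpow_neg_atTop (sub_pos.2 hs)).congr' ?_
      filter_upwards [eventually_gt_atTop 0] with τ hτ; rw [← rpow_sub hτ]; congr 1; ring
  refine isLittleO_irrefl ?_ ((h.trans_isLittleO h1).trans_isBigO (IsBigO.of_bound ‖c‖⁻¹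
    (.of_forall fun τ => (?_ : _ ≤ _ * ‖c * ℂ(τ ^ (-u))‖))))
  · refine Eventually.frequently ?_; filter_upwards [eventually_gt_atTop 0] with τ hτ
    exact mul_ne_zero hc (Complex.ofReal_ne_zero.2 (rpow_pos_of_pos hτ _).ne')
  · rw [norm_mul, norm_real, inv_mul_cancel_left₀ (norm_ne_zero_iff.2 hc)]

lemma le_of_isBigO_sub_rpow {c c' : ℂ} (hc : c ≠ 0) {u w s : ℝ} (hw : c' = 0 ∨ u < w)
    (h : (fun τ : ℝ => c * ℂ(τ ^ (-u)) - c' * ℂ(τ ^ (-w))) =𝒪 (-s)) : s ≤ u := by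
  rcases hw with rfl | hw
  · exact le_of_isBigO_rpow hc (by simpa using h)
  · by_contra! hs
    exact (lt_min hs hw).not_ge (le_of_isBigO_rpow hc (((h.trans (isBigO_rpow (neg_le_neg
      (min_le_left s w)))).add ((isBigO_const_mul_ofReal c' _).trans (isBigO_rpow (neg_le_neg
      (min_le_right s w))))).congr_left fun τ => sub_add_cancel _ _))

/-- A difference of two powers is small only if both are or if they cancel. -/
lemma of_isBigO_sub_rpow {c c' : ℂ} {u w s : ℝ}
    (h : (fun τ : ℝ => c * ℂ(τ ^ (-u)) - c' * ℂ(τ ^ (-w))) =𝒪 (-s)) :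
    ((c = 0 ∨ s ≤ u) ∧ (c' = 0 ∨ s ≤ w)) ∨ (u = w ∧ c = c') := by
  have h' : (fun τ : ℝ => c' * ℂ(τ ^ (-w)) - c * ℂ(τ ^ (-u))) =𝒪 (-s) := h.neg_left.congr_left fun τ => neg_sub _ _
  by_cases hc : c = 0
  · by_cases hc' : c' = 0
    · exact Or.inl ⟨Or.inl hc, Or.inl hc'⟩
    · exact Or.inl ⟨Or.inl hc, Or.inr (le_of_isBigO_sub_rpow hc' (Or.inl hc) h')⟩
  by_cases hc' : c' = 0
  · exact Or.inl ⟨Or.inr (le_of_isBigO_sub_rpow hc (Or.inl hc') h), Or.inl hc'⟩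
  rcases lt_trichotomy u w with huw | rfl | huw
  · have := le_of_isBigO_sub_rpow hc (Or.inr huw) h
    exact Or.inl ⟨Or.inr this, Or.inr (this.trans huw.le)⟩
  · by_cases he : c = c'
    · exact Or.inr ⟨rfl, he⟩
    · have := le_of_isBigO_rpow (sub_ne_zero.2 he) (h.congr_left fun τ => (sub_mul _ _ _).symm)
      exact Or.inl ⟨Or.inr this, Or.inr this⟩
  · have := le_of_isBigO_sub_rpow hc' (Or.inr huw) h'
    exact Or.inl ⟨Or.inr (this.trans huw.le), Or.inr this⟩

variable {f : ℝ → ℂ} {c : ℂ} {u : ℝ}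

lemma isBigO_of_lead (h : ∀ L : ℝ, (fun τ : ℝ => f τ - c * ℂ(τ ^ (-u))) =𝒪 (-L)) {s : ℝ}
    (hs : c = 0 ∨ s ≤ u) : f =𝒪 (-s) := by
  refine (IsBigO.add (h s) (?_ : (fun τ : ℝ => c * ℂ(τ ^ (-u))) =O[atTop] _)).congr_left
    fun τ => sub_add_cancel _ _
  rcases hs with rfl | hs
  · simpa using isBigO_zero _ _
  · exact (isBigO_const_mul_ofReal c _).trans (isBigO_rpow (neg_le_neg hs))

variable {p q r a b c e : ℝ}

lemma rate_isBigO_rpow {s : ℝ} (ha : p ≠ 0 → s ≤ a) (hb : q ≠ 0 → s ≤ b) (hc : r ≠ 0 → s ≤ c)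
    (he : s ≤ e) : rate p q r a b c e =𝒪 (-s) := by
  have h : ∀ {p a : ℝ}, (p ≠ 0 → s ≤ a) → (fun τ : ℝ => p * τ ^ (-a)) =𝒪 (-s) := fun {p a} h => by
    by_cases hp : p = 0
    · simpa [hp] using isBigO_zero _ _
    · exact (isBigO_const_mul_rpow _ _).trans (isBigO_rpow (neg_le_neg (h hp)))
  exact rate_isBigO (h ha) (h hb) (h hc) (isBigO_rpow (neg_le_neg he))

lemma exists_rpow_isBigO_rate (hp : 0 ≤ p) (hq : 0 ≤ q) (hr : 0 ≤ r) : ∃ s, (p ≠ 0 → s ≤ a) ∧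
    (q ≠ 0 → s ≤ b) ∧ (r ≠ 0 → s ≤ c) ∧ s ≤ e ∧ (fun τ : ℝ => τ ^ (-s)) =O[atTop] rate p q r a b
    c e := by
  set R := rate p q r a b c e
  have step : ∀ {p a s : ℝ}, (fun τ : ℝ => p * τ ^ (-a)) =O[atTop] R →
      (fun τ : ℝ => τ ^ (-s)) =O[atTop] R →
      ∃ s' ≤ s, (p ≠ 0 → s' ≤ a) ∧ (fun τ : ℝ => τ ^ (-s')) =O[atTop] R := fun {p a s} h h' => by
    by_cases hpa : p ≠ 0 ∧ a < s
    · exact ⟨a, hpa.2.le, fun _ => le_rfl, (isBigO_rpow_mul hpa.1 _).trans h⟩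
    · exact ⟨s, le_rfl, fun hp => not_lt.1 fun ha => hpa ⟨hp, ha⟩, h'⟩
  obtain ⟨s₁, l₁, k₁, h₁⟩ := step (isBigO_rate hp hq hr).1 (isBigO_rate hp hq hr).2.2.2
  obtain ⟨s₂, l₂, k₂, h₂⟩ := step (isBigO_rate hp hq hr).2.1 h₁
  obtain ⟨s₃, l₃, k₃, h₃⟩ := step (isBigO_rate hp hq hr).2.2.1 h₂
  exact ⟨s₃, fun h => by linarith [k₁ h], fun h => by linarith [k₂ h], k₃, by linarith, h₃⟩

end Powers

/-- The bounds of two integrals with given leading terms that follow from bounds of their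
combination. -/
theorem isBigO_of_combination {I₁ I₂ : ℝ → ℂ} {a b σ σ₀ A B : ℝ} {c₀ c₂ : ℂ} (hA : 0 ≤ A)
    (hB : 0 ≤ B) (h₁ : ∀ L : ℝ, (fun τ : ℝ => I₁ τ - c₀ * ℂ(τ ^ (-(a - 1)))) =𝒪 (-L))
    (h₂ : ∀ L : ℝ, (fun τ : ℝ => I₂ τ - c₂ * ℂ(τ ^ (-b))) =𝒪 (-L)) (hA0 : A = 0 → c₀ = 0)
    (hA1 : A ≠ 0 → 1 ≤ a) (hB0 : B = 0 → c₂ = 0) (hB1 : B ≠ 0 → 0 ≤ b) (hX : 1 < a + σ → k = 0 ∨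
    0 < b + σ → (fun τ => I₁ τ - ℂ(k) ^ 2 * I₂ τ) =O[atTop] rate (k ^ 2 * B) (k ^ 2) A (b + 1) (b
    + σ) a (a + σ - 1))
    (hS : A ≠ 0 → B ≠ 0 → k ≠ 0 → c₀ ≠ 0 → c₂ = 0 → b + 1 ≤ a - 1 → b + min σ σ₀ ≤ a - 1) : I₁
    =O[atTop] rate (k ^ 2 * B) (k ^ 2) A b (b + σ) a (a + σ - 1) ∧ (fun τ => ℂ(k) ^ 2 * I₂ τ)
    =O[atTop] rate (k ^ 2 * B) (k ^ 2) A (b + σ₀) (b + σ) (a - 1) (a + σ - 1) ∧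
    (fun τ => I₁ τ - ℂ(k) ^ 2 * I₂ τ) =O[atTop] rate (k ^ 2 * B) (k ^ 2) A (b + σ₀) (b + σ) a
    (a + σ - 1) := by
  have hq : 0 ≤ k ^ 2 := sq_nonneg k; have hp : 0 ≤ k ^ 2 * B := mul_nonneg hq hB
  have hk2 : ℂ(k) ^ 2 * c₂ ≠ 0 → k ^ 2 ≠ 0 ∧ c₂ ≠ 0 ∧ k ^ 2 * B ≠ 0 ∧ 0 ≤ b := fun h => by
    have h1 : k ^ 2 ≠ 0 := by exact_mod_cast left_ne_zero_of_mul h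
    have h2 := right_ne_zero_of_mul h; have h3 : B ≠ 0 := fun h => h2 (hB0 h)
    exact ⟨h1, h2, mul_ne_zero h1 h3, hB1 h3⟩
  have hA' : c₀ ≠ 0 → A ≠ 0 ∧ 1 ≤ a := fun h =>
    have h1 : A ≠ 0 := fun h0 => h (hA0 h0)
    ⟨h1, hA1 h1⟩
  have h₂' : ∀ L : ℝ, (fun τ : ℝ => ℂ(k) ^ 2 * I₂ τ - ℂ(k) ^ 2 * c₂ * ℂ(τ ^ (-b))) =𝒪 (-L) := fun L
    => ((h₂ L).const_mul_left (ℂ(k) ^ 2)).congr_left fun τ => by ring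
  set c' := ℂ(k) ^ 2 * c₂
  -- the behaviour of the combination
  have hd : ∀ s, (k ^ 2 * B ≠ 0 → s ≤ b + 1) → (k ^ 2 ≠ 0 → s ≤ b + σ) → (A ≠ 0 → s ≤ a) →
      s ≤ a + σ - 1 → ((c₀ = 0 ∨ s ≤ a - 1) ∧ (c' = 0 ∨ s ≤ b)) ∨ (a - 1 = b ∧ c₀ = c') :=
      fun s s1 s2 s3 s4 => by
    by_cases ht : 1 < a + σ ∧ (k = 0 ∨ 0 < b + σ)
    · refine of_isBigO_sub_rpow ((((hX ht.1 ht.2).trans (rate_isBigO_rpow s1 s2 s3 s4)).sub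
        ((h₁ s).sub (h₂' s))).congr_left fun τ => by ring)
    · have h0 : s ≤ 0 := by
        by_contra! h0
        refine ht ⟨by linarith, or_iff_not_imp_left.2 fun hk => ?_⟩
        linarith [s2 (pow_ne_zero 2 hk)]
      refine Or.inl ⟨or_iff_not_imp_left.2 fun h => ?_, or_iff_not_imp_left.2 fun h => ?_⟩
      · linarith [(hA' h).2]
      · linarith [(hk2 h).2.2.2]
  refine ⟨?_, ?_, ?_⟩
  · obtain ⟨s, s1, s2, s3, s4, hs⟩ := exists_rpow_isBigO_rate (a := b) (b := b + σ) (c := a)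
      (e := a + σ - 1) hp hq hA
    refine (isBigO_of_lead h₁ ?_).trans hs
    rcases hd s (fun h => by linarith [s1 h]) s2 s3 s4 with h | ⟨hab, hc⟩
    · exact h.1
    · refine or_iff_not_imp_left.2 fun h => ?_; rw [hab]; exact s1 (hk2 (hc ▸ h)).2.2.1
  · obtain ⟨s, s1, s2, s3, s4, hs⟩ := exists_rpow_isBigO_rate (a := b + σ₀) (b := b + σ)
      (c := a - 1) (e := a + σ - 1) hp hq hA
    refine (isBigO_of_lead h₂' (or_iff_not_imp_left.2 fun hc' => ?_)).trans hs
    by_contra! hbs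
    rcases hd (min s (b + 1)) (fun _ => min_le_right _ _) (fun h => (min_le_left _ _).trans (s2 h))
      (fun h => (min_le_left _ _).trans (by linarith [s3 h])) ((min_le_left _ _).trans s4)
      with h | ⟨hab, hc⟩
    · exact (lt_min hbs (lt_add_one b)).not_ge (h.2.resolve_left hc')
    · linarith [s3 (hA' (hc ▸ hc')).1]
  · obtain ⟨s, s1, s2, s3, s4, hs⟩ := exists_rpow_isBigO_rate (a := b + σ₀) (b := b + σ)
      (c := a) (e := a + σ - 1) hp hq hA
    suffices h : ((c₀ = 0 ∨ s ≤ a - 1) ∧ (c' = 0 ∨ s ≤ b)) ∨ (a - 1 = b ∧ c₀ = c') by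
      rcases h with h | ⟨hab, hc⟩
      · exact ((isBigO_of_lead h₁ h.1).sub (isBigO_of_lead h₂' h.2)).trans hs
      · refine (((h₁ s).sub (h₂' s)).congr_left fun τ => ?_).trans hs
        rw [hab, hc, sub_sub_sub_cancel_right]
    by_cases hb : k ^ 2 * B ≠ 0 → s ≤ b + 1
    · exact hd s hb s2 s3 s4
    rw [Classical.not_imp, not_le] at hb; have hk := left_ne_zero_of_mul hb.1
    rcases hd (b + 1) (fun _ => le_rfl) (fun h => by linarith [s2 h]) (fun h => by linarith [s3 h])
      (by linarith) with h | h
    · refine Or.inl ⟨or_iff_not_imp_left.2 fun h0 => ?_, Or.inl (h.2.resolve_right (by linarith))⟩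
      have hc₂ : c₂ = 0 := (mul_eq_zero.1 (h.2.resolve_right (by linarith))).resolve_left
        (by exact_mod_cast hk)
      have := hS (hA' h0).1 (right_ne_zero_of_mul hb.1) (ne_zero_pow two_ne_zero hk) h0 hc₂
        (h.1.resolve_left h0)
      rcases min_choice σ σ₀ with e | e <;> rw [e] at this
      · linarith [s2 hk]
      · linarith [s1 hb.1]
    · exact Or.inr h

section Products

variable {σ : ℝ}

lemma HasLeadingTerm.exists_norm_le [NormedSpace ℝ F] (hK : MeasurableSet K) (hσ : 0 < σ)
    {f f₀ : 𝔼 → F} {m : ℝ} (hf₀ : MemLinfty K f₀) (hf : HasLeadingTerm 𝒞 f f₀ m σ) :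
    ∃ C, 0 ≤ C ∧ ∀ᵐ x ∂vol 𝒞, ‖f x‖ ≤ C * ‖x‖ ^ m := by
  obtain ⟨C, hC⟩ := hf
  refine ⟨|C| * |ε| ^ σ + linftyNorm K f₀, by have := linftyNorm_nonneg (K := K) f₀; positivity, ?_⟩
  filter_upwards [hC, ae_restrict_of_ae_restrict_of_subset inter_subset_left
    (ae_le_linftyNorm hf₀), ae_restrict_mem (meas_truncCone hK ε)] with x h1 h2 hx
  have h0 := norm_pos_of_mem hx.1; have hε := (norm_lt_of_mem hx).le.trans (le_abs_self ε)
  have h3 := norm_add_le (f x - ‖x‖ ^ m • f₀ (dir x)) (‖x‖ ^ m • f₀ (dir x))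
  rw [sub_add_cancel, norm_smul, norm_of_nonneg (by positivity)] at h3
  have h4 : C * ‖x‖ ^ (m + σ) ≤ |C| * |ε| ^ σ * ‖x‖ ^ m := by
    rw [rpow_add h0]
    have : C * (‖x‖ ^ m * ‖x‖ ^ σ) ≤ |C| * (‖x‖ ^ m * |ε| ^ σ) := by
      gcongr; exact le_abs_self C
    linarith
  have h5 := mul_le_mul_of_nonneg_left h2 (by positivity : 0 ≤ ‖x‖ ^ m); linarith

/-- The leading term of a product. -/
lemma exists_product_expansion [NormedSpace ℂ F] (hK : MeasurableSet K) (hσ : 0 < σ)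
    {f f₀ : 𝔼 → ℝ} {g g₀ : 𝔼 → F} {α β : ℝ} (hf₀ : MemLinfty K f₀) (hg₀ : MemLinfty K g₀)
    (hf : HasLeadingTerm 𝒞 f f₀ β σ) (hg : HasLeadingTerm 𝒞 g g₀ α σ) : ∃ C, 0 ≤ C ∧ ∀ᵐ x ∂vol 𝒞,
    ‖(f x : ℂ) • g x - ℂ(f₀ (dir x) * ‖x‖ ^ (α + β)) • g₀ (dir x)‖ ≤ C * ‖x‖ ^ (α + β + σ) := by
  obtain ⟨C₁, hC₁, h1⟩ := hf.exists_norm_le hK hσ hf₀; obtain ⟨C₂, h2⟩ := hf; obtain ⟨C₃, h3⟩ := hg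
  have hn₀ := linftyNorm_nonneg (K := K) g₀
  refine ⟨C₁ * |C₃| + |C₂| * linftyNorm K g₀, by positivity, ?_⟩
  filter_upwards [h1, h2, h3, ae_restrict_of_ae_restrict_of_subset inter_subset_left
    (ae_le_linftyNorm hg₀), ae_restrict_mem (meas_truncCone hK ε)] with x g1 g2 g3 g4 hx
  have h0 := norm_pos_of_mem hx.1
  have e : (f x : ℂ) • g x - ℂ(f₀ (dir x) * ‖x‖ ^ (α + β)) • g₀ (dir x) =
      (f x : ℂ) • (g x - ‖x‖ ^ α • g₀ (dir x))
      + ℂ((f x - ‖x‖ ^ β • f₀ (dir x)) * ‖x‖ ^ α) • g₀ (dir x) := by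
    rw [← coe_smul (‖x‖ ^ α), smul_sub, smul_smul, sub_add_eq_add_sub, add_sub_assoc,
      ← sub_smul, sub_eq_add_neg, ← neg_smul]
    congr 2; rw [rpow_add h0, smul_eq_mul]; push_cast; ring
  rw [e]; refine (norm_add_le _ _).trans ?_
  rw [norm_smul, norm_smul, norm_real, norm_real, norm_mul, norm_of_nonneg (rpow_nonneg h0.le α)]
  have e1 : ‖x‖ ^ (α + β + σ) = ‖x‖ ^ β * ‖x‖ ^ (α + σ) := by rw [← rpow_add h0]; congr 1; ring
  have e2 : ‖x‖ ^ (α + β + σ) = ‖x‖ ^ (β + σ) * ‖x‖ ^ α := by rw [← rpow_add h0]; congr 1; ring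
  have t1 : ‖f x‖ * ‖g x - ‖x‖ ^ α • g₀ (dir x)‖ ≤ C₁ * ‖x‖ ^ β * (|C₃| * ‖x‖ ^ (α + σ)) :=
    mul_le_mul g1 (g3.trans (by gcongr; exact le_abs_self _)) (norm_nonneg _) (by positivity)
  have t2 : ‖f x - ‖x‖ ^ β • f₀ (dir x)‖ * ‖x‖ ^ α * ‖g₀ (dir x)‖ ≤
      |C₂| * ‖x‖ ^ (β + σ) * ‖x‖ ^ α * linftyNorm K g₀ := by
    have := g2.trans (mul_le_mul_of_nonneg_right (le_abs_self C₂) (by positivity)); gcongr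
  calc _ ≤ C₁ * ‖x‖ ^ β * (|C₃| * ‖x‖ ^ (α + σ)) + |C₂| * ‖x‖ ^ (β + σ) * ‖x‖ ^ α * linftyNorm K g₀ :=
        add_le_add t1 t2
    _ = C₁ * |C₃| * (‖x‖ ^ β * ‖x‖ ^ (α + σ)) + |C₂| * linftyNorm K g₀ * (‖x‖ ^ (β + σ) * ‖x‖ ^ α) := by
        ring
    _ = _ := by rw [← e1, ← e2]; ring

/-- The product of angular parts, extended homogeneously. -/
def leadTerm [NormedSpace ℂ F] (f₀ : 𝔼 → ℝ) (g₀ : 𝔼 → F) (m : ℝ) (x : 𝔼) : F :=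
  ℂ(f₀ (dir x) * ‖x‖ ^ m) • g₀ (dir x)

variable [NormedSpace ℂ F] {f₀ : RSpace n → ℝ} {g₀ : RSpace n → F} {m : ℝ}

lemma aesm_leadTerm (hf₀ : MemLinfty K f₀) (hg₀ : MemLinfty K g₀) :
    AESM (leadTerm f₀ g₀ m) vol (cone K) :=
  (continuous_ofReal.comp_aestronglyMeasurable ((aesm_comp_dir hf₀.1).mul (measurable_norm.pow_const
    m).aestronglyMeasurable)).smul (aesm_comp_dir hg₀.1)

lemma norm_leadTerm_le (hf₀ : MemLinfty K f₀) (hg₀ : MemLinfty K g₀) :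
    ∀ᵐ x ∂vol (cone K), ‖leadTerm f₀ g₀ m x‖ ≤ linftyNorm K f₀ * linftyNorm K g₀ * ‖x‖ ^ m := by
  filter_upwards [ae_le_linftyNorm hf₀, ae_le_linftyNorm hg₀] with x h1 h2
  rw [leadTerm, norm_smul, norm_real, norm_mul, norm_of_nonneg (by positivity : 0 ≤ ‖x‖ ^ m),
    mul_right_comm]
  have := linftyNorm_nonneg (K := K) f₀; gcongr

lemma leadTerm_smul {t : ℝ} (ht : 0 < t) (x : 𝔼) :
    leadTerm f₀ g₀ m (t • x) = ℂ(t ^ m) • leadTerm f₀ g₀ m x := by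
  rw [leadTerm, leadTerm, dir_smul x ht, norm_smul, norm_of_nonneg ht.le,
    mul_rpow ht.le (norm_nonneg _), smul_smul]
  congr 1; push_cast; ring

end Products

namespace DifferenceProblem

variable {α β α₀ β₀ σ : ℝ} {γβ ρ₀ : RSpace n → ℝ} {V : RSpace n → CSpace n} {v₀ : RSpace n → ℂ}
include D

lemma exponent_nonneg (hn : 0 < n) (hσ : 0 < σ) {c : 𝔼 → ℝ} (hc : ∀ᵐ x ∂vol 𝒞, |c x - 1| ≤ M + 1)
    (hγβ : MemLinfty K γβ) (hne : linftyNorm K γβ ≠ 0)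
    (h : HasLeadingTerm 𝒞 (fun x => (c x - 1) * γ x ^ (-½)) γβ β σ) : 0 ≤ β := by
  refine nonneg_of_leadingTerm_bounded hn D.isOpen.measurableSet D.eps_pos hσ hγβ hne h
    (M := (M + 1) * lam ^ (-½)) ?_
  filter_upwards [hc, D.neg_sqrt_bound] with x h1 h2; have := D.M_nonneg; rw [norm_mul]
  exact mul_le_mul h1 h2 (norm_nonneg _) (by positivity)

/-- The expansions of the coefficients and of the solution give those of the data. -/
lemma exists_vertexExpansion (hn : 0 < n) (hσ : 0 < σ) (hγβ : MemLinfty K γβ)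
    (hV : MemLinfty K V) (hρ₀ : MemLinfty K ρ₀) (hv₀ : MemLinfty K v₀)
    (hexpγ : HasLeadingTerm 𝒞 (fun x => (γ x - 1) * γ x ^ (-½)) γβ β σ)
    (hexpV : HasLeadingTerm 𝒞 Dv V α σ)
    (hexpρ : HasLeadingTerm 𝒞 (fun x => (ρ x - 1) * γ x ^ (-½)) ρ₀ β₀ σ)
    (hexpv : HasLeadingTerm 𝒞 v v₀ α₀ σ) : ∃ C, VertexExpansion K ε γ ρ v Dv
    (linftyNorm K γβ * linftyNorm K V) (linftyNorm K ρ₀ * linftyNorm K v₀) (α + β) (α₀ + β₀) σ C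
    (leadTerm γβ V (α + β)) (leadTerm ρ₀ v₀ (α₀ + β₀)) := by
  have hK := D.isOpen.measurableSet
  obtain ⟨C₁, hC₁, h1⟩ := exists_product_expansion hK hσ hγβ hV hexpγ hexpV
  obtain ⟨C₂, hC₂, h2⟩ := exists_product_expansion hK hσ hρ₀ hv₀ hexpρ hexpv
  refine ⟨max C₁ C₂, mul_nonneg (linftyNorm_nonneg _) (linftyNorm_nonneg _),
    mul_nonneg (linftyNorm_nonneg _) (linftyNorm_nonneg _), le_max_of_le_left hC₁, hσ,
    (aesm_leadTerm hγβ hV).mono_set inter_subset_left,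
    (aesm_leadTerm hρ₀ hv₀).mono_set inter_subset_left,
    ae_restrict_of_ae_restrict_of_subset inter_subset_left (norm_leadTerm_le hγβ hV),
    ae_restrict_of_ae_restrict_of_subset inter_subset_left (norm_leadTerm_le hρ₀ hv₀),
    h1.mono fun x hx => hx.trans (by gcongr; exact le_max_left _ _),
    h2.mono fun x hx => hx.trans (by gcongr; exact le_max_right _ _), fun h => ?_, fun h => ?_⟩
  · have := D.exponent_nonneg hn hσ D.gamma_sub_one_bound hγβ (left_ne_zero_of_mul h) hexpγ
    linarith [neg_half_lt_of_memLp hn hK D.eps_pos hσ hV (right_ne_zero_of_mul h) hexpV D.Dv_mem]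
  · have := D.exponent_nonneg hn hσ D.rho_sub_one_bound hρ₀ (left_ne_zero_of_mul h) hexpρ
    linarith [neg_half_lt_of_memLp hn hK D.eps_pos hσ hv₀ (right_ne_zero_of_mul h) hexpv D.v_mem]

end DifferenceProblem

/-- The asymptotics of the integral of a homogeneous function of known size. -/
lemma exists_asymptotics {m C s : ℝ} {Q : 𝔼 → ℂ} {J : ℝ → ℂ} (hn : 0 < n) (hK : MeasurableSet K)
    (hε : 0 < ε) (hδ : 0 < δ) (hd : d ∈ 𝒟) (hm : C ≠ 0 → -(n / 2 : ℝ) < m)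
    (hQm : AESM Q vol (cone K)) (hQ : ∀ᵐ x ∂vol (cone K), ‖Q x‖ ≤ C * ‖x‖ ^ m)
    (hom : ∀ t : ℝ, 0 < t → ∀ x, Q (t • x) = ℂ(t ^ m) * Q x)
    (hJ : ∀ τ : ℝ, J τ = ℂ(τ ^ s) * ∫ x in 𝒞, Q x * 𝐞 τ x) :
    ∃ c : ℂ, (C = 0 → c = 0) ∧ ∀ L : ℝ, (fun τ : ℝ => J τ - c * ℂ(τ ^ (-(n + m - s)))) =𝒪 (-L) := by
  by_cases hC : C = 0
  · refine ⟨0, fun _ => rfl, fun L => ?_⟩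
    have h0 : ∀ τ, J τ = 0 := fun τ => by
      rw [hJ, integral_eq_zero_of_ae, mul_zero]
      filter_upwards [ae_restrict_of_ae_restrict_of_subset inter_subset_left hQ] with x hx
      rw [hC, zero_mul] at hx; rw [norm_le_zero_iff.1 hx, zero_mul, Pi.zero_apply]
    simpa only [h0, zero_mul, sub_zero] using isBigO_zero _ _
  · have hn0 : (0 : ℝ) ≤ n / 2 := by positivity
    obtain ⟨c, hc⟩ := exists_homogeneous_asymptotics hn hK hε hδ hd (d' := d')
      (by linarith [hm hC]) hQm hQ hom
    refine ⟨c, fun h => absurd h hC, fun L => ?_⟩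
    have h1 : (fun τ : ℝ => ℂ(τ ^ s)) =𝒪 s := by
      simpa only [one_mul] using isBigO_const_mul_ofReal 1 s
    refine (h1.mul (hc (s + L))).congr' ?_ ?_ <;> filter_upwards [eventually_gt_atTop 0] with τ hτ
    · rw [hJ, mul_sub, mul_left_comm, ← Complex.ofReal_mul, ← rpow_add hτ, neg_sub, sub_eq_add_neg s]
    · rw [← rpow_add hτ]; congr 1; ring

namespace DifferenceProblem

include D V

/-- A nonzero leading gradient term is controlled when the leading potential term vanishes. -/
theorem exponent_le_of_leadIntegral (hn : 0 < n) (hδ : 0 < δ) (hd : d ∈ 𝒟)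
    (hdd' : inner ℝ (d : 𝔼) (d' : 𝔼) = 0) {r : ℝ → 𝔼 → ℂ} {Dr : ℝ → 𝔼 → CSpace n}
    {p q σ₀ Cp Cq : ℝ} (hA : A ≠ 0) (hB : B ≠ 0) (R : CGOFamily K ε k γ ρ d d' p q σ₀ Cp Cq r Dr)
    (hσ₀ : 0 < σ₀) (hm : m₂ + 2 ≤ m₁) {c₀ : ℂ} (hc₀ : c₀ ≠ 0) (hlead : ∀ L : ℝ, (fun τ : ℝ =>
    leadIntegral K ε k d d' L₁ L₂ τ - c₀ * ℂ(τ ^ (-(n + m₁ - 1)))) =O[atTop] fun τ => τ ^ (-L))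
    (hflat : m₂ < 0 → σ ≤ 2 ∧ ∃ β Cγ : ℝ, 0 < β ∧ m₁ - 1 < m₂ + β ∧ ∀ᵐ x ∂vol 𝒞, |γ x - 1| ≤ Cγ *
    ‖x‖ ^ β) : n + m₂ + min σ σ₀ ≤ n + m₁ - 1 := by
  have hσ := V.sigma_pos
  suffices h : ∃ t : ℝ, n + m₁ - 1 < t ∧ leadIntegral K ε k d d' L₁ L₂ =O[atTop]
      fun τ : ℝ => τ ^ (-min (n + m₂ + min σ σ₀) t) by
    obtain ⟨t, ht, h⟩ := h
    exact (min_le_iff.1 (le_of_isBigO_rpow hc₀ ((h.sub (hlead _)).congr_left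
      fun τ => sub_sub_cancel _ _))).resolve_right ht.not_ge
  have hs : 0 < min σ σ₀ := lt_min hσ hσ₀; have hsσ : min σ σ₀ ≤ σ := min_le_left _ _
  have hsσ₀ : min σ σ₀ ≤ σ₀ := min_le_right _ _; rcases le_or_gt 0 m₂ with h0 | h0
  · set u := min 1 (min σ σ₀); have hu : 0 < u := lt_min one_pos hs
    have hu1 : u ≤ 1 := min_le_left _ _; have hus : u ≤ min σ σ₀ := min_le_right _ _
    refine ⟨n + m₁ - 1 + u, by linarith, ?_⟩
    have l := min_le_left (n + m₂ + min σ σ₀) (n + m₁ - 1 + u)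
    have l' := min_le_right (n + m₂ + min σ σ₀) (n + m₁ - 1 + u)
    exact D.isBigO_leadIntegral_of_cgo V hn hδ hd hA hB (by linarith) h0 R (by linarith)
      (by linarith) (by linarith) (by linarith) (by linarith)
  · obtain ⟨hσ2, β, Cγ, hβ, hmβ, hγ⟩ := hflat h0; refine ⟨n + m₂ + β, by linarith, ?_⟩
    have l := min_le_left (n + m₂ + min σ σ₀) (n + m₂ + β)
    have l' := min_le_right (n + m₂ + min σ σ₀) (n + m₂ + β)
    exact D.isBigO_leadIntegral_of_flat V hn hδ hd hdd' hA hB (by linarith) hβ.le hγ (by linarith)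
      (by linarith) (by linarith)

end DifferenceProblem

section LeadingIntegrals

variable {γβ ρ₀ : RSpace n → ℝ} {V : RSpace n → CSpace n} {v₀ : RSpace n → ℂ} {α β α₀ β₀ : ℝ}
    {η : CSpace n}

lemma leadGrad_eq (x : 𝔼) :
    leadGrad γβ V α β η x = cdot (leadTerm γβ V (α + β) x) η * cexpDot η x := by
  rw [leadGrad, leadTerm, cdot_smul_left, Complex.ofReal_mul]; ring

lemma leadPot_eq (x : 𝔼) : leadPot ρ₀ v₀ α₀ β₀ η x = leadTerm ρ₀ v₀ (α₀ + β₀) x * cexpDot η x := by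
  rw [leadPot, leadTerm, smul_eq_mul, Complex.ofReal_mul]; ring

lemma aesm_cdot_const {μ : Measure 𝔼} {L : 𝔼 → CSpace n} (hL : AESM L μ) (a : CSpace n) :
    AESM (fun x => cdot (L x) a) μ :=
  (by unfold cdot; fun_prop : Continuous fun b : CSpace n => cdot b a).comp_aestronglyMeasurable hL

end LeadingIntegrals

namespace DifferenceProblem

variable {α β α₀ β₀ σ : ℝ} {γβ ρ₀ : RSpace n → ℝ} {V : RSpace n → CSpace n} {v₀ : RSpace n → ℂ}
include D

/-- The conductivity tends to one at the vertex when its expansion has a positive exponent. -/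
lemma exists_gamma_sub_one_le (hσ : 0 < σ) (hγβ : MemLinfty K γβ)
    (hexpγ : HasLeadingTerm 𝒞 (fun x => (γ x - 1) * γ x ^ (-½)) γβ β σ) :
    ∃ C : ℝ, ∀ᵐ x ∂vol 𝒞, |γ x - 1| ≤ C * ‖x‖ ^ β := by
  obtain ⟨C, hC, h⟩ := hexpγ.exists_norm_le D.isOpen.measurableSet hσ hγβ; refine ⟨M ^ ½ * C, ?_⟩
  filter_upwards [h, D.sqrt_bound, D.ell] with x h1 h2 h3; rw [mul_assoc]
  calc |γ x - 1| = |γ x ^ ½| * ‖(γ x - 1) * γ x ^ (-½)‖ := by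
        rw [norm_eq_abs, ← abs_mul, mul_left_comm,
          rpow_half_mul_neg_half (D.lam_pos.trans_le h3), mul_one]
    _ ≤ _ := mul_le_mul h2 h1 (norm_nonneg _) ((abs_nonneg _).trans h2)

/-- When the potential term is singular, the conductivity is flat at the vertex. -/
lemma flat_of_exponents (hn : 2 ≤ n) (hσ : 0 < σ) (hk : k ≠ 0) (hv : IsWeakSolution k 1 1 𝒞 v Dv)
    (hA : linftyNorm K γβ * linftyNorm K V ≠ 0) (hB : linftyNorm K ρ₀ * linftyNorm K v₀ ≠ 0)
    (hγβ : MemLinfty K γβ) (hV : MemLinfty K V) (hρ₀ : MemLinfty K ρ₀) (hv₀ : MemLinfty K v₀)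
    (hexpγ : HasLeadingTerm 𝒞 (fun x => (γ x - 1) * γ x ^ (-½)) γβ β σ)
    (hexpV : HasLeadingTerm 𝒞 Dv V α σ)
    (hexpρ : HasLeadingTerm 𝒞 (fun x => (ρ x - 1) * γ x ^ (-½)) ρ₀ β₀ σ)
    (hexpv : HasLeadingTerm 𝒞 v v₀ α₀ σ) (hm : α₀ + β₀ + 2 ≤ α + β) (h0 : α₀ + β₀ < 0) : σ ≤ 2 ∧
    ∃ β' C : ℝ, 0 < β' ∧ α + β - 1 < α₀ + β₀ + β' ∧ ∀ᵐ x ∂vol 𝒞, |γ x - 1| ≤ C * ‖x‖ ^ β' := by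
  have hn0 : 0 < n := by omega
  have hn1 : (1 : ℝ) ≤ n / 2 := by
    rw [le_div_iff₀ two_pos]; exact_mod_cast (by omega : 1 * 2 ≤ n)
  have hK := D.isOpen.measurableSet; have : Fact (volume 𝒞 < ⊤) := ⟨vol_truncCone_lt_top K ε⟩
  have hvi : IntegrableOn v 𝒞 := D.v_mem.integrable one_le_two
  have hDvi : IntegrableOn Dv 𝒞 := D.Dv_mem.integrable one_le_two
  have hβ₀ := D.exponent_nonneg hn0 hσ D.rho_sub_one_bound hρ₀ (left_ne_zero_of_mul hB) hexpρ
  have hα := neg_half_lt_of_memLp hn0 hK D.eps_pos hσ hV (right_ne_zero_of_mul hA) hexpV D.Dv_mem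
  have hα₀ := neg_half_lt_of_memLp hn0 hK D.eps_pos hσ hv₀ (right_ne_zero_of_mul hB) hexpv D.v_mem
  obtain ⟨C, -, hC⟩ := hexpV.exists_norm_le hK hσ hV
  have hle := le_sub_one_of_leadingTerm hn0 D.isOpen D.eps_pos hvi hDvi hv.1.2.2 hv₀
    (right_ne_zero_of_mul hB) hexpv hσ (by linarith) (by linarith) (by linarith) hC
  obtain ⟨C', hC'⟩ := D.exists_gamma_sub_one_le hσ hγβ hexpγ
  exact ⟨sigma_le_two_of_isWeakSolution hk hn0 D.isOpen D.eps_pos hvi hDvi hv hv₀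
    (right_ne_zero_of_mul hB) hexpv hσ (by linarith), β, C', by linarith, by linarith, hC'⟩

end DifferenceProblem

end CornerScattering

end

theorem mainTheorem8 {n : ℕ} (hn : 2 ≤ n)
    -- the generalized cone, its truncation, and the directions
    (K : Set (USphere n)) (hK : IsOpen K) (ε δ : ℝ) (hε : 0 < ε) (hδ : 0 < δ)
    (d d' : USphere n) (hd : d ∈ admissibleDirections K δ)
    (hdd' : inner ℝ (d : RSpace n) (d' : RSpace n) = 0)
    -- the coefficients
    (k : ℝ) (γ ρ : RSpace n → ℝ) (hγ : IsW1Infty γ)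
    (hρ : MemLp ρ ∞ (volume : Measure (RSpace n)))
    (lam₁ lam₂ : ℝ) (hlam₁ : 0 < lam₁)
    (hell : ∀ᵐ x ∂(volume : Measure (RSpace n)).restrict (truncCone K ε),
      lam₁ ≤ γ x ∧ γ x ≤ lam₂)
    -- the solutions of the transmission problem
    (u v : RSpace n → ℂ) (Du Dv : RSpace n → CSpace n)
    (huv : LocalTransmission k γ ρ K ε u v Du Dv)
    -- the CGO solutions, one for each large τ, and the decay of their residuals
    (r : ℝ → RSpace n → ℂ) (Dr : ℝ → RSpace n → CSpace n)
    (hr : ∀ᶠ τ : ℝ in atTop, IsH1 (truncCone K ε) (r τ) (Dr τ))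
    (hw : ∀ᶠ τ : ℝ in atTop, ∃ Dw : RSpace n → CSpace n,
      IsWeakSolution k γ ρ (truncCone K ε) (cgo γ (r τ) (eta d d' τ)) Dw)
    (p q σ₀ : ℝ) (hp : 1 < p) (hq : 1 < q) (hσ₀ : 0 < σ₀)
    (hrp : ∃ C : ℝ, ∀ᶠ τ : ℝ in atTop,
      eLpNorm (r τ) (ENNReal.ofReal p) (volume.restrict (truncCone K ε)) ≤
        ENNReal.ofReal (C * τ ^ (-(n : ℝ) / p - σ₀)))
    (hrq : ∃ C : ℝ, ∀ᶠ τ : ℝ in atTop,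
      eLpNorm (Dr τ) (ENNReal.ofReal q) (volume.restrict (truncCone K ε)) ≤
        ENNReal.ofReal (C * τ ^ (1 - (n : ℝ) / q - σ₀)))
    -- the leading terms at the vertex
    (α β α₀ β₀ σ : ℝ) (hσ : 0 < σ) (hα : α ≠ -1)
    (γβ ρ₀ : RSpace n → ℝ) (V : RSpace n → CSpace n) (v₀ : RSpace n → ℂ)
    (hγβ : MemLinfty K γβ) (hV : MemLinfty K V)
    (hρ₀ : MemLinfty K ρ₀) (hv₀ : MemLinfty K v₀)
    (hexpγ : HasLeadingTerm (truncCone K ε)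
      (fun x => (γ x - 1) * γ x ^ (-(1 / 2) : ℝ)) γβ β σ)
    (hexpV : HasLeadingTerm (truncCone K ε) Dv V α σ)
    (hexpρ : HasLeadingTerm (truncCone K ε)
      (fun x => (ρ x - 1) * γ x ^ (-(1 / 2) : ℝ)) ρ₀ β₀ σ)
    (hexpv : HasLeadingTerm (truncCone K ε) v v₀ α₀ σ) :
    -- the integrals of the leading terms converge
    (∀ τ : ℝ, IntegrableOn (leadGrad γβ V α β (eta d d' τ)) (truncCone K ε)) ∧
    (∀ τ : ℝ, IntegrableOn (leadPot ρ₀ v₀ α₀ β₀ (eta d d' τ)) (truncCone K ε)) ∧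
    -- the bound of the gradient term
    ((fun τ : ℝ => ∫ x in truncCone K ε, leadGrad γβ V α β (eta d d' τ) x) =O[atTop]
      fun τ : ℝ =>
        k ^ 2 * (linftyNorm K ρ₀ * linftyNorm K v₀) * τ ^ (-((n : ℝ) + β₀ + α₀))
        + k ^ 2 * τ ^ (-((n : ℝ) + β₀ + α₀ + σ))
        + linftyNorm K γβ * linftyNorm K V * τ ^ (-((n : ℝ) + β + α))
        + τ ^ (-((n : ℝ) + β + α - 1 + σ))) ∧
    -- the bound of the potential term
    ((fun τ : ℝ => (k : ℂ) ^ 2 *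
        ∫ x in truncCone K ε, leadPot ρ₀ v₀ α₀ β₀ (eta d d' τ) x) =O[atTop]
      fun τ : ℝ =>
        k ^ 2 * (linftyNorm K ρ₀ * linftyNorm K v₀) * τ ^ (-((n : ℝ) + β₀ + α₀ + σ₀))
        + k ^ 2 * τ ^ (-((n : ℝ) + β₀ + α₀ + σ))
        + linftyNorm K γβ * linftyNorm K V * τ ^ (-((n : ℝ) + β + α - 1))
        + τ ^ (-((n : ℝ) + β + α - 1 + σ))) ∧
    -- the bound of the sum
    ((fun τ : ℝ => ∫ x in truncCone K ε,
        (-(k : ℂ) ^ 2 * leadPot ρ₀ v₀ α₀ β₀ (eta d d' τ) x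
          + leadGrad γβ V α β (eta d d' τ) x)) =O[atTop]
      fun τ : ℝ =>
        k ^ 2 * (linftyNorm K ρ₀ * linftyNorm K v₀) * τ ^ (-((n : ℝ) + β₀ + α₀ + σ₀))
        + k ^ 2 * τ ^ (-((n : ℝ) + β₀ + α₀ + σ))
        + linftyNorm K γβ * linftyNorm K V * τ ^ (-((n : ℝ) + β + α))
        + τ ^ (-((n : ℝ) + β + α - 1 + σ))) := by
  obtain ⟨G, M₀, hM₀, hγ'⟩ := hγ.exists_isW1Bounded; obtain ⟨Cp, hrp⟩ := hrp
  obtain ⟨Cq, hrq⟩ := hrq; have hn0 : 0 < n := by omega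
  have hn1 : (1 : ℝ) ≤ n / 2 := by
    rw [le_div_iff₀ two_pos]; exact_mod_cast (by omega : 1 * 2 ≤ n)
  have hKm := hK.measurableSet
  have D := huv.differenceProblem hK hε hlam₁ (le_max_of_le_left hM₀) ⟨hγ'.1, hγ'.2,
    hγ'.3.mono fun x hx => hx.trans (le_max_left _ (eLpNorm ρ ∞ volume).toReal),
    hγ'.4.mono fun x hx => hx.trans (le_max_left _ _), hγ'.5⟩ (hell.mono fun x hx => hx.1) hρ.1
    ((ae_norm_le_of_memLp_top hρ).mono fun x hx => hx.trans (le_max_right M₀ _))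
  obtain ⟨C, W⟩ := D.exists_vertexExpansion hn0 hσ hγβ hV hρ₀ hv₀ hexpγ hexpV hexpρ hexpv
  have i₁ : ∀ τ, IntegrableOn (leadGrad γβ V α β (eta d d' τ)) (truncCone K ε) := fun τ => by
    refine (integrableOn_mul_cexpDot' hKm (Integrable.mono' ((integrableOn_of_le_rpow hn0 W.meas₁
      W.lead₁ W.exp₁).norm.mul_const ‖eta d d' τ‖) (aesm_cdot_const W.meas₁ _)
      (.of_forall fun x => norm_cdot_le _ _)) (eta d d' τ)).congr_fun
      (fun x _ => (leadGrad_eq x).symm) (meas_truncCone hKm ε)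
  have i₂ : ∀ τ, IntegrableOn (leadPot ρ₀ v₀ α₀ β₀ (eta d d' τ)) (truncCone K ε) := fun τ =>
    (integrableOn_mul_cexpDot' hKm (integrableOn_of_le_rpow hn0 W.meas₂ W.lead₂ W.exp₂) (eta d d'
    τ)).congr_fun (fun x _ => (leadPot_eq x).symm) (meas_truncCone hKm ε)
  obtain ⟨c₀, hc₀, h₁⟩ := exists_asymptotics (C := 2 * (linftyNorm K γβ * linftyNorm K V)) (s := 1)
    (Q := fun x => cdot (leadTerm γβ V (α + β) x) (eta d d' 1))
    (J := fun τ => ∫ x in truncCone K ε, leadGrad γβ V α β (eta d d' τ) x) hn0 hKm hε hδ hd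
    (fun h => W.exp₁ (right_ne_zero_of_mul h))
    (aesm_cdot_const (aesm_leadTerm hγβ hV) _)
    ((norm_leadTerm_le hγβ hV).mono fun x hx => by
      have h1 := norm_eta_le d d' 1; rw [abs_one, mul_one] at h1
      refine (norm_cdot_le _ _).trans ((mul_le_mul hx h1 (norm_nonneg _)
        ((norm_nonneg _).trans hx)).trans_eq (by ring)))
    (fun t ht x => by rw [leadTerm_smul ht, cdot_smul_left])
    (fun τ => by
      simp_rw [leadGrad_eq]; rw [Real.rpow_one, ← integral_const_mul]
      refine integral_congr_ae (.of_forall fun x => ?_); simp only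
      rw [← mul_assoc, ← cdot_smul_right, ← eta_eq_smul])
  obtain ⟨c₂, hc₂, h₂⟩ := exists_asymptotics (s := 0) (Q := leadTerm ρ₀ v₀ (α₀ + β₀))
    (J := fun τ => ∫ x in truncCone K ε, leadPot ρ₀ v₀ α₀ β₀ (eta d d' τ) x) hn0 hKm hε hδ hd W.exp₂
    (aesm_leadTerm hρ₀ hv₀) (norm_leadTerm_le hρ₀ hv₀)
    (fun t ht x => by rw [leadTerm_smul ht, smul_eq_mul])
    (fun τ => by simp_rw [leadPot_eq]; rw [Real.rpow_zero, Complex.ofReal_one, one_mul])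
  rw [sub_zero] at h₂
  have hJ : leadIntegral K ε k d d' (leadTerm γβ V (α + β)) (leadTerm ρ₀ v₀ (α₀ + β₀)) = fun τ =>
      (∫ x in truncCone K ε, leadGrad γβ V α β (eta d d' τ) x)
        - (k : ℂ) ^ 2 * ∫ x in truncCone K ε, leadPot ρ₀ v₀ α₀ β₀ (eta d d' τ) x := by
    funext τ; simp_rw [leadIntegral, leadGrad_eq, leadPot_eq]
  have h₃ : ∀ τ, (∫ x in truncCone K ε, leadGrad γβ V α β (eta d d' τ) x)
      - (k : ℂ) ^ 2 * ∫ x in truncCone K ε, leadPot ρ₀ v₀ α₀ β₀ (eta d d' τ) x =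
      ∫ x in truncCone K ε, (-(k : ℂ) ^ 2 * leadPot ρ₀ v₀ α₀ β₀ (eta d d' τ) x
          + leadGrad γβ V α β (eta d d' τ) x) := fun τ => by
    rw [integral_add ((i₂ τ).const_mul _) (i₁ τ), integral_const_mul]; ring
  have H := isBigO_of_combination W.A_nonneg W.B_nonneg h₁ h₂
    (fun h => hc₀ (by rw [h, mul_zero])) (fun h => by linarith [W.exp₁ h]) hc₂
    (fun h => by linarith [W.exp₂ h])
    (fun h h' => hJ ▸ D.isBigO_leadIntegral W hn0 hδ hd hdd' (by linarith)
      (h'.imp_right fun h => by linarith))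
    (fun hA hB hk hne hz hm => D.exponent_le_of_leadIntegral W hn0 hδ hd hdd' hA hB
      ⟨hp, hq, hr, hw, hrp, hrq⟩ hσ₀ (by linarith) hne (fun L => by
        refine ((h₁ L).sub ((h₂ L).const_mul_left ((k : ℂ) ^ 2))).congr_left fun τ => ?_
        rw [hJ, hz]; ring)
      (D.flat_of_exponents hn hσ hk huv.sol_v hA hB hγβ hV hρ₀ hv₀ hexpγ hexpV hexpρ hexpv
        (by linarith)))
  simp only [h₃] at H; have e : ∀ s t : ℝ, (n : ℝ) + (s + t) = n + t + s := fun s t => by ring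
  simp only [e, add_sub_right_comm _ σ] at H; exact ⟨i₁, i₂, H⟩
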